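/- **Conventions.** $n\ge 1$; $M$ is a smooth manifold (Hausdorff, $\sigma$-compact) of dimension $4n+3$; $\epsilon_1=\epsilon_2=1$, $\epsilon_3=-1$; $s,t\in\{1,2,3\}$ and $(i,j,k)$ is any cyclic permutation of $(1,2,3)$. $d\eta(A,B)=A\eta(B)-B\eta(A)-\eta([A,B])$. A *paraquaternionic contact (pqc) structure* $(H,[g],\mathbb{PQ})$ on $M$ consists of a smooth distribution $H$ of codimension three, a conformal class $[g]$ of metrics of signature $(2n,2n)$ on $H$, and a bundle $\mathbb{PQ}\subset \mathrm{End}(H)$, such that for each $g\in[g]$ there are, near every point, 1-forms $\eta_1,\eta_2,\eta_3$ with $H=\bigcap_s\ker\eta_s$ and a local basis $I_1,I_2,I_3$ of $\mathbb{PQ}$ (together called a *local frame* for $g$) with $$I_s^2=\epsilon_s\,\mathrm{id},\quad I_iI_j=-I_jI_i=-\epsilon_kI_k,\quad g(I_sX,I_sY)=-\epsilon_s g(X,Y),\quad d\eta_s(X,Y)=-2\epsilon_s g(I_sX,Y)\qquad (X,Y\in H).$$ Fix $g\in[g]$ and put $\omega_s(X,Y)=g(I_sX,Y)$. For a bilinear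 form $P$ on $H$, $P(e_a,e_a)$ denotes the metric contraction $\sum_a g(e_a,e_a)P(e_a,e_a)$ over an orthonormal basis; on $\mathrm{End}(H)$ let $\langle A,B\rangle=g(Ae_a,Be_a)$. At each point $sp(1,\mathbb R)=\mathbb{PQ}$, and $sp(n,\mathbb R)$ is the space of $g$-skew endomorphisms of $H$ commuting with $\mathbb{PQ}$. *Reeb fields* of a local frame are vector fields $\xi_1,\xi_2,\xi_3$ on its domain with $$\eta_s(\xi_t)=\delta_{st},\qquad (\xi_s\lrcorner d\eta_s)|_H=0,\qquad (\xi_j\lrcorner d\eta_i)|_H=\epsilon_k(\xi_i\lrcorner d\eta_j)|_H.\tag{xi}$$ For a complement $V$ of $H$ in $TM$ (a smooth rank-three distribution with $TM=H\oplus V$), subscripts $H,V$ denote the projections, and $\varphi:V\to\mathbb{PQ}$ is $\varphi(v)=\sum_s\eta_s(v)I_s$. For a connection $\nabla$ on $TM$, $T(A,B)=\nabla_AB-\nabla_BA-[A,B]$. Call $(V,\nabla)$ *canonical* if 1. $\nabla$ preserves $H$ and $V$, $\nabla g=0$ on $H$, and $\nabla\sigma\in\Gamma(\mathbb{PQ})$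 for $\sigma\in\Gamma(\mathbb{PQ})$; 2. $T(X,Y)=-[X,Y]_V$ for $X,Y\in H$; 3. for $\xi\in V$ the endomorphism $T(\xi,\cdot)_H$ of $H$ lies in $(sp(n,\mathbb R)\oplus sp(1,\mathbb R))^\perp\subset \mathrm{End}(H)$; 4. $\nabla\varphi=0$. **Theorem.** If $n=1$, assume moreover that near every point there is a local frame for $g$ that has Reeb fields. Then there is a unique complement $V$ of $H$ that is locally spanned by Reeb fields; over the domain of every local frame $V$ is spanned by Reeb fields of that frame. There is a unique connection $\nabla$ such that $(V,\nabla)$ is canonical. If $n>1$, no other complement $V'$ admits a connection $\nabla'$ with $(V',\nabla')$ canonical. Explicitly, there are smooth $\tau,\mu$ (bilinear forms on $H$) and $\lambda:M\to\mathbb R$ such that, for every local frame and its Reeb fields $\xi_s$ spanning $V$, there are smooth 1-forms $\alpha_s$ for which the following holds. Here $X,Y\in H$; $g$ is extended to $TM$ by $V\perp H$, $g|_V=-\sum_s\epsilon_s\eta_s^2$, and $\omega_s$ by zero on $V$; $T(A,B,C)=g(T(A,B),C)$; $(\mathbb L_{\xi_t}I_s)X=[\xi_t,I_sX]_H-I_s[\xi_t,X]_H$;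 $T^0(\xi,X,Y)$ and $T^a(\xi,X,Y)$ are the symmetric and skew-symmetric parts of $T(\xi,X,Y)$ in $X,Y$. * The extended metric is parallel, $\nabla I_i=\alpha_jI_k+\epsilon_k\alpha_kI_j$ and $\nabla\xi_i=\alpha_j\xi_k+\epsilon_k\alpha_k\xi_j$, where $$\alpha_k(X)=d\eta_i(\xi_j,X)=\epsilon_kd\eta_j(\xi_i,X),\quad \alpha_j(\xi_i)=-\epsilon_jd\eta_i(\xi_i,\xi_k),\quad \alpha_k(\xi_i)=-d\eta_i(\xi_i,\xi_j),$$ $$\alpha_i(\xi_i)=\tfrac12\big[\epsilon_kd\eta_i(\xi_j,\xi_k)+d\eta_j(\xi_k,\xi_i)-\epsilon_id\eta_k(\xi_i,\xi_j)-\epsilon_j\lambda\big]=\tfrac{\epsilon_j}{4n}g((\mathbb L_{\xi_i}I_k)I_je_a,e_a),$$ $$\lambda=\tfrac1{2n}g((\mathbb L_{\xi_i}I_k)e_a,I_je_a)-\epsilon_id\eta_i(\xi_j,\xi_k)+\epsilon_jd\eta_j(\xi_k,\xi_i)+\epsilon_kd\eta_k(\xi_i,\xi_j).$$ * $T(X,Y)=\sum_sd\eta_s(X,Y)\xi_s=-2\sum_s\epsilon_s\omega_s(X,Y)\xi_s$;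 $T(\xi_s,X)=\nabla_{\xi_s}X-[\xi_s,X]_H\in H$; $T(\xi_t,\xi_s,X)=-\epsilon_i(\mathbb L_{\xi_t}\omega_i)(\xi_s,I_iX)$; $T(\xi_i,\xi_j,\xi_i)=T(\xi_i,\xi_k,\xi_i)=0$; $T(\xi_i,\xi_j,\xi_k)=-\lambda$. * $T(\xi_t,e_a,e_a)=T(\xi_t,I_se_a,e_a)=0$; $T^0(\xi_t,X,Y)=\frac12(\mathbb L_{\xi_t}g)(X,Y)$; and $T^a(\xi_t,\cdot,\cdot)=-\frac18\big(B_t-(B_t)_{sp(1)}\big)$, where $$B_t(X,Y)=\sum_s\epsilon_s\big[g((\mathbb L_{\xi_t}I_s)X,I_sY)-g((\mathbb L_{\xi_t}I_s)Y,I_sX)\big],\qquad (B_t)_{sp(1)}=-\frac1{4n}\sum_s\epsilon_sB_t(e_a,I_se_a)\,\omega_s.$$ * $\tau(X,Y)=-\sum_s\epsilon_sT^0(\xi_s,I_sX,Y)$ is symmetric, $\tau(e_a,e_a)=\tau(I_se_a,e_a)=0$, $\tau(X,Y)-\sum_s\epsilon_s\tau(I_sX,I_sY)=0$, and $T^0(\xi_s,X,Y)=-\frac14[\tau(I_sX,Y)+\tau(X,I_sY)]$.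 * $\mu(X,Y)=\epsilon_sT^a(\xi_s,I_sX,Y)$ for each $s$; $\mu$ is symmetric and trace-free, $\mu(I_sX,I_sY)=-\epsilon_s\mu(X,Y)$, $T^a(\xi_s,X,Y)=\mu(I_sX,Y)$; and $\mu=0$ if $n=1$. -/

import Mathlib

open scoped Manifold ContDiff
open VectorField

noncomputable section

namespace Pqc

/-- The signs `ε₁ = ε₂ = 1`, `ε₃ = -1`; the index set `{1, 2, 3}` is `Fin 3 = {0, 1, 2}`, and the
cyclic triples `(i, j, k)` are `(i, i + 1, i + 2)`. -/
def eps : Fin 3 → ℝ := ![1, 1, -1]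

section Fields

variable (n : ℕ) (M : Type*) [TopologicalSpace M]
  [ChartedSpace (EuclideanSpace ℝ (Fin (4 * n + 3))) M] [IsManifold (𝓡 (4 * n + 3)) ∞ M]

/-- The tangent space at `x` of a manifold of dimension `4n + 3`. -/
abbrev Tan (x : M) : Type := TangentSpace (𝓡 (4 * n + 3)) x

/-- (Not necessarily smooth) vector fields. -/
abbrev VField : Type _ := Π x : M, Tan n M x

/-- A field of subspaces of the tangent spaces. -/
abbrev SubspaceField : Type _ := Π x : M, Submodule ℝ (Tan n M x)

variable {n M}

/-- Horizontal vector fields: sections of the field of subspaces `H`. -/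
abbrev HField (H : SubspaceField n M) : Type _ := Π x : M, H x

/-- A horizontal vector field, seen as a vector field. -/
def HField.toVField {H : SubspaceField n M} (X : HField H) : VField n M := fun x => (X x : Tan n M x)

/-- Smoothness of a function on `U`. -/
def SmoothFun (U : Set M) (f : M → ℝ) : Prop := ContMDiffOn (𝓡 (4 * n + 3)) 𝓘(ℝ, ℝ) ∞ f U

/-- Smoothness of a vector field on `U`. -/
def SmoothVF (U : Set M) (X : VField n M) : Prop :=
  ContMDiffOn (𝓡 (4 * n + 3)) (𝓡 (4 * n + 3)).tangent ∞
    (fun x => (⟨x, X x⟩ : TangentBundle (𝓡 (4 * n + 3)) M)) U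

/-- Smoothness of a horizontal vector field on `U`. -/
def SmoothHF {H : SubspaceField n M} (U : Set M) (X : HField H) : Prop := SmoothVF U X.toVField

/-- Smooth distribution of rank `k`: locally spanned by `k` smooth pointwise independent fields. -/
def IsSmoothDistribution (k : ℕ) (D : SubspaceField n M) : Prop :=
  ∀ x₀ : M, ∃ U : Set M, IsOpen U ∧ x₀ ∈ U ∧ ∃ e : Fin k → VField n M,
    (∀ a, SmoothVF U (e a)) ∧
    ∀ x ∈ U, LinearIndependent ℝ (fun a => e a x) ∧
      Submodule.span ℝ (Set.range fun a => e a x) = D x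

/-- Smoothness on `U` of a 1-form, tested on smooth vector fields. -/
def SmoothOneForm (U : Set M) (η : Π x : M, Module.Dual ℝ (Tan n M x)) : Prop :=
  ∀ W : Set M, IsOpen W → W ⊆ U → ∀ X : VField n M, SmoothVF W X →
    SmoothFun (n := n) W (fun x => η x (X x))

/-- Smoothness on `U` of a field of endomorphisms of `H`, tested on smooth horizontal fields. -/
def SmoothEnd {H : SubspaceField n M} (U : Set M) (A : Π x : M, Module.End ℝ (H x)) : Prop :=
  ∀ W : Set M, IsOpen W → W ⊆ U → ∀ X : HField H, SmoothHF W X →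
    SmoothHF W (fun x => A x (X x) : HField H)

/-- Smoothness on `U` of a field of bilinear forms on `H`, tested on smooth horizontal fields. -/
def SmoothForm {H : SubspaceField n M} (U : Set M)
    (B : Π x : M, LinearMap.BilinForm ℝ (H x)) : Prop :=
  ∀ W : Set M, IsOpen W → W ⊆ U → ∀ X Y : HField H, SmoothHF W X → SmoothHF W Y →
    SmoothFun (n := n) W (fun x => B x (X x) (Y x))

/-- The derivative `v(f)` of a function `f` along a tangent vector `v` at `x`. -/
def dirD (f : M → ℝ) (x : M) (v : Tan n M x) : ℝ := mvfderiv (𝓡 (4 * n + 3)) f x v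

/-- The Lie bracket `[X, Y]` of vector fields. -/
def bracket (X Y : VField n M) : VField n M := mlieBracket (𝓡 (4 * n + 3)) X Y

/-- The exterior derivative of a 1-form:
`dη(X, Y) = X(η(Y)) - Y(η(X)) - η([X, Y])` at the point `x`. -/
def extD (η : Π x : M, Module.Dual ℝ (Tan n M x)) (X Y : VField n M) (x : M) : ℝ :=
  dirD (fun y => η y (Y y)) x (X x) - dirD (fun y => η y (X y)) x (Y x) - η x (bracket X Y x)

/-- The Lie derivative of a `(0,2)`-tensor:
`(L_ξ B)(X, Y) = ξ(B(X, Y)) - B([ξ, X], Y) - B(X, [ξ, Y])` at the point `x`. -/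
def lieForm (B : Π x : M, LinearMap.BilinForm ℝ (Tan n M x)) (ξ X Y : VField n M) (x : M) : ℝ :=
  dirD (fun y => B y (X y) (Y y)) x (ξ x) - B x (bracket ξ X x) (Y x)
    - B x (X x) (bracket ξ Y x)

end Fields

section Structures

variable {n : ℕ} {M : Type*} [TopologicalSpace M]
  [ChartedSpace (EuclideanSpace ℝ (Fin (4 * n + 3))) M] [IsManifold (𝓡 (4 * n + 3)) ∞ M]

/-- A smooth neutral metric, of signature `(2n, 2n)`, on the distribution `H`. -/
structure HMetric (H : SubspaceField n M) where
  form : Π x : M, LinearMap.BilinForm ℝ (H x)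
  symm : ∀ x, ∀ X Y : H x, form x X Y = form x Y X
  nondegenerate : ∀ x, (form x).Nondegenerate
  neutral : ∀ x, ∃ b : Module.Basis (Fin (2 * n) ⊕ Fin (2 * n)) ℝ (H x), ∀ a c,
    form x (b a) (b c) = if a = c then Sum.elim (fun _ => (1 : ℝ)) (fun _ => -1) a else 0
  smooth : SmoothForm Set.univ form

/-- The metric contraction `P(e_a, e_a) = ∑ₐ g(e_a, e_a) P(e_a, e_a)` of a bilinear form `P` on
`H x`, that is, the trace of the endomorphism `A` with `g(A X, Y) = P(X, Y)`. -/
def HMetric.contr {H : SubspaceField n M} (g : HMetric H) (x : M)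
    (P : LinearMap.BilinForm ℝ (H x)) : ℝ :=
  haveI : FiniteDimensional ℝ (Tan n M x) :=
    inferInstanceAs (FiniteDimensional ℝ (EuclideanSpace ℝ (Fin (4 * n + 3))))
  LinearMap.trace ℝ (H x)
    (((g.form x).toDual (g.nondegenerate x)).symm.toLinearMap ∘ₗ P)

/-- The neutral inner product `⟨A, B⟩ = ∑ₐ g(e_a, e_a) g(A e_a, B e_a)` of endomorphisms. -/
def HMetric.endInner {H : SubspaceField n M} (g : HMetric H) (x : M)
    (A B : Module.End ℝ (H x)) : ℝ :=
  g.contr x ((g.form x).comp A B)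

/-- A compatible local paraquaternionic contact frame on the open set `U`, for the distribution
`H`, the metric `g` on `H` and the bundle `PQ` of endomorphisms of `H`: smooth 1-forms
`η₁, η₂, η₃` on `U` with common kernel `H`, and a smooth local basis `I₁, I₂, I₃` of `PQ`
satisfying the paraquaternionic identities, compatible with `g` and with
`dη_s(X, Y) = -2 ε_s g(I_s X, Y)` on `H`. -/
structure LocalFrame (H : SubspaceField n M) (PQ : Π x : M, Submodule ℝ (Module.End ℝ (H x)))
    (g : HMetric H) (U : Set M) where
  isOpen : IsOpen U
  η : Fin 3 → Π x : M, Module.Dual ℝ (Tan n M x)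
  I : Fin 3 → Π x : M, Module.End ℝ (H x)
  smooth_η : ∀ s, SmoothOneForm U (η s)
  smooth_I : ∀ s, SmoothEnd U (I s)
  ker_η : ∀ x ∈ U, H x = ⨅ s, LinearMap.ker (η s x)
  span_I : ∀ x ∈ U, PQ x = Submodule.span ℝ (Set.range fun s => I s x)
  I_sq : ∀ s, ∀ x ∈ U, I s x * I s x = eps s • 1
  I_mul : ∀ i, ∀ x ∈ U, I i x * I (i + 1) x = -(eps (i + 2) • I (i + 2) x)
  I_mul_rev : ∀ i, ∀ x ∈ U, I (i + 1) x * I i x = eps (i + 2) • I (i + 2) x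
  compatible : ∀ s, ∀ x ∈ U, ∀ X Y : H x,
    g.form x (I s x X) (I s x Y) = -(eps s * g.form x X Y)
  contact : ∀ s, ∀ W : Set M, IsOpen W → W ⊆ U → ∀ X Y : HField H, SmoothHF W X → SmoothHF W Y →
    ∀ x ∈ W, extD (η s) X.toVField Y.toVField x = -2 * eps s * g.form x (I s x (X x)) (Y x)

variable (n M) in
/-- A paraquaternionic contact structure `(H, [g], PQ)` on a manifold of dimension `4n + 3`. -/
structure PqcStructure where
  /-- the horizontal distribution, of codimension three -/
  H : SubspaceField n M
  smooth_H : IsSmoothDistribution (4 * n) H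
  /-- the conformal class `[g]` -/
  metrics : Set (HMetric H)
  metrics_nonempty : metrics.Nonempty
  conformal : ∀ g ∈ metrics, ∀ g' : HMetric H, g' ∈ metrics ↔
    ∃ f : M → ℝ, SmoothFun (n := n) Set.univ f ∧ (∀ x, 0 < f x) ∧
      ∀ x, ∀ X Y : H x, g'.form x X Y = f x * g.form x X Y
  /-- the bundle of paraquaternionic endomorphisms of `H` -/
  PQ : Π x : M, Submodule ℝ (Module.End ℝ (H x))
  exists_frame : ∀ g ∈ metrics, ∀ x₀ : M, ∃ U : Set M, x₀ ∈ U ∧ Nonempty (LocalFrame H PQ g U)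

/-- A smooth rank three distribution `V` with `TM = H ⊕ V`. -/
structure Complement (H : SubspaceField n M) where
  V : SubspaceField n M
  smooth_V : IsSmoothDistribution 3 V
  isCompl : ∀ x, IsCompl (H x) (V x)

/-- The projection to `H` along `V`. -/
def Complement.projH {H : SubspaceField n M} (C : Complement H) (x : M) : Tan n M x →ₗ[ℝ] H x :=
  (H x).projectionOnto (C.V x) (C.isCompl x)

/-- The projection to `V` along `H`. -/
def Complement.projV {H : SubspaceField n M} (C : Complement H) (x : M) :
    Tan n M x →ₗ[ℝ] Tan n M x :=
  (C.V x).projection (H x) (C.isCompl x).symm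

variable {H : SubspaceField n M} {PQ : Π x : M, Submodule ℝ (Module.End ℝ (H x))} {g : HMetric H}
  {U : Set M}

/-- `ξ₁, ξ₂, ξ₃` are Reeb fields of the local frame:
`η_s(ξ_t) = δ_st`, `(ξ_s ⌟ dη_s)|_H = 0` and `(ξ_j ⌟ dη_i)|_H = ε_k (ξ_i ⌟ dη_j)|_H`. -/
structure IsReeb (F : LocalFrame H PQ g U) (ξ : Fin 3 → VField n M) : Prop where
  smooth : ∀ s, SmoothVF U (ξ s)
  dual : ∀ s t, ∀ x ∈ U, F.η s x (ξ t x) = if s = t then 1 else 0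
  self : ∀ s, ∀ W : Set M, IsOpen W → W ⊆ U → ∀ X : HField H, SmoothHF W X →
    ∀ x ∈ W, extD (F.η s) (ξ s) X.toVField x = 0
  cross : ∀ i, ∀ W : Set M, IsOpen W → W ⊆ U → ∀ X : HField H, SmoothHF W X →
    ∀ x ∈ W, extD (F.η i) (ξ (i + 1)) X.toVField x
      = eps (i + 2) * extD (F.η (i + 1)) (ξ i) X.toVField x

/-- `V` is spanned over `U` by `ξ₁, ξ₂, ξ₃`. -/
def Complement.SpannedBy (C : Complement H) (U : Set M) (ξ : Fin 3 → VField n M) : Prop :=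
  ∀ x ∈ U, C.V x = Submodule.span ℝ (Set.range fun s => ξ s x)

/-- Around every point there is a local frame with Reeb fields. -/
def PqcStructure.HasReebFields (P : PqcStructure n M) (g : HMetric P.H) : Prop :=
  ∀ x₀ : M, ∃ (U : Set M) (F : LocalFrame P.H P.PQ g U) (ξ : Fin 3 → VField n M),
    x₀ ∈ U ∧ IsReeb F ξ

/-- `V` is locally spanned by Reeb fields. -/
def PqcStructure.IsReebComplement (P : PqcStructure n M) (g : HMetric P.H)
    (C : Complement P.H) : Prop :=
  ∀ x₀ : M, ∃ (U : Set M) (F : LocalFrame P.H P.PQ g U) (ξ : Fin 3 → VField n M),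
    x₀ ∈ U ∧ IsReeb F ξ ∧ C.SpannedBy U ξ

/-- The identification `φ` of `V` with the subspace `sp(1, ℝ) = PQ` of the endomorphisms of `H`,
`φ(ξ_s) = I_s` for the basis `ξ_s` of `V` with `η_s(ξ_t) = δ_st`, extended by zero to `H`. -/
def LocalFrame.phi (F : LocalFrame H PQ g U) (x : M) (v : Tan n M x) : Module.End ℝ (H x) :=
  ∑ s, F.η s x v • F.I s x

/-- The extended metric `g|_H + g|_V`, with `V ⟂ H` and
`g|_V = -∑ ε_s η_s² = η₃² - η₁² - η₂²`. -/
def LocalFrame.extMetric (F : LocalFrame H PQ g U) (C : Complement H) (x : M) :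
    LinearMap.BilinForm ℝ (Tan n M x) :=
  (g.form x).comp (C.projH x) (C.projH x)
    - ∑ s, eps s • LinearMap.BilinForm.linMulLin (F.η s x) (F.η s x)

/-- The fundamental 2-form `ω_s(X, Y) = g(I_s X, Y)`, extended by zero on `V`. -/
def LocalFrame.omega (F : LocalFrame H PQ g U) (C : Complement H) (s : Fin 3) (x : M) :
    LinearMap.BilinForm ℝ (Tan n M x) :=
  (g.form x).comp (F.I s x ∘ₗ C.projH x) (C.projH x)

/-- The algebra `sp(n, ℝ)` at `x`: `g`-skew endomorphisms of `H x` commuting with `PQ x`. -/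
def spn (g : HMetric H) (PQ : Π x : M, Submodule ℝ (Module.End ℝ (H x))) (x : M) :
    Set (Module.End ℝ (H x)) :=
  {A | (∀ X Y : H x, g.form x (A X) Y = -g.form x X (A Y)) ∧ ∀ B ∈ PQ x, A * B = B * A}

/-- The endomorphism `A` of `H x` lies in `(sp(n, ℝ) ⊕ sp(1, ℝ))^⊥`, where `sp(1, ℝ)` at `x`
is `PQ x`. -/
def InPerp (g : HMetric H) (PQ : Π x : M, Submodule ℝ (Module.End ℝ (H x))) (x : M)
    (A : Module.End ℝ (H x)) : Prop :=
  ∀ B ∈ spn g PQ x, ∀ D ∈ PQ x, g.endInner x A (B + D) = 0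

end Structures

section Connections

variable (n : ℕ) (M : Type*) [TopologicalSpace M]
  [ChartedSpace (EuclideanSpace ℝ (Fin (4 * n + 3))) M] [IsManifold (𝓡 (4 * n + 3)) ∞ M]

/-- Linear connections on `M`; `∇_v Y` at `x` is `nab Y x v`. -/
abbrev Conn : Type _ :=
  CovariantDerivative (𝓡 (4 * n + 3)) (EuclideanSpace ℝ (Fin (4 * n + 3)))
    (fun x : M => TangentSpace (𝓡 (4 * n + 3)) x)

variable {n M} {H : SubspaceField n M} {PQ : Π x : M, Submodule ℝ (Module.End ℝ (H x))}
  {g : HMetric H} {U : Set M}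

/-- The torsion `T(u, v)`, i.e. `T(A, B) = ∇_A B - ∇_B A - [A, B]`. -/
def tors (nab : Conn n M) (x : M) (u v : Tan n M x) : Tan n M x := nab.torsion x u v

/-- The horizontal part of `∇_v Y`, for a horizontal field `Y`. -/
def covH (C : Complement H) (nab : Conn n M) (Y : HField H) (x : M) (v : Tan n M x) : H x :=
  C.projH x (nab Y.toVField x v)

/-- The torsion endomorphism `T(u, ·)_H` of `H x`. -/
def torsEnd (C : Complement H) (nab : Conn n M) (x : M) (u : Tan n M x) : Module.End ℝ (H x) :=
  C.projH x ∘ₗ (nab.torsion x u).toLinearMap ∘ₗ (H x).subtype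

/-- `V` and `∇` satisfy the requirements on the canonical connection. -/
structure IsCanonical (g : HMetric H) (PQ : Π x : M, Submodule ℝ (Module.End ℝ (H x)))
    (C : Complement H) (nab : Conn n M) : Prop where
  smooth : CovariantDerivative.ContMDiffCovariantDerivative nab ∞
  /-- `∇` preserves `H` -/
  pres_H : ∀ W : Set M, IsOpen W → ∀ Y : HField H, SmoothHF W Y → ∀ x ∈ W, ∀ v,
    nab Y.toVField x v ∈ H x
  /-- `∇` preserves `V` -/
  pres_V : ∀ W : Set M, IsOpen W → ∀ Y : VField n M, SmoothVF W Y → (∀ x ∈ W, Y x ∈ C.V x) →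
    ∀ x ∈ W, ∀ v, nab Y x v ∈ C.V x
  /-- `∇ g = 0` -/
  pres_g : ∀ W : Set M, IsOpen W → ∀ Y Z : HField H, SmoothHF W Y → SmoothHF W Z →
    ∀ x ∈ W, ∀ v, dirD (fun y => g.form y (Y y) (Z y)) x v
      = g.form x (covH C nab Y x v) (Z x) + g.form x (Y x) (covH C nab Z x v)
  /-- `∇ σ` is a section of `PQ` for every section `σ` of `PQ` -/
  pres_PQ : ∀ W : Set M, IsOpen W → ∀ σ : Π x : M, Module.End ℝ (H x), SmoothEnd W σ →
    (∀ x ∈ W, σ x ∈ PQ x) → ∀ x ∈ W, ∀ v, ∃ ρ ∈ PQ x,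
      ∀ W' : Set M, IsOpen W' → W' ⊆ W → x ∈ W' → ∀ Y : HField H, SmoothHF W' Y →
        covH C nab (fun y => σ y (Y y)) x v - σ x (covH C nab Y x v) = ρ (Y x)
  /-- `T(X, Y) = -[X, Y]_V` for horizontal `X`, `Y` -/
  tors_H : ∀ W : Set M, IsOpen W → ∀ X Y : HField H, SmoothHF W X → SmoothHF W Y →
    ∀ x ∈ W, tors nab x (X x) (Y x) = -C.projV x (bracket X.toVField Y.toVField x)
  /-- `T(ξ, ·)_H` lies in `(sp(n, ℝ) ⊕ sp(1, ℝ))^⊥` for vertical `ξ` -/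
  tors_V : ∀ x, ∀ u ∈ C.V x, InPerp g PQ x (torsEnd C nab x u)
  /-- `∇ φ = 0` -/
  pres_phi : ∀ (U : Set M) (F : LocalFrame H PQ g U), ∀ W : Set M, IsOpen W → W ⊆ U →
    ∀ ξ : VField n M, SmoothVF W ξ → (∀ x ∈ W, ξ x ∈ C.V x) →
    ∀ Y : HField H, SmoothHF W Y → ∀ x ∈ W, ∀ v,
      covH C nab (fun y => F.phi y (ξ y) (Y y)) x v
        = F.phi x (nab ξ x v) (Y x) + F.phi x (ξ x) (covH C nab Y x v)

/-- `T(A, B, D) = g(T(A, B), D)` for the extended metric `g`. -/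
def tors3 (F : LocalFrame H PQ g U) (C : Complement H) (nab : Conn n M) (x : M)
    (A B D : Tan n M x) : ℝ :=
  F.extMetric C x (tors nab x A B) D

/-- The symmetric part `T⁰(u, X, Y)` of the torsion endomorphism, for `X`, `Y` in `H x`. -/
def torsSym (F : LocalFrame H PQ g U) (C : Complement H) (nab : Conn n M) (x : M)
    (u : Tan n M x) (X Y : H x) : ℝ :=
  (tors3 F C nab x u X Y + tors3 F C nab x u Y X) / 2

/-- The skew-symmetric part `Tᵃ(u, X, Y)` of the torsion endomorphism, for `X`, `Y` in `H x`. -/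
def torsSkew (F : LocalFrame H PQ g U) (C : Complement H) (nab : Conn n M) (x : M)
    (u : Tan n M x) (X Y : H x) : ℝ :=
  (tors3 F C nab x u X Y - tors3 F C nab x u Y X) / 2

/-- `L t s` is the horizontal Lie derivative `L_{ξ_t} I_s`, i.e.
`(L_{ξ_t} I_s) X = [ξ_t, I_s X]_H - I_s [ξ_t, X]_H`. -/
def IsLieI (F : LocalFrame H PQ g U) (C : Complement H) (ξ : Fin 3 → VField n M)
    (L : Fin 3 → Fin 3 → Π x : M, Module.End ℝ (H x)) : Prop :=
  ∀ t s, ∀ W : Set M, IsOpen W → W ⊆ U → ∀ X : HField H, SmoothHF W X → ∀ x ∈ W,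
    L t s x (X x)
      = C.projH x (bracket (ξ t) (HField.toVField (fun y => F.I s y (X y))) x)
        - F.I s x (C.projH x (bracket (ξ t) X.toVField x))

/-- The skew-symmetric form
`B(X, Y) = ∑_s ε_s (g((L_{ξ_t} I_s) X, I_s Y) - g((L_{ξ_t} I_s) Y, I_s X))`, where `Lt s` is
`L_{ξ_t} I_s` at the point `x`. -/
def skewLie (F : LocalFrame H PQ g U) (x : M) (Lt : Fin 3 → Module.End ℝ (H x)) :
    LinearMap.BilinForm ℝ (H x) :=
  ∑ s, eps s • ((g.form x).comp (Lt s) (F.I s x) - ((g.form x).comp (Lt s) (F.I s x)).flip)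

/-- The `sp(1, ℝ)`-component
`B_{sp(1)} = -(1 / 4n) ∑_s ε_s B(e_a, I_s e_a) ω_s` of a skew-symmetric form `B`. -/
def sp1Part (F : LocalFrame H PQ g U) (x : M) (B : LinearMap.BilinForm ℝ (H x)) :
    LinearMap.BilinForm ℝ (H x) :=
  -((1 / (4 * (n : ℝ))) • ∑ s, (eps s * g.contr x (B.comp LinearMap.id (F.I s x))) •
    (g.form x).comp (F.I s x) LinearMap.id)

/-- The explicit description, over the domain `U` of a local frame with Reeb fields `ξ`, of the
connection 1-forms `α_s` and the torsion in terms of the Lie derivatives of the structure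
tensors, the tensors `τ` and `μ` and the function `lam`. -/
structure ExplicitForm (F : LocalFrame H PQ g U) (C : Complement H) (nab : Conn n M)
    (ξ : Fin 3 → VField n M) (τ μ : Π x : M, LinearMap.BilinForm ℝ (H x)) (lam : M → ℝ)
    (α : Fin 3 → Π x : M, Module.Dual ℝ (Tan n M x))
    (L : Fin 3 → Fin 3 → Π x : M, Module.End ℝ (H x)) : Prop where
  /-- the extended metric is parallel -/
  pres_ext : ∀ W : Set M, IsOpen W → W ⊆ U → ∀ A B : VField n M, SmoothVF W A → SmoothVF W B →
    ∀ x ∈ W, ∀ v, dirD (fun y => F.extMetric C y (A y) (B y)) x v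
      = F.extMetric C x (nab A x v) (B x) + F.extMetric C x (A x) (nab B x v)
  /-- `∇ I_i = α_j I_k + ε_k α_k I_j` -/
  cov_I : ∀ i, ∀ W : Set M, IsOpen W → W ⊆ U → ∀ Y : HField H, SmoothHF W Y → ∀ x ∈ W, ∀ v,
    covH C nab (fun y => F.I i y (Y y)) x v - F.I i x (covH C nab Y x v)
      = α (i + 1) x v • F.I (i + 2) x (Y x)
        + (eps (i + 2) * α (i + 2) x v) • F.I (i + 1) x (Y x)
  /-- `∇ ξ_i = α_j ξ_k + ε_k α_k ξ_j` -/
  cov_ξ : ∀ i, ∀ x ∈ U, ∀ v, nab (ξ i) x v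
    = α (i + 1) x v • ξ (i + 2) x + (eps (i + 2) * α (i + 2) x v) • ξ (i + 1) x
  /-- `α_k(X) = dη_i(ξ_j, X) = ε_k dη_j(ξ_i, X)` -/
  α_hor : ∀ i, ∀ W : Set M, IsOpen W → W ⊆ U → ∀ X : HField H, SmoothHF W X → ∀ x ∈ W,
    α (i + 2) x (X x) = extD (F.η i) (ξ (i + 1)) X.toVField x ∧
    α (i + 2) x (X x) = eps (i + 2) * extD (F.η (i + 1)) (ξ i) X.toVField x
  /-- `α_j(ξ_i) = -ε_j dη_i(ξ_i, ξ_k)` -/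
  α_vert₁ : ∀ i, ∀ x ∈ U, α (i + 1) x (ξ i x) = -(eps (i + 1) * extD (F.η i) (ξ i) (ξ (i + 2)) x)
  /-- `α_k(ξ_i) = -dη_i(ξ_i, ξ_j)` -/
  α_vert₂ : ∀ i, ∀ x ∈ U, α (i + 2) x (ξ i x) = -extD (F.η i) (ξ i) (ξ (i + 1)) x
  /-- `α_i(ξ_i) = (ε_k dη_i(ξ_j, ξ_k) + dη_j(ξ_k, ξ_i) - ε_i dη_k(ξ_i, ξ_j) - ε_j λ) / 2` -/
  α_vert₃ : ∀ i, ∀ x ∈ U, α i x (ξ i x)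
    = (eps (i + 2) * extD (F.η i) (ξ (i + 1)) (ξ (i + 2)) x
      + extD (F.η (i + 1)) (ξ (i + 2)) (ξ i) x
      - eps i * extD (F.η (i + 2)) (ξ i) (ξ (i + 1)) x
      - eps (i + 1) * lam x) / 2
  /-- `α_i(ξ_i) = (ε_j / 4n) g((L_{ξ_i} I_k) I_j e_a, e_a)` -/
  α_vert₄ : ∀ i, ∀ x ∈ U, α i x (ξ i x)
    = eps (i + 1) / (4 * (n : ℝ))
      * g.contr x ((g.form x).comp (L i (i + 2) x * F.I (i + 1) x) LinearMap.id)
  /-- `λ = (1 / 2n) g((L_{ξ_i} I_k) e_a, I_j e_a) - ε_i dη_i(ξ_j, ξ_k) + ε_j dη_j(ξ_k, ξ_i)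
  + ε_k dη_k(ξ_i, ξ_j)` -/
  lam_eq : ∀ i, ∀ x ∈ U, lam x
    = 1 / (2 * (n : ℝ)) * g.contr x ((g.form x).comp (L i (i + 2) x) (F.I (i + 1) x))
      - eps i * extD (F.η i) (ξ (i + 1)) (ξ (i + 2)) x
      + eps (i + 1) * extD (F.η (i + 1)) (ξ (i + 2)) (ξ i) x
      + eps (i + 2) * extD (F.η (i + 2)) (ξ i) (ξ (i + 1)) x
  /-- `T(X, Y) = ∑ dη_s(X, Y) ξ_s` -/
  tors_hor₁ : ∀ W : Set M, IsOpen W → W ⊆ U → ∀ X Y : HField H, SmoothHF W X → SmoothHF W Y →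
    ∀ x ∈ W, tors nab x (X x) (Y x)
      = ∑ s, extD (F.η s) X.toVField Y.toVField x • ξ s x
  /-- `T(X, Y) = -2 ∑ ε_s ω_s(X, Y) ξ_s` -/
  tors_hor₂ : ∀ x ∈ U, ∀ X Y : H x, tors nab x X Y
      = -((2 : ℝ) • ∑ s, (eps s * F.omega C s x X Y) • ξ s x)
  /-- `T(ξ_s, X) = ∇_{ξ_s} X - [ξ_s, X]_H`; in particular it is horizontal -/
  tors_mixed : ∀ s, ∀ W : Set M, IsOpen W → W ⊆ U → ∀ X : HField H, SmoothHF W X → ∀ x ∈ W,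
    tors nab x (ξ s x) (X x)
      = nab X.toVField x (ξ s x) - (C.projH x (bracket (ξ s) X.toVField x) : Tan n M x)
        ∧ tors nab x (ξ s x) (X x) ∈ H x
  /-- `T(ξ_t, e_a, e_a) = 0` and `T(ξ_t, I_s e_a, e_a) = 0` -/
  tors_trace : ∀ t, ∀ x ∈ U,
    g.contr x ((g.form x).comp (torsEnd C nab x (ξ t x)) LinearMap.id) = 0 ∧
    ∀ s, g.contr x ((g.form x).comp (torsEnd C nab x (ξ t x) * F.I s x) LinearMap.id) = 0
  /-- `T⁰(ξ_t, X, Y) = (L_{ξ_t} g)(X, Y) / 2` -/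
  tors_sym : ∀ t, ∀ W : Set M, IsOpen W → W ⊆ U → ∀ X Y : HField H, SmoothHF W X → SmoothHF W Y →
    ∀ x ∈ W, torsSym F C nab x (ξ t x) (X x) (Y x)
      = lieForm (F.extMetric C) (ξ t) X.toVField Y.toVField x / 2
  /-- `Tᵃ(ξ_t, X, Y) = -(B(X, Y) - B_{sp(1)}(X, Y)) / 8` with
  `B(X, Y) = ∑_s ε_s (g((L_{ξ_t} I_s) X, I_s Y) - g((L_{ξ_t} I_s) Y, I_s X))` -/
  tors_skew : ∀ t, ∀ x ∈ U, ∀ X Y : H x, torsSkew F C nab x (ξ t x) X Y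
      = -(1 / 8) * (skewLie F x (fun s => L t s x) X Y
          - sp1Part F x (skewLie F x (fun s => L t s x)) X Y)
  /-- `T(ξ_t, ξ_s, X) = -ε_i (L_{ξ_t} ω_i)(ξ_s, I_i X)` -/
  tors_VVH : ∀ i s t, ∀ W : Set M, IsOpen W → W ⊆ U → ∀ X : HField H, SmoothHF W X → ∀ x ∈ W,
    tors3 F C nab x (ξ t x) (ξ s x) (X x)
      = -(eps i * lieForm (F.omega C i) (ξ t) (ξ s) (HField.toVField (fun y => F.I i y (X y))) x)
  /-- `T(ξ_i, ξ_j, ξ_i) = T(ξ_i, ξ_k, ξ_i) = 0` -/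
  tors_VVV₁ : ∀ i, ∀ x ∈ U, tors3 F C nab x (ξ i x) (ξ (i + 1) x) (ξ i x) = 0 ∧
    tors3 F C nab x (ξ i x) (ξ (i + 2) x) (ξ i x) = 0
  /-- `T(ξ_i, ξ_j, ξ_k) = -λ` -/
  tors_VVV₂ : ∀ i, ∀ x ∈ U, tors3 F C nab x (ξ i x) (ξ (i + 1) x) (ξ (i + 2) x) = -lam x
  /-- `τ(X, Y) = -∑ ε_s T⁰(ξ_s, I_s X, Y)` -/
  tau_def : ∀ x ∈ U, ∀ X Y : H x,
    τ x X Y = -∑ s, eps s * torsSym F C nab x (ξ s x) (F.I s x X) Y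
  tau_symm : ∀ x ∈ U, ∀ X Y : H x, τ x X Y = τ x Y X
  tau_trace : ∀ x ∈ U, g.contr x (τ x) = 0 ∧
    ∀ s, g.contr x ((τ x).comp (F.I s x) LinearMap.id) = 0
  /-- `τ(X, Y) - τ(I₁X, I₁Y) - τ(I₂X, I₂Y) + τ(I₃X, I₃Y) = 0` -/
  tau_type : ∀ x ∈ U, ∀ X Y : H x,
    τ x X Y - ∑ s, eps s * τ x (F.I s x X) (F.I s x Y) = 0
  /-- `T⁰(ξ_s, X, Y) = -(τ(I_s X, Y) + τ(X, I_s Y)) / 4` -/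
  tors_tau : ∀ s, ∀ x ∈ U, ∀ X Y : H x, torsSym F C nab x (ξ s x) X Y
    = -(1 / 4) * (τ x (F.I s x X) Y + τ x X (F.I s x Y))
  /-- `μ(X, Y) = ε_s Tᵃ(ξ_s, I_s X, Y)` for each `s` -/
  mu_def : ∀ s, ∀ x ∈ U, ∀ X Y : H x,
    μ x X Y = eps s * torsSkew F C nab x (ξ s x) (F.I s x X) Y
  mu_symm : ∀ x ∈ U, ∀ X Y : H x, μ x X Y = μ x Y X
  mu_trace : ∀ x ∈ U, g.contr x (μ x) = 0
  /-- `μ(I_s X, I_s Y) = -ε_s μ(X, Y)` -/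
  mu_type : ∀ s, ∀ x ∈ U, ∀ X Y : H x, μ x (F.I s x X) (F.I s x Y) = -(eps s * μ x X Y)
  /-- `Tᵃ(ξ_s, X, Y) = μ(I_s X, Y)` -/
  tors_mu : ∀ s, ∀ x ∈ U, ∀ X Y : H x, torsSkew F C nab x (ξ s x) X Y = μ x (F.I s x X) Y
  /-- in dimension seven `μ = 0` -/
  mu_zero : n = 1 → ∀ x ∈ U, μ x = 0

end Connections

end Pqc

end

noncomputable section

namespace Pqc

set_option linter.unusedSectionVars false

/-! ### Vector fields, the exterior derivative as a tensor, and d² = 0 -/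

section Basic

variable {n : ℕ} {M : Type*} [TopologicalSpace M]
  [ChartedSpace (EuclideanSpace ℝ (Fin (4 * n + 3))) M] [IsManifold (𝓡 (4 * n + 3)) ∞ M]

-- The geometry is reduced to linear algebra on a single space H_x by means of an auxiliary
-- connection. Near every point a local frame, together with any fields ξ_s dual to the η_s, has an
-- adapted connection D, for which g, I_s, η_s and ξ_s are all parallel (`adaptedConn_adapted`). Its
-- horizontal part is an average of flat connections, conjugated by 1, I_1, I_2, I_3. Everything of
-- interest then sits in the torsion of D. Its vertical part is dη_s, and d(dη_s) = 0 becomes a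
-- first Bianchi identity (`bianchi_extT`).
--
-- Reeb fields. Since dη_s is nondegenerate on H, each ξ_s has exactly one horizontal correction
-- with (ξ_s ⌟ dη_s)|_H = 0. On three horizontal vectors the Bianchi identity of D is a cyclic
-- relation between the horizontal torsion and the forms dη_i(ξ_s, ·). If dim H > 4 it can be
-- evaluated on vectors with orthogonal quaternionic spans, which yields the remaining Reeb
-- condition (`ParaQuat.cross_of_cyclic`); for n = 1 this condition is the extra hypothesis. Two
-- frames differ by a matrix orthogonal for diag(ε). Differentiating the orthogonality shows that
-- the Reeb condition does not depend on the frame (`ReebOn.change`), so the spans of the Reeb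
-- fields fit together to V.
--
-- Existence and uniqueness of ∇. The canonical connection is D plus a tensor. In horizontal
-- directions the tensor is the contorsion that removes the horizontal torsion; by the Bianchi
-- identity, the Reeb condition and an algebraic form of Hitchin's lemma on closed triples
-- (`ParaQuat.commute_of_cyclic`) this contorsion normalises the span of the I_s
-- (`ParaQuat.koszul_commute`). In the direction ξ_t the sp(n, ℝ) ⊕ sp(1, ℝ) component of the
-- torsion endomorphism is subtracted. The sp(1)-part of the tensor dictates its action on V through
-- φ. The difference of two canonical connections is skew and symmetric along H, hence zero there,
-- and along V it is both in and orthogonal to sp(n, ℝ) ⊕ sp(1, ℝ) (`CanonOn.unique`); uniqueness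
-- also glues the local connections. If n > 1 and (V', ∇') is canonical, its Bianchi identity reads
-- Σ ω_s ∧ θ_s = 0. This forces θ_s = 0 (`ParaQuat.wedge_injective`), which together with metricity
-- is the Reeb condition for V' (`CanonOn.reebOn`).
--
-- Explicit form. With one vertical argument the Bianchi identity of D gives the relations `TorsRel`
-- between the endomorphisms T(ξ_t, ·)_H and the numbers dη_s(ξ_u, ξ_v). Their symmetric part leads
-- to τ, their skew part orthogonal to sp(n, ℝ) ⊕ sp(1, ℝ) leads to μ, and their traces against the
-- I_s give α_s(ξ_t) and λ. The Lie derivatives L_{ξ_t} I_s are commutators of I_s with the torsion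
-- of D, since I_s is D-parallel. Finally τ and μ are contractions of the form Σ ε_s B(ξ_s) I_s, and
-- λ is the factor in φ(T(u, v)) = -(λ/2)[φ(u), φ(v)], so all three are independent of the frame.

scoped instance manifold_minSmoothness : IsManifold (𝓡 (4 * n + 3)) (minSmoothness ℝ 3) M :=
  IsManifold.of_le (n := ∞) (by
    rw [minSmoothness_of_isRCLikeNormedField]; exact WithTop.coe_le_coe.2 (le_top : (3 : ℕ∞) ≤ ⊤))

scoped instance finiteDimensional_tan (x : M) : FiniteDimensional ℝ (Tan n M x) :=
  inferInstanceAs (FiniteDimensional ℝ (EuclideanSpace ℝ (Fin (4 * n + 3))))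

/-- Differentiability of a vector field at a point. -/
def DiffVF (X : VField n M) (x : M) : Prop :=
  MDifferentiableAt (𝓡 (4 * n + 3)) (𝓡 (4 * n + 3)).tangent
    (fun y => (⟨y, X y⟩ : TangentBundle (𝓡 (4 * n + 3)) M)) x

/-- Differentiability of a function at a point. -/
def DiffFun (f : M → ℝ) (x : M) : Prop :=
  MDifferentiableAt (𝓡 (4 * n + 3)) 𝓘(ℝ, ℝ) f x

variable {U W : Set M} {X Y Z : VField n M} {f h : M → ℝ} {x : M}

theorem SmoothVF.mono (hX : SmoothVF U X) (h : W ⊆ U) : SmoothVF W X := ContMDiffOn.mono hX h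

theorem SmoothFun.mono (hf : SmoothFun (n := n) U f) (h : W ⊆ U) : SmoothFun (n := n) W f :=
  ContMDiffOn.mono hf h

theorem SmoothVF.diffVF (hX : SmoothVF U X) (hU : IsOpen U) (hx : x ∈ U) : DiffVF X x :=
  (hX.contMDiffAt (hU.mem_nhds hx)).mdifferentiableAt (by simp)

theorem SmoothFun.diffFun (hf : SmoothFun (n := n) U f) (hU : IsOpen U) (hx : x ∈ U) :
    DiffFun (n := n) f x :=
  (ContMDiffOn.contMDiffAt hf (hU.mem_nhds hx)).mdifferentiableAt (by simp)

theorem SmoothVF.congr (hX : SmoothVF U X) (h : ∀ y ∈ U, Y y = X y) : SmoothVF U Y :=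
  ContMDiffOn.congr hX fun y hy => by simp [h y hy]

theorem SmoothFun.congr (hf : SmoothFun (n := n) U f) (h' : ∀ y ∈ U, h y = f y) :
    SmoothFun (n := n) U h :=
  ContMDiffOn.congr hf h'

theorem SmoothVF.add (hX : SmoothVF U X) (hY : SmoothVF U Y) : SmoothVF U (fun y => X y + Y y) :=
  ContMDiffOn.add_section hX hY

theorem SmoothVF.sub (hX : SmoothVF U X) (hY : SmoothVF U Y) : SmoothVF U (fun y => X y - Y y) :=
  ContMDiffOn.sub_section hX hY

theorem SmoothVF.neg (hX : SmoothVF U X) : SmoothVF U (fun y => -X y) :=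
  ContMDiffOn.neg_section hX

theorem SmoothVF.smul (hf : SmoothFun (n := n) U f) (hX : SmoothVF U X) :
    SmoothVF U (fun y => f y • X y) :=
  ContMDiffOn.smul_section hf hX

theorem SmoothFun.const (c : ℝ) : SmoothFun (n := n) U (fun _ : M => c) := contMDiffOn_const

theorem SmoothVF.const_smul (c : ℝ) (hX : SmoothVF U X) : SmoothVF U (fun y => c • X y) :=
  SmoothVF.smul (SmoothFun.const c) hX

theorem SmoothVF.sum {ι : Type*} {s : Finset ι} {X : ι → VField n M}
    (hX : ∀ i ∈ s, SmoothVF U (X i)) : SmoothVF U (fun y => ∑ i ∈ s, X i y) :=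
  ContMDiffOn.sum_section hX

theorem SmoothFun.add (hf : SmoothFun (n := n) U f) (hh : SmoothFun (n := n) U h) :
    SmoothFun (n := n) U (fun y => f y + h y) := ContMDiffOn.add hf hh

theorem SmoothFun.sub (hf : SmoothFun (n := n) U f) (hh : SmoothFun (n := n) U h) :
    SmoothFun (n := n) U (fun y => f y - h y) := ContMDiffOn.sub hf hh

theorem SmoothFun.mul (hf : SmoothFun (n := n) U f) (hh : SmoothFun (n := n) U h) :
    SmoothFun (n := n) U (fun y => f y * h y) := ContMDiffOn.mul hf hh

theorem SmoothFun.const_mul (c : ℝ) (hf : SmoothFun (n := n) U f) :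
    SmoothFun (n := n) U (fun y => c * f y) := (SmoothFun.const c).mul hf

theorem SmoothFun.sum {ι : Type*} {s : Finset ι} {f : ι → M → ℝ}
    (hf : ∀ i ∈ s, SmoothFun (n := n) U (f i)) : SmoothFun (n := n) U (fun y => ∑ i ∈ s, f i y) :=
  contMDiffOn_finsetSum hf

theorem SmoothFun.inv (hf : SmoothFun (n := n) U f) (h0 : ∀ y ∈ U, f y ≠ 0) :
    SmoothFun (n := n) U (fun y => (f y)⁻¹) := ContMDiffOn.inv₀ hf h0

theorem SmoothFun.prod {ι : Type*} {s : Finset ι} {f : ι → M → ℝ}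
    (hf : ∀ i ∈ s, SmoothFun (n := n) U (f i)) : SmoothFun (n := n) U (fun y => ∏ i ∈ s, f i y) :=
  contMDiffOn_finsetProd hf

theorem SmoothVF.of_locally (h : ∀ x ∈ U, ∃ W, IsOpen W ∧ x ∈ W ∧ SmoothVF (U ∩ W) X) : SmoothVF U X :=
  contMDiffOn_of_locally_contMDiffOn h

theorem SmoothFun.of_locally (h : ∀ x ∈ U, ∃ W, IsOpen W ∧ x ∈ W ∧ SmoothFun (n := n) (U ∩ W) f) :
    SmoothFun (n := n) U f :=
  contMDiffOn_of_locally_contMDiffOn h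

theorem SmoothVF.bracket (hU : IsOpen U) (hX : SmoothVF U X) (hY : SmoothVF U Y) :
    SmoothVF U (bracket X Y) := by
  intro x hx
  have : IsManifold (𝓡 (4 * n + 3)) (((⊤ : ℕ∞) : WithTop ℕ∞) + 1) M := by simpa
  have := ContMDiffAt.mlieBracket_vectorField (m := ⊤) (n := ⊤)
    (hX.contMDiffAt (hU.mem_nhds hx)) (hY.contMDiffAt (hU.mem_nhds hx))
    (by simp [minSmoothness_of_isRCLikeNormedField])
  exact this.contMDiffWithinAt

theorem DiffVF.smul (hf : DiffFun (n := n) f x) (hX : DiffVF X x) : DiffVF (fun y => f y • X y) x :=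
  MDifferentiableAt.smul_section hf hX

theorem DiffVF.sum {ι : Type*} {s : Finset ι} {X : ι → VField n M}
    (hX : ∀ i ∈ s, DiffVF (X i) x) : DiffVF (fun y => ∑ i ∈ s, X i y) x :=
  MDifferentiableAt.sum_section hX

theorem DiffFun.add (hf : DiffFun (n := n) f x) (hh : DiffFun (n := n) h x) :
    DiffFun (n := n) (fun y => f y + h y) x := MDifferentiableAt.add hf hh

theorem DiffFun.sub (hf : DiffFun (n := n) f x) (hh : DiffFun (n := n) h x) :
    DiffFun (n := n) (fun y => f y - h y) x := MDifferentiableAt.sub hf hh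

theorem DiffFun.mul (hf : DiffFun (n := n) f x) (hh : DiffFun (n := n) h x) :
    DiffFun (n := n) (fun y => f y * h y) x := MDifferentiableAt.mul hf hh

theorem DiffFun.const (c : ℝ) : DiffFun (n := n) (fun _ : M => c) x := mdifferentiableAt_const

theorem DiffFun.congr (hf : DiffFun (n := n) f x) (h' : h =ᶠ[nhds x] f) : DiffFun (n := n) h x :=
  MDifferentiableAt.congr_of_eventuallyEq hf h'

theorem DiffVF.congr (hX : DiffVF X x) (h : ∀ᶠ y in nhds x, Y y = X y) : DiffVF Y x :=
  MDifferentiableAt.congr_of_eventuallyEq hX (h.mono fun y hy => by simp [hy])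

theorem dirD_congr (h' : h =ᶠ[nhds x] f) (v : Tan n M x) : dirD h x v = dirD f x v := by
  have := h'.mfderiv_eq (I := 𝓡 (4 * n + 3)) (I' := 𝓘(ℝ, ℝ))
  unfold dirD mvfderiv
  simp only [ContinuousLinearMap.comp_apply]
  rw [this, h'.eq_of_nhds]

theorem dirD_add (hf : DiffFun (n := n) f x) (hh : DiffFun (n := n) h x) (v : Tan n M x) :
    dirD (fun y => f y + h y) x v = dirD f x v + dirD h x v := by
  simp [dirD, mvfderiv_fun_add hf hh]

theorem dirD_sub (hf : DiffFun (n := n) f x) (hh : DiffFun (n := n) h x) (v : Tan n M x) :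
    dirD (fun y => f y - h y) x v = dirD f x v - dirD h x v := by
  simp [dirD, mvfderiv_fun_sub hf hh]

theorem dirD_neg (v : Tan n M x) :
    dirD (fun y => -f y) x v = -dirD f x v := by
  simp [dirD, mvfderiv_fun_neg]

theorem dirD_mul (hf : DiffFun (n := n) f x) (hh : DiffFun (n := n) h x) (v : Tan n M x) :
    dirD (fun y => f y * h y) x v = f x * dirD h x v + h x * dirD f x v := by
  simp [dirD, mvfderiv_fun_mul hf hh]

theorem dirD_const (c : ℝ) (v : Tan n M x) : dirD (fun _ : M => c) x v = 0 := by
  simp [dirD, mvfderiv_const]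

theorem dirD_const_mul (c : ℝ) (hf : DiffFun (n := n) f x) (v : Tan n M x) :
    dirD (fun y => c * f y) x v = c * dirD f x v := by
  rw [dirD_mul (DiffFun.const c) hf, dirD_const]; simp

theorem DiffFun.sum {ι : Type*} {s : Finset ι} {f : ι → M → ℝ}
    (hf : ∀ i ∈ s, DiffFun (n := n) (f i) x) : DiffFun (n := n) (fun y => ∑ i ∈ s, f i y) x := by
  classical
  induction s using Finset.induction_on with
  | empty => simpa using DiffFun.const 0
  | insert a s ha ih =>
    simp only [Finset.sum_insert ha]
    exact (hf a (by simp)).add (ih fun i hi => hf i (by simp [hi]))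

theorem dirD_sum {ι : Type*} {s : Finset ι} {f : ι → M → ℝ}
    (hf : ∀ i ∈ s, DiffFun (n := n) (f i) x) (v : Tan n M x) :
    dirD (fun y => ∑ i ∈ s, f i y) x v = ∑ i ∈ s, dirD (f i) x v := by
  classical
  induction s using Finset.induction_on with
  | empty => simpa using dirD_const 0 v
  | insert a s ha ih =>
    simp only [Finset.sum_insert ha]
    rw [dirD_add (hf a (by simp)) (DiffFun.sum fun i hi => hf i (by simp [hi])),
      ih fun i hi => hf i (by simp [hi])]

theorem dirD_vadd (f : M → ℝ) (v w : Tan n M x) : dirD f x (v + w) = dirD f x v + dirD f x w :=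
  map_add _ _ _

theorem dirD_vsmul (f : M → ℝ) (c : ℝ) (v : Tan n M x) : dirD f x (c • v) = c * dirD f x v :=
  map_smul _ _ _

/-- The derivative of a smooth function along a smooth field is smooth. -/
theorem SmoothFun.dirD (hU : IsOpen U) (hf : SmoothFun (n := n) U f) (hX : SmoothVF U X) :
    SmoothFun (n := n) U (fun y => dirD f y (X y)) := by
  have h1 := ContMDiffOn.contMDiffOn_tangentMapWithin (m := ∞) hf (by simp) hU.uniqueMDiffOn
  have h2 := h1.comp hX (fun y hy => hy)
  have h3 := (contMDiff_snd_tangentBundle_modelSpace ℝ 𝓘(ℝ, ℝ) (n := ∞)).comp_contMDiffOn h2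
  refine h3.congr fun y hy => ?_
  simp only [Function.comp, tangentMapWithin, mfderivWithin_of_isOpen hU hy]
  rfl

theorem bracket_swap (X Y : VField n M) (x : M) : bracket X Y x = -bracket Y X x :=
  mlieBracket_swap_apply

theorem bracket_congr {X X' Y Y' : VField n M} (hX : ∀ᶠ y in nhds x, X y = X' y)
    (hY : ∀ᶠ y in nhds x, Y y = Y' y) : bracket X Y x = bracket X' Y' x :=
  Filter.EventuallyEq.mlieBracket_vectorField_eq hX hY

theorem bracket_smul_right (hf : DiffFun (n := n) f x) (hY : DiffVF Y x) :
    bracket X (fun y => f y • Y y) x = dirD f x (X x) • Y x + f x • bracket X Y x :=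
  mlieBracket_smul_right hf hY

theorem bracket_add_right (hY : DiffVF Y x) (hZ : DiffVF Z x) :
    bracket X (fun y => Y y + Z y) x = bracket X Y x + bracket X Z x :=
  mlieBracket_add_right hY hZ

theorem jacobi (hU : IsOpen U) (hx : x ∈ U) (hX : SmoothVF U X) (hY : SmoothVF U Y)
    (hZ : SmoothVF U Z) : bracket X (bracket Y Z) x
      = bracket (bracket X Y) Z x + bracket Y (bracket X Z) x := by
  have h : ∀ {V : VField n M}, SmoothVF U V → ContMDiffAt (𝓡 (4 * n + 3)) (𝓡 (4 * n + 3)).tangent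
      (minSmoothness ℝ 2) (fun x => (⟨x, V x⟩ : TangentBundle (𝓡 (4 * n + 3)) M)) x := fun hV =>
    (hV.contMDiffAt (hU.mem_nhds hx)).of_le (by
      rw [minSmoothness_of_isRCLikeNormedField]; exact WithTop.coe_le_coe.2 (le_top : (2 : ℕ∞) ≤ ⊤))
  exact leibniz_identity_mlieBracket_apply (h hX) (h hY) (h hZ)

theorem exists_smooth_extend (x : M) (v : Tan n M x) :
    ∃ (W : Set M) (X : VField n M), IsOpen W ∧ x ∈ W ∧ SmoothVF W X ∧ X x = v := by
  obtain ⟨s, hs, h⟩ := FiberBundle.exists_contMDiffOn_extend (k := ∞) (𝓡 (4 * n + 3))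
    (EuclideanSpace ℝ (Fin (4 * n + 3))) (V := fun x : M => TangentSpace (𝓡 (4 * n + 3)) x) v
  obtain ⟨W, hWs, hW, hx⟩ := mem_nhds_iff.1 hs
  exact ⟨W, _, hW, hx, h.mono hWs, FiberBundle.extend_apply_self _ v⟩

/-- A local frame of the tangent bundle, with smooth coefficients. -/
theorem exists_tangent_frame (x : M) :
    ∃ (W : Set M) (E : Fin (4 * n + 3) → VField n M)
      (c : Fin (4 * n + 3) → Π y : M, Module.Dual ℝ (Tan n M y)),
      IsOpen W ∧ x ∈ W ∧ (∀ a, SmoothVF W (E a)) ∧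
      (∀ y ∈ W, ∀ v : Tan n M y, v = ∑ a, c a y v • E a y) ∧
      (∀ a, SmoothOneForm W (c a)) ∧
      (∀ a, ∀ Y : VField n M, ∀ y ∈ W, DiffVF Y y → DiffFun (n := n) (fun z => c a z (Y z)) y) := by
  let e := trivializationAt (EuclideanSpace ℝ (Fin (4 * n + 3)))
    (fun x : M => TangentSpace (𝓡 (4 * n + 3)) x) x
  let b := (EuclideanSpace.basisFun (Fin (4 * n + 3)) ℝ).toBasis
  refine ⟨e.baseSet, e.localFrame b, e.localFrameCoeff (𝓡 (4 * n + 3)) b, e.open_baseSet,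
    FiberBundle.mem_baseSet_trivializationAt _ _ x, ?_, ?_, ?_, ?_⟩
  · intro a
    exact e.contMDiffOn_localFrame_baseSet ∞ b a
  · intro y hy v
    have := Bundle.Trivialization.eq_sum_localFrameCoeff_smul (I := 𝓡 (4 * n + 3)) (e := e) (b := b)
      (s := FiberBundle.extend (EuclideanSpace ℝ (Fin (4 * n + 3))) v) hy
    simpa using this
  · intro a W hW hWU X hX
    exact contMDiffOn_localFrameCoeff b hW hWU hX a
  · intro a Y y hy hY
    exact mdifferentiableAt_localFrameCoeff b hy hY a

/-- Compare the Jacobi identity for X, Y, f Z with f times the one for X, Y, Z: after the product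
rule the difference is the desired identity multiplied by Z. The field Z is taken nonzero at x,
which is possible because the dimension 4n + 3 is positive. -/
theorem dirD_bracket (hU : IsOpen U) (hx : x ∈ U) (hf : SmoothFun (n := n) U f)
    (hX : SmoothVF U X) (hY : SmoothVF U Y) :
    dirD f x (bracket X Y x) = dirD (fun y => dirD f y (Y y)) x (X x)
      - dirD (fun y => dirD f y (X y)) x (Y x) := by
  obtain ⟨v, hv⟩ : ∃ v : Tan n M x, v ≠ 0 := by
    have : Nontrivial (EuclideanSpace ℝ (Fin (4 * n + 3))) := inferInstance
    exact exists_ne (0 : EuclideanSpace ℝ (Fin (4 * n + 3)))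
  obtain ⟨W, Z, hW, hxW, hZ, rfl⟩ := exists_smooth_extend x v
  have hUW := hU.inter hW
  have hxU : x ∈ U ∩ W := ⟨hx, hxW⟩
  replace hf := hf.mono (Set.inter_subset_left (t := W))
  replace hX := hX.mono (Set.inter_subset_left (t := W))
  replace hY := hY.mono (Set.inter_subset_left (t := W))
  replace hZ := hZ.mono (Set.inter_subset_right (s := U))
  have key : ∀ {A B : VField n M}, SmoothVF (U ∩ W) A → SmoothVF (U ∩ W) B →
      bracket A (bracket B (fun y => f y • Z y)) x
        = dirD (fun y => dirD f y (B y)) x (A x) • Z x + dirD f x (B x) • bracket A Z x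
          + (dirD f x (A x) • bracket B Z x + f x • bracket A (bracket B Z) x) := by
    intro A B hA hB
    have e1 : bracket A (bracket B (fun y => f y • Z y)) x = bracket A (fun y =>
        dirD f y (B y) • Z y + f y • bracket B Z y) x := by
      refine bracket_congr (Filter.Eventually.of_forall fun _ => rfl) ?_
      filter_upwards [hUW.mem_nhds hxU] with y hy
      exact bracket_smul_right (hf.diffFun hUW hy) (hZ.diffVF hUW hy)
    rw [e1, bracket_add_right ((SmoothVF.smul (hf.dirD hUW hB) hZ).diffVF hUW hxU)
      ((SmoothVF.smul hf (hB.bracket hUW hZ)).diffVF hUW hxU),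
      bracket_smul_right ((hf.dirD hUW hB).diffFun hUW hxU) (hZ.diffVF hUW hxU),
      bracket_smul_right (hf.diffFun hUW hxU) ((hB.bracket hUW hZ).diffVF hUW hxU)]
  have J := jacobi hUW hxU hX hY (SmoothVF.smul hf hZ)
  have J' := jacobi hUW hxU hX hY hZ
  rw [key hX hY, key hY hX, bracket_smul_right (hf.diffFun hUW hxU) (hZ.diffVF hUW hxU), J'] at J
  have : (dirD f x (bracket X Y x) - (dirD (fun y => dirD f y (Y y)) x (X x)
      - dirD (fun y => dirD f y (X y)) x (Y x))) • Z x = 0 := by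
    rw [← sub_eq_zero] at J
    rw [← neg_eq_zero, ← J]
    module
  rcases smul_eq_zero.1 this with h | h
  · linarith
  · exact absurd h hv

/-- The identity `d² = 0` on 1-forms. -/
theorem extD_extD {η : Π x : M, Module.Dual ℝ (Tan n M x)} (hη : SmoothOneForm U η)
    (hU : IsOpen U) (hx : x ∈ U) (hX : SmoothVF U X) (hY : SmoothVF U Y) (hZ : SmoothVF U Z) :
    (dirD (fun y => extD η Y Z y) x (X x) - extD η (bracket X Y) Z x)
    + (dirD (fun y => extD η Z X y) x (Y x) - extD η (bracket Y Z) X x)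
    + (dirD (fun y => extD η X Y y) x (Z x) - extD η (bracket Z X) Y x) = 0 := by
  have s : ∀ {A : VField n M}, SmoothVF U A → SmoothFun (n := n) U (fun y => η y (A y)) :=
    fun hA => hη U hU le_rfl _ hA
  have key : ∀ {A B C : VField n M}, SmoothVF U A → SmoothVF U B → SmoothVF U C →
      dirD (fun y => extD η B C y) x (A x) - extD η (bracket A B) C x
      = (dirD (fun y => dirD (fun z => η z (C z)) y (B y)) x (A x)
        - dirD (fun y => dirD (fun z => η z (B z)) y (C y)) x (A x)
        - dirD (fun y => η y (bracket B C y)) x (A x))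
        - (dirD (fun y => dirD (fun z => η z (C z)) y (B y)) x (A x)
          - dirD (fun y => dirD (fun z => η z (C z)) y (A y)) x (B x)
          - dirD (fun y => η y (bracket A B y)) x (C x) - η x (bracket (bracket A B) C x)) := by
    intro A B C hA hB hC
    have d1 := ((s hC).dirD hU hB).diffFun hU hx
    have d2 := ((s hB).dirD hU hC).diffFun hU hx
    have d3 := (s (hB.bracket hU hC)).diffFun hU hx
    simp only [extD]
    rw [dirD_sub (d1.sub d2) d3, dirD_sub d1 d2, dirD_bracket hU hx (s hC) hA hB]
  -- By `dirD_bracket` the derivative terms cancel in the cyclic sum; what remains is η applied to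
  -- the Jacobi identity, which is brought here to its cyclic form.
  have J := jacobi hU hx hX hY hZ
  rw [bracket_swap X (bracket Y Z), bracket_swap Y (bracket X Z),
    bracket_congr (X := bracket X Z) (X' := fun y => -bracket Z X y) (Y := Y) (Y' := Y)
      (Filter.Eventually.of_forall fun y => bracket_swap X Z y)
      (Filter.Eventually.of_forall fun _ => rfl)] at J
  have hneg : bracket (fun y => -bracket Z X y) Y x = -bracket (bracket Z X) Y x := by
    have := bracket_smul_right (X := Y) (f := fun _ => (-1 : ℝ)) (DiffFun.const (-1))
      ((hZ.bracket hU hX).diffVF hU hx)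
    rw [bracket_swap, bracket_swap (bracket Z X) Y]
    rw [neg_inj]
    simpa [dirD_const] using this
  rw [hneg, neg_neg] at J
  have J' := congrArg (η x) J
  rw [key hX hY hZ, key hY hZ hX, key hZ hX hY]
  simp only [map_neg, map_add] at J'
  linarith

/-- Smoothness of a 1-form is tested on smooth fields only, whereas the tensoriality criterion asks
about fields differentiable at the single point x. Expansion in a smooth local frame of the tangent
bundle bridges the two. -/
theorem SmoothOneForm.diffFun {η : Π x : M, Module.Dual ℝ (Tan n M x)} (hη : SmoothOneForm U η)
    (hU : IsOpen U) (hx : x ∈ U) (hY : DiffVF Y x) : DiffFun (n := n) (fun y => η y (Y y)) x := by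
  obtain ⟨W, E, c, hW, hxW, hE, hc, -, hc'⟩ := exists_tangent_frame (n := n) x
  have h1 : DiffFun (n := n) (fun y => ∑ a, c a y (Y y) * η y (E a y)) x := by
    refine DiffFun.sum fun a _ => (hc' a Y x hxW hY).mul ?_
    have h2 : SmoothFun (n := n) (U ∩ W) (fun y => η y (E a y)) :=
      hη (U ∩ W) (hU.inter hW) Set.inter_subset_left _ ((hE a).mono Set.inter_subset_right)
    exact h2.diffFun (hU.inter hW) ⟨hx, hxW⟩
  refine h1.congr ?_
  filter_upwards [hW.mem_nhds hxW] with y hy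
  conv_lhs => rw [hc y hy (Y y)]
  simp

/-- The 1-form `η` maps fields differentiable at `x` to functions differentiable at `x`. -/
def DiffForm (η : Π x : M, Module.Dual ℝ (Tan n M x)) (x : M) : Prop :=
  ∀ Y : VField n M, DiffVF Y x → DiffFun (n := n) (fun y => η y (Y y)) x

theorem extD_swap (η : Π x : M, Module.Dual ℝ (Tan n M x)) (X Y : VField n M) (x : M) :
    extD η X Y x = -extD η Y X x := by
  simp only [extD, bracket_swap X Y, map_neg]; ring

/-- The derivative of f coming from X(η(f Y)) cancels the one coming from [X, f Y]. Tensoriality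
makes `extT` well defined and turns the later identities into pointwise linear algebra. -/
theorem extD_tensorial_right {η : Π x : M, Module.Dual ℝ (Tan n M x)} (hη : DiffForm η x)
    (X : VField n M) :
    TensorialAt (𝓡 (4 * n + 3)) (EuclideanSpace ℝ (Fin (4 * n + 3))) (fun Y => extD η X Y x) x where
  smul {f σ} hf hσ := by
    change extD η X (fun y => f y • σ y) x = f x * _
    simp only [extD]
    rw [bracket_smul_right hf hσ]
    have : dirD (fun y => η y (f y • σ y)) x (X x) = dirD (fun y => f y * η y (σ y)) x (X x) := by
      simp
    rw [this, dirD_mul hf (hη _ hσ), dirD_vsmul]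
    simp
    ring
  add {σ σ'} hσ hσ' := by
    change extD η X (fun y => σ y + σ' y) x = _
    simp only [extD]
    rw [bracket_add_right hσ hσ']
    have : dirD (fun y => η y (σ y + σ' y)) x (X x)
        = dirD (fun y => η y (σ y) + η y (σ' y)) x (X x) := by simp
    rw [this, dirD_add (hη _ hσ) (hη _ hσ'), dirD_vadd]
    simp
    ring

theorem extD_tensorial_left {η : Π x : M, Module.Dual ℝ (Tan n M x)} (hη : DiffForm η x)
    (Y : VField n M) :
    TensorialAt (𝓡 (4 * n + 3)) (EuclideanSpace ℝ (Fin (4 * n + 3))) (fun X => extD η X Y x) x where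
  smul {f σ} hf hσ := by
    have := (extD_tensorial_right hη Y).smul hf hσ
    simp only [extD_swap η _ Y, this, smul_neg]
  add {σ σ'} hσ hσ' := by
    have := (extD_tensorial_right hη Y).add hσ hσ'
    simp only [extD_swap η _ Y, this]; ring

open scoped Classical in
/-- The exterior derivative of a 1-form at a point, as a bilinear form on the tangent space. -/
def extT (η : Π x : M, Module.Dual ℝ (Tan n M x)) (x : M) : LinearMap.BilinForm ℝ (Tan n M x) :=
  if h : DiffForm η x then
    LinearMap.mk₂ ℝ (fun u v => TensorialAt.mkHom₂ (fun X Y => extD η X Y x) x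
      (fun Y _ => extD_tensorial_left h Y) (fun X _ => extD_tensorial_right h X) u v)
      (by simp) (by simp) (by simp) (by simp)
  else 0

theorem extT_apply {η : Π x : M, Module.Dual ℝ (Tan n M x)} (h : DiffForm η x) (hX : DiffVF X x)
    (hY : DiffVF Y x) : extT η x (X x) (Y x) = extD η X Y x := by
  simp only [extT, dif_pos h, LinearMap.mk₂_apply]
  exact TensorialAt.mkHom₂_apply _ _ hX hY

theorem extT_swap (η : Π x : M, Module.Dual ℝ (Tan n M x)) (u v : Tan n M x) :
    extT η x u v = -extT η x v u := by
  by_cases h : DiffForm η x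
  · obtain ⟨W, X, hW, hx, hX, rfl⟩ := exists_smooth_extend x u
    obtain ⟨W', Y, hW', hx', hY, rfl⟩ := exists_smooth_extend x v
    rw [extT_apply h (hX.diffVF hW hx) (hY.diffVF hW' hx'),
      extT_apply h (hY.diffVF hW' hx') (hX.diffVF hW hx), extD_swap]
  · simp [extT, dif_neg h]

theorem SmoothOneForm.diffForm {η : Π x : M, Module.Dual ℝ (Tan n M x)} (hη : SmoothOneForm U η)
    (hU : IsOpen U) (hx : x ∈ U) : DiffForm η x := fun _ hY => hη.diffFun hU hx hY

/-- The exterior derivative of a smooth 1-form is smooth. -/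
theorem SmoothOneForm.extT {η : Π x : M, Module.Dual ℝ (Tan n M x)} (hη : SmoothOneForm U η)
    (hU : IsOpen U) (hW : IsOpen W) (hWU : W ⊆ U) (hX : SmoothVF W X) (hY : SmoothVF W Y) :
    SmoothFun (n := n) W (fun y => extT η y (X y) (Y y)) := by
  have : SmoothFun (n := n) W (fun y => extD η X Y y) :=
    (((hη W hW hWU _ hY).dirD hW hX).sub ((hη W hW hWU _ hX).dirD hW hY)).sub
      (hη W hW hWU _ (hX.bracket hW hY))
  refine this.congr fun y hy => ?_
  exact extT_apply (hη.diffForm hU (hWU hy)) (hX.diffVF hW hy) (hY.diffVF hW hy)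

/-- The first Bianchi identity for the closed 2-form `dη`, in terms of an arbitrary connection. -/
theorem bianchi_extT {η : Π x : M, Module.Dual ℝ (Tan n M x)} (hη : SmoothOneForm U η)
    (D : Conn n M)
    (hU : IsOpen U) (hx : x ∈ U) (hX : SmoothVF U X) (hY : SmoothVF U Y) (hZ : SmoothVF U Z) :
    (dirD (fun y => Pqc.extT η y (Y y) (Z y)) x (X x) - Pqc.extT η x (D Y x (X x)) (Z x)
      - Pqc.extT η x (Y x) (D Z x (X x)) + Pqc.extT η x (tors D x (X x) (Y x)) (Z x))
    + (dirD (fun y => Pqc.extT η y (Z y) (X y)) x (Y x) - Pqc.extT η x (D Z x (Y x)) (X x)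
      - Pqc.extT η x (Z x) (D X x (Y x)) + Pqc.extT η x (tors D x (Y x) (Z x)) (X x))
    + (dirD (fun y => Pqc.extT η y (X y) (Y y)) x (Z x) - Pqc.extT η x (D X x (Z x)) (Y x)
      - Pqc.extT η x (X x) (D Y x (Z x)) + Pqc.extT η x (tors D x (Z x) (X x)) (Y x)) = 0 := by
  -- The brackets in d(dη) are eliminated through [A, B] = D_A B - D_B A - T(A, B); the cyclic sum
  -- regroups into covariant derivatives of dη and torsion terms.
  have key : ∀ {A B C : VField n M}, SmoothVF U A → SmoothVF U B → SmoothVF U C →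
      dirD (fun y => extD η B C y) x (A x) - extD η (bracket A B) C x
      = dirD (fun y => Pqc.extT η y (B y) (C y)) x (A x) - Pqc.extT η x (D B x (A x)) (C x)
        + Pqc.extT η x (D A x (B x)) (C x) + Pqc.extT η x (tors D x (A x) (B x)) (C x) := by
    intro A B C hA hB hC
    have e1 : dirD (fun y => extD η B C y) x (A x)
        = dirD (fun y => Pqc.extT η y (B y) (C y)) x (A x) := by
      refine dirD_congr ?_ _
      filter_upwards [hU.mem_nhds hx] with y hy
      rw [extT_apply (hη.diffForm hU hy) (hB.diffVF hU hy) (hC.diffVF hU hy)]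
    have e2 : tors D x (A x) (B x) = D B x (A x) - D A x (B x) - bracket A B x :=
      D.torsion_apply (hA.diffVF hU hx) (hB.diffVF hU hx)
    rw [e1, e2, ← extT_apply (hη.diffForm hU hx) ((hA.bracket hU hB).diffVF hU hx)
      (hC.diffVF hU hx)]
    simp
    ring
  have := extD_extD hη hU hx hX hY hZ
  rw [key hX hY hZ, key hY hZ hX, key hZ hX hY] at this
  rw [extT_swap η (Y x) (D Z x (X x)), extT_swap η (Z x) (D X x (Y x)),
    extT_swap η (X x) (D Y x (Z x))]
  linarith

end Basic

/-! ### Linear algebra of a paraquaternionic hermitian space -/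

@[simp] theorem eps_zero : eps 0 = 1 := rfl
@[simp] theorem eps_one : eps 1 = 1 := rfl
@[simp] theorem eps_two : eps 2 = -1 := rfl

theorem eps_mul_self (s : Fin 3) : eps s * eps s = 1 := by fin_cases s <;> simp

theorem eps_ne_zero (s : Fin 3) : eps s ≠ 0 := by fin_cases s <;> simp

section LinAlg

variable {E : Type*} [AddCommGroup E] [Module ℝ E]

/-- The algebraic relations of a paraquaternionic hermitian structure on a vector space. -/
structure ParaQuat (g : LinearMap.BilinForm ℝ E) (I : Fin 3 → Module.End ℝ E) : Prop where
  symm : ∀ X Y, g X Y = g Y X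
  nondeg : g.Nondegenerate
  sq : ∀ s, I s * I s = eps s • 1
  mul : ∀ i, I i * I (i + 1) = -(eps (i + 2) • I (i + 2))
  mul_rev : ∀ i, I (i + 1) * I i = eps (i + 2) • I (i + 2)
  compat : ∀ s X Y, g (I s X) (I s Y) = -(eps s * g X Y)

namespace ParaQuat

variable {g : LinearMap.BilinForm ℝ E} {I : Fin 3 → Module.End ℝ E} (h : ParaQuat g I)
include h

theorem sq_apply (s : Fin 3) (X : E) : I s (I s X) = eps s • X := by
  simpa using congr($(h.sq s) X)

theorem I00 (X : E) : I 0 (I 0 X) = X := by simpa using h.sq_apply 0 X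
theorem I11 (X : E) : I 1 (I 1 X) = X := by simpa using h.sq_apply 1 X
theorem I22 (X : E) : I 2 (I 2 X) = -X := by simpa using h.sq_apply 2 X
theorem I01 (X : E) : I 0 (I 1 X) = I 2 X := by simpa using congr($(h.mul 0) X)
theorem I12 (X : E) : I 1 (I 2 X) = -I 0 X := by simpa using congr($(h.mul 1) X)
theorem I20 (X : E) : I 2 (I 0 X) = -I 1 X := by simpa using congr($(h.mul 2) X)
theorem I10 (X : E) : I 1 (I 0 X) = -I 2 X := by simpa using congr($(h.mul_rev 0) X)
theorem I21 (X : E) : I 2 (I 1 X) = I 0 X := by simpa using congr($(h.mul_rev 1) X)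
theorem I02 (X : E) : I 0 (I 2 X) = I 1 X := by simpa using congr($(h.mul_rev 2) X)

theorem skew (s : Fin 3) (X Y : E) : g (I s X) Y = -g X (I s Y) := by
  have h1 := h.compat s X (I s Y)
  rw [h.sq_apply, map_smul, smul_eq_mul] at h1
  have h2 := eps_mul_self s
  have h3 : eps s * eps s * g (I s X) Y = -(eps s * eps s) * g X (I s Y) := by
    rw [mul_assoc, h1]; ring
  rw [h2] at h3
  linarith

theorem form_I_self (s : Fin 3) (X : E) : g (I s X) X = 0 := by
  have := h.skew s X X
  rw [h.symm X] at this
  linarith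

theorem ext {X Y : E} (hXY : ∀ Z, g X Z = g Y Z) : X = Y := by
  have := h.nondeg.1 (X - Y) (fun Z => by simp [hXY Z])
  exact sub_eq_zero.1 this

theorem ext_end {A B : Module.End ℝ E} (hAB : ∀ X Y, g (A X) Y = g (B X) Y) : A = B :=
  LinearMap.ext fun X => h.ext (hAB X)

/-- A metric torsion-free-like tensor `B` whose associated forms `(∇ω_i)` are in the kernel of
the alternation commutes with the paraquaternionic structure. -/
theorem commute_of_cyclic (B : E →ₗ[ℝ] Module.End ℝ E)
    (hskew : ∀ X Y Z, g (B X Y) Z = -g Y (B X Z))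
    (hcyc : ∀ i X Y Z, g (B X (I i Y) - I i (B X Y)) Z + g (B Y (I i Z) - I i (B Y Z)) X
      + g (B Z (I i X) - I i (B Z X)) Y = 0) (i : Fin 3) (X Y : E) :
    B X (I i Y) = I i (B X Y) := by
  -- This is the algebra of Hitchin's lemma, with B_X in the role of ∇_X: the cyclic condition says
  -- that the three forms ω_i are closed, the conclusion that the three I_i are parallel.
  set b : E → E → E → ℝ := fun X Y Z => g (B X Y) Z with hb
  have bsk : ∀ X Y Z, b X Y Z = -b X Z Y := fun X Y Z => by
    simp only [hb]; rw [hskew, h.symm]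
  have hc : ∀ i X Y Z, b X (I i Y) Z + b X Y (I i Z) + (b Y (I i Z) X + b Y Z (I i X))
      + (b Z (I i X) Y + b Z X (I i Y)) = 0 := by
    intro i X Y Z
    have := hcyc i X Y Z
    simp only [map_sub, LinearMap.sub_apply, h.skew] at this
    simp only [hb]
    linarith
  have e2 : ∀ s : Fin 3, eps s = 1 ∨ eps s = -1 := fun s => by fin_cases s <;> simp
  have bneg1 : ∀ X Y Z, b (-X) Y Z = -b X Y Z := fun X Y Z => by simp [hb]
  have bneg2 : ∀ X Y Z, b X (-Y) Z = -b X Y Z := fun X Y Z => by simp [hb]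
  have bneg3 : ∀ X Y Z, b X Y (-Z) = -b X Y Z := fun X Y Z => by simp [hb]
  have bs1 : ∀ (c : ℝ) X Y Z, b (c • X) Y Z = c * b X Y Z := fun c X Y Z => by simp [hb]
  have bs2 : ∀ (c : ℝ) X Y Z, b X (c • Y) Z = c * b X Y Z := fun c X Y Z => by simp [hb]
  have bs3 : ∀ (c : ℝ) X Y Z, b X Y (c • Z) = c * b X Y Z := fun c X Y Z => by simp [hb]
  -- The almost Kähler identity [B_{I_i X}, I_i] Y = [B_X, I_i] I_i Y of a closed ω_i. It combines
  -- the cyclic condition with one, or all three, of the arguments moved by I_i.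
  have R : ∀ i X Y Z, b (I i X) (I i Y) Z + b (I i X) Y (I i Z)
      - eps i * b X Y Z - b X (I i Y) (I i Z) = 0 := by
    intro i X Y Z
    have a1 := hc i X (I i Y) Z
    have a2 := hc i X Y (I i Z)
    have a3 := hc i (I i X) Y Z
    have a4 := hc i (I i X) (I i Y) (I i Z)
    simp only [h.sq_apply, bs2, bs3] at a1 a2 a3 a4
    rcases e2 i with e | e <;> rw [e] at a1 a2 a3 a4 ⊢ <;>
      linarith [bsk X (I i Y) (I i Z), bsk Y (I i Z) (I i X), bsk Z (I i X) (I i Y), bsk X Y Z,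
        bsk Y Z X, bsk Z X Y, bsk (I i X) (I i Y) Z, bsk (I i X) Y (I i Z),
        bsk (I i Y) (I i Z) X, bsk (I i Y) Z (I i X), bsk (I i Z) (I i X) Y,
        bsk (I i Z) X (I i Y)]
  refine h.ext fun Z => ?_
  rw [h.skew]
  suffices b X (I i Y) Z + b X Y (I i Z) = 0 by simp only [hb] at this; linarith
  have r0 := R 0
  have r1 := R 1
  have r2 := R 2
  simp only [eps_zero, eps_one, eps_two] at r0 r1 r2
  -- The identities R of the three structures, at nine suitable triples of arguments, combine
  -- linearly to the vanishing of [B_X, I_i].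
  fin_cases i
  · have q1 := r0 (I 0 X) (I 0 Y) (I 0 Z)
    have q2 := r1 (I 2 X) (I 2 Y) (I 0 Z)
    have q3 := r2 X (I 0 Y) Z
    have q4 := r1 (I 0 X) Y Z
    have q5 := r2 X (I 2 Y) (I 1 Z)
    have q6 := r1 (I 1 X) (I 1 Y) (I 0 Z)
    have q7 := r2 (I 0 X) (I 2 Y) (I 2 Z)
    have q8 := r1 X (I 2 Y) (I 1 Z)
    have q9 := r2 (I 0 X) (I 1 Y) (I 1 Z)
    simp only [h.I00, h.I11, h.I22, h.I12, h.I20, h.I10, h.I21, bneg1, bneg2,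
      bneg3] at q1 q2 q3 q4 q5 q6 q7 q8 q9
    simp only [Fin.zero_eta]
    linarith
  · have q1 := r0 (I 2 X) (I 0 Y) Z
    have q2 := r1 X (I 1 Y) Z
    have q3 := r2 X (I 1 Y) Z
    have q4 := r2 X (I 2 Y) (I 0 Z)
    have q5 := r0 (I 2 X) (I 2 Y) (I 1 Z)
    have q6 := r2 (I 0 X) (I 2 Y) Z
    have q7 := r0 X (I 0 Y) (I 2 Z)
    have q8 := r2 (I 1 X) (I 1 Y) (I 1 Z)
    have q9 := r0 (I 0 X) (I 1 Y) (I 0 Z)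
    simp only [h.I00, h.I11, h.I22, h.I01, h.I20, h.I21, h.I02, bneg1, bneg2,
      bneg3] at q1 q2 q3 q4 q5 q6 q7 q8 q9
    simp only [Fin.mk_one]
    linarith
  · have q1 := r2 X Y (I 2 Z)
    have q2 := r0 (I 1 X) (I 0 Y) Z
    have q3 := r1 (I 0 X) (I 2 Y) (I 0 Z)
    have q4 := r1 (I 0 X) (I 1 Y) Z
    have q5 := r0 (I 0 X) (I 2 Y) (I 0 Z)
    have q6 := r1 (I 1 X) (I 1 Y) (I 2 Z)
    have q7 := r0 (I 2 X) (I 2 Y) (I 2 Z)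
    have q8 := r1 X (I 0 Y) (I 1 Z)
    have q9 := r0 (I 0 X) (I 0 Y) (I 2 Z)
    simp only [h.I00, h.I11, h.I22, h.I01, h.I12, h.I10, h.I02, bneg1, bneg2,
      bneg3] at q1 q2 q3 q4 q5 q6 q7 q8 q9
    simp only [Fin.reduceFinMk]
    linarith

theorem form_I_I {s t : Fin 3} (hst : s ≠ t) (X : E) : g (I s X) (I t X) = 0 := by
  rw [h.skew, neg_eq_zero]
  have k : ∀ u, g X (I u X) = 0 := fun u => by rw [h.symm]; exact h.form_I_self u X
  fin_cases s <;> fin_cases t <;> simp [h.I01, h.I12, h.I20, h.I10, h.I21, h.I02, k] at hst ⊢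

theorem form_self_I (s : Fin 3) (X : E) : g X (I s X) = 0 := by
  rw [h.symm]; exact h.form_I_self s X

/-- A linear functional vanishing on non-null vectors vanishes. -/
theorem eq_zero_of_nonnull [Nontrivial E] {f : E →ₗ[ℝ] ℝ} (hf : ∀ X, g X X ≠ 0 → f X = 0) :
    f = 0 := by
  obtain ⟨X, hX⟩ : ∃ X, g X X ≠ 0 := by
    by_contra! hX
    obtain ⟨Y, hY⟩ := exists_ne (0 : E)
    refine hY (h.ext fun Z => ?_)
    have h1 := hX (Y + Z)
    simp only [map_add, LinearMap.add_apply, hX, h.symm Z Y] at h1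
    simp only [map_zero, LinearMap.zero_apply]
    linarith
  ext Y
  by_cases hY : g Y Y = 0
  -- For null Y at least one of Y + X and Y - X is not null, because their squares are g(X, X) ± 2
  -- g(X, Y).
  · by_cases h1 : g (Y + X) (Y + X) = 0
    · have h2 : g (Y - X) (Y - X) ≠ 0 := by
        intro h2
        simp only [map_add, map_sub, LinearMap.add_apply, LinearMap.sub_apply, hY] at h1 h2
        apply hX
        linarith
      have := hf _ h2
      rw [map_sub, hf X hX] at this
      simpa using this
    · have := hf _ h1
      rw [map_add, hf X hX] at this
      simpa using this
  · simpa using hf Y hY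

theorem exists_nonnull [Nontrivial E] : ∃ X, g X X ≠ 0 := by
  by_contra! hX
  obtain ⟨Y, hY⟩ := exists_ne (0 : E)
  refine hY (h.ext fun Z => ?_)
  have h1 := hX (Y + Z)
  simp only [map_add, LinearMap.add_apply, hX, h.symm Z Y] at h1
  simp only [map_zero, LinearMap.zero_apply]
  linarith

/-- The four vectors `Z, I₁ Z, I₂ Z, I₃ Z`. -/
theorem mem_span_of_totally_null {Z : E} (hZ : g Z Z ≠ 0)
    (hnull : ∀ X, g X Z = 0 → (∀ s, g X (I s Z) = 0) → g X X = 0) (Y : E) :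
    Y ∈ Submodule.span ℝ (Set.range (![Z, I 0 Z, I 1 Z, I 2 Z] : Fin 4 → E)) := by
  -- The orthogonal projection away from Z, I_s Z, four pairwise orthogonal vectors with squares
  -- g(Z, Z) and -ε_s g(Z, Z). If its image is totally null, polarisation puts the image into the
  -- kernel of g, so p = 0.
  let p : E → E := fun Y => Y - ((g Y Z / g Z Z) • Z
    - ∑ s, (eps s * g Y (I s Z) / g Z Z) • I s Z)
  have kk : ∀ s t : Fin 3, g (I s Z) (I t Z) = if s = t then -(eps s * g Z Z) else 0 := by
    intro s t
    split_ifs with e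
    · subst e; exact h.compat s Z Z
    · exact h.form_I_I e Z
  have p1 : ∀ Y, g (p Y) Z = 0 := by
    intro Y
    simp [p, Fin.sum_univ_three, h.form_I_self]
    field_simp
    ring
  have p2 : ∀ Y s, g (p Y) (I s Z) = 0 := by
    intro Y s
    fin_cases s <;> simp [p, Fin.sum_univ_three, h.form_self_I, kk] <;> field_simp <;> ring
  have padd : ∀ Y W, p (Y + W) = p Y + p W := by
    intro Y W
    simp only [p, map_add, LinearMap.add_apply, Fin.sum_univ_three]
    module
  have pnull : ∀ Y, g (p Y) (p Y) = 0 := fun Y => hnull _ (p1 Y) (p2 Y)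
  have p3 : ∀ Y W, g (p Y) W = 0 := by
    intro Y W
    have h1 := pnull (Y + W)
    rw [padd] at h1
    simp only [map_add, LinearMap.add_apply, pnull, h.symm (p W) (p Y)] at h1
    have h2 : g (p Y) W = g (p Y) (p W) := by
      have e1 : W = p W + ((g W Z / g Z Z) • Z - ∑ s, (eps s * g W (I s Z) / g Z Z) • I s Z) := by
        simp only [p]; abel
      rw [e1]
      simp only [map_add, map_sub, map_smul, map_sum, p1, p2, smul_zero, Finset.sum_const_zero,
        sub_zero, add_zero]
      rw [← e1]
    rw [h2]; linarith
  have p4 : p Y = 0 := h.ext fun W => by simp [p3]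
  have : Y = (g Y Z / g Z Z) • Z - ∑ s, (eps s * g Y (I s Z) / g Z Z) • I s Z :=
    sub_eq_zero.1 p4
  rw [this]
  have m : ∀ a : Fin 4, (![Z, I 0 Z, I 1 Z, I 2 Z] : Fin 4 → E) a ∈
      Submodule.span ℝ (Set.range (![Z, I 0 Z, I 1 Z, I 2 Z] : Fin 4 → E)) :=
    fun a => Submodule.subset_span ⟨a, rfl⟩
  refine Submodule.sub_mem _ (Submodule.smul_mem _ _ (m 0)) (Submodule.sum_mem _ fun s _ =>
    Submodule.smul_mem _ _ ?_)
  fin_cases s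
  exacts [m 1, m 2, m 3]

/-- Otherwise the orthogonal complement of Z, I_1 Z, I_2 Z, I_3 Z is totally null, so these four
vectors span the space and its dimension is at most four. -/
theorem exists_orthogonal (hd : 4 < Module.finrank ℝ E) {Z : E} (hZ : g Z Z ≠ 0) :
    ∃ X, g X X ≠ 0 ∧ g X Z = 0 ∧ ∀ s, g X (I s Z) = 0 := by
  by_contra! hX
  have hm := h.mem_span_of_totally_null hZ (fun X h1 h2 => by
    by_contra h3
    obtain ⟨s, hs⟩ := hX X h3 h1
    exact hs (h2 s))
  have htop : Submodule.span ℝ (Set.range (![Z, I 0 Z, I 1 Z, I 2 Z] : Fin 4 → E)) = ⊤ :=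
    eq_top_iff.2 fun Y _ => hm Y
  have := finrank_range_le_card (R := ℝ) (![Z, I 0 Z, I 1 Z, I 2 Z] : Fin 4 → E)
  rw [Set.finrank, htop, finrank_top] at this
  simp at this
  omega

theorem orthogonal_symm {X Z : E} (h1 : g X Z = 0) (h2 : ∀ s, g X (I s Z) = 0) :
    g Z X = 0 ∧ ∀ s, g Z (I s X) = 0 := by
  refine ⟨by rw [h.symm, h1], fun s => ?_⟩
  rw [h.symm, h.skew, h2, neg_zero]

/-- In dimension greater than four the map `θ ↦ ∑ ω_s ∧ θ_s` is injective. -/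
theorem wedge_injective (hd : 4 < Module.finrank ℝ E) (θ : Fin 3 → E →ₗ[ℝ] ℝ)
    (hθ : ∀ X Y Z, ∑ s, (g (I s X) Y * θ s Z + g (I s Y) Z * θ s X + g (I s Z) X * θ s Y) = 0)
    (s : Fin 3) : θ s = 0 := by
  have : Nontrivial E := Module.nontrivial_of_finrank_pos (R := ℝ) (by omega)
  refine h.eq_zero_of_nonnull fun Z hZ => ?_
  obtain ⟨X, hX, h1, h2⟩ := h.exists_orthogonal hd hZ
  obtain ⟨h3, h4⟩ := h.orthogonal_symm h1 h2
  -- Since Z is orthogonal to the quaternionic span of X, only the term with θ_s(Z) survives, with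
  -- the factor ±g(X, X).
  have := hθ X (I s X) Z
  have k := h.form_self_I
  rw [Fin.sum_univ_three] at this
  fin_cases s <;>
  simp only [h.skew, h.I00, h.I11, h.I22, h.I01, h.I12, h.I20, h.I10, h.I21, h.I02, map_neg, h1,
    h2, h4, k, neg_zero, zero_mul, add_zero, zero_add, neg_neg, Fin.zero_eta, Fin.mk_one,
    Fin.reduceFinMk, neg_mul, neg_eq_zero, mul_eq_zero, hX, false_or, LinearMap.neg_apply] at this ⊢ <;> exact this

/-- In dimension greater than four, the structure equations force the symmetry that makes the
Reeb fields exist. -/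
theorem cross_of_cyclic (hd : 4 < Module.finrank ℝ E) (t : E →ₗ[ℝ] E →ₗ[ℝ] E)
    (ht : ∀ X Y, t X Y = -t Y X) (a : Fin 3 → Fin 3 → E →ₗ[ℝ] ℝ) (ha : ∀ s, a s s = 0)
    (hC : ∀ i X Y Z,
      (eps i * g (I i (t X Y)) Z + ∑ s, eps s * g (I s X) Y * a i s Z)
      + (eps i * g (I i (t Y Z)) X + ∑ s, eps s * g (I s Y) Z * a i s X)
      + (eps i * g (I i (t Z X)) Y + ∑ s, eps s * g (I s Z) X * a i s Y) = 0) (i : Fin 3) :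
    a i (i + 1) = eps (i + 2) • a (i + 1) i := by
  have : Nontrivial E := Module.nontrivial_of_finrank_pos (R := ℝ) (by omega)
  rw [← sub_eq_zero]
  refine h.eq_zero_of_nonnull fun Z hZ => ?_
  obtain ⟨X, hX, h1, h2⟩ := h.exists_orthogonal hd hZ
  obtain ⟨h3, h4⟩ := h.orthogonal_symm h1 h2
  have k := h.form_self_I
  have tZ : ∀ W, t W Z = -t Z W := fun W => ht W Z
  have tZ' : ∀ s W, t W (I s Z) = -t (I s Z) W := fun s W => ht W (I s Z)
  have z0 : a 0 0 = 0 := ha 0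
  have z1 : a 1 1 = 0 := ha 1
  have z2 : a 2 2 = 0 := ha 2
  have r0 := hC 0
  have r1 := hC 1
  have r2 := hC 2
  simp only [Fin.sum_univ_three, eps_zero, eps_one, eps_two, z0, z1, z2, LinearMap.zero_apply,
    mul_zero, add_zero, zero_add, h.skew, one_mul] at r0 r1 r2
  rw [LinearMap.sub_apply, LinearMap.smul_apply, smul_eq_mul]
  fin_cases i
  -- The relations of the two structures i and i + 1 are taken at two vectors of the quaternionic
  -- span of X and at Z or I_{i+2} Z, both orthogonal to that span. In the combination the t-terms
  -- cancel, and g(X, X) times the sought difference remains.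
  · have q1 := r1 (I 1 X) (I 2 X) Z
    have q2 := r0 (I 1 X) (I 2 X) (I 2 Z)
    have q3 := r1 X (I 1 X) (I 2 Z)
    have q4 := r0 X (I 1 X) Z
    have q5 := r1 (I 0 X) (I 2 X) (I 2 Z)
    have q6 := r0 (I 0 X) (I 2 X) Z
    have q7 := r1 X (I 0 X) Z
    have q8 := r0 X (I 0 X) (I 2 Z)
    simp only [h.skew, h.I00, h.I11, h.I22, h.I01, h.I12, h.I20, h.I10, h.I21, h.I02, map_neg, h1,
      h2, h3, h4, k, neg_zero, zero_mul, mul_zero, add_zero, neg_neg, tZ, tZ',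
      LinearMap.neg_apply] at q1 q2 q3 q4 q5 q6 q7 q8
    change a 0 1 Z - -1 * a 1 0 Z = 0
    have : g X X * (a 0 1 Z - -1 * a 1 0 Z) = 0 := by linarith
    simpa [hX] using this
  · have q1 := r2 (I 0 X) (I 2 X) Z
    have q2 := r1 X (I 2 X) Z
    have q3 := r2 X (I 1 X) Z
    have q4 := r1 (I 0 X) (I 1 X) Z
    have q5 := r2 (I 0 X) (I 1 X) (I 0 Z)
    have q6 := r1 X (I 1 X) (I 0 Z)
    have q7 := r2 X (I 2 X) (I 0 Z)
    have q8 := r1 (I 0 X) (I 2 X) (I 0 Z)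
    simp only [h.skew, h.I00, h.I11, h.I22, h.I01, h.I12, h.I20, h.I10, h.I21, h.I02, map_neg, h1,
      h2, h3, h4, k, neg_zero, zero_mul, mul_zero, add_zero, zero_add, neg_neg, tZ, tZ',
      LinearMap.neg_apply] at q1 q2 q3 q4 q5 q6 q7 q8
    change a 1 2 Z - 1 * a 2 1 Z = 0
    have : g X X * (a 1 2 Z - 1 * a 2 1 Z) = 0 := by linarith
    simpa [hX] using this
  · have q1 := r2 (I 1 X) (I 2 X) Z
    have q2 := r0 (I 1 X) (I 2 X) (I 1 Z)
    have q3 := r0 X (I 0 X) (I 1 Z)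
    have q4 := r2 (I 0 X) (I 1 X) (I 1 Z)
    have q5 := r0 (I 0 X) (I 1 X) Z
    have q6 := r2 X (I 0 X) Z
    have q7 := r2 X (I 2 X) (I 1 Z)
    have q8 := r0 X (I 2 X) Z
    simp only [h.skew, h.I00, h.I11, h.I22, h.I01, h.I12, h.I20, h.I10, h.I21, h.I02, map_neg, h1,
      h2, h3, h4, k, neg_zero, zero_mul, mul_zero, add_zero, zero_add, neg_neg, tZ, tZ',
      LinearMap.neg_apply] at q1 q2 q3 q4 q5 q6 q7 q8
    change a 2 0 Z - 1 * a 0 2 Z = 0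
    have : g X X * (a 2 0 Z - 1 * a 0 2 Z) = 0 := by linarith
    simpa [hX] using this

end ParaQuat

end LinAlg

/-! ### Adjoints, traces and the projection to sp(n, ℝ) ⊕ sp(1, ℝ) -/

section Operators

variable {E : Type*} [AddCommGroup E] [Module ℝ E] [FiniteDimensional ℝ E]

/-- The adjoint of an endomorphism with respect to a nondegenerate form. -/
def adj (g : LinearMap.BilinForm ℝ E) (hg : g.Nondegenerate) :
    Module.End ℝ E →ₗ[ℝ] Module.End ℝ E where
  toFun A := (g.toDual hg).symm.toLinearMap ∘ₗ A.dualMap ∘ₗ (g.toDual hg).toLinearMap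
  map_add' A B := by
    refine LinearMap.ext fun X => (g.toDual hg).injective ?_
    ext Y; simp [LinearMap.BilinForm.toDual_def]
  map_smul' c A := by
    refine LinearMap.ext fun X => (g.toDual hg).injective ?_
    ext Y; simp [LinearMap.BilinForm.toDual_def]

theorem form_adj (g : LinearMap.BilinForm ℝ E) (hg : g.Nondegenerate) (A : Module.End ℝ E)
    (X Y : E) : g (adj g hg A X) Y = g X (A Y) := by
  simp [adj, LinearMap.BilinForm.apply_toDual_symm_apply, LinearMap.BilinForm.toDual_def]

theorem trace_adj (g : LinearMap.BilinForm ℝ E) (hg : g.Nondegenerate) (A : Module.End ℝ E) :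
    LinearMap.trace ℝ E (adj g hg A) = LinearMap.trace ℝ E A := by
  have := LinearMap.trace_conj' A.dualMap (g.toDual hg).symm
  rw [show (A.dualMap : Module.End ℝ (Module.Dual ℝ E)) = Module.Dual.transpose (R := ℝ) A from rfl,
    LinearMap.trace_transpose'] at this
  rw [← this]
  rfl

/-- The metric contraction of a bilinear form. -/
def contraction (g : LinearMap.BilinForm ℝ E) (hg : g.Nondegenerate)
    (P : LinearMap.BilinForm ℝ E) : ℝ :=
  LinearMap.trace ℝ E ((g.toDual hg).symm.toLinearMap ∘ₗ P)

theorem contraction_of_form {g : LinearMap.BilinForm ℝ E} (hg : g.Nondegenerate)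
    {P : LinearMap.BilinForm ℝ E} {Q : Module.End ℝ E} (hP : ∀ X Y, P X Y = g (Q X) Y) :
    contraction g hg P = LinearMap.trace ℝ E Q := by
  unfold contraction
  congr 1
  refine LinearMap.ext fun X => (g.toDual hg).injective ?_
  ext Y
  simp [LinearMap.BilinForm.toDual_def, hP]

theorem contraction_comp {g : LinearMap.BilinForm ℝ E}
    (hg : g.Nondegenerate) (A B : Module.End ℝ E) :
    contraction g hg (g.comp A B) = LinearMap.trace ℝ E (adj g hg B * A) :=
  contraction_of_form hg fun X Y => by
    simp [form_adj]

/-- The skew-symmetric part of an endomorphism. -/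
def skewPart (g : LinearMap.BilinForm ℝ E) (hg : g.Nondegenerate) :
    Module.End ℝ E →ₗ[ℝ] Module.End ℝ E :=
  (1 / 2 : ℝ) • (LinearMap.id - adj g hg)

/-- The symmetric part of an endomorphism. -/
def symPart (g : LinearMap.BilinForm ℝ E) (hg : g.Nondegenerate) :
    Module.End ℝ E →ₗ[ℝ] Module.End ℝ E :=
  (1 / 2 : ℝ) • (LinearMap.id + adj g hg)

/-- The projection to the endomorphisms commuting with the structure `I`. -/
def commPart (I : Fin 3 → Module.End ℝ E) : Module.End ℝ E →ₗ[ℝ] Module.End ℝ E :=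
  -- The average of the conjugates by 1, I_1, I_2, I_3; the signs appear because I_s⁻¹ = ε_s I_s.
  (1 / 4 : ℝ) • (LinearMap.id + ∑ s, eps s • (LinearMap.mulLeft ℝ (I s) ∘ₗ LinearMap.mulRight ℝ (I s)))

/-- The coefficient of `I s` in the projection to the span of the `I s`. -/
def coefPart (I : Fin 3 → Module.End ℝ E) (s : Fin 3) : Module.End ℝ E →ₗ[ℝ] ℝ :=
  -- The normalisation comes from tr(I_s I_t) = δ_st ε_s dim E.
  (eps s / Module.finrank ℝ E) • (LinearMap.trace ℝ E ∘ₗ LinearMap.mulLeft ℝ (I s))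

/-- The projection of endomorphisms to `sp(n, ℝ) ⊕ sp(1, ℝ)`. -/
def spProj (g : LinearMap.BilinForm ℝ E) (hg : g.Nondegenerate) (I : Fin 3 → Module.End ℝ E) :
    Module.End ℝ E →ₗ[ℝ] Module.End ℝ E :=
  commPart I ∘ₗ skewPart g hg + ∑ s, (coefPart I s).smulRight (I s)

theorem commPart_apply (I : Fin 3 → Module.End ℝ E) (A : Module.End ℝ E) (X : E) :
    commPart I A X = (1 / 4 : ℝ) • (A X + I 0 (A (I 0 X)) + I 1 (A (I 1 X)) - I 2 (A (I 2 X))) := by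
  simp [commPart, Fin.sum_univ_three]
  module

theorem skewPart_apply (g : LinearMap.BilinForm ℝ E) (hg : g.Nondegenerate) (A : Module.End ℝ E) :
    skewPart g hg A = (1 / 2 : ℝ) • (A - adj g hg A) := by simp [skewPart]

theorem symPart_apply (g : LinearMap.BilinForm ℝ E) (hg : g.Nondegenerate) (A : Module.End ℝ E) :
    symPart g hg A = (1 / 2 : ℝ) • (A + adj g hg A) := by simp [symPart]

theorem symPart_add_skewPart (g : LinearMap.BilinForm ℝ E) (hg : g.Nondegenerate)
    (A : Module.End ℝ E) : symPart g hg A + skewPart g hg A = A := by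
  rw [skewPart_apply, symPart_apply]; module

theorem coefPart_apply (I : Fin 3 → Module.End ℝ E) (s : Fin 3) (A : Module.End ℝ E) :
    coefPart I s A = eps s / Module.finrank ℝ E * LinearMap.trace ℝ E (I s * A) := by
  simp [coefPart]

theorem spProj_apply (g : LinearMap.BilinForm ℝ E) (hg : g.Nondegenerate)
    (I : Fin 3 → Module.End ℝ E) (A : Module.End ℝ E) :
    spProj g hg I A = commPart I (skewPart g hg A) + ∑ s, coefPart I s A • I s := by
  simp [spProj]

namespace ParaQuat

variable {g : LinearMap.BilinForm ℝ E} {I : Fin 3 → Module.End ℝ E} (h : ParaQuat g I)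
include h

theorem adj_eq_of_form {A B : Module.End ℝ E} (hAB : ∀ X Y, g (B X) Y = g X (A Y)) :
    adj g h.nondeg A = B :=
  h.ext_end fun X Y => by rw [form_adj, hAB]

theorem adj_mul (A B : Module.End ℝ E) :
    adj g h.nondeg (A * B) = adj g h.nondeg B * adj g h.nondeg A :=
  h.adj_eq_of_form fun X Y => by simp [form_adj]

theorem adj_adj (A : Module.End ℝ E) : adj g h.nondeg (adj g h.nondeg A) = A :=
  h.adj_eq_of_form fun X Y => by rw [h.symm X, form_adj, h.symm]

theorem adj_I (s : Fin 3) : adj g h.nondeg (I s) = -I s :=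
  h.adj_eq_of_form fun X Y => by simp [h.skew]

theorem adj_skewPart (A : Module.End ℝ E) :
    adj g h.nondeg (skewPart g h.nondeg A) = -skewPart g h.nondeg A := by
  simp only [skewPart_apply, map_smul, map_sub, h.adj_adj]; module

theorem adj_symPart (A : Module.End ℝ E) :
    adj g h.nondeg (symPart g h.nondeg A) = symPart g h.nondeg A := by
  simp only [symPart_apply, map_smul, map_add, h.adj_adj]; module

theorem skewPart_of_skew {A : Module.End ℝ E} (hA : adj g h.nondeg A = -A) :
    skewPart g h.nondeg A = A := by
  rw [skewPart_apply, hA]; module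

theorem skewPart_of_sym {A : Module.End ℝ E} (hA : adj g h.nondeg A = A) :
    skewPart g h.nondeg A = 0 := by
  rw [skewPart_apply, hA]; module

theorem symPart_of_skew {A : Module.End ℝ E} (hA : adj g h.nondeg A = -A) :
    symPart g h.nondeg A = 0 := by
  rw [symPart_apply, hA]; module

theorem symPart_of_sym {A : Module.End ℝ E} (hA : adj g h.nondeg A = A) :
    symPart g h.nondeg A = A := by
  rw [symPart_apply, hA]; module

theorem form_skew_iff {A : Module.End ℝ E} :
    (∀ X Y, g (A X) Y = -g X (A Y)) ↔ adj g h.nondeg A = -A := by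
  constructor
  · intro hA
    exact h.adj_eq_of_form fun X Y => by simp [hA]
  · intro hA X Y
    rw [← form_adj g h.nondeg, hA]; simp

theorem commute_commPart (A : Module.End ℝ E) (s : Fin 3) :
    commPart I A * I s = I s * commPart I A := by
  refine LinearMap.ext fun X => ?_
  fin_cases s <;>
  · simp only [Module.End.mul_apply, commPart_apply, map_add, map_sub, map_smul, map_neg, h.I00,
      h.I11, h.I22, h.I01, h.I12, h.I20, h.I10, h.I21, h.I02, Fin.zero_eta, Fin.mk_one,
      Fin.reduceFinMk]
    module

theorem commPart_of_commute {A : Module.End ℝ E} (hA : ∀ s, A * I s = I s * A) :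
    commPart I A = A := by
  refine LinearMap.ext fun X => ?_
  have k : ∀ s X, A (I s X) = I s (A X) := fun s X => congr($(hA s) X)
  simp only [commPart_apply, k, h.I00, h.I11, h.I22]
  module

/-- The terms cancel in pairs: ε_s I_s A I_s = -A, and since the third structure I_k is ±I_s I_j,
also ε_k I_k A I_k = -ε_j I_j A I_j. -/
theorem commPart_of_anticommute {A : Module.End ℝ E} {s : Fin 3} (hA : A * I s = -(I s * A)) :
    commPart I A = 0 := by
  refine LinearMap.ext fun X => ?_
  have k : ∀ X, A (I s X) = -I s (A X) := fun X => congr($hA X)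
  have k1 : ∀ X, A (I 1 (I 0 X)) = -A (I 2 X) := fun X => by rw [h.I10, map_neg]
  have k2 : ∀ X, A (I 2 (I 0 X)) = -A (I 1 X) := fun X => by rw [h.I20, map_neg]
  have k3 : ∀ X, A (I 2 (I 1 X)) = A (I 0 X) := fun X => by rw [h.I21]
  have k4 : ∀ X, A (I 0 (I 1 X)) = A (I 2 X) := fun X => by rw [h.I01]
  have k5 : ∀ X, A (I 0 (I 2 X)) = A (I 1 X) := fun X => by rw [h.I02]
  have k6 : ∀ X, A (I 1 (I 2 X)) = -A (I 0 X) := fun X => by rw [h.I12, map_neg]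
  rw [commPart_apply]
  fin_cases s
  · simp only [Fin.zero_eta] at k
    simp only [k] at k1 k2 k4 k5
    have k7 : A (I 2 X) = -I 0 (A (I 1 X)) := by rw [k4]
    simp only [k, map_neg, h.I00, k7, h.I20, LinearMap.zero_apply]
    module
  · simp only [Fin.mk_one] at k
    simp only [k] at k1 k3 k4 k6
    have k7 : A (I 2 X) = I 1 (A (I 0 X)) := by rw [← neg_neg (A (I 2 X)), ← k1, neg_neg]
    simp only [k, map_neg, h.I11, k7, h.I21, LinearMap.zero_apply]
    module
  · simp only [Fin.reduceFinMk] at k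
    simp only [k] at k2 k3 k5 k6
    have k7 : A (I 1 X) = I 2 (A (I 0 X)) := by rw [← neg_neg (A (I 1 X)), ← k2, neg_neg]
    simp only [k, map_neg, h.I22, k7, h.I12, LinearMap.zero_apply]
    module

theorem adj_commPart (A : Module.End ℝ E) :
    adj g h.nondeg (commPart I A) = commPart I (adj g h.nondeg A) := by
  refine h.adj_eq_of_form fun X Y => ?_
  simp only [commPart_apply, map_add, map_sub, map_smul, LinearMap.add_apply, LinearMap.sub_apply,
    LinearMap.smul_apply, form_adj, h.skew, smul_eq_mul]
  simp only [← h.skew]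
  simp only [h.skew, neg_neg]

theorem commPart_I (s : Fin 3) : commPart I (I s) = 0 := by
  refine h.commPart_of_anticommute (s := s + 1) ?_
  rw [h.mul, h.mul_rev]

/-- An endomorphism commuting with two of the `I s` commutes with all. -/
theorem commute_all {A : Module.End ℝ E} {i : Fin 3} (h1 : A * I i = I i * A)
    (h2 : A * I (i + 1) = I (i + 1) * A) (s : Fin 3) : A * I s = I s * A := by
  have h3 : A * I (i + 2) = I (i + 2) * A := by
    have e : I (i + 2) = eps (i + 2) • (I (i + 1) * I i) := by
      rw [h.mul_rev, smul_smul, eps_mul_self, one_smul]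
    rw [e, mul_smul_comm, smul_mul_assoc, ← mul_assoc, h2, mul_assoc, h1, mul_assoc]
  fin_cases i <;> fin_cases s <;> first | exact h1 | exact h2 | exact h3

/-- By cyclicity of the trace, I_{s+1} I_{s+2} A and I_{s+2} I_{s+1} A have equal traces; the two
products of structures are opposite nonzero multiples of I_s. -/
theorem trace_mul_of_commute {A : Module.End ℝ E} (hA : ∀ s, A * I s = I s * A) (s : Fin 3) :
    LinearMap.trace ℝ E (I s * A) = 0 := by
  have e : I (s + 2 + 1) = I s := by congr 1; fin_cases s <;> rfl
  have e' : I (s + 1 + 1) = I (s + 2) := by congr 1; fin_cases s <;> rfl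
  have e'' : I (s + 1 + 2) = I s := by congr 1; fin_cases s <;> rfl
  have ee : eps (s + 1 + 2) = eps s := by congr 1; fin_cases s <;> rfl
  have m1 := h.mul (s + 1)
  have m2 := h.mul_rev (s + 1)
  rw [e', e'', ee] at m1 m2
  have t1 : LinearMap.trace ℝ E (I (s + 1) * I (s + 2) * A)
      = LinearMap.trace ℝ E (I (s + 2) * I (s + 1) * A) := by
    rw [mul_assoc, LinearMap.trace_mul_comm, mul_assoc, hA, ← mul_assoc]
  rw [m1, m2] at t1
  simp only [neg_mul, smul_mul_assoc, map_neg, map_smul, smul_eq_mul] at t1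
  have := eps_ne_zero s
  have : eps s * LinearMap.trace ℝ E (I s * A) = 0 := by linarith
  simpa [eps_ne_zero] using this

theorem trace_I (s : Fin 3) : LinearMap.trace ℝ E (I s) = 0 := by
  have := h.trace_mul_of_commute (A := 1) (fun s => by rw [one_mul, mul_one]) s
  rwa [mul_one] at this

theorem trace_I_mul_I (s t : Fin 3) :
    LinearMap.trace ℝ E (I s * I t) = if s = t then eps s * Module.finrank ℝ E else 0 := by
  split_ifs with e
  · subst e; rw [h.sq]; simp
  · have k : ∀ u X, I u X = I u X := fun _ _ => rfl
    have : ∃ u, ∃ c : ℝ, I s * I t = c • I u := by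
      fin_cases s <;> fin_cases t <;> simp only [Fin.zero_eta, Fin.mk_one, Fin.reduceFinMk,
        not_true_eq_false] at e ⊢
      · exact ⟨2, -eps 2, by simpa using h.mul 0⟩
      · exact ⟨1, eps 1, by simpa using h.mul_rev 2⟩
      · exact ⟨2, eps 2, by simpa using h.mul_rev 0⟩
      · exact ⟨0, -eps 0, by simpa using h.mul 1⟩
      · exact ⟨1, -eps 1, by simpa using h.mul 2⟩
      · exact ⟨0, eps 0, by simpa using h.mul_rev 1⟩
    obtain ⟨u, c, hc⟩ := this
    rw [hc, map_smul, h.trace_I, smul_zero]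

theorem coefPart_I [Nontrivial E] (s t : Fin 3) :
    coefPart I s (I t) = if s = t then 1 else 0 := by
  have : (Module.finrank ℝ E : ℝ) ≠ 0 := by
    exact_mod_cast (Module.finrank_pos (R := ℝ) (M := E)).ne'
  rw [coefPart_apply, h.trace_I_mul_I]
  split_ifs
  · field_simp; rw [pow_two, eps_mul_self]
  · simp

theorem coefPart_of_commute {A : Module.End ℝ E} (hA : ∀ s, A * I s = I s * A) (s : Fin 3) :
    coefPart I s A = 0 := by
  rw [coefPart_apply, h.trace_mul_of_commute hA, mul_zero]

theorem trace_sym_mul_skew {A B : Module.End ℝ E} (hA : adj g h.nondeg A = A)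
    (hB : adj g h.nondeg B = -B) : LinearMap.trace ℝ E (A * B) = 0 := by
  have := trace_adj g h.nondeg (A * B)
  rw [h.adj_mul, hA, hB, neg_mul, map_neg, LinearMap.trace_mul_comm] at this
  linarith

theorem coefPart_of_sym {A : Module.End ℝ E} (hA : adj g h.nondeg A = A) (s : Fin 3) :
    coefPart I s A = 0 := by
  rw [coefPart_apply, LinearMap.trace_mul_comm, h.trace_sym_mul_skew hA (h.adj_I s), mul_zero]

theorem coefPart_eq_skewPart (A : Module.End ℝ E) (s : Fin 3) :
    coefPart I s A = coefPart I s (skewPart g h.nondeg A) := by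
  conv_lhs => rw [← symPart_add_skewPart g h.nondeg A, map_add,
    h.coefPart_of_sym (h.adj_symPart A), zero_add]

/-- The averaging is self-adjoint for the trace form, by cyclicity. Orthogonality to sp(n, ℝ) is
thereby reduced to the vanishing of the commuting component of the skew part. -/
theorem trace_mul_commPart (A B : Module.End ℝ E) :
    LinearMap.trace ℝ E (A * commPart I B) = LinearMap.trace ℝ E (commPart I A * B) := by
  have : ∀ s, LinearMap.trace ℝ E (A * (I s * B * I s)) = LinearMap.trace ℝ E (I s * A * I s * B) := by
    intro s
    rw [← mul_assoc, LinearMap.trace_mul_comm, ← mul_assoc, ← mul_assoc]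
  simp only [← mul_assoc] at this
  simp only [commPart, LinearMap.smul_apply, LinearMap.add_apply, LinearMap.id_apply,
    LinearMap.sum_apply, LinearMap.comp_apply, LinearMap.mulLeft_apply, LinearMap.mulRight_apply,
    mul_smul_comm, smul_mul_assoc, mul_add, add_mul, Finset.mul_sum, Finset.sum_mul, map_smul,
    map_add, map_sum, this, ← mul_assoc]

theorem spProj_of_skew_commute {A : Module.End ℝ E} (hA : adj g h.nondeg A = -A)
    (hc : ∀ s, A * I s = I s * A) : spProj g h.nondeg I A = A := by
  rw [spProj_apply, h.skewPart_of_skew hA, h.commPart_of_commute hc]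
  simp [h.coefPart_of_commute hc]

theorem spProj_I [Nontrivial E] (t : Fin 3) : spProj g h.nondeg I (I t) = I t := by
  rw [spProj_apply, h.skewPart_of_skew (h.adj_I t), h.commPart_I]
  simp [h.coefPart_I]

theorem adj_spProj (A : Module.End ℝ E) :
    adj g h.nondeg (spProj g h.nondeg I A) = -spProj g h.nondeg I A := by
  rw [spProj_apply, map_add, h.adj_commPart, h.adj_skewPart, map_neg, map_sum, neg_add]
  congr 1
  simp [h.adj_I]

theorem spProj_spProj [Nontrivial E] (A : Module.End ℝ E) :
    spProj g h.nondeg I (spProj g h.nondeg I A) = spProj g h.nondeg I A := by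
  conv_lhs => rw [spProj_apply g h.nondeg I A, map_add, map_sum]
  simp only [map_smul, h.spProj_I]
  rw [h.spProj_of_skew_commute _ (h.commute_commPart _), spProj_apply]
  rw [h.adj_commPart, h.adj_skewPart, map_neg]

theorem coefPart_spProj [Nontrivial E] (A : Module.End ℝ E) (s : Fin 3) :
    coefPart I s (spProj g h.nondeg I A) = coefPart I s A := by
  rw [spProj_apply, map_add, map_sum, h.coefPart_of_commute (h.commute_commPart _)]
  simp [h.coefPart_I]

theorem commPart_spProj (A : Module.End ℝ E) :
    commPart I (spProj g h.nondeg I A) = commPart I (skewPart g h.nondeg A) := by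
  rw [spProj_apply, map_add, map_sum, h.commPart_of_commute (h.commute_commPart _)]
  simp [h.commPart_I]

/-- `A` with vanishing projection to `sp(n, ℝ) ⊕ sp(1, ℝ)` is orthogonal to it. -/
theorem trace_mul_eq_zero_of_spProj [Nontrivial E] {A B : Module.End ℝ E}
    (hA : spProj g h.nondeg I A = 0) (hB : adj g h.nondeg B = -B)
    (hc : ∀ s, B * I s = I s * B) : LinearMap.trace ℝ E (B * A) = 0 := by
  have h1 : commPart I (skewPart g h.nondeg A) = 0 := by
    rw [← h.commPart_spProj, hA, map_zero]
  rw [← symPart_add_skewPart g h.nondeg A, mul_add, map_add, LinearMap.trace_mul_comm,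
    h.trace_sym_mul_skew (h.adj_symPart A) hB, zero_add]
  rw [← h.commPart_of_commute hc, ← h.trace_mul_commPart, h1, mul_zero, map_zero]

/-- Nondegeneracy of the trace form on sp(n, ℝ). Against an arbitrary A only the projection of A to
sp(n, ℝ) counts, so B is trace-orthogonal to every endomorphism, and those of rank one recover the
entries g(B X, Y). -/
theorem eq_zero_of_trace_mul {B : Module.End ℝ E} (hB : adj g h.nondeg B = -B)
    (hc : ∀ s, B * I s = I s * B)
    (ht : ∀ A : Module.End ℝ E, adj g h.nondeg A = -A → (∀ s, A * I s = I s * A) →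
      LinearMap.trace ℝ E (A * B) = 0) : B = 0 := by
  have ht' : ∀ A : Module.End ℝ E, LinearMap.trace ℝ E (A * B) = 0 := by
    intro A
    rw [← symPart_add_skewPart g h.nondeg A, add_mul, map_add,
      h.trace_sym_mul_skew (h.adj_symPart A) hB, zero_add]
    rw [← h.commPart_of_commute hc, h.trace_mul_commPart]
    refine ht _ ?_ (h.commute_commPart _)
    rw [h.adj_commPart, h.adj_skewPart, map_neg]
  refine LinearMap.ext fun X => h.ext fun Y => ?_
  have := ht' ((g Y).smulRight X)
  rw [LinearMap.trace_mul_comm] at this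
  have e : B * (g Y).smulRight X = (g Y).smulRight (B X) := LinearMap.ext fun Z => by simp
  rw [e, LinearMap.trace_smulRight] at this
  simpa [h.symm] using this

end ParaQuat

end Operators

/-! ### The contorsion of a metric connection and its sp(1)-part -/

section Torsion

variable {E : Type*} [AddCommGroup E] [Module ℝ E] [FiniteDimensional ℝ E]

/-- The contorsion of a metric connection with torsion `-t`, in terms of `t`. -/
def koszul (g : LinearMap.BilinForm ℝ E) (hg : g.Nondegenerate) (t : E →ₗ[ℝ] Module.End ℝ E) :
    E →ₗ[ℝ] Module.End ℝ E :=
  (1 / 2 : ℝ) • (-t + adj g hg ∘ₗ t + (adj g hg ∘ₗ t).flip)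

theorem koszul_apply (g : LinearMap.BilinForm ℝ E) (hg : g.Nondegenerate)
    (t : E →ₗ[ℝ] Module.End ℝ E) (X Y : E) : koszul g hg t X Y
      = (1 / 2 : ℝ) • (-t X Y + adj g hg (t X) Y + adj g hg (t Y) X) := by
  simp [koszul]

namespace ParaQuat

variable {g : LinearMap.BilinForm ℝ E} {I : Fin 3 → Module.End ℝ E} (h : ParaQuat g I)
include h

theorem koszul_skew {t : E →ₗ[ℝ] Module.End ℝ E} (ht : ∀ X Y, t X Y = -t Y X) (X Y Z : E) :
    g (koszul g h.nondeg t X Y) Z = -g Y (koszul g h.nondeg t X Z) := by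
  rw [h.symm Y]
  simp only [koszul_apply, map_add, map_smul, map_neg, LinearMap.add_apply, LinearMap.smul_apply,
    LinearMap.neg_apply, form_adj, smul_eq_mul]
  rw [ht Z Y, h.symm (t X Y), h.symm (t X Z), map_neg]
  ring

theorem koszul_sub {t : E →ₗ[ℝ] Module.End ℝ E} (ht : ∀ X Y, t X Y = -t Y X) (X Y : E) :
    koszul g h.nondeg t X Y - koszul g h.nondeg t Y X = -t X Y := by
  simp only [koszul_apply]
  rw [ht Y X]
  module

/-- The argument behind the uniqueness of the Levi-Civita connection: a trilinear expression
symmetric in the first two slots and skew in the last two vanishes. It makes the horizontal part of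
the canonical connection unique. -/
theorem eq_zero_of_skew_of_symm {D : E → E → E} (hs : ∀ X Y Z, g (D X Y) Z = -g Y (D X Z))
    (hD : ∀ X Y, D X Y = D Y X) (X Y : E) : D X Y = 0 := by
  refine h.ext fun Z => ?_
  rw [map_zero, LinearMap.zero_apply]
  have h1 := hs X Y Z
  have h2 := hs Y Z X
  have h3 := hs Z X Y
  rw [h.symm Y] at h1
  rw [h.symm Z] at h2
  rw [h.symm X] at h3
  rw [hD Z X] at h3
  rw [hD Y Z] at h2
  rw [hD Y X] at h2
  linarith

omit [FiniteDimensional ℝ E] in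
theorem comm_I (p : Fin 3 → ℝ) (i : Fin 3) :
    (∑ s, p s • I s) * I i - I i * ∑ s, p s • I s
      = (2 * eps (i + 2) * p (i + 1)) • I (i + 2) - (2 * eps (i + 1) * p (i + 2)) • I (i + 1) := by
  refine LinearMap.ext fun X => ?_
  fin_cases i <;>
  · simp [Fin.sum_univ_three, h.I00, h.I11, h.I22, h.I01, h.I12, h.I20, h.I10, h.I21, h.I02]
    module

/-- An endomorphism normalising the structure lies in the sum of its commutant and its span. -/
theorem commute_of_normalizes [Nontrivial E] {A : Module.End ℝ E} {m : Fin 3 → Fin 3 → ℝ}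
    (hA : ∀ i, A * I i - I i * A = ∑ s, m i s • I s) (i : Fin 3) :
    (A - ∑ s, coefPart I s A • I s) * I i = I i * (A - ∑ s, coefPart I s A • I s) := by
  have hN : (Module.finrank ℝ E : ℝ) ≠ 0 := by
    exact_mod_cast (Module.finrank_pos (R := ℝ) (M := E)).ne'
  set B := A - ∑ s, coefPart I s A • I s with hB
  have hcoef : ∀ s, LinearMap.trace ℝ E (I s * B) = 0 := by
    intro s
    have h1 : coefPart I s B = 0 := by
      rw [hB, map_sub, map_sum]
      simp [h.coefPart_I]
    rw [coefPart_apply, mul_eq_zero] at h1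
    exact h1.resolve_left (div_ne_zero (eps_ne_zero s) hN)
  -- B has no component along the I_s, while [B, I_i] is still in their span. The component of [B,
  -- I_i] along I_s is a multiple of tr(I_s [B, I_i]) = tr([I_i, I_s] B), again a trace of B against
  -- the span, hence zero.
  have hspan : ∃ m' : Fin 3 → ℝ, B * I i - I i * B = ∑ s, m' s • I s := by
    have e : B * I i - I i * B = (∑ s, m i s • I s)
        - ((∑ s, coefPart I s A • I s) * I i - I i * ∑ s, coefPart I s A • I s) := by
      rw [hB, ← hA]; noncomm_ring
    have : B * I i - I i * B ∈ Submodule.span ℝ (Set.range I) := by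
      rw [e, h.comm_I]
      refine Submodule.sub_mem _ (Submodule.sum_mem _ fun s _ => Submodule.smul_mem _ _
        (Submodule.subset_span ⟨s, rfl⟩)) (Submodule.sub_mem _ ?_ ?_) <;>
      exact Submodule.smul_mem _ _ (Submodule.subset_span ⟨_, rfl⟩)
    obtain ⟨m', hm'⟩ := (Submodule.mem_span_range_iff_exists_fun ℝ).1 this
    exact ⟨m', hm'.symm⟩
  obtain ⟨m', hm'⟩ := hspan
  rw [← sub_eq_zero, hm']
  refine Finset.sum_eq_zero fun s _ => ?_
  have h2 : LinearMap.trace ℝ E (I s * (B * I i - I i * B)) = 0 := by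
    have e : LinearMap.trace ℝ E (I s * (B * I i - I i * B))
        = LinearMap.trace ℝ E ((I i * I s - I s * I i) * B) := by
      rw [mul_sub (I s) (B * I i), sub_mul (I i * I s), map_sub, map_sub, ← mul_assoc, LinearMap.trace_mul_comm, ← mul_assoc,
        ← mul_assoc]
    rw [e]
    have e2 : I i * I s - I s * I i ∈ Submodule.span ℝ (Set.range I) := by
      have := h.comm_I (fun u => if u = i then 1 else 0) s
      simp only [ite_smul, one_smul, zero_smul, Finset.sum_ite_eq', Finset.mem_univ, if_true] at this
      rw [this]
      refine Submodule.sub_mem _ ?_ ?_ <;>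
      exact Submodule.smul_mem _ _ (Submodule.subset_span ⟨_, rfl⟩)
    obtain ⟨q, hq⟩ := (Submodule.mem_span_range_iff_exists_fun ℝ).1 e2
    rw [← hq, Finset.sum_mul, map_sum]
    simp [hcoef]
  rw [hm', Finset.mul_sum, map_sum] at h2
  simp only [mul_smul_comm, map_smul, h.trace_I_mul_I, smul_eq_mul] at h2
  simp [hN, eps_ne_zero] at h2
  rw [h2, zero_smul]

/-- The coefficients of a derivation of the structure are skew. -/
theorem skew_of_derivation [Nontrivial E] {d : Fin 3 → Module.End ℝ E} {m : Fin 3 → Fin 3 → ℝ}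
    (hm : ∀ i, d i = ∑ s, m i s • I s)
    (hd : ∀ i j, d i * I j + I i * d j + (d j * I i + I j * d i) = 0) (i j : Fin 3) :
    eps j * m i j + eps i * m j i = 0 := by
  have hN : (Module.finrank ℝ E : ℝ) ≠ 0 := by
    exact_mod_cast (Module.finrank_pos (R := ℝ) (M := E)).ne'
  -- The hypothesis `hd` is the derivative of I_i I_j + I_j I_i = const. Its trace isolates the
  -- coefficients, because the I_s are orthogonal for the trace form.
  have h1 := congr(LinearMap.trace ℝ E $(hd i j))
  rw [hm, hm] at h1
  simp only [map_add, Finset.sum_mul, Finset.mul_sum, map_sum, mul_smul_comm, smul_mul_assoc,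
    map_smul, h.trace_I_mul_I, smul_eq_mul, mul_ite, mul_zero, Finset.sum_ite_eq,
    Finset.sum_ite_eq', Finset.mem_univ, if_true, map_zero] at h1
  have : (Module.finrank ℝ E : ℝ) * (eps j * m i j + eps i * m j i) = 0 := by linarith
  simpa [hN] using this

/-- The metric connection with torsion `t` normalises the structure. -/
theorem koszul_commute [Nontrivial E] {t : E →ₗ[ℝ] Module.End ℝ E} (ht : ∀ X Y, t X Y = -t Y X)
    {a : Fin 3 → Fin 3 → E →ₗ[ℝ] ℝ} (ha : ∀ s u, eps u • a s u + eps s • a u s = 0)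
    (hC : ∀ i X Y Z,
      (eps i * g (I i (t X Y)) Z + ∑ s, eps s * g (I s X) Y * a i s Z)
      + (eps i * g (I i (t Y Z)) X + ∑ s, eps s * g (I s Y) Z * a i s X)
      + (eps i * g (I i (t Z X)) Y + ∑ s, eps s * g (I s Z) X * a i s Y) = 0) (i : Fin 3) (X : E) :
    (koszul g h.nondeg t X - ∑ s, (eps (s + 1) / 2 * a (s + 1) (s + 2) X) • I s) * I i
      = I i * (koszul g h.nondeg t X - ∑ s, (eps (s + 1) / 2 * a (s + 1) (s + 2) X) • I s) := by
  -- With the symmetry `ha` of a, this choice gives [Σ p_s I_s, I_i] = -ε_i Σ_s ε_s a_is I_s.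
  -- Subtracting Σ p_s I_s from the contorsion therefore absorbs the a-terms of `hC`, and
  -- `commute_of_cyclic` applies to the difference B.
  set p : Fin 3 → E →ₗ[ℝ] ℝ := fun s => (eps (s + 1) / 2) • a (s + 1) (s + 2) with hp
  let B : E →ₗ[ℝ] Module.End ℝ E := koszul g h.nondeg t - ∑ s, (p s).smulRight (I s)
  have hB : ∀ X, B X = koszul g h.nondeg t X - ∑ s, p s X • I s := fun X => by simp [B]
  have key := h.commute_of_cyclic B (fun X Y Z => by
    simp only [hB, LinearMap.sub_apply, map_sub, h.koszul_skew ht, LinearMap.sum_apply, map_sum,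
      LinearMap.smul_apply, map_smul, h.skew, smul_eq_mul, mul_neg, Finset.sum_neg_distrib]
    ring) ?_ i X
  · refine LinearMap.ext fun Y => ?_
    have := key Y
    simpa [hB, hp] using this
  · intro i X Y Z
    have c1 : ∀ X Y, B X (I i Y) - I i (B X Y) = koszul g h.nondeg t X (I i Y)
        - I i (koszul g h.nondeg t X Y) - ((2 * eps (i + 2) * p (i + 1) X) • I (i + 2) Y
          - (2 * eps (i + 1) * p (i + 2) X) • I (i + 1) Y) := by
      intro X Y
      have := congr($(h.comm_I (fun s => p s X) i) Y)
      simp only [LinearMap.sub_apply, Module.End.mul_apply, LinearMap.smul_apply] at this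
      rw [← this, hB]
      simp only [LinearMap.sub_apply, map_sub]
      abel
    have c2 : ∀ X Y, I i (koszul g h.nondeg t X Y) = I i (koszul g h.nondeg t Y X) - I i (t X Y) := by
      intro X Y
      rw [← map_sub]; congr 1
      have := h.koszul_sub ht X Y
      rw [sub_eq_iff_eq_add] at this
      rw [this]; abel
    have c3 : ∀ X Y Z, g (koszul g h.nondeg t X (I i Y)) Z = g (I i (koszul g h.nondeg t X Z)) Y := by
      intro X Y Z
      rw [h.koszul_skew ht, h.skew, neg_neg, h.symm]
    have c4 := hC i X Y Z
    simp only [c1, map_sub, LinearMap.sub_apply, c3, map_smul, LinearMap.smul_apply, smul_eq_mul]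
    rw [c2 X Y, c2 Y Z, c2 Z X]
    simp only [map_sub, LinearMap.sub_apply]
    have e := ha
    have ha' : ∀ s u X, eps u * a s u X + eps s * a u s X = 0 := fun s u X => by
      simpa using congr($(ha s u) X)
    simp only [hp, LinearMap.smul_apply, smul_eq_mul]
    fin_cases i <;> simp [Fin.sum_univ_three] at c4 ⊢ <;>
    · have b1 := ha' 0 1
      have b2 := ha' 1 2
      have b3 := ha' 2 0
      have b4 := ha' 0 0
      have b5 := ha' 1 1
      have b6 := ha' 2 2
      simp at b1 b2 b3 b4 b5 b6
      have d1 : ∀ X, a 1 0 X = -a 0 1 X := fun X => by linarith [b1 X]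
      have d2 : ∀ X, a 2 1 X = a 1 2 X := fun X => by linarith [b2 X]
      have d3 : ∀ X, a 0 2 X = a 2 0 X := fun X => by linarith [b3 X]
      simp only [d1, d2, d3, b4, b5, b6, mul_zero, add_zero, zero_add] at c4 ⊢
      linarith

end ParaQuat

end Torsion

theorem eq_add_one_or {s t : Fin 3} (hst : s ≠ t) : t = s + 1 ∨ s = t + 1 := by
  revert hst; revert s t; decide

/-! ### Torsion endomorphisms: the algebra of τ, μ and λ -/

section Torsion

variable {E : Type*} [AddCommGroup E] [Module ℝ E] [FiniteDimensional ℝ E]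

/-- The relations between the torsion endomorphisms `T t = T(ξ_t, ·)_H` of a connection preserving
a local frame and the vertical components `c` of its torsion. -/
structure TorsRel (g : LinearMap.BilinForm ℝ E) (hg : g.Nondegenerate) (I : Fin 3 → Module.End ℝ E)
    (T : Fin 3 → Module.End ℝ E) (c : Fin 3 → Fin 3 → Fin 3 → ℝ) : Prop where
  swap : ∀ s u v, c s u v = -c s v u
  rel : ∀ s t, (I s * T t + adj g hg (T t) * I s) + (I t * T s + adj g hg (T s) * I t)
    = -∑ u, (eps u * (eps s * c s u t + eps t * c t u s)) • I u

/-- The skew part of an endomorphism orthogonal to `sp(n, ℝ) ⊕ sp(1, ℝ)`. -/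
def perpSkew (g : LinearMap.BilinForm ℝ E) (hg : g.Nondegenerate) (I : Fin 3 → Module.End ℝ E)
    (A : Module.End ℝ E) : Module.End ℝ E :=
  skewPart g hg A - spProj g hg I A

namespace ParaQuat

variable {g : LinearMap.BilinForm ℝ E} {I : Fin 3 → Module.End ℝ E} (h : ParaQuat g I)
include h

omit [FiniteDimensional ℝ E] in
theorem mul_comm_ne {s t : Fin 3} (hst : s ≠ t) : I s * I t = -(I t * I s) := by
  have m := h.mul
  have m' := h.mul_rev
  have key : ∀ i, I i * I (i + 1) = -(I (i + 1) * I i) := fun i => by rw [m, m']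
  have k0 := key 0
  have k1 := key 1
  have k2 := key 2
  simp only [Fin.isValue, zero_add, Fin.reduceAdd] at k0 k1 k2
  fin_cases s <;> fin_cases t <;> simp only [Fin.zero_eta, Fin.mk_one, Fin.reduceFinMk,
    not_true_eq_false, ne_eq] at hst ⊢ <;>
  first | assumption | (rw [k0, neg_neg]) | (rw [k1, neg_neg]) | (rw [k2, neg_neg])

theorem adj_perpSkew (A : Module.End ℝ E) :
    adj g h.nondeg (perpSkew g h.nondeg I A) = -perpSkew g h.nondeg I A := by
  rw [perpSkew, map_sub, h.adj_skewPart, h.adj_spProj]; abel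

theorem coefPart_perpSkew [Nontrivial E] (A : Module.End ℝ E) (s : Fin 3) :
    coefPart I s (perpSkew g h.nondeg I A) = 0 := by
  rw [perpSkew, map_sub, h.coefPart_spProj, ← h.coefPart_eq_skewPart, sub_self]

theorem trace_I_perpSkew [Nontrivial E] (A : Module.End ℝ E) (s : Fin 3) :
    LinearMap.trace ℝ E (I s * perpSkew g h.nondeg I A) = 0 := by
  have h1 := h.coefPart_perpSkew A s
  have hN : (Module.finrank ℝ E : ℝ) ≠ 0 := by
    exact_mod_cast (Module.finrank_pos (R := ℝ) (M := E)).ne'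
  rw [coefPart_apply, mul_eq_zero] at h1
  exact h1.resolve_left (div_ne_zero (eps_ne_zero s) hN)

theorem commPart_perpSkew (A : Module.End ℝ E) : commPart I (perpSkew g h.nondeg I A) = 0 := by
  rw [perpSkew, map_sub, h.commPart_spProj, sub_self]

theorem sub_spProj (A : Module.End ℝ E) :
    A - spProj g h.nondeg I A = symPart g h.nondeg A + perpSkew g h.nondeg I A := by
  rw [perpSkew, ← add_sub_assoc, symPart_add_skewPart]

theorem commPart_eq_zero_iff (A : Module.End ℝ E) : commPart I A = 0 ↔
    A + ∑ s, eps s • (I s * A * I s) = 0 := by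
  have : commPart I A = (1 / 4 : ℝ) • (A + ∑ s, eps s • (I s * A * I s)) := by
    simp [commPart, mul_assoc]
  rw [this, smul_eq_zero]; simp only [one_div, inv_eq_zero, OfNat.ofNat_ne_zero, false_or]

end ParaQuat

namespace TorsRel

variable {g : LinearMap.BilinForm ℝ E} {I : Fin 3 → Module.End ℝ E} (h : ParaQuat g I)
variable {T : Fin 3 → Module.End ℝ E} {c : Fin 3 → Fin 3 → Fin 3 → ℝ}
  (r : TorsRel g h.nondeg I T c)
include r

theorem swap_self (s u : Fin 3) : c s u u = 0 := by linarith [r.swap s u u]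

/-- The relations, split into the symmetric and skew parts of the torsion endomorphisms. -/
theorem rel' (s t : Fin 3) : (I s * symPart g h.nondeg (T t) + symPart g h.nondeg (T t) * I s)
    + (I t * symPart g h.nondeg (T s) + symPart g h.nondeg (T s) * I t)
    + (I s * skewPart g h.nondeg (T t) - skewPart g h.nondeg (T t) * I s)
    + (I t * skewPart g h.nondeg (T s) - skewPart g h.nondeg (T s) * I t)
    = -∑ u, (eps u * (eps s * c s u t + eps t * c t u s)) • I u := by
  rw [← r.rel]
  simp only [symPart_apply, skewPart_apply, smul_mul_assoc, mul_smul_comm, mul_add, add_mul,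
    mul_sub, sub_mul]
  module

/-- In the relation with s = t the right side has no I_s-component, as c_s(s, s) = 0, so it
anticommutes with I_s. So does the commutator of I_s with the skew part. But I_s S + S I_s commutes
with I_s, so it must vanish. -/
theorem sym_anticommute (s : Fin 3) :
    I s * symPart g h.nondeg (T s) = -(symPart g h.nondeg (T s) * I s) := by
  have h1 := r.rel' h s s
  set S := symPart g h.nondeg (T s)
  set K := skewPart g h.nondeg (T s)
  set R := -∑ u, (eps u * (eps s * c s u s + eps s * c s u s)) • I u with hR
  have hRI : I s * R = -(R * I s) := by
    rw [hR, mul_neg, neg_mul, neg_neg, Finset.mul_sum, Finset.sum_mul, ← Finset.sum_neg_distrib]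
    refine Finset.sum_congr rfl fun u _ => ?_
    by_cases hu : u = s
    · subst hu; rw [r.swap_self h]; simp
    · rw [mul_smul_comm, smul_mul_assoc, h.mul_comm_ne (Ne.symm hu)]; simp
  rw [← h1] at hRI
  have h2 : (4 : ℝ) • (I s * (I s * S + S * I s)) = 0 := by
    have e : I s * I s * S = S * (I s * I s) := by rw [h.sq]; simp
    have e' : I s * I s * K = K * (I s * I s) := by rw [h.sq]; simp
    linear_combination (norm := skip) hRI + (2 : ℝ) • e + (-2 : ℝ) • e'
    simp only [mul_add, add_mul, mul_sub, sub_mul, mul_assoc]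
    module
  have h3 : I s * (I s * S + S * I s) = 0 := by simpa using h2
  have h4 : I s * (I s * (I s * S + S * I s)) = 0 := by rw [h3, mul_zero]
  rw [← mul_assoc, h.sq, smul_mul_assoc, one_mul] at h4
  have h5 := (smul_eq_zero.1 h4).resolve_left (eps_ne_zero s)
  rw [← sub_eq_zero, sub_neg_eq_add, h5]

/-- By `sym_anticommute` the symmetric contribution to the relation commutes with I_s and I_t, hence
with the whole structure. The other terms are commutators with some I_u or multiples of I_u and have
no commuting component, so projecting the relation by `commPart` leaves exactly this contribution.
-/
theorem sym_cross (s t : Fin 3) :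
    I s * symPart g h.nondeg (T t) + symPart g h.nondeg (T t) * I s
      + (I t * symPart g h.nondeg (T s) + symPart g h.nondeg (T s) * I t) = 0 := by
  by_cases hst : s = t
  · subst hst; rw [r.sym_anticommute h]; abel
  have h1 := r.rel' h s t
  have hs := r.sym_anticommute h s
  have ht := r.sym_anticommute h t
  set Ss := symPart g h.nondeg (T s)
  set St := symPart g h.nondeg (T t)
  set Ks := skewPart g h.nondeg (T s)
  set Kt := skewPart g h.nondeg (T t)
  have anti := h.mul_comm_ne hst
  have cm : ∀ {s t : Fin 3} {A : Module.End ℝ E}, I s * I t = -(I t * I s) → I s * A = -(A * I s) →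
      (I t * A + A * I t) * I s = I s * (I t * A + A * I t) ∧
      (I t * A + A * I t) * I t = I t * (I t * A + A * I t) := by
    intro s t A e1 e2
    constructor
    · linear_combination (norm := noncomm_ring) -e1 * A - e2 * I t + I t * e2 + A * e1
    · have e3 : I t * I t * A = A * (I t * I t) := by rw [h.sq]; simp
      linear_combination (norm := noncomm_ring) -e3
  obtain ⟨a1, a2⟩ := cm anti hs
  obtain ⟨a3, a4⟩ := cm (by rw [anti, neg_neg] : I t * I s = -(I s * I t)) ht
  have hall : ∀ A : Module.End ℝ E, A * I s = I s * A → A * I t = I t * A →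
      ∀ u, A * I u = I u * A := by
    intro A b1 b2
    have : t = s + 1 ∨ s = t + 1 := eq_add_one_or hst
    rcases this with e | e <;> subst e
    · exact h.commute_all b1 b2
    · exact h.commute_all b2 b1
  have k1 := h.commPart_of_commute (hall _ a1 a2)
  have k2 := h.commPart_of_commute (hall _ a4 a3)
  have k3 : ∀ u (A : Module.End ℝ E), commPart I (I u * A - A * I u) = 0 := by
    intro u A
    refine h.commPart_of_anticommute (s := u) ?_
    have e3 : I u * I u * A = A * (I u * I u) := by rw [h.sq]; simp
    linear_combination (norm := noncomm_ring) e3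
  have k4 := congr(commPart I $h1)
  simp only [map_add, k3, map_neg, map_sum, map_smul, h.commPart_I, smul_zero,
    Finset.sum_const_zero, neg_zero, add_zero] at k4
  simp only [← map_add] at k4
  rw [map_add, k1, k2] at k4
  exact k4

theorem skew_rel (s t : Fin 3) :
    (I s * skewPart g h.nondeg (T t) - skewPart g h.nondeg (T t) * I s)
    + (I t * skewPart g h.nondeg (T s) - skewPart g h.nondeg (T s) * I t)
    = -∑ u, (eps u * (eps s * c s u t + eps t * c t u s)) • I u := by
  rw [← r.rel' h, r.sym_cross h]; abel

/-- Dropping the sp(n, ℝ) ⊕ sp(1, ℝ) component changes the relation only by elements of the span of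
the I_u, so the left side lies in that span. Its trace against each I_u is a combination of traces
tr(I_v K) with K orthogonal to sp(1, ℝ), hence zero. -/
theorem perp_cross [Nontrivial E] (s t : Fin 3) :
    (I s * perpSkew g h.nondeg I (T t) - perpSkew g h.nondeg I (T t) * I s)
    + (I t * perpSkew g h.nondeg I (T s) - perpSkew g h.nondeg I (T s) * I t) = 0 := by
  have hN : (Module.finrank ℝ E : ℝ) ≠ 0 := by
    exact_mod_cast (Module.finrank_pos (R := ℝ) (M := E)).ne'
  have hspan : (I s * perpSkew g h.nondeg I (T t) - perpSkew g h.nondeg I (T t) * I s)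
    + (I t * perpSkew g h.nondeg I (T s) - perpSkew g h.nondeg I (T s) * I t)
      ∈ Submodule.span ℝ (Set.range I) := by
    have e : ∀ s t, I s * spProj g h.nondeg I (T t) - spProj g h.nondeg I (T t) * I s
        ∈ Submodule.span ℝ (Set.range I) := by
      intro s t
      rw [spProj_apply, mul_add, add_mul, h.commute_commPart, add_sub_add_left_eq_sub, ← neg_sub,
        h.comm_I]
      refine Submodule.neg_mem _ (Submodule.sub_mem _ ?_ ?_) <;>
      exact Submodule.smul_mem _ _ (Submodule.subset_span ⟨_, rfl⟩)
    have e2 := r.skew_rel h s t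
    have e3 : (I s * perpSkew g h.nondeg I (T t) - perpSkew g h.nondeg I (T t) * I s)
        + (I t * perpSkew g h.nondeg I (T s) - perpSkew g h.nondeg I (T s) * I t)
        = (-∑ u, (eps u * (eps s * c s u t + eps t * c t u s)) • I u)
          - (I s * spProj g h.nondeg I (T t) - spProj g h.nondeg I (T t) * I s)
          - (I t * spProj g h.nondeg I (T s) - spProj g h.nondeg I (T s) * I t) := by
      rw [← e2]; simp only [perpSkew, mul_sub, sub_mul]; abel
    rw [e3]
    exact Submodule.sub_mem _ (Submodule.sub_mem _ (Submodule.neg_mem _ (Submodule.sum_mem _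
      fun u _ => Submodule.smul_mem _ _ (Submodule.subset_span ⟨u, rfl⟩))) (e s t)) (e t s)
  obtain ⟨q, hq⟩ := (Submodule.mem_span_range_iff_exists_fun ℝ).1 hspan
  have htr : ∀ u s t, LinearMap.trace ℝ E (I u * (I s * perpSkew g h.nondeg I (T t)
      - perpSkew g h.nondeg I (T t) * I s)) = 0 := by
    intro u s t
    rw [mul_sub, map_sub, ← mul_assoc (I u) _ (I s), LinearMap.trace_mul_comm ℝ (_ * _) (I s),
      ← mul_assoc, ← mul_assoc, ← map_sub, ← sub_mul]
    have e2 : I u * I s - I s * I u ∈ Submodule.span ℝ (Set.range I) := by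
      have := h.comm_I (fun v => if v = u then 1 else 0) s
      simp only [ite_smul, one_smul, zero_smul, Finset.sum_ite_eq', Finset.mem_univ, if_true] at this
      rw [this]
      refine Submodule.sub_mem _ ?_ ?_ <;>
      exact Submodule.smul_mem _ _ (Submodule.subset_span ⟨_, rfl⟩)
    obtain ⟨q, hq⟩ := (Submodule.mem_span_range_iff_exists_fun ℝ).1 e2
    rw [← hq, Finset.sum_mul, map_sum]
    simp [h.trace_I_perpSkew]
  rw [← hq]
  refine Finset.sum_eq_zero fun u _ => ?_
  have h2 := congr(LinearMap.trace ℝ E (I u * $hq))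
  rw [mul_add, map_add, htr, htr, Finset.mul_sum, map_sum] at h2
  simp only [mul_smul_comm, map_smul, h.trace_I_mul_I, smul_eq_mul] at h2
  simp [hN, eps_ne_zero] at h2
  rw [h2, zero_smul]

theorem perp_commute [Nontrivial E] (s : Fin 3) :
    I s * perpSkew g h.nondeg I (T s) = perpSkew g h.nondeg I (T s) * I s := by
  have h1 := r.perp_cross h s s
  have : (2 : ℝ) • (I s * perpSkew g h.nondeg I (T s) - perpSkew g h.nondeg I (T s) * I s) = 0 := by
    rw [two_smul, h1]
  exact sub_eq_zero.1 ((smul_eq_zero.1 this).resolve_left two_ne_zero)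

/-- If K commutes with I_s, the four terms of its average over 1, I_1, I_2, I_3 agree in pairs: K =
ε_s I_s K I_s, and the two others coincide. The average vanishes, so K + ε_t I_t K I_t = 0. -/
theorem perp_anticommute [Nontrivial E] {s t : Fin 3} (hst : s ≠ t) :
    I t * perpSkew g h.nondeg I (T s) = -(perpSkew g h.nondeg I (T s) * I t) := by
  have h1 := r.perp_commute h s
  have h2 := (h.commPart_eq_zero_iff _).1 (h.commPart_perpSkew (T s))
  set K := perpSkew g h.nondeg I (T s)
  refine LinearMap.ext fun X => ?_
  have k : ∀ X, K (I s X) = I s (K X) := fun X => congr($h1.symm X)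
  have k0 : ∀ X, K X + (I 0 (K (I 0 X)) + I 1 (K (I 1 X)) - I 2 (K (I 2 X))) = 0 := by
    intro X
    have := congr($h2 X)
    simpa [Fin.sum_univ_three, mul_assoc, sub_eq_add_neg, add_assoc] using this
  have k1 : ∀ X, K (I 0 (I 1 X)) = K (I 2 X) := fun X => by rw [h.I01]
  have k2 : ∀ X, K (I 0 (I 2 X)) = K (I 1 X) := fun X => by rw [h.I02]
  have k3 : ∀ X, K (I 1 (I 0 X)) = -K (I 2 X) := fun X => by rw [h.I10, map_neg]
  have k4 : ∀ X, K (I 1 (I 2 X)) = -K (I 0 X) := fun X => by rw [h.I12, map_neg]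
  have k5 : ∀ X, K (I 2 (I 0 X)) = -K (I 1 X) := fun X => by rw [h.I20, map_neg]
  have k6 : ∀ X, K (I 2 (I 1 X)) = K (I 0 X) := fun X => by rw [h.I21]
  fin_cases s <;> fin_cases t <;> simp only [Fin.zero_eta, Fin.mk_one, Fin.reduceFinMk,
    not_true_eq_false, ne_eq] at hst k ⊢
  · have e : K (I 2 X) = I 0 (K (I 1 X)) := by rw [← k, k1]
    have k7 := congr(I 1 $(k0 X))
    simp only [k, e, h.I00, h.I11, map_add, map_sub, map_neg, map_zero,
      h.I20] at k7
    have : (2 : ℝ) • (I 1 (K X) + K (I 1 X)) = 0 := by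
      rw [← k7]; module
    exact eq_neg_of_add_eq_zero_left ((smul_eq_zero.1 this).resolve_left two_ne_zero)
  · have e : K (I 1 X) = I 0 (K (I 2 X)) := by rw [← k, k2]
    have k7 := congr(I 2 $(k0 X))
    simp only [k, e, h.I00, h.I22, map_add, map_sub, map_neg, map_zero, h.I10] at k7
    have : (2 : ℝ) • (I 2 (K X) + K (I 2 X)) = 0 := by
      rw [← k7]; module
    exact eq_neg_of_add_eq_zero_left ((smul_eq_zero.1 this).resolve_left two_ne_zero)
  · have e : K (I 2 X) = -I 1 (K (I 0 X)) := by rw [← k, k3, neg_neg]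
    have k7 := congr(I 0 $(k0 X))
    simp only [k, e, h.I00, h.I11, map_add, map_sub, map_neg, map_zero,
      h.I21] at k7
    have : (2 : ℝ) • (I 0 (K X) + K (I 0 X)) = 0 := by
      rw [← k7]; module
    exact eq_neg_of_add_eq_zero_left ((smul_eq_zero.1 this).resolve_left two_ne_zero)
  · have e : K (I 0 X) = -I 1 (K (I 2 X)) := by rw [← k, k4, neg_neg]
    have k7 := congr(I 2 $(k0 X))
    simp only [k, e, h.I11, h.I22, map_add, map_sub, map_neg, map_zero, h.I01] at k7
    have : (2 : ℝ) • (I 2 (K X) + K (I 2 X)) = 0 := by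
      rw [← k7]; module
    exact eq_neg_of_add_eq_zero_left ((smul_eq_zero.1 this).resolve_left two_ne_zero)
  · have e : K (I 1 X) = -I 2 (K (I 0 X)) := by rw [← k, k5, neg_neg]
    have k7 := congr(I 0 $(k0 X))
    simp only [k, e, h.I00, h.I22, map_add, map_sub, map_neg, map_zero,
      h.I12] at k7
    have : (2 : ℝ) • (I 0 (K X) + K (I 0 X)) = 0 := by
      rw [← k7]; module
    exact eq_neg_of_add_eq_zero_left ((smul_eq_zero.1 this).resolve_left two_ne_zero)
  · have e : K (I 0 X) = I 2 (K (I 1 X)) := by rw [← k, k6]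
    have k7 := congr(I 1 $(k0 X))
    simp only [k, e, h.I11, h.I22, map_add, map_sub, map_neg, map_zero, h.I02] at k7
    have : (2 : ℝ) • (I 1 (K X) + K (I 1 X)) = 0 := by
      rw [← k7]; module
    exact eq_neg_of_add_eq_zero_left ((smul_eq_zero.1 this).resolve_left two_ne_zero)

/-- The operator of the tensor `τ`. -/
def _root_.Pqc.tauOp (g : LinearMap.BilinForm ℝ E) (hg : g.Nondegenerate)
    (I : Fin 3 → Module.End ℝ E) (T : Fin 3 → Module.End ℝ E) : Module.End ℝ E :=
  -∑ s, eps s • (symPart g hg (T s) * I s)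

theorem adj_tauOp : adj g h.nondeg (tauOp g h.nondeg I T) = tauOp g h.nondeg I T := by
  simp only [tauOp, map_neg, map_sum, map_smul, h.adj_mul, h.adj_I, h.adj_symPart, neg_mul,
    r.sym_anticommute h, neg_neg]

theorem commPart_tauOp : commPart I (tauOp g h.nondeg I T) = 0 := by
  have : ∀ s, commPart I (symPart g h.nondeg (T s) * I s) = 0 := fun s =>
    h.commPart_of_anticommute (s := s) (by
      rw [← mul_assoc, r.sym_anticommute h, neg_mul, neg_neg])
  simp [tauOp, this]

theorem trace_tauOp : LinearMap.trace ℝ E (tauOp g h.nondeg I T) = 0 := by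
  simp [tauOp, h.trace_sym_mul_skew (h.adj_symPart _) (h.adj_I _)]

theorem trace_tauOp_mul_I (s : Fin 3) :
    LinearMap.trace ℝ E (tauOp g h.nondeg I T * I s) = 0 :=
  h.trace_sym_mul_skew (r.adj_tauOp h) (h.adj_I s)

theorem commPart_symPart (s : Fin 3) : commPart I (symPart g h.nondeg (T s)) = 0 :=
  h.commPart_of_anticommute (s := s) (by rw [r.sym_anticommute h, neg_neg])

theorem trace_symPart (s : Fin 3) : LinearMap.trace ℝ E (symPart g h.nondeg (T s)) = 0 := by
  have h1 := h.trace_mul_commPart 1 (symPart g h.nondeg (T s))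
  rw [r.commPart_symPart h, h.commPart_of_commute (A := 1) fun s => by rw [one_mul, mul_one]] at h1
  simpa using h1.symm

/-- In the commutator of τ with I_s, `sym_cross` trades each S_u I_s for S_s I_u. The three summands
contribute 3 S from the plain terms, -S from the terms ε_u I_u S I_u by `commPart_symPart`, and 2 S
from the anticommutator with u = s. The total 4 S explains the factor 1/4. -/
theorem symPart_eq (s : Fin 3) : symPart g h.nondeg (T s)
    = -(1 / 4 : ℝ) • (tauOp g h.nondeg I T * I s - I s * tauOp g h.nondeg I T) := by
  have h0 := (h.commPart_eq_zero_iff _).1 (r.commPart_symPart h s)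
  set S := symPart g h.nondeg (T s) with hS
  have hu : ∀ u, eps u • (symPart g h.nondeg (T u) * I u * I s
      - I s * (symPart g h.nondeg (T u) * I u)) = S + eps u • (I u * S * I u) +
      eps u • (symPart g h.nondeg (T u) * (I u * I s + I s * I u)) := by
    intro u
    have hc := r.sym_cross h s u
    rw [← hS] at hc
    have hq := h.sq u
    have hq' : eps u • (S * (I u * I u)) = S := by
      rw [hq, mul_smul_comm, smul_smul, eps_mul_self, one_smul, mul_one]
    conv_rhs => enter [1, 1]; rw [← hq']
    rw [← smul_add, ← smul_add]
    congr 1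
    linear_combination (norm := noncomm_ring) -hc * I u
  have hanti : ∀ u, eps u • (symPart g h.nondeg (T u) * (I u * I s + I s * I u))
      = if u = s then (2 : ℝ) • S else 0 := by
    intro u
    split_ifs with e
    · subst e
      rw [h.sq, ← add_smul, mul_smul_comm, smul_smul, mul_add, eps_mul_self, mul_one, hS]
      norm_num
    · rw [h.mul_comm_ne e]; simp
  have hsum : tauOp g h.nondeg I T * I s - I s * tauOp g h.nondeg I T
      = -∑ u, eps u • (symPart g h.nondeg (T u) * I u * I s
      - I s * (symPart g h.nondeg (T u) * I u)) := by
    simp only [tauOp, neg_mul, mul_neg, Finset.sum_mul, Finset.mul_sum, smul_mul_assoc,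
      mul_smul_comm, smul_sub, Finset.sum_sub_distrib]
    abel
  rw [hsum, Finset.sum_congr rfl fun u _ => hu u, Finset.sum_add_distrib, Finset.sum_add_distrib,
    Finset.sum_congr rfl fun u _ => hanti u, Finset.sum_const, Finset.card_univ, Fintype.card_fin,
    Finset.sum_ite_eq' Finset.univ s, if_pos (Finset.mem_univ _)]
  have h1 : ∑ u, eps u • (I u * S * I u) = -S := by
    rw [eq_neg_iff_add_eq_zero, add_comm, h0]
  rw [h1]
  module

/-- The operator of the tensor `μ`. -/
def _root_.Pqc.muOp (g : LinearMap.BilinForm ℝ E) (hg : g.Nondegenerate)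
    (I : Fin 3 → Module.End ℝ E) (T : Fin 3 → Module.End ℝ E) : Module.End ℝ E :=
  eps 0 • (perpSkew g hg I (T 0) * I 0)

/-- Anticommutation turns `perp_cross` into K_t I_s + K_s I_t = 0, and multiplication by I_t I_s
gives the identity. Thus one tensor μ encodes the skew torsion of all three ξ_s. -/
theorem muOp_eq_of_ne [Nontrivial E] {s t : Fin 3} (hst : s ≠ t) :
    eps s • (perpSkew g h.nondeg I (T s) * I s) = eps t • (perpSkew g h.nondeg I (T t) * I t) := by
  have h1 := r.perp_cross h s t
  have h2 := r.perp_anticommute h hst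
  have h3 := r.perp_anticommute h hst.symm
  set Ks := perpSkew g h.nondeg I (T s)
  set Kt := perpSkew g h.nondeg I (T t)
  have h4 : Kt * I s + Ks * I t = 0 := by
    have : (-2 : ℝ) • (Kt * I s + Ks * I t) = 0 := by
      rw [← h1, h2, h3]; module
    exact (smul_eq_zero.1 this).resolve_left (by norm_num)
  have anti := h.mul_comm_ne hst
  have e1 : Ks * (I s * (I t * I t)) = eps t • (Ks * I s) := by rw [h.sq]; simp
  have e2 : Kt * (I t * (I s * I s)) = eps s • (Kt * I t) := by rw [h.sq]; simp
  have e3 : eps t • (Ks * I s) = eps s • (Kt * I t) := by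
    rw [← e1, ← e2]
    linear_combination (norm := noncomm_ring) h4 * (I t * I s) + Ks * anti * I t - Ks * I t * anti
      - Kt * anti * I s
  have := congr((eps s * eps t) • $e3)
  rw [smul_smul, smul_smul, mul_assoc, eps_mul_self, mul_one, mul_comm, ← mul_assoc, eps_mul_self,
    one_mul] at this
  exact this

theorem muOp_eq [Nontrivial E] (s : Fin 3) :
    muOp g h.nondeg I T = eps s • (perpSkew g h.nondeg I (T s) * I s) := by
  by_cases hs : 0 = s
  · subst hs; rfl
  · exact r.muOp_eq_of_ne h hs

theorem adj_muOp [Nontrivial E] : adj g h.nondeg (muOp g h.nondeg I T) = muOp g h.nondeg I T := by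
  rw [muOp, map_smul, h.adj_mul, h.adj_I, h.adj_perpSkew, neg_mul_neg, r.perp_commute h]

theorem trace_muOp [Nontrivial E] : LinearMap.trace ℝ E (muOp g h.nondeg I T) = 0 := by
  rw [muOp, map_smul, LinearMap.trace_mul_comm, h.trace_I_perpSkew, smul_zero]

theorem muOp_mul_I [Nontrivial E] (s : Fin 3) :
    muOp g h.nondeg I T * I s = perpSkew g h.nondeg I (T s) := by
  rw [r.muOp_eq h s, smul_mul_assoc, mul_assoc, h.sq, mul_smul_comm, smul_smul, eps_mul_self,
    one_smul, mul_one]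

theorem muOp_commute [Nontrivial E] (s : Fin 3) :
    muOp g h.nondeg I T * I s = I s * muOp g h.nondeg I T := by
  rw [r.muOp_eq h s, smul_mul_assoc, mul_smul_comm, ← mul_assoc (I s), r.perp_commute h]

/-- In dimension four a non-null Z together with I_1 Z, I_2 Z, I_3 Z is a basis. The operator is
symmetric and commutes with the I_s, so P Z is orthogonal to each I_s Z and P Z = k Z. Commutation
then gives P = k, and P is trace-free. -/
theorem muOp_eq_zero (hd : Module.finrank ℝ E = 4) : muOp g h.nondeg I T = 0 := by
  have : Nontrivial E := Module.nontrivial_of_finrank_pos (R := ℝ) (by omega)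
  set P := muOp g h.nondeg I T with hP
  have hPc : ∀ s X, P (I s X) = I s (P X) := fun s X => congr($(r.muOp_commute h s) X)
  have hPs : ∀ X Y, g (P X) Y = g X (P Y) := fun X Y => by
    rw [← form_adj g h.nondeg, hP, r.adj_muOp h]
  obtain ⟨Z, hZ⟩ := h.exists_nonnull
  have horth : ∀ X, g X Z = 0 → (∀ s, g X (I s Z) = 0) → X = 0 := by
    intro X h1 h2
    have hspan : ∀ Y, Y ∈ Submodule.span ℝ (Set.range (![Z, I 0 Z, I 1 Z, I 2 Z] : Fin 4 → E)) := by
      have hli : LinearIndependent ℝ (![Z, I 0 Z, I 1 Z, I 2 Z] : Fin 4 → E) := by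
        rw [Fintype.linearIndependent_iff]
        intro q hq
        simp only [Fin.sum_univ_four, Matrix.cons_val_zero, Matrix.cons_val_one,
          Matrix.cons_val] at hq
        have q0 := congr(g $hq Z)
        have q1 := congr(g $hq (I 0 Z))
        have q2 := congr(g $hq (I 1 Z))
        have q3 := congr(g $hq (I 2 Z))
        simp [h.form_self_I, h.form_I_self, h.compat, h.form_I_I, hZ] at q0 q1 q2 q3
        intro i; fin_cases i <;> assumption
      have := hli.span_eq_top_of_card_eq_finrank' (by simp [hd])
      intro Y; rw [this]; trivial
    refine h.ext fun Y => ?_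
    rw [map_zero, LinearMap.zero_apply]
    induction hspan Y using Submodule.span_induction with
    | mem y hy =>
      obtain ⟨a, rfl⟩ := hy
      fin_cases a
      exacts [h1, h2 0, h2 1, h2 2]
    | zero => simp
    | add y z _ _ hy hz => rw [map_add, hy, hz, add_zero]
    | smul a y _ hy => rw [map_smul, hy, smul_zero]
  set k := g (P Z) Z / g Z Z with hk
  have hPZI : ∀ s, g (P Z) (I s Z) = 0 := by
    intro s
    have e1 : g (P Z) (I s Z) = -g (P Z) (I s Z) := by
      conv_lhs => rw [hPs, hPc, ← neg_neg (g Z (I s (P Z))), ← h.skew, h.symm]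
    linarith
  have hPZ : P Z = k • Z := by
    refine sub_eq_zero.1 (horth _ ?_ fun s => ?_)
    · simp only [map_sub, map_smul, LinearMap.sub_apply, LinearMap.smul_apply, smul_eq_mul, hk]
      field_simp; ring
    · simp [hPZI, h.form_self_I]
  have hPk : P - k • 1 = 0 := by
    refine LinearMap.ext fun X => horth _ ?_ fun s => ?_
    · simp [hPs, hPZ]
    · simp [hPs, hPZ, hPc]
  have htr : LinearMap.trace ℝ E P = 0 := r.trace_muOp h
  rw [sub_eq_zero.1 hPk] at htr ⊢
  simp [hd] at htr
  rw [htr, zero_smul]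

/-- Traced against I_u, the relations express sp(1)-components of the T_t through the numbers c. The
off-diagonal components are determined outright (`coefPart_succ`, `coefPart_pred`), but of the
diagonal ones only the differences (`coefPart_diag_sub`); λ records the remaining freedom. -/
theorem trace_rel (u s t : Fin 3) : LinearMap.trace ℝ E (I u * I s * T t)
      + LinearMap.trace ℝ E (I u * I t * T s)
    = -(Module.finrank ℝ E * (eps s * c s u t + eps t * c t u s)) / 2 := by
  have key : ∀ s t, LinearMap.trace ℝ E (I u * (adj g h.nondeg (T t) * I s))
      = LinearMap.trace ℝ E (I u * I s * T t) := by
    intro s t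
    rw [← trace_adj g h.nondeg, h.adj_mul, h.adj_mul, h.adj_adj, h.adj_I, h.adj_I,
      LinearMap.trace_mul_comm, ← mul_assoc]
    simp
  have h1 := congr(LinearMap.trace ℝ E (I u * $(r.rel s t)))
  rw [mul_add, mul_add, mul_add, map_add, map_add, map_add, key, key, ← mul_assoc, ← mul_assoc,
    mul_neg, Finset.mul_sum, map_neg, map_sum] at h1
  simp only [mul_smul_comm, map_smul, h.trace_I_mul_I, smul_eq_mul, mul_ite, mul_zero,
    Finset.sum_ite_eq, Finset.mem_univ, if_true] at h1
  have := eps_mul_self u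
  linear_combination h1 / 2 - (Module.finrank ℝ E * (eps s * c s u t + eps t * c t u s)) / 2 * this

variable [Nontrivial E]

omit r in
theorem trace_I_mul (s : Fin 3) (A : Module.End ℝ E) :
    LinearMap.trace ℝ E (I s * A) = Module.finrank ℝ E * (eps s * coefPart I s A) := by
  have hN : (Module.finrank ℝ E : ℝ) ≠ 0 := by
    exact_mod_cast (Module.finrank_pos (R := ℝ) (M := E)).ne'
  rw [coefPart_apply]
  field_simp
  rw [pow_two, eps_mul_self, mul_one]

theorem coefPart_succ (i : Fin 3) :
    coefPart I (i + 1) (T i) = eps i / 2 * c i (i + 2) i := by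
  have hN : (Module.finrank ℝ E : ℝ) ≠ 0 := by
    exact_mod_cast (Module.finrank_pos (R := ℝ) (M := E)).ne'
  have h1 := r.trace_rel h (i + 2) i i
  have e : I (i + 2) * I i = -(eps (i + 1) • I (i + 1)) := by
    have := h.mul (i + 2)
    fin_cases i <;> simpa using this
  rw [e] at h1
  simp only [neg_mul, smul_mul_assoc, map_neg, map_smul, trace_I_mul, smul_eq_mul] at h1
  have e2 := eps_mul_self (i + 1)
  have : (Module.finrank ℝ E : ℝ) * (coefPart I (i + 1) (T i) - eps i / 2 * c i (i + 2) i) = 0 := by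
    linear_combination -h1 / 2 - (Module.finrank ℝ E : ℝ) * coefPart I (i + 1) (T i) * e2
  linarith [(mul_eq_zero.1 this).resolve_left hN]

theorem coefPart_pred (i : Fin 3) :
    coefPart I (i + 2) (T i) = -(eps i / 2 * c i (i + 1) i) := by
  have hN : (Module.finrank ℝ E : ℝ) ≠ 0 := by
    exact_mod_cast (Module.finrank_pos (R := ℝ) (M := E)).ne'
  have h1 := r.trace_rel h (i + 1) i i
  rw [h.mul_rev] at h1
  simp only [smul_mul_assoc, map_smul, trace_I_mul, smul_eq_mul] at h1
  have e2 := eps_mul_self (i + 2)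
  have : (Module.finrank ℝ E : ℝ) * (coefPart I (i + 2) (T i) + eps i / 2 * c i (i + 1) i) = 0 := by
    linear_combination h1 / 2 - (Module.finrank ℝ E : ℝ) * coefPart I (i + 2) (T i) * e2
  linarith [(mul_eq_zero.1 this).resolve_left hN]

theorem coefPart_diag_sub (i : Fin 3) : coefPart I i (T i) - coefPart I (i + 1) (T (i + 1))
    = eps i / 2 * c i (i + 1) (i + 2) - eps (i + 1) / 2 * c (i + 1) (i + 2) i := by
  have hN : (Module.finrank ℝ E : ℝ) ≠ 0 := by
    exact_mod_cast (Module.finrank_pos (R := ℝ) (M := E)).ne'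
  have h1 := r.trace_rel h (i + 2) i (i + 1)
  have e : I (i + 2) * I i = -(eps (i + 1) • I (i + 1)) := by
    have := h.mul (i + 2)
    fin_cases i <;> simpa using this
  have e' : I (i + 2) * I (i + 1) = eps i • I i := by
    have := h.mul_rev (i + 1)
    fin_cases i <;> simpa using this
  rw [e, e', r.swap i (i + 2)] at h1
  simp only [neg_mul, smul_mul_assoc, map_neg, map_smul, trace_I_mul, smul_eq_mul] at h1
  have e1 := eps_mul_self i
  have e2 := eps_mul_self (i + 1)
  have : (Module.finrank ℝ E : ℝ) * (coefPart I i (T i) - coefPart I (i + 1) (T (i + 1))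
      - (eps i / 2 * c i (i + 1) (i + 2) - eps (i + 1) / 2 * c (i + 1) (i + 2) i)) = 0 := by
    linear_combination h1 + (Module.finrank ℝ E : ℝ) * coefPart I (i + 1) (T (i + 1)) * e2
      - (Module.finrank ℝ E : ℝ) * coefPart I i (T i) * e1
  linarith [(mul_eq_zero.1 this).resolve_left hN]

/-- The value of the function `λ`, computed with the `i`-th Reeb field. -/
theorem lam_succ (i : Fin 3) :
    4 * coefPart I i (T i) - eps i * c i (i + 1) (i + 2) + eps (i + 1) * c (i + 1) (i + 2) i
      + eps (i + 2) * c (i + 2) i (i + 1)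
    = 4 * coefPart I (i + 1) (T (i + 1)) - eps (i + 1) * c (i + 1) (i + 2) i
      + eps (i + 2) * c (i + 2) i (i + 1) + eps i * c i (i + 1) (i + 2) := by
  linear_combination 4 * r.coefPart_diag_sub h i

end TorsRel

end Torsion

/-! ### Smooth frames of H and fields dual to the contact forms -/

section Horizontal

variable {n : ℕ} {M : Type*} [TopologicalSpace M]
  [ChartedSpace (EuclideanSpace ℝ (Fin (4 * n + 3))) M] [IsManifold (𝓡 (4 * n + 3)) ∞ M]
  {H : SubspaceField n M} {PQ : Π x : M, Submodule ℝ (Module.End ℝ (H x))} {g : HMetric H}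
  {U W : Set M} {X Y Z : HField H} {f h : M → ℝ} {x : M}

theorem SmoothHF.mono (hX : SmoothHF U X) (h : W ⊆ U) : SmoothHF W X := SmoothVF.mono hX h

theorem SmoothHF.congr (hX : SmoothHF U X) (h : ∀ y ∈ U, Y y = X y) : SmoothHF U Y :=
  SmoothVF.congr hX fun y hy => by simp [HField.toVField, h y hy]

theorem SmoothHF.add (hX : SmoothHF U X) (hY : SmoothHF U Y) :
    SmoothHF U (fun y => X y + Y y : HField H) := SmoothVF.add hX hY

theorem SmoothHF.sub (hX : SmoothHF U X) (hY : SmoothHF U Y) :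
    SmoothHF U (fun y => X y - Y y : HField H) := SmoothVF.sub hX hY

theorem SmoothHF.neg (hX : SmoothHF U X) : SmoothHF U (fun y => -X y : HField H) := SmoothVF.neg hX

theorem SmoothHF.smul (hf : SmoothFun (n := n) U f) (hX : SmoothHF U X) :
    SmoothHF U (fun y => f y • X y : HField H) := SmoothVF.smul hf hX

theorem SmoothHF.const_smul (c : ℝ) (hX : SmoothHF U X) :
    SmoothHF U (fun y => c • X y : HField H) := SmoothVF.const_smul c hX

theorem SmoothHF.sum {ι : Type*} {s : Finset ι} {X : ι → HField H}
    (hX : ∀ i ∈ s, SmoothHF U (X i)) : SmoothHF U (fun y => ∑ i ∈ s, X i y : HField H) := by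
  refine SmoothVF.congr (SmoothVF.sum hX) fun y _ => ?_
  simp [HField.toVField]

theorem SmoothHF.of_locally (h : ∀ x ∈ U, ∃ W, IsOpen W ∧ x ∈ W ∧ SmoothHF (U ∩ W) X) :
    SmoothHF U X := SmoothVF.of_locally h

theorem HMetric.smoothFun (g : HMetric H) (hU : IsOpen U) (hX : SmoothHF U X) (hY : SmoothHF U Y) :
    SmoothFun (n := n) U (fun y => g.form y (X y) (Y y)) :=
  g.smooth U hU (Set.subset_univ _) X Y hX hY

open Classical in
/-- A vector field, made horizontal by replacing non-horizontal values by zero. -/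
def HField.ofVField (H : SubspaceField n M) (X : VField n M) : HField H :=
  fun y => if h : X y ∈ H y then ⟨X y, h⟩ else 0

theorem HField.coe_ofVField {X : VField n M} {y : M} (h : X y ∈ H y) :
    (HField.ofVField H X y : Tan n M y) = X y := by
  simp [HField.ofVField, h]

theorem SmoothVF.ofVField {X : VField n M} (hX : SmoothVF U X) (h : ∀ y ∈ U, X y ∈ H y) :
    SmoothHF U (HField.ofVField H X) :=
  SmoothVF.congr hX fun y hy => HField.coe_ofVField (h y hy)

theorem SmoothFun.matrix_det {k : ℕ} {G : M → Matrix (Fin k) (Fin k) ℝ}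
    (hG : ∀ a b, SmoothFun (n := n) U (fun y => G y a b)) :
    SmoothFun (n := n) U (fun y => (G y).det) := by
  simp only [Matrix.det_apply]
  refine SmoothFun.sum fun σ _ => ?_
  simp only [Units.smul_def, zsmul_eq_mul]
  exact SmoothFun.const_mul _ (SmoothFun.prod fun i _ => hG _ _)

theorem SmoothFun.matrix_inv {k : ℕ} {G : M → Matrix (Fin k) (Fin k) ℝ}
    (hG : ∀ a b, SmoothFun (n := n) U (fun y => G y a b)) (h0 : ∀ y ∈ U, (G y).det ≠ 0)
    (a b : Fin k) : SmoothFun (n := n) U (fun y => (G y)⁻¹ a b) := by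
  have : ∀ y, (G y)⁻¹ a b = (G y).det⁻¹ * ((G y).updateRow b (Pi.single a 1)).det := by
    intro y
    rw [Matrix.inv_def, Matrix.smul_apply, Matrix.adjugate_apply, smul_eq_mul, Ring.inverse_eq_inv]
  simp only [this]
  refine (SmoothFun.inv (SmoothFun.matrix_det hG) h0).mul (SmoothFun.matrix_det fun i j => ?_)
  by_cases hi : i = b
  · subst hi; simp only [Matrix.updateRow_self]; exact SmoothFun.const _
  · simp only [Matrix.updateRow_ne hi]; exact hG i j

/-- A smooth local frame of `H` and its `g`-dual frame. -/
structure HFrame (g : HMetric H) (W : Set M) where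
  e : Fin (4 * n) → HField H
  f : Fin (4 * n) → HField H
  smooth_e : ∀ a, SmoothHF W (e a)
  smooth_f : ∀ a, SmoothHF W (f a)
  expand_e : ∀ y ∈ W, ∀ Y : H y, Y = ∑ a, g.form y Y (f a y) • e a y
  expand_f : ∀ y ∈ W, ∀ Y : H y, Y = ∑ a, g.form y Y (e a y) • f a y
  linInd : ∀ y ∈ W, LinearIndependent ℝ (fun a => e a y)
  dual : ∀ y ∈ W, ∀ a b, g.form y (e a y) (f b y) = if a = b then 1 else 0

theorem exists_hframe (hH : IsSmoothDistribution (4 * n) H) (g : HMetric H) (x : M) :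
    ∃ W : Set M, IsOpen W ∧ x ∈ W ∧ Nonempty (HFrame g W) := by
  obtain ⟨W, hW, hx, e₀, he₀, hspan⟩ := hH x
  have hmem : ∀ a, ∀ y ∈ W, e₀ a y ∈ H y := fun a y hy => by
    rw [← (hspan y hy).2]; exact Submodule.subset_span ⟨a, rfl⟩
  set e : Fin (4 * n) → HField H := fun a => HField.ofVField H (e₀ a) with he
  have hcoe : ∀ a, ∀ y ∈ W, (e a y : Tan n M y) = e₀ a y := fun a y hy =>
    HField.coe_ofVField (hmem a y hy)
  have hse : ∀ a, SmoothHF W (e a) := fun a => (he₀ a).ofVField (hmem a)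
  have hli : ∀ y ∈ W, LinearIndependent ℝ (fun a => e a y) := fun y hy => by
    have : LinearIndependent ℝ (fun a => (H y).subtype (e a y)) := by
      simpa [hcoe _ y hy] using (hspan y hy).1
    exact LinearIndependent.of_comp _ this
  have hexp : ∀ y ∈ W, ∀ Y : H y, ∃ c : Fin (4 * n) → ℝ, ∑ a, c a • e a y = Y := fun y hy Y => by
    have : (Y : Tan n M y) ∈ Submodule.span ℝ (Set.range fun a => e₀ a y) := by
      rw [(hspan y hy).2]; exact Y.2
    obtain ⟨c, hc⟩ := (Submodule.mem_span_range_iff_exists_fun ℝ).1 this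
    refine ⟨c, Subtype.ext ?_⟩
    rw [← hc]
    simp [hcoe _ y hy]
  set G : M → Matrix (Fin (4 * n)) (Fin (4 * n)) ℝ := fun y => .of fun a b => g.form y (e a y) (e b y)
    with hG
  -- A vector in the kernel of the Gram matrix would give a combination of the e_a orthogonal to all
  -- of H.
  have hdet : ∀ y ∈ W, (G y).det ≠ 0 := by
    intro y hy hdet
    obtain ⟨v, hv, hv'⟩ := Matrix.exists_mulVec_eq_zero_iff.2 hdet
    have h1 : ∑ b, v b • e b y = 0 := by
      refine (g.nondegenerate y).2 _ fun Y => ?_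
      obtain ⟨c, rfl⟩ := hexp y hy Y
      have h2 : ∀ a, g.form y (e a y) (∑ b, v b • e b y) = 0 := fun a => by
        have := congrFun hv' a
        simp only [Matrix.mulVec, dotProduct, hG, Matrix.of_apply, Pi.zero_apply] at this
        rw [← this, map_sum]
        exact Finset.sum_congr rfl fun b _ => by rw [map_smul, smul_eq_mul, mul_comm]
      rw [map_sum (g.form y), LinearMap.sum_apply]
      exact Finset.sum_eq_zero fun a _ => by rw [map_smul, LinearMap.smul_apply, h2, smul_zero]
    exact hv (funext fun b => Fintype.linearIndependent_iff.1 (hli y hy) v h1 b)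
  set fr : Fin (4 * n) → HField H := fun a y => ∑ b, (G y)⁻¹ a b • e b y with hfr
  have hGs : ∀ a b, SmoothFun (n := n) W (fun y => G y a b) := fun a b =>
    g.smoothFun hW (hse a) (hse b)
  have hsf : ∀ a, SmoothHF W (fr a) := fun a =>
    SmoothHF.sum fun b _ => SmoothHF.smul (SmoothFun.matrix_inv hGs hdet a b) (hse b)
  have hef : ∀ y ∈ W, ∀ a b, g.form y (e a y) (fr b y) = if a = b then 1 else 0 := by
    intro y hy a b
    have h1 := congrFun (congrFun (Matrix.mul_nonsing_inv (G y) (hdet y hy).isUnit) a) b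
    have hs : (G y)⁻¹ = ((G y)⁻¹).transpose := by
      rw [Matrix.transpose_nonsing_inv]
      congr 1
      ext c d
      exact g.symm y _ _
    rw [hs, Matrix.mul_apply, Matrix.one_apply] at h1
    rw [← h1]
    simp only [hfr, map_sum, map_smul, smul_eq_mul, Matrix.transpose_apply]
    exact Finset.sum_congr rfl fun c _ => mul_comm _ _
  refine ⟨W, hW, hx, ⟨⟨e, fr, hse, hsf, fun y hy Y => ?_, fun y hy Y => ?_, hli, hef⟩⟩⟩
  · obtain ⟨c, rfl⟩ := hexp y hy Y
    refine Finset.sum_congr rfl fun a _ => ?_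
    congr 1
    simp only [map_sum, LinearMap.sum_apply, map_smul, LinearMap.smul_apply, hef y hy, smul_eq_mul]
    simp
  · refine sub_eq_zero.1 ((g.nondegenerate y).2 _ fun Z => ?_)
    obtain ⟨c, rfl⟩ := hexp y hy Z
    have : ∀ b, g.form y (e b y) (Y - ∑ a, g.form y Y (e a y) • fr a y) = 0 := fun b => by
      simp only [map_sub, map_sum, map_smul, hef y hy, smul_eq_mul]
      simp [g.symm y Y]
    simp only [map_sum, LinearMap.sum_apply, map_smul, LinearMap.smul_apply, this]
    simp

theorem HFrame.form_raise (E : HFrame g W) (hx : x ∈ W) (θ : H x →ₗ[ℝ] ℝ) (v : H x) :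
    g.form x (∑ a, θ (E.e a x) • E.f a x) v = θ v := by
  conv_rhs => rw [E.expand_e x hx v]
  simp only [map_sum, LinearMap.sum_apply, map_smul, LinearMap.smul_apply, smul_eq_mul]
  exact Finset.sum_congr rfl fun a _ => by rw [g.symm x v, mul_comm]

theorem exists_horizontal_extend (hH : IsSmoothDistribution (4 * n) H) (g : HMetric H) (x : M)
    (v : H x) : ∃ (W : Set M) (Y : HField H), IsOpen W ∧ x ∈ W ∧ SmoothHF W Y ∧ Y x = v := by
  obtain ⟨W, hW, hx, ⟨E⟩⟩ := exists_hframe hH g x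
  refine ⟨W, fun y => ∑ a, g.form x v (E.f a x) • E.e a y, hW, hx,
    SmoothHF.sum fun a _ => SmoothHF.const_smul _ (E.smooth_e a), (E.expand_e x hx v).symm⟩

theorem finrank_horizontal (hH : IsSmoothDistribution (4 * n) H) (x : M) :
    Module.finrank ℝ (H x) = 4 * n := by
  obtain ⟨W, hW, hx, e₀, he₀, hspan⟩ := hH x
  rw [← (hspan x hx).2, finrank_span_eq_card (hspan x hx).1, Fintype.card_fin]

theorem LocalFrame.paraQuat (F : LocalFrame H PQ g U) (hx : x ∈ U) :
    ParaQuat (g.form x) (fun s => F.I s x) where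
  symm := g.symm x
  nondeg := g.nondegenerate x
  sq s := F.I_sq s x hx
  mul i := F.I_mul i x hx
  mul_rev i := F.I_mul_rev i x hx
  compat s := F.compatible s x hx

theorem LocalFrame.mem_iff (F : LocalFrame H PQ g U) (hx : x ∈ U) (v : Tan n M x) :
    v ∈ H x ↔ ∀ s, F.η s x v = 0 := by
  rw [F.ker_η x hx]; simp

theorem LocalFrame.η_coe (F : LocalFrame H PQ g U) (hx : x ∈ U) (s : Fin 3) (X : H x) :
    F.η s x X = 0 := (F.mem_iff hx _).1 X.2 s

theorem LocalFrame.diffForm (F : LocalFrame H PQ g U) (hx : x ∈ U) (s : Fin 3) :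
    DiffForm (F.η s) x := (F.smooth_η s).diffForm F.isOpen hx

theorem LocalFrame.extT_horizontal (hH : IsSmoothDistribution (4 * n) H)
    (F : LocalFrame H PQ g U) (hx : x ∈ U) (s : Fin 3) (X Y : H x) :
    extT (F.η s) x X Y = -2 * eps s * g.form x (F.I s x X) Y := by
  obtain ⟨W, X', hW, hxW, hX', rfl⟩ := exists_horizontal_extend hH g x X
  obtain ⟨W', Y', hW', hxW', hY', rfl⟩ := exists_horizontal_extend hH g x Y
  have ho : IsOpen (W ∩ W' ∩ U) := (hW.inter hW').inter F.isOpen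
  rw [← F.contact s (W ∩ W' ∩ U) ho Set.inter_subset_right X' Y'
    (hX'.mono fun y hy => hy.1.1) (hY'.mono fun y hy => hy.1.2) x ⟨⟨hxW, hxW'⟩, hx⟩]
  exact extT_apply (F.diffForm hx s) (hX'.diffVF hW hxW) (hY'.diffVF hW' hxW')

/-- Smooth fields `ξ` on the open subset `W` of the domain of a frame dual to its 1-forms. -/
structure IsDual (F : LocalFrame H PQ g U) (ξ : Fin 3 → VField n M) (W : Set M) : Prop where
  isOpen : IsOpen W
  subset : W ⊆ U
  smooth : ∀ s, SmoothVF W (ξ s)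
  dual : ∀ s t, ∀ x ∈ W, F.η s x (ξ t x) = if s = t then 1 else 0

theorem IsDual.mono {F : LocalFrame H PQ g U} {ξ : Fin 3 → VField n M} (hξ : IsDual F ξ W)
    {W' : Set M} (hW' : IsOpen W') (h : W' ⊆ W) : IsDual F ξ W' :=
  ⟨hW', h.trans hξ.subset, fun s => (hξ.smooth s).mono h, fun s t x hx => hξ.dual s t x (h hx)⟩

/-- The vertical-free part of a tangent vector, with respect to fields dual to a frame. -/
def LocalFrame.preproj (F : LocalFrame H PQ g U) (ξ : Fin 3 → VField n M) (x : M) :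
    Tan n M x →ₗ[ℝ] Tan n M x :=
  LinearMap.id - ∑ s, (F.η s x).smulRight (ξ s x)

open Classical in
/-- The projection to `H` along the span of fields dual to the 1-forms of a frame. -/
def LocalFrame.hproj (F : LocalFrame H PQ g U) (ξ : Fin 3 → VField n M) (x : M) :
    Tan n M x →ₗ[ℝ] H x :=
  if h : ∀ v, F.preproj ξ x v ∈ H x then
    LinearMap.codRestrict (H x) (F.preproj ξ x) h
  else 0

namespace IsDual

variable {F : LocalFrame H PQ g U} {ξ : Fin 3 → VField n M} (hξ : IsDual F ξ W)
include hξ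

theorem coe_hproj (hx : x ∈ W) (v : Tan n M x) :
    (F.hproj ξ x v : Tan n M x) = v - ∑ s, F.η s x v • ξ s x := by
  have h : ∀ v, F.preproj ξ x v ∈ H x := fun v => by
    rw [F.mem_iff (hξ.subset hx)]
    intro s
    simp [LocalFrame.preproj, hξ.dual _ _ x hx]
  simp only [LocalFrame.hproj, h, implies_true, dif_pos]
  simp [LocalFrame.preproj]

theorem decomp (hx : x ∈ W) (v : Tan n M x) :
    v = (F.hproj ξ x v : Tan n M x) + ∑ s, F.η s x v • ξ s x := by
  rw [hξ.coe_hproj hx, sub_add_cancel]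

theorem hproj_coe (hx : x ∈ W) (X : H x) : F.hproj ξ x (X : Tan n M x) = X := by
  refine Subtype.ext ?_
  rw [hξ.coe_hproj hx]
  simp [F.η_coe (hξ.subset hx)]

theorem hproj_ξ (hx : x ∈ W) (s : Fin 3) : F.hproj ξ x (ξ s x) = 0 := by
  refine Subtype.ext ?_
  rw [hξ.coe_hproj hx]
  simp [hξ.dual _ _ x hx]

theorem smooth_hproj {W' : Set M} (hW' : IsOpen W') (h : W' ⊆ W) {X : VField n M}
    (hX : SmoothVF W' X) : SmoothHF W' (fun y => F.hproj ξ y (X y) : HField H) := by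
  refine SmoothVF.congr (hX.sub (SmoothVF.sum (s := Finset.univ) fun s _ => SmoothVF.smul
    (F.smooth_η s W' hW' (h.trans hξ.subset) X hX) ((hξ.smooth s).mono h))) fun y hy => ?_
  exact hξ.coe_hproj (h hy) _

end IsDual

/-- Counting dimensions, (η_1, η_2, η_3) maps the tangent space at x onto ℝ³. Extensions of dual
vectors at x are corrected by the inverse of the matrix η_s(X_t), which is invertible near x. -/
theorem LocalFrame.exists_isDual (hH : IsSmoothDistribution (4 * n) H) (F : LocalFrame H PQ g U)
    (hx : x ∈ U) : ∃ (W : Set M) (ξ : Fin 3 → VField n M), x ∈ W ∧ IsDual F ξ W := by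
  let p : Tan n M x →ₗ[ℝ] (Fin 3 → ℝ) := LinearMap.pi fun s => F.η s x
  have hker : LinearMap.ker p = H x := by
    rw [F.ker_η x hx, LinearMap.ker_pi]
  have hsurj : LinearMap.range p = ⊤ := by
    have h1 := LinearMap.finrank_range_add_finrank_ker p
    rw [hker, finrank_horizontal hH] at h1
    have h2 : Module.finrank ℝ (Tan n M x) = 4 * n + 3 := by
      change Module.finrank ℝ (EuclideanSpace ℝ (Fin (4 * n + 3))) = _
      simp
    apply Submodule.eq_top_of_finrank_eq
    rw [Module.finrank_fin_fun]
    omega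
  have hv : ∀ t : Fin 3, ∃ v : Tan n M x, p v = Pi.single t 1 := fun t =>
    LinearMap.range_eq_top.1 hsurj _
  choose v hv using hv
  have hext := fun t => exists_smooth_extend x (v t)
  choose V X hV hxV hX hXv using hext
  set W₀ : Set M := U ∩ ⋂ t, V t with hW₀
  have hW₀o : IsOpen W₀ := F.isOpen.inter (isOpen_iInter_of_finite hV)
  have hXs : ∀ t, SmoothVF W₀ (X t) := fun t =>
    (hX t).mono (Set.inter_subset_right.trans (Set.iInter_subset _ t))
  set G : M → Matrix (Fin 3) (Fin 3) ℝ := fun y => .of fun s t => F.η s y (X t y) with hG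
  have hGs : ∀ a b, SmoothFun (n := n) W₀ (fun y => G y a b) := fun a b =>
    F.smooth_η a W₀ hW₀o Set.inter_subset_left _ (hXs b)
  have hdet := SmoothFun.matrix_det hGs
  have hx₀ : x ∈ W₀ := ⟨hx, Set.mem_iInter.2 hxV⟩
  have hG1 : G x = 1 := by
    ext s t
    have := congrFun (hv t) s
    simp only [p, LinearMap.pi_apply] at this
    simp only [hG, Matrix.of_apply, hXv, this, Matrix.one_apply, Pi.single_apply]
  have hWo : IsOpen (W₀ ∩ (fun y => (G y).det) ⁻¹' {0}ᶜ) :=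
    ContMDiffOn.continuousOn hdet |>.isOpen_inter_preimage hW₀o isOpen_compl_singleton
  refine ⟨W₀ ∩ (fun y => (G y).det) ⁻¹' {0}ᶜ, fun t y => ∑ u, (G y)⁻¹ u t • X u y,
    ⟨hx₀, by simp [hG1]⟩, hWo, Set.inter_subset_left.trans Set.inter_subset_left, fun s => ?_,
    fun s t y hy => ?_⟩
  · exact SmoothVF.sum fun u _ => SmoothVF.smul (SmoothFun.matrix_inv
      (fun a b => (hGs a b).mono Set.inter_subset_left) (fun y hy => hy.2) u s)
      ((hXs u).mono Set.inter_subset_left)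
  · have h1 := congrFun (congrFun (Matrix.mul_nonsing_inv (G y)
      (isUnit_iff_ne_zero.2 hy.2)) s) t
    rw [Matrix.mul_apply, Matrix.one_apply] at h1
    rw [← h1, map_sum]
    exact Finset.sum_congr rfl fun u _ => by rw [map_smul, smul_eq_mul, mul_comm]; rfl

end Horizontal

/-! ### Reeb fields and the change of local frame -/

section Reeb

variable {n : ℕ} {M : Type*} [TopologicalSpace M]
  [ChartedSpace (EuclideanSpace ℝ (Fin (4 * n + 3))) M] [IsManifold (𝓡 (4 * n + 3)) ∞ M]
  {H : SubspaceField n M} {PQ : Π x : M, Submodule ℝ (Module.End ℝ (H x))} {g : HMetric H}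
  {U U' W : Set M} {x : M}

/-- The exterior derivative of a combination of 1-forms. -/
theorem extT_sum {ι : Type*} [Fintype ι] {θ : Π x : M, Module.Dual ℝ (Tan n M x)}
    {η : ι → Π x : M, Module.Dual ℝ (Tan n M x)} {b : ι → M → ℝ}
    (hθ : ∀ᶠ y in nhds x, ∀ v, θ y v = ∑ t, b t y * η t y v) (hη : ∀ t, DiffForm (η t) x)
    (hb : ∀ t, DiffFun (n := n) (b t) x) (u v : Tan n M x) :
    extT θ x u v = ∑ t, (b t x * extT (η t) x u v + dirD (b t) x u * η t x v
      - dirD (b t) x v * η t x u) := by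
  have hθd : DiffForm θ x := fun Y hY => (DiffFun.sum fun t _ => (hb t).mul (hη t Y hY)).congr
    (hθ.mono fun y hy => hy _)
  obtain ⟨V, X, hV, hxV, hX, rfl⟩ := exists_smooth_extend x u
  obtain ⟨V', Y, hV', hxV', hY, rfl⟩ := exists_smooth_extend x v
  have hX' := hX.diffVF hV hxV
  have hY' := hY.diffVF hV' hxV'
  have hd : ∀ {Z : VField n M}, DiffVF Z x → ∀ w : Tan n M x, dirD (fun y => θ y (Z y)) x w
      = ∑ t, (b t x * dirD (fun y => η t y (Z y)) x w + η t x (Z x) * dirD (b t) x w) := by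
    intro Z hZ w
    rw [dirD_congr (hθ.mono fun y hy => hy (Z y)),
      dirD_sum fun t _ => (hb t).mul (hη t Z hZ)]
    exact Finset.sum_congr rfl fun t _ => dirD_mul (hb t) (hη t Z hZ) w
  rw [extT_apply hθd hX' hY']
  simp only [extT_apply (hη _) hX' hY']
  simp only [extD, hd hX', hd hY', hθ.self_of_nhds]
  rw [← Finset.sum_sub_distrib, ← Finset.sum_sub_distrib]
  exact Finset.sum_congr rfl fun t _ => by ring

/-- Reeb fields over an open subset of the domain of a frame, in terms of the tensors `dη_s`. -/
structure ReebOn (F : LocalFrame H PQ g U) (ξ : Fin 3 → VField n M) (W : Set M) : Prop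
    extends IsDual F ξ W where
  reeb : ∀ s t, ∀ x ∈ W, ∀ X : H x,
    eps t * extT (F.η s) x (ξ t x) X + eps s * extT (F.η t) x (ξ s x) X = 0

theorem ReebOn.self {F : LocalFrame H PQ g U} {ξ : Fin 3 → VField n M} (h : ReebOn F ξ W) (s : Fin 3)
    (hx : x ∈ W) (X : H x) : extT (F.η s) x (ξ s x) X = 0 := by
  have h1 := h.reeb s s x hx X
  have : eps s * extT (F.η s) x (ξ s x) X = 0 := by linarith
  simpa [eps_ne_zero] using this

theorem ReebOn.cross {F : LocalFrame H PQ g U} {ξ : Fin 3 → VField n M} (h : ReebOn F ξ W)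
    (i : Fin 3) (hx : x ∈ W) (X : H x) : extT (F.η i) x (ξ (i + 1) x) X
      = eps (i + 2) * extT (F.η (i + 1)) x (ξ i x) X := by
  have h1 := h.reeb i (i + 1) x hx X
  fin_cases i <;> simp at h1 ⊢ <;> linarith

/-- By ε_i ε_{i+1} = -ε_{i+2} the conditions stated for cyclic indices become one condition
symmetric in s and t. In this form its behaviour under a change of frame is visible. -/
theorem reeb_of_self_cross {a : Fin 3 → Fin 3 → ℝ} (hs : ∀ s, a s s = 0)
    (hc : ∀ i, a i (i + 1) = eps (i + 2) * a (i + 1) i) (s t : Fin 3) :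
    eps t * a s t + eps s * a t s = 0 := by
  have c0 := hc 0
  have c1 := hc 1
  have c2 := hc 2
  have s0 := hs 0
  have s1 := hs 1
  have s2 := hs 2
  fin_cases s <;> fin_cases t <;> simp at c0 c1 c2 s0 s1 s2 ⊢ <;> linarith

theorem ReebOn.mono {F : LocalFrame H PQ g U} {ξ : Fin 3 → VField n M} (hξ : ReebOn F ξ W)
    {W' : Set M} (hW' : IsOpen W') (h : W' ⊆ W) : ReebOn F ξ W' :=
  ⟨hξ.toIsDual.mono hW' h, fun s t x hx => hξ.reeb s t x (h hx)⟩

theorem isReeb_iff (hH : IsSmoothDistribution (4 * n) H) (F : LocalFrame H PQ g U)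
    (ξ : Fin 3 → VField n M) : IsReeb F ξ ↔ ReebOn F ξ U := by
  constructor
  · intro h
    refine ⟨⟨F.isOpen, subset_rfl, h.smooth, h.dual⟩, fun s t x hx X => ?_⟩
    obtain ⟨W, X', hW, hxW, hX', rfl⟩ := exists_horizontal_extend hH g x X
    have ho : IsOpen (W ∩ U) := hW.inter F.isOpen
    have e : ∀ s t, extT (F.η s) x (ξ t x) (X' x) = extD (F.η s) (ξ t) X'.toVField x :=
      fun s t => extT_apply (F.diffForm hx s) ((h.smooth t).diffVF F.isOpen hx) (hX'.diffVF hW hxW)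
    simp only [e]
    exact reeb_of_self_cross (a := fun s t => extD (F.η s) (ξ t) X'.toVField x)
      (fun s => h.self s _ ho Set.inter_subset_right X' (hX'.mono Set.inter_subset_left) x ⟨hxW, hx⟩)
      (fun i => h.cross i _ ho Set.inter_subset_right X' (hX'.mono Set.inter_subset_left) x ⟨hxW, hx⟩)
      s t
  · intro h
    have e : ∀ W : Set M, IsOpen W → W ⊆ U → ∀ X : HField H, SmoothHF W X → ∀ x ∈ W, ∀ s t,
        extT (F.η s) x (ξ t x) (X x) = extD (F.η s) (ξ t) X.toVField x :=
      fun W hW hWU X hX x hx s t => extT_apply (F.diffForm (hWU hx) s)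
        ((h.smooth t).diffVF F.isOpen (hWU hx)) (hX.diffVF hW hx)
    refine ⟨h.smooth, h.dual, fun s W hW hWU X hX x hx => ?_, fun i W hW hWU X hX x hx => ?_⟩
    · rw [← e W hW hWU X hX x hx]; exact h.self s (hWU hx) _
    · rw [← e W hW hWU X hX x hx, ← e W hW hWU X hX x hx]; exact h.cross i (hWU hx) _

/-- The difference of two candidates is horizontal, and dη_s is nondegenerate on H because I_s is
invertible. Hence the choice made in `LocalFrame.reeb` is forced. -/
theorem LocalFrame.eq_of_self (hH : IsSmoothDistribution (4 * n) H) (F : LocalFrame H PQ g U)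
    (hx : x ∈ U) (s : Fin 3) {u v : Tan n M x} (h1 : ∀ t, F.η t x u = F.η t x v)
    (h2 : ∀ X : H x, extT (F.η s) x u X = extT (F.η s) x v X) : u = v := by
  have hm : u - v ∈ H x := by
    rw [F.mem_iff hx]; intro t; simp [h1]
  have h3 : (⟨u - v, hm⟩ : H x) = 0 := by
    have h4 : F.I s x ⟨u - v, hm⟩ = 0 := by
      refine (F.paraQuat hx).ext fun X => ?_
      have h5 := F.extT_horizontal hH hx s ⟨u - v, hm⟩ X
      simp only [map_sub, LinearMap.sub_apply, h2, sub_self] at h5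
      have := eps_ne_zero s
      rw [map_zero, LinearMap.zero_apply]
      have h6 : eps s * g.form x (F.I s x ⟨u - v, hm⟩) X = 0 := by linarith
      simpa [this] using h6
    have h7 := (F.paraQuat hx).sq_apply s ⟨u - v, hm⟩
    rw [h4, map_zero] at h7
    exact (smul_eq_zero.1 h7.symm).resolve_left (eps_ne_zero s)
  exact sub_eq_zero.1 (congrArg Subtype.val h3)

theorem LocalFrame.exists_self (hH : IsSmoothDistribution (4 * n) H) (F : LocalFrame H PQ g U)
    (hx : x ∈ U) : ∃ (W : Set M) (ξ : Fin 3 → VField n M), x ∈ W ∧ IsDual F ξ W ∧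
      ∀ s, ∀ y ∈ W, ∀ X : H y, extT (F.η s) y (ξ s y) X = 0 := by
  obtain ⟨W₁, ξ, hx₁, hξ⟩ := F.exists_isDual hH hx
  obtain ⟨W₂, hW₂, hx₂, ⟨E⟩⟩ := exists_hframe hH g x
  set W := W₁ ∩ W₂ with hW
  have hWo : IsOpen W := hξ.isOpen.inter hW₂
  have hWU : W ⊆ U := Set.inter_subset_left.trans hξ.subset
  set Z : Fin 3 → HField H := fun s y => ∑ a, extT (F.η s) y (ξ s y) (E.e a y) • E.f a y with hZ
  have hZs : ∀ s, SmoothHF W (Z s) := fun s => SmoothHF.sum fun a _ => SmoothHF.smul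
    ((F.smooth_η s).extT F.isOpen hWo hWU ((hξ.smooth s).mono Set.inter_subset_left)
      (SmoothHF.mono (E.smooth_e a) Set.inter_subset_right)) ((E.smooth_f a).mono Set.inter_subset_right)
  -- As dη_s = -2 ε_s ω_s on H and I_s² = ε_s, the field h_s = ½ I_s Z_s contributes -g(Z_s, ·) to
  -- (ξ_s ⌟ dη_s)|_H, and Z_s is the g-dual of the form to be removed.
  set h : Fin 3 → HField H := fun s y => (1 / 2 : ℝ) • F.I s y (Z s y) with hh
  have hhs : ∀ s, SmoothHF W (h s) := fun s =>
    SmoothHF.const_smul _ (F.smooth_I s W hWo hWU _ (hZs s))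
  refine ⟨W, fun s y => ξ s y + (h s y : Tan n M y), ⟨hx₁, hx₂⟩, ⟨hWo, hWU, fun s =>
    ((hξ.smooth s).mono Set.inter_subset_left).add (hhs s), fun s t y hy => ?_⟩, fun s y hy X => ?_⟩
  · rw [map_add, hξ.dual s t y hy.1, F.η_coe (hWU hy), add_zero]
  · rw [map_add, LinearMap.add_apply, F.extT_horizontal hH (hWU hy)]
    have h1 : g.form y (Z s y) X = extT (F.η s) y (ξ s y) X := by
      exact E.form_raise hy.2 (extT (F.η s) y (ξ s y) ∘ₗ (H y).subtype) X
    simp only [hh, map_smul, (F.paraQuat (hWU hy)).sq_apply, LinearMap.smul_apply, smul_eq_mul, h1]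
    have := eps_mul_self s
    linear_combination (-extT (F.η s) y (ξ s y) X) * this

open Classical in
/-- The fields dual to the 1-forms of a local frame with `(ξ_s ⌟ dη_s)|_H = 0`. -/
def LocalFrame.reeb (F : LocalFrame H PQ g U) (s : Fin 3) : VField n M := fun x =>
  if h : ∃ v : Tan n M x, (∀ t, F.η t x v = if t = s then 1 else 0) ∧
    ∀ X : H x, extT (F.η s) x v X = 0 then h.choose else 0

theorem LocalFrame.reeb_eq (hH : IsSmoothDistribution (4 * n) H) (F : LocalFrame H PQ g U)
    (hx : x ∈ U) {s : Fin 3} {v : Tan n M x} (h1 : ∀ t, F.η t x v = if t = s then 1 else 0)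
    (h2 : ∀ X : H x, extT (F.η s) x v X = 0) : F.reeb s x = v := by
  have h : ∃ v : Tan n M x, (∀ t, F.η t x v = if t = s then 1 else 0) ∧
    ∀ X : H x, extT (F.η s) x v X = 0 := ⟨v, h1, h2⟩
  rw [LocalFrame.reeb, dif_pos h]
  exact F.eq_of_self hH hx s (fun t => by rw [h.choose_spec.1, h1])
    (fun X => by rw [h.choose_spec.2, h2])

/-- Pointwise uniqueness identifies the chosen vectors with the smooth local solutions of
`LocalFrame.exists_self`, so the choice at each point is smooth. -/
theorem LocalFrame.reeb_isDual (hH : IsSmoothDistribution (4 * n) H) (F : LocalFrame H PQ g U) :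
    IsDual F F.reeb U := by
  have key : ∀ x ∈ U, ∃ (W : Set M) (ξ : Fin 3 → VField n M), x ∈ W ∧ IsDual F ξ W ∧
      ∀ s, ∀ y ∈ W, F.reeb s y = ξ s y := by
    intro x hx
    obtain ⟨W, ξ, hxW, hξ, hs⟩ := F.exists_self hH hx
    exact ⟨W, ξ, hxW, hξ, fun s y hy => F.reeb_eq hH (hξ.subset hy)
      (fun t => hξ.dual t s y hy) (hs s y hy)⟩
  refine ⟨F.isOpen, subset_rfl, fun s => SmoothVF.of_locally fun x hx => ?_, fun s t x hx => ?_⟩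
  · obtain ⟨W, ξ, hxW, hξ, h⟩ := key x hx
    exact ⟨W, hξ.isOpen, hxW, ((hξ.smooth s).mono Set.inter_subset_right).congr
      fun y hy => h s y hy.2⟩
  · obtain ⟨W, ξ, hxW, hξ, h⟩ := key x hx
    rw [h t x hxW, hξ.dual s t x hxW]

theorem LocalFrame.reeb_self (hH : IsSmoothDistribution (4 * n) H) (F : LocalFrame H PQ g U)
    (s : Fin 3) (hx : x ∈ U) (X : H x) : extT (F.η s) x (F.reeb s x) X = 0 := by
  obtain ⟨W, ξ, hxW, hξ, hs⟩ := F.exists_self hH hx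
  rw [F.reeb_eq hH hx (fun t => hξ.dual t s x hxW) (hs s x hxW)]
  exact hs s x hxW X

theorem ReebOn.eq_reeb (hH : IsSmoothDistribution (4 * n) H) {F : LocalFrame H PQ g U}
    {ξ : Fin 3 → VField n M} (hξ : ReebOn F ξ W) (s : Fin 3) (hx : x ∈ W) : ξ s x = F.reeb s x :=
  (F.reeb_eq hH (hξ.subset hx) (fun t => hξ.dual t s x hx) (hξ.self s hx)).symm

/-- The transition matrix between two local frames. -/
def transition (F' : LocalFrame H PQ g U') (ξ : Fin 3 → VField n M) (s t : Fin 3) (x : M) : ℝ :=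
  F'.η s x (ξ t x)

section FrameChange

variable {F : LocalFrame H PQ g U} {F' : LocalFrame H PQ g U'} {ξ : Fin 3 → VField n M}
  (hξ : IsDual F ξ W)
include hξ

theorem IsDual.η_change (hx : x ∈ W) (hx' : x ∈ U') (s : Fin 3) (v : Tan n M x) :
    F'.η s x v = ∑ t, transition F' ξ s t x * F.η t x v := by
  conv_lhs => rw [hξ.decomp hx v]
  rw [map_add, F'.η_coe hx', zero_add, map_sum]
  exact Finset.sum_congr rfl fun t _ => by rw [map_smul, smul_eq_mul, mul_comm]; rfl

theorem IsDual.smooth_transition (s t : Fin 3) :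
    SmoothFun (n := n) (W ∩ U') (transition F' ξ s t) :=
  F'.smooth_η s _ (hξ.isOpen.inter F'.isOpen) Set.inter_subset_right _
    ((hξ.smooth t).mono Set.inter_subset_left)

theorem IsDual.extT_change (hx : x ∈ W) (hx' : x ∈ U') (s : Fin 3) (u v : Tan n M x) :
    extT (F'.η s) x u v = ∑ t, (transition F' ξ s t x * extT (F.η t) x u v
      + dirD (transition F' ξ s t) x u * F.η t x v - dirD (transition F' ξ s t) x v * F.η t x u) := by
  have ho : IsOpen (W ∩ U') := hξ.isOpen.inter F'.isOpen
  refine extT_sum ?_ (fun t => F.diffForm (hξ.subset hx) t)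
    (fun t => (hξ.smooth_transition s t).diffFun ho ⟨hx, hx'⟩) u v
  filter_upwards [ho.mem_nhds ⟨hx, hx'⟩] with y hy w
  exact hξ.η_change hy.1 hy.2 s w

/-- Compare dη'_s with d(Σ b_st η_t) on H: the terms with db_st drop out because η_t vanishes there,
and dη_s determines I_s. -/
theorem IsDual.I_change (hH : IsSmoothDistribution (4 * n) H) (hx : x ∈ W) (hx' : x ∈ U')
    (s : Fin 3) : F'.I s x = ∑ t, (eps s * eps t * transition F' ξ s t x) • F.I t x := by
  have hxU := hξ.subset hx
  refine (F.paraQuat hxU).ext_end fun X Y => ?_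
  have h1 := hξ.extT_change (F' := F') hx hx' s X Y
  simp only [F'.extT_horizontal hH hx', F.extT_horizontal hH hxU, F.η_coe hxU, mul_zero, add_zero,
    sub_zero] at h1
  have e := eps_mul_self s
  have h2 : g.form x (F'.I s x X) Y
      = ∑ t, -(eps s / 2) * (transition F' ξ s t x * (-2 * eps t * g.form x (F.I t x X) Y)) := by
    rw [← Finset.mul_sum, ← h1]
    linear_combination (-g.form x (F'.I s x X) Y) * e
  rw [h2]
  simp only [LinearMap.sum_apply, map_sum, LinearMap.smul_apply, map_smul, smul_eq_mul]
  exact Finset.sum_congr rfl fun t _ => by ring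

variable (hn : 1 ≤ n)
include hn

omit hξ in
theorem nontrivial_horizontal (hH : IsSmoothDistribution (4 * n) H) (x : M) : Nontrivial (H x) :=
  Module.nontrivial_of_finrank_pos (R := ℝ) (by rw [finrank_horizontal hH]; omega)

/-- Both triples of structures are orthogonal for the trace form, with tr(I_s²) = ε_s dim H; the
matrix relating them therefore preserves diag(ε). -/
theorem IsDual.transition_orthogonal (hH : IsSmoothDistribution (4 * n) H) (hx : x ∈ W)
    (hx' : x ∈ U') (s t : Fin 3) :
    ∑ u, eps u * transition F' ξ s u x * transition F' ξ t u x = if s = t then eps s else 0 := by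
  have := nontrivial_horizontal hn hH x
  have hN : (Module.finrank ℝ (H x) : ℝ) ≠ 0 := by
    exact_mod_cast (Module.finrank_pos (R := ℝ) (M := H x)).ne'
  have h1 := (F'.paraQuat hx').trace_I_mul_I s t
  rw [hξ.I_change hH hx hx', hξ.I_change hH hx hx'] at h1
  simp only [Finset.sum_mul, Finset.mul_sum, map_sum, smul_mul_assoc, mul_smul_comm, map_smul,
    (F.paraQuat (hξ.subset hx)).trace_I_mul_I, smul_eq_mul, mul_ite, mul_zero,
    Finset.sum_ite_eq', Finset.mem_univ, if_true] at h1
  have es := eps_mul_self s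
  have et := eps_mul_self t
  have h2 : (∑ u, eps u * transition F' ξ s u x * transition F' ξ t u x)
      * (eps s * eps t * Module.finrank ℝ (H x)) = if s = t then eps s * Module.finrank ℝ (H x) else 0 := by
    rw [← h1, Finset.sum_mul]
    refine Finset.sum_congr rfl fun u _ => ?_
    have eu := eps_mul_self u
    linear_combination (-eps s * eps t * eps u * transition F' ξ s u x * transition F' ξ t u x
      * Module.finrank ℝ (H x)) * eu
  have h3 : (∑ u, eps u * transition F' ξ s u x * transition F' ξ t u x)
      = (if s = t then eps s * Module.finrank ℝ (H x) else 0) * (eps s * eps t) / Module.finrank ℝ (H x) := by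
    rw [← h2]; field_simp; rw [pow_two, pow_two, es, et]; ring
  rw [h3]
  split_ifs with e
  · subst e; rw [es]; field_simp
  · simp

/-- The dual form of the orthogonality of the transition matrix. -/
theorem IsDual.transition_orthogonal' (hH : IsSmoothDistribution (4 * n) H) (hx : x ∈ W)
    (hx' : x ∈ U') (u v : Fin 3) :
    ∑ s, eps s * transition F' ξ s u x * transition F' ξ s v x = if u = v then eps u else 0 := by
  set b : Matrix (Fin 3) (Fin 3) ℝ := .of fun s t => transition F' ξ s t x with hb
  set D : Matrix (Fin 3) (Fin 3) ℝ := Matrix.diagonal eps with hD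
  have hDD : D * D = 1 := by
    rw [hD, Matrix.diagonal_mul_diagonal]
    simp [eps_mul_self]
  have h1 : b * D * b.transpose = D := by
    ext s t
    have := hξ.transition_orthogonal (F' := F') hn hH hx hx' s t
    rw [Matrix.mul_apply, hD, Matrix.diagonal_apply, ← this]
    refine Finset.sum_congr rfl fun u _ => ?_
    rw [Matrix.mul_diagonal]
    simp only [hb, Matrix.of_apply, Matrix.transpose_apply]; ring
  have h2 : (b * D * b.transpose) * D = 1 := by rw [h1, hDD]
  have h3 : b * (D * b.transpose * D) = 1 := by simpa [Matrix.mul_assoc] using h2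
  have h4 := mul_eq_one_comm.1 h3
  have h5 : b.transpose * D * b = D := by
    have := congrArg (D * ·) h4
    simp only [mul_one] at this
    simpa only [← Matrix.mul_assoc, hDD, Matrix.one_mul] using this
  have h6 := congrFun (congrFun h5 u) v
  rw [Matrix.mul_apply, hD, Matrix.diagonal_apply] at h6
  rw [← h6]
  refine Finset.sum_congr rfl fun s _ => ?_
  rw [Matrix.mul_diagonal]
  simp only [hb, Matrix.of_apply, Matrix.transpose_apply]; ring

/-- The fields dual to the 1-forms of another frame. -/
def changeFields (F' : LocalFrame H PQ g U') (ξ : Fin 3 → VField n M) : Fin 3 → VField n M :=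
  fun t x => ∑ u, (eps t * eps u * transition F' ξ t u x) • ξ u x

theorem IsDual.change (hH : IsSmoothDistribution (4 * n) H) :
    IsDual F' (changeFields F' ξ) (W ∩ U') := by
  refine ⟨hξ.isOpen.inter F'.isOpen, Set.inter_subset_right, fun t => SmoothVF.sum fun u _ =>
    SmoothVF.smul ((hξ.smooth_transition t u).const_mul (eps t * eps u))
      ((hξ.smooth u).mono Set.inter_subset_left), fun s t x hx => ?_⟩
  simp only [changeFields, map_sum, map_smul, smul_eq_mul]
  have h1 := hξ.transition_orthogonal (F' := F') hn hH hx.1 hx.2 s t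
  have : ∑ u, eps t * eps u * transition F' ξ t u x * F'.η s x (ξ u x)
      = eps t * ∑ u, eps u * transition F' ξ s u x * transition F' ξ t u x := by
    rw [Finset.mul_sum]
    exact Finset.sum_congr rfl fun u _ => by simp only [transition]; ring
  rw [this, h1]
  split_ifs with e
  · rw [e, eps_mul_self]
  · simp

end FrameChange

/-- After expansion the terms without derivatives of b are antisymmetric under exchange of s and t
by the Reeb condition of the old frame. The terms with derivatives add up to the derivative of Σ ε_u
b_su b_tu, which is constant by orthogonality. -/
theorem ReebOn.change (hn : 1 ≤ n) (hH : IsSmoothDistribution (4 * n) H) {F : LocalFrame H PQ g U}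
    {ξ : Fin 3 → VField n M} (hξ : ReebOn F ξ W) (F' : LocalFrame H PQ g U') :
    ReebOn F' (changeFields F' ξ) (W ∩ U') := by
  refine ⟨hξ.toIsDual.change hn hH, fun s t x hx X => ?_⟩
  have hxU := hξ.subset hx.1
  have ho : IsOpen (W ∩ U') := hξ.isOpen.inter F'.isOpen
  set b := fun s t => transition F' ξ s t with hb
  have key : ∀ s t, eps t * extT (F'.η s) x (changeFields F' ξ t x) X
      = ∑ u, ∑ v, b s u x * b t v x * (eps v * extT (F.η u) x (ξ v x) X)
        - ∑ u, eps u * (b t u x * dirD (n := n) (b s u) x X) := by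
    intro s t
    rw [hξ.extT_change hx.1 hx.2]
    simp only [F.η_coe hxU, mul_zero, add_zero]
    have e1 : ∀ u, F.η u x (changeFields F' ξ t x) = eps t * eps u * b t u x := by
      intro u
      simp [changeFields, hξ.dual _ _ x hx.1, hb]
    simp only [e1]
    rw [Finset.sum_sub_distrib, mul_sub, Finset.mul_sum, Finset.mul_sum]
    have et := eps_mul_self t
    congr 1
    · refine Finset.sum_congr rfl fun u _ => ?_
      simp only [changeFields, map_sum, map_smul, LinearMap.sum_apply, LinearMap.smul_apply,
        smul_eq_mul, Finset.mul_sum]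
      refine Finset.sum_congr rfl fun v _ => ?_
      simp only [hb]
      linear_combination (transition F' ξ s u x * transition F' ξ t v x *
        (eps v * extT (F.η u) x (ξ v x) X)) * et
    · refine Finset.sum_congr rfl fun u _ => ?_
      linear_combination (dirD (n := n) (b s u) x X * eps u * b t u x) * et
  rw [key, key]
  have h1 : ∑ u, ∑ v, b t u x * b s v x * (eps v * extT (F.η u) x (ξ v x) X)
      = -∑ u, ∑ v, b s u x * b t v x * (eps v * extT (F.η u) x (ξ v x) X) := by
    rw [Finset.sum_comm, ← Finset.sum_neg_distrib]
    refine Finset.sum_congr rfl fun u _ => ?_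
    rw [← Finset.sum_neg_distrib]
    refine Finset.sum_congr rfl fun v _ => ?_
    have := hξ.reeb u v x hx.1 X
    linear_combination (b s u x * b t v x) * this
  have hsm : ∀ s u, DiffFun (n := n) (b s u) x := fun s u =>
    (hξ.smooth_transition s u).diffFun ho hx
  have h2 : dirD (n := n) (fun y => ∑ u, eps u * (b s u y * b t u y)) x X = 0 := by
    rw [dirD_congr (f := fun _ => if s = t then eps s else 0), dirD_const]
    filter_upwards [ho.mem_nhds hx] with y hy
    rw [← hξ.transition_orthogonal (F' := F') hn hH hy.1 hy.2 s t]
    exact Finset.sum_congr rfl fun u _ => by simp only [hb]; ring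
  rw [dirD_sum fun u _ => (DiffFun.const _).mul ((hsm s u).mul (hsm t u))] at h2
  have h3 : ∀ u, dirD (n := n) (fun y => eps u * (b s u y * b t u y)) x X
      = eps u * (b t u x * dirD (n := n) (b s u) x X) + eps u * (b s u x * dirD (n := n) (b t u) x X) := by
    intro u
    rw [dirD_const_mul _ ((hsm s u).mul (hsm t u)), dirD_mul (hsm s u) (hsm t u)]; ring
  simp only [h3, Finset.sum_add_distrib] at h2
  linear_combination h1 - h2

/-- If Reeb fields exist locally for some frames then they exist for every frame. -/
theorem LocalFrame.reebOn (hn : 1 ≤ n) (hH : IsSmoothDistribution (4 * n) H)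
    (hR : ∀ x : M, ∃ (V : Set M) (F : LocalFrame H PQ g V) (ξ : Fin 3 → VField n M) (W : Set M),
      x ∈ W ∧ ReebOn F ξ W) (F : LocalFrame H PQ g U) : ReebOn F F.reeb U := by
  refine ⟨F.reeb_isDual hH, fun s t x hx X => ?_⟩
  obtain ⟨V, F₀, ξ, W, hxW, hξ⟩ := hR x
  have h := hξ.change hn hH F
  rw [← h.eq_reeb hH s ⟨hxW, hx⟩, ← h.eq_reeb hH t ⟨hxW, hx⟩]
  exact h.reeb s t x ⟨hxW, hx⟩ X

end Reeb

/-! ### Connections adapted to a local frame -/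

section Adapted

variable {n : ℕ} {M : Type*} [TopologicalSpace M]
  [ChartedSpace (EuclideanSpace ℝ (Fin (4 * n + 3))) M] [IsManifold (𝓡 (4 * n + 3)) ∞ M]
  {H : SubspaceField n M} {PQ : Π x : M, Submodule ℝ (Module.End ℝ (H x))} {g : HMetric H}
  {U U' W V : Set M} {x : M}

scoped instance t2Space_tan (x : M) : T2Space (Tan n M x) :=
  inferInstanceAs (T2Space (EuclideanSpace ℝ (Fin (4 * n + 3))))

/-- A family of 1-forms and vectors at `x` resolving the identity of the tangent space. -/
structure ResolvingFamily (x : M) where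
  ι : Type
  [fintype : Fintype ι]
  Φ : ι → Π y : M, Module.Dual ℝ (Tan n M y)
  Z : ι → Tan n M x
  diff : ∀ κ, DiffForm (Φ κ) x
  sum : ∀ v : Tan n M x, ∑ κ, Φ κ x v • Z κ = v

attribute [scoped instance] ResolvingFamily.fintype

theorem nonempty_resolvingFamily (x : M) : Nonempty (ResolvingFamily (n := n) x) := by
  obtain ⟨W, E, c, hW, hx, hE, hc, hs, hd⟩ := exists_tangent_frame (n := n) x
  exact ⟨⟨Fin (4 * n + 3), c, fun a => E a x, fun κ Y hY => hd κ Y x hx hY, fun v => (hc x hx v).symm⟩⟩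

/-- The connection `∇_v Y = ∑ v(Φ_κ(Y)) Z_κ` defined by a resolving family at every point. -/
def connOfFamilies (L : Π x : M, ResolvingFamily (n := n) x) : Conn n M where
  toFun Y x := LinearMap.toContinuousLinearMap
    { toFun := fun v => ∑ κ, dirD (fun y => (L x).Φ κ y (Y y)) x v • (L x).Z κ
      map_add' := fun u v => by simp [dirD_vadd, add_smul, Finset.sum_add_distrib]
      map_smul' := fun c v => by simp [dirD_vsmul, Finset.smul_sum, smul_smul] }
  isCovariantDerivativeOnUniv :=
    { add := fun {X Y x} hX hY _ => by
        ext v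
        simp only [LinearMap.coe_toContinuousLinearMap', LinearMap.coe_mk, AddHom.coe_mk,
          add_apply]
        have h1 : ∀ κ, dirD (fun y => (L x).Φ κ y ((X + Y) y)) x v • (L x).Z κ
            = dirD (fun y => (L x).Φ κ y (X y)) x v • (L x).Z κ
              + dirD (fun y => (L x).Φ κ y (Y y)) x v • (L x).Z κ := by
          intro κ
          have : dirD (fun y => (L x).Φ κ y ((X + Y) y)) x v
              = dirD (fun y => (L x).Φ κ y (X y)) x v + dirD (fun y => (L x).Φ κ y (Y y)) x v := by
            rw [← dirD_add ((L x).diff κ X hX) ((L x).diff κ Y hY)]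
            simp
          rw [this, add_smul]
        rw [Finset.sum_congr rfl fun κ _ => h1 κ, Finset.sum_add_distrib]
      leibniz := fun {X f x} hX hf _ => by
        ext v
        simp only [LinearMap.coe_toContinuousLinearMap', LinearMap.coe_mk, AddHom.coe_mk,
          add_apply, smul_apply,
          ContinuousLinearMap.smulRight_apply, Finset.smul_sum]
        have h1 : ∀ κ, dirD (fun y => (L x).Φ κ y ((f • X) y)) x v • (L x).Z κ
            = f x • dirD (fun y => (L x).Φ κ y (X y)) x v • (L x).Z κ
              + dirD f x v • (L x).Φ κ x (X x) • (L x).Z κ := by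
          intro κ
          have : dirD (fun y => (L x).Φ κ y ((f • X) y)) x v
              = f x * dirD (fun y => (L x).Φ κ y (X y)) x v + (L x).Φ κ x (X x) * dirD f x v := by
            rw [← dirD_mul hf ((L x).diff κ X hX)]
            simp
          rw [this]; module
        -- The family resolves the identity; this is what produces the term v(f) X of the Leibniz
        -- rule.
        have h2 : ∑ κ, dirD f x v • (L x).Φ κ x (X x) • (L x).Z κ = dirD f x v • X x := by
          rw [← Finset.smul_sum, (L x).sum]
        rw [Finset.sum_congr rfl fun κ _ => h1 κ, Finset.sum_add_distrib, h2]
        rfl }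

theorem connOfFamilies_apply (L : Π x : M, ResolvingFamily (n := n) x) (Y : VField n M) (x : M)
    (v : Tan n M x) : connOfFamilies L Y x v
      = ∑ κ, dirD (fun y => (L x).Φ κ y (Y y)) x v • (L x).Z κ := rfl

/-- The metric connection on `H` defined by a frame and the dual frame (up to a factor two). -/
def HFrame.deriv (E : HFrame g W) (Y : HField H) (x : M) (v : Tan n M x) : H x :=
  ∑ a, (dirD (fun y => g.form y (Y y) (E.f a y)) x v • E.e a x
    + dirD (fun y => g.form y (Y y) (E.e a y)) x v • E.f a x)

theorem HFrame.deriv_congr (E : HFrame g W) {Y Z : HField H} (h : ∀ᶠ y in nhds x, Y y = Z y)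
    (v : Tan n M x) : E.deriv Y x v = E.deriv Z x v := by
  refine Finset.sum_congr rfl fun a _ => ?_
  congr 2 <;> refine dirD_congr (h.mono fun y hy => ?_) v <;> simp [hy]

theorem HFrame.deriv_neg (E : HFrame g W) (Y : HField H) (v : Tan n M x) :
    E.deriv (fun y => -Y y) x v = -E.deriv Y x v := by
  simp only [HFrame.deriv, map_neg, LinearMap.neg_apply, dirD_neg, neg_smul, ← neg_add,
    Finset.sum_neg_distrib]

/-- The flat connection with parallel e_a and the one with parallel f_a are adjoint to each other
with respect to g, so their sum is twice a metric connection. -/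
theorem HFrame.deriv_metric (E : HFrame g W) (hV : IsOpen V) (hVW : V ⊆ W)
    {Y Z : HField H} (hY : SmoothHF V Y) (hZ : SmoothHF V Z) (hx : x ∈ V) (v : Tan n M x) :
    g.form x (E.deriv Y x v) (Z x) + g.form x (Y x) (E.deriv Z x v)
      = 2 * dirD (fun y => g.form y (Y y) (Z y)) x v := by
  have he : ∀ a, SmoothHF V (E.e a) := fun a => (E.smooth_e a).mono hVW
  have hf : ∀ a, SmoothHF V (E.f a) := fun a => (E.smooth_f a).mono hVW
  have d : ∀ {A B : HField H}, SmoothHF V A → SmoothHF V B →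
      DiffFun (n := n) (fun y => g.form y (A y) (B y)) x := fun hA hB =>
    (g.smoothFun hV hA hB).diffFun hV hx
  have h1 : dirD (fun y => g.form y (Y y) (Z y)) x v
      = ∑ a, (g.form x (Y x) (E.f a x) * dirD (fun y => g.form y (E.e a y) (Z y)) x v
        + g.form x (E.e a x) (Z x) * dirD (fun y => g.form y (Y y) (E.f a y)) x v) := by
    rw [dirD_congr (f := fun y => ∑ a, g.form y (Y y) (E.f a y) * g.form y (E.e a y) (Z y)),
      dirD_sum fun a _ => (d hY (hf a)).mul (d (he a) hZ)]
    · exact Finset.sum_congr rfl fun a _ => dirD_mul (d hY (hf a)) (d (he a) hZ) v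
    · filter_upwards [hV.mem_nhds hx] with y hy
      conv_lhs => rw [E.expand_e y (hVW hy) (Y y)]
      simp
  have h2 : dirD (fun y => g.form y (Y y) (Z y)) x v
      = ∑ a, (g.form x (Y x) (E.e a x) * dirD (fun y => g.form y (E.f a y) (Z y)) x v
        + g.form x (E.f a x) (Z x) * dirD (fun y => g.form y (Y y) (E.e a y)) x v) := by
    rw [dirD_congr (f := fun y => ∑ a, g.form y (Y y) (E.e a y) * g.form y (E.f a y) (Z y)),
      dirD_sum fun a _ => (d hY (he a)).mul (d (hf a) hZ)]
    · exact Finset.sum_congr rfl fun a _ => dirD_mul (d hY (he a)) (d (hf a) hZ) v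
    · filter_upwards [hV.mem_nhds hx] with y hy
      conv_lhs => rw [E.expand_f y (hVW hy) (Y y)]
      simp
  rw [two_mul]
  conv_rhs => enter [1]; rw [h1]
  conv_rhs => enter [2]; rw [h2]
  have hs : ∀ a, (fun y => g.form y (Z y) (E.e a y)) = fun y => g.form y (E.e a y) (Z y) :=
    fun a => funext fun y => g.symm y _ _
  have hs' : ∀ a, (fun y => g.form y (Z y) (E.f a y)) = fun y => g.form y (E.f a y) (Z y) :=
    fun a => funext fun y => g.symm y _ _
  simp only [HFrame.deriv, map_sum, map_add, map_smul, LinearMap.sum_apply, LinearMap.add_apply,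
    LinearMap.smul_apply, smul_eq_mul, hs, hs']
  rw [← Finset.sum_add_distrib, ← Finset.sum_add_distrib]
  exact Finset.sum_congr rfl fun a _ => by ring

/-- A connection for which the 1-forms, the endomorphisms, the metric of a local frame and the
fields `ξ` are parallel over `W`. -/
structure Adapted (F : LocalFrame H PQ g U) (ξ : Fin 3 → VField n M) (W : Set M) (D : Conn n M) :
    Prop where
  par_η : ∀ s, ∀ V : Set M, IsOpen V → V ⊆ W → ∀ Y : VField n M, SmoothVF V Y → ∀ x ∈ V, ∀ v,
    F.η s x (D Y x v) = dirD (fun y => F.η s y (Y y)) x v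
  par_ξ : ∀ s, ∀ x ∈ W, ∀ v, D (ξ s) x v = 0
  par_I : ∀ s, ∀ V : Set M, IsOpen V → V ⊆ W → ∀ Y : HField H, SmoothHF V Y → ∀ x ∈ V, ∀ v,
    F.hproj ξ x (D (HField.toVField fun y => F.I s y (Y y)) x v)
      = F.I s x (F.hproj ξ x (D Y.toVField x v))
  par_g : ∀ V : Set M, IsOpen V → V ⊆ W → ∀ Y Z : HField H, SmoothHF V Y → SmoothHF V Z →
    ∀ x ∈ V, ∀ v, dirD (fun y => g.form y (Y y) (Z y)) x v
      = g.form x (F.hproj ξ x (D Y.toVField x v)) (Z x)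
        + g.form x (Y x) (F.hproj ξ x (D Z.toVField x v))
  smooth : ∀ V : Set M, IsOpen V → V ⊆ W → ∀ X Y : VField n M, SmoothVF V X → SmoothVF V Y →
    SmoothVF V (fun y => D Y y (X y))

/-- The identity and the endomorphisms of a frame. -/
def LocalFrame.J (F : LocalFrame H PQ g U) (r : Option (Fin 3)) (x : M) : Module.End ℝ (H x) :=
  r.elim 1 fun s => F.I s x

/-- The signs of `LocalFrame.J`. -/
def optEps (r : Option (Fin 3)) : ℝ := r.elim 1 eps

theorem LocalFrame.smooth_J (F : LocalFrame H PQ g U) (r : Option (Fin 3)) (hV : IsOpen V)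
    (hVU : V ⊆ U) {Y : HField H} (hY : SmoothHF V Y) : SmoothHF V (fun y => F.J r y (Y y)) := by
  cases r with
  | none => exact hY
  | some s => exact F.smooth_I s V hV hVU Y hY

theorem LocalFrame.J_J (F : LocalFrame H PQ g U) (r : Option (Fin 3)) (hx : x ∈ U) (X : H x) :
    optEps r • F.J r x (F.J r x X) = X := by
  cases r with
  | none => simp [optEps, LocalFrame.J]
  | some s =>
    simp only [optEps, LocalFrame.J, Option.elim]
    rw [(F.paraQuat hx).sq_apply, smul_smul, eps_mul_self, one_smul]

theorem IsDual.smooth_form {F : LocalFrame H PQ g U} {ξ : Fin 3 → VField n M} (hξ : IsDual F ξ W)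
    (r : Option (Fin 3)) {Z : HField H} (hZ : SmoothHF W Z) :
    SmoothOneForm W (fun y => (g.form y).flip (Z y) ∘ₗ F.J r y ∘ₗ F.hproj ξ y) := by
  intro V hV hVW X hX
  have h1 := hξ.smooth_hproj hV hVW hX
  have h2 := F.smooth_J r hV (hVW.trans hξ.subset) h1
  exact g.smoothFun hV h2 (hZ.mono hVW)

/-- The resolving family of the adapted connection. -/
def adaptedFamily {F : LocalFrame H PQ g U} {ξ : Fin 3 → VField n M} (hξ : IsDual F ξ W)
    (E : HFrame g W) (hx : x ∈ W) : ResolvingFamily (n := n) x where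
  ι := (Option (Fin 3) × Fin (4 * n) × Bool) ⊕ Fin 3
  Φ := Sum.elim (fun κ y => (g.form y).flip (cond κ.2.2 (E.e κ.2.1 y) (E.f κ.2.1 y))
    ∘ₗ F.J κ.1 y ∘ₗ F.hproj ξ y) (fun s y => F.η s y)
  -- The factor 1/8 averages over the four J in {1, I_1, I_2, I_3}, with J⁻¹ = ±J and the sign given
  -- by `optEps`, and over the two flat connections of `HFrame.deriv`.
  Z := Sum.elim (fun κ => ((optEps κ.1 / 8) • F.J κ.1 x (cond κ.2.2 (E.f κ.2.1 x) (E.e κ.2.1 x)) :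
    H x)) (fun s => ξ s x)
  diff := by
    rintro (⟨r, a, b⟩ | s)
    · cases b
      · exact (hξ.smooth_form r (E.smooth_f a)).diffForm hξ.isOpen hx
      · exact (hξ.smooth_form r (E.smooth_e a)).diffForm hξ.isOpen hx
    · exact F.diffForm (hξ.subset hx) s
  sum v := by
    conv_rhs => rw [hξ.decomp hx v]
    rw [Fintype.sum_sum_type]
    congr 1
    simp only [Sum.elim_inl, Fintype.sum_prod_type, Fintype.sum_bool, cond_true, cond_false,
      LinearMap.comp_apply]
    have h1 : ∀ r, ∑ a, (g.form x (F.J r x (F.hproj ξ x v)) (E.e a x)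
          • ((optEps r / 8) • F.J r x (E.f a x))
        + g.form x (F.J r x (F.hproj ξ x v)) (E.f a x) • ((optEps r / 8) • F.J r x (E.e a x)))
        = (1 / 4 : ℝ) • F.hproj ξ x v := by
      intro r
      have e1 := E.expand_e x hx (F.J r x (F.hproj ξ x v))
      have e2 := E.expand_f x hx (F.J r x (F.hproj ξ x v))
      have e3 := F.J_J r (hξ.subset hx) (F.hproj ξ x v)
      rw [Finset.sum_add_distrib]
      have f1 : ∑ a, g.form x (F.J r x (F.hproj ξ x v)) (E.e a x) • ((optEps r / 8) • F.J r x (E.f a x))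
          = (1 / 8 : ℝ) • (optEps r • F.J r x (F.J r x (F.hproj ξ x v))) := by
        conv_rhs => rw [e2]
        simp only [map_sum, map_smul, Finset.smul_sum]
        exact Finset.sum_congr rfl fun a _ => by module
      have f2 : ∑ a, g.form x (F.J r x (F.hproj ξ x v)) (E.f a x) • ((optEps r / 8) • F.J r x (E.e a x))
          = (1 / 8 : ℝ) • (optEps r • F.J r x (F.J r x (F.hproj ξ x v))) := by
        conv_rhs => rw [e1]
        simp only [map_sum, map_smul, Finset.smul_sum]
        exact Finset.sum_congr rfl fun a _ => by module
      rw [f1, f2, e3]; module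
    have h2 := congrArg (Subtype.val : H x → Tan n M x)
      (Finset.sum_congr (rfl : (Finset.univ : Finset (Option (Fin 3))) = Finset.univ) fun r _ => h1 r)
    simp only [Finset.sum_const, Finset.card_univ, Fintype.card_option, Fintype.card_fin] at h2
    rw [AddSubmonoidClass.coe_finsetSum] at h2
    simp only [AddSubmonoidClass.coe_finsetSum] at h2
    refine Eq.trans ?_ (h2.trans ?_)
    · rfl
    · rw [← Nat.cast_smul_eq_nsmul ℝ, smul_smul]; norm_num

open Classical in
/-- A connection adapted to a local frame. -/
def adaptedConn {F : LocalFrame H PQ g U} {ξ : Fin 3 → VField n M} (hξ : IsDual F ξ W)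
    (E : HFrame g W) : Conn n M :=
  -- Outside W any resolving family will do, since only the behaviour over W is used.
  connOfFamilies fun x => if hx : x ∈ W then adaptedFamily hξ E hx
    else (nonempty_resolvingFamily x).some

theorem adaptedConn_apply {F : LocalFrame H PQ g U} {ξ : Fin 3 → VField n M} (hξ : IsDual F ξ W)
    (E : HFrame g W) (hx : x ∈ W) (Y : VField n M) (v : Tan n M x) : adaptedConn hξ E Y x v
      = (((1 / 8 : ℝ) • ∑ r, optEps r • F.J r x (E.deriv (fun y => F.J r y (F.hproj ξ y (Y y))) x v) :
        H x) : Tan n M x) + ∑ s, dirD (fun y => F.η s y (Y y)) x v • ξ s x := by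
  rw [adaptedConn, connOfFamilies_apply, dif_pos hx]
  change ∑ κ : (Option (Fin 3) × Fin (4 * n) × Bool) ⊕ Fin 3, _ = _
  rw [Fintype.sum_sum_type]
  congr 1
  rw [Finset.smul_sum, AddSubmonoidClass.coe_finsetSum, Fintype.sum_prod_type]
  refine Finset.sum_congr rfl fun r _ => ?_
  rw [HFrame.deriv, map_sum, Finset.smul_sum, Finset.smul_sum, AddSubmonoidClass.coe_finsetSum,
    Fintype.sum_prod_type]
  refine Finset.sum_congr rfl fun a _ => ?_
  rw [Fintype.sum_bool]
  have : ((((1 / 8 : ℝ) • optEps r • F.J r x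
      (dirD (fun y => g.form y (F.J r y (F.hproj ξ y (Y y))) (E.f a y)) x v • E.e a x
        + dirD (fun y => g.form y (F.J r y (F.hproj ξ y (Y y))) (E.e a y)) x v • E.f a x) : H x)) :
          Tan n M x)
      = ((dirD (fun y => g.form y (F.J r y (F.hproj ξ y (Y y))) (E.f a y)) x v •
          ((optEps r / 8) • F.J r x (E.e a x)) : H x) : Tan n M x)
        + ((dirD (fun y => g.form y (F.J r y (F.hproj ξ y (Y y))) (E.e a y)) x v •
          ((optEps r / 8) • F.J r x (E.f a x)) : H x) : Tan n M x) := by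
    rw [← Submodule.coe_add]
    congr 1
    simp only [map_add, map_smul]
    module
  exact (add_comm _ _).trans this.symm

section AdaptedConn

variable {F : LocalFrame H PQ g U} {ξ : Fin 3 → VField n M} (hξ : IsDual F ξ W) (E : HFrame g W)

theorem hproj_adaptedConn (hx : x ∈ W) (Y : VField n M) (v : Tan n M x) :
    F.hproj ξ x (adaptedConn hξ E Y x v)
      = (1 / 8 : ℝ) • ∑ r, optEps r • F.J r x (E.deriv (fun y => F.J r y (F.hproj ξ y (Y y))) x v) := by
  rw [adaptedConn_apply hξ E hx, map_add, hξ.hproj_coe hx, map_sum]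
  simp [hξ.hproj_ξ hx]

theorem hproj_adaptedConn_horizontal (hV : IsOpen V) (hVW : V ⊆ W) (hx : x ∈ V) (Y : HField H)
    (v : Tan n M x) :
    F.hproj ξ x (adaptedConn hξ E Y.toVField x v)
      = (1 / 8 : ℝ) • (E.deriv Y x v + F.I 0 x (E.deriv (fun y => F.I 0 y (Y y)) x v)
        + F.I 1 x (E.deriv (fun y => F.I 1 y (Y y)) x v)
        - F.I 2 x (E.deriv (fun y => F.I 2 y (Y y)) x v)) := by
  rw [hproj_adaptedConn hξ E (hVW hx)]
  have h1 : ∀ r, E.deriv (fun y => F.J r y (F.hproj ξ y (Y.toVField y))) x v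
      = E.deriv (fun y => F.J r y (Y y)) x v := fun r => E.deriv_congr (by
    filter_upwards [hV.mem_nhds hx] with y hy
    rw [HField.toVField, hξ.hproj_coe (hVW hy)]) v
  simp only [h1, Fintype.sum_option, Fin.sum_univ_three]
  simp [LocalFrame.J, optEps, sub_eq_add_neg, add_assoc]

/-- The horizontal part is the average of J⁻¹ ∘ ∇ ∘ J over J in {1, I_1, I_2, I_3}, a set closed
under multiplication up to sign, hence it commutes with each I_s. Conjugation by I_s preserves
metric connections because g(I_s ·, I_s ·) = -ε_s g. The vertical part is the flat connection for
which the ξ_s are parallel. -/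
theorem adaptedConn_adapted : Adapted F ξ W (adaptedConn hξ E) where
  par_η s V hV hVW Y hY x hx v := by
    rw [adaptedConn_apply hξ E (hVW hx), map_add, F.η_coe (hξ.subset (hVW hx)), zero_add, map_sum]
    simp [hξ.dual s _ x (hVW hx)]
  par_ξ s x hx v := by
    have hη : ∀ t, dirD (fun y => F.η t y (ξ s y)) x v = 0 := fun t => by
      rw [dirD_congr (f := fun _ => if t = s then 1 else 0), dirD_const]
      filter_upwards [hξ.isOpen.mem_nhds hx] with y hy
      exact hξ.dual t s y hy
    have h1 : F.hproj ξ x (adaptedConn hξ E (ξ s) x v) = 0 := by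
      rw [hproj_adaptedConn hξ E hx]
      have h2 : ∀ r, E.deriv (fun y => F.J r y (F.hproj ξ y (ξ s y))) x v = 0 := fun r => by
        rw [E.deriv_congr (Z := fun _ => 0)]
        · simp [HFrame.deriv, dirD_const]
        · filter_upwards [hξ.isOpen.mem_nhds hx] with y hy
          rw [hξ.hproj_ξ hy, map_zero]
      simp [h2]
    rw [hξ.decomp hx (adaptedConn hξ E (ξ s) x v), h1, adaptedConn_apply hξ E hx]
    simp [hη, F.η_coe (hξ.subset hx)]
  par_I s V hV hVW Y hY x hx v := by
    rw [hproj_adaptedConn_horizontal hξ E hV hVW hx, hproj_adaptedConn_horizontal hξ E hV hVW hx]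
    have h := F.paraQuat (hξ.subset (hVW hx))
    have hc : ∀ {A B : HField H}, (∀ y ∈ V, A y = B y) → E.deriv A x v = E.deriv B x v :=
      fun hAB => E.deriv_congr (by filter_upwards [hV.mem_nhds hx] with y hy using hAB y hy) v
    have hp : ∀ y ∈ V, ParaQuat (g.form y) (fun s => F.I s y) := fun y hy =>
      F.paraQuat (hξ.subset (hVW hy))
    have c00 := hc (A := fun y => F.I 0 y (F.I 0 y (Y y))) (B := Y) fun y hy => (hp y hy).I00 _
    have c11 := hc (A := fun y => F.I 1 y (F.I 1 y (Y y))) (B := Y) fun y hy => (hp y hy).I11 _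
    have c22 := hc (A := fun y => F.I 2 y (F.I 2 y (Y y))) (B := fun y => -Y y)
      fun y hy => (hp y hy).I22 _
    have c01 := hc (A := fun y => F.I 0 y (F.I 1 y (Y y))) (B := fun y => F.I 2 y (Y y))
      fun y hy => (hp y hy).I01 _
    have c02 := hc (A := fun y => F.I 0 y (F.I 2 y (Y y))) (B := fun y => F.I 1 y (Y y))
      fun y hy => (hp y hy).I02 _
    have c10 := hc (A := fun y => F.I 1 y (F.I 0 y (Y y))) (B := fun y => -F.I 2 y (Y y))
      fun y hy => (hp y hy).I10 _
    have c12 := hc (A := fun y => F.I 1 y (F.I 2 y (Y y))) (B := fun y => -F.I 0 y (Y y))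
      fun y hy => (hp y hy).I12 _
    have c20 := hc (A := fun y => F.I 2 y (F.I 0 y (Y y))) (B := fun y => -F.I 1 y (Y y))
      fun y hy => (hp y hy).I20 _
    have c21 := hc (A := fun y => F.I 2 y (F.I 1 y (Y y))) (B := fun y => F.I 0 y (Y y))
      fun y hy => (hp y hy).I21 _
    simp only [E.deriv_neg] at c22 c10 c12 c20
    fin_cases s <;>
    · simp only [Fin.zero_eta, Fin.mk_one, Fin.reduceFinMk, c00, c11, c22, c01, c02, c10, c12, c20,
        c21, map_smul, map_add, map_sub, map_neg, h.I00, h.I11, h.I22, h.I01, h.I02, h.I10, h.I12,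
        h.I20, h.I21]
      module
  par_g V hV hVW Y Z hY hZ x hx v := by
    rw [hproj_adaptedConn_horizontal hξ E hV hVW hx, hproj_adaptedConn_horizontal hξ E hV hVW hx]
    have h := F.paraQuat (hξ.subset (hVW hx))
    have m0 := E.deriv_metric hV hVW hY hZ hx v
    have hI : ∀ s {A : HField H}, SmoothHF V A → SmoothHF V (fun y => F.I s y (A y)) :=
      fun s A hA => F.smooth_I s V hV (hVW.trans hξ.subset) A hA
    have m1 : ∀ s, g.form x (F.I s x (E.deriv (fun y => F.I s y (Y y)) x v)) (Z x)
        + g.form x (Y x) (F.I s x (E.deriv (fun y => F.I s y (Z y)) x v))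
        = eps s * (2 * dirD (fun y => g.form y (Y y) (Z y)) x v) := by
      intro s
      have h1 := E.deriv_metric hV hVW (hI s hY) (hI s hZ) hx v
      have h2 : dirD (fun y => g.form y (F.I s y (Y y)) (F.I s y (Z y))) x v
          = -eps s * dirD (fun y => g.form y (Y y) (Z y)) x v := by
        rw [← dirD_const_mul _ ((g.smoothFun hV hY hZ).diffFun hV hx)]
        refine dirD_congr ?_ v
        filter_upwards [hV.mem_nhds hx] with y hy
        rw [F.compatible s y (hξ.subset (hVW hy))]; ring
      rw [h2] at h1
      have h3 := h.skew s (E.deriv (fun y => F.I s y (Y y)) x v) (Z x)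
      have h4 := h.skew s (Y x) (E.deriv (fun y => F.I s y (Z y)) x v)
      linarith
    have m10 := m1 0
    have m11 := m1 1
    have m12 := m1 2
    simp only [eps_zero, eps_one, eps_two] at m10 m11 m12
    simp only [map_smul, map_add, map_sub, LinearMap.smul_apply, LinearMap.add_apply,
      LinearMap.sub_apply, smul_eq_mul]
    linarith
  smooth V hV hVW X Y hX hY := by
    have hJ : ∀ r {A : HField H}, SmoothHF V A → SmoothHF V (fun y => F.J r y (A y)) :=
      fun r A hA => F.smooth_J r hV (hVW.trans hξ.subset) hA
    have hd : ∀ {A : HField H}, SmoothHF V A → SmoothHF V (fun y => E.deriv A y (X y)) := by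
      intro A hA
      refine SmoothHF.sum fun a _ => SmoothHF.add (SmoothHF.smul ?_ ((E.smooth_e a).mono hVW))
        (SmoothHF.smul ?_ ((E.smooth_f a).mono hVW))
      · exact (g.smoothFun hV hA ((E.smooth_f a).mono hVW)).dirD hV hX
      · exact (g.smoothFun hV hA ((E.smooth_e a).mono hVW)).dirD hV hX
    have h1 : SmoothHF V (fun y => (1 / 8 : ℝ) • ∑ r, optEps r • F.J r y
        (E.deriv (fun z => F.J r z (F.hproj ξ z (Y z))) y (X y))) :=
      SmoothHF.const_smul _ (SmoothHF.sum fun r _ => SmoothHF.const_smul _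
        (hJ r (hd (hJ r (hξ.smooth_hproj hV hVW hY)))))
    have h2 : SmoothVF V (fun y => ∑ s, dirD (fun z => F.η s z (Y z)) y (X y) • ξ s y) :=
      SmoothVF.sum fun s _ => SmoothVF.smul
        ((F.smooth_η s V hV (hVW.trans hξ.subset) Y hY).dirD hV hX) ((hξ.smooth s).mono hVW)
    exact (SmoothVF.add h1 h2).congr fun y hy => adaptedConn_apply hξ E (hVW hy) Y (X y)

end AdaptedConn

/-- Adapted connections exist locally. -/
theorem IsDual.exists_adapted (hH : IsSmoothDistribution (4 * n) H) {F : LocalFrame H PQ g U}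
    {ξ : Fin 3 → VField n M} (hξ : IsDual F ξ W) (hx : x ∈ W) : ∃ (W' : Set M) (D : Conn n M),
      x ∈ W' ∧ W' ⊆ W ∧ IsDual F ξ W' ∧ Nonempty (HFrame g W') ∧ Adapted F ξ W' D := by
  obtain ⟨V, hV, hxV, ⟨E⟩⟩ := exists_hframe hH g x
  have hd := hξ.mono (hξ.isOpen.inter hV) Set.inter_subset_left
  have E' : HFrame g (W ∩ V) := ⟨E.e, E.f, fun a => (E.smooth_e a).mono Set.inter_subset_right,
    fun a => (E.smooth_f a).mono Set.inter_subset_right, fun y hy => E.expand_e y hy.2,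
    fun y hy => E.expand_f y hy.2, fun y hy => E.linInd y hy.2, fun y hy => E.dual y hy.2⟩
  exact ⟨W ∩ V, adaptedConn hd E', ⟨hx, hxV⟩, Set.inter_subset_left, hd, ⟨E'⟩,
    adaptedConn_adapted hd E'⟩

end Adapted

/-! ### Bianchi identities for connections compatible with a local frame -/

section Compat

variable {n : ℕ} {M : Type*} [TopologicalSpace M]
  [ChartedSpace (EuclideanSpace ℝ (Fin (4 * n + 3))) M] [IsManifold (𝓡 (4 * n + 3)) ∞ M]
  {H : SubspaceField n M} {PQ : Π x : M, Submodule ℝ (Module.End ℝ (H x))} {g : HMetric H}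
  {U U' W V : Set M} {x : M}

theorem tors_apply (nab : Conn n M) {X Y : VField n M} (hX : DiffVF X x) (hY : DiffVF Y x) :
    tors nab x (X x) (Y x) = nab Y x (X x) - nab X x (Y x) - bracket X Y x :=
  nab.torsion_apply hX hY

theorem tors_swap (nab : Conn n M) (u v : Tan n M x) : tors nab x u v = -tors nab x v u :=
  nab.torsion_antisymm u v

/-- The horizontal part, along the span of `ξ`, of the torsion endomorphisms. -/
def LocalFrame.torsE (F : LocalFrame H PQ g U) (ξ : Fin 3 → VField n M) (nab : Conn n M) (x : M) :
    Tan n M x →ₗ[ℝ] Module.End ℝ (H x) :=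
  LinearMap.mk₂ ℝ (fun u Y => F.hproj ξ x (tors nab x u Y)) (by simp [tors]) (by simp [tors])
    (by simp [tors]) (by simp [tors])

theorem LocalFrame.torsE_apply (F : LocalFrame H PQ g U) (ξ : Fin 3 → VField n M) (nab : Conn n M)
    (x : M) (u : Tan n M x) (Y : H x) :
    F.torsE ξ nab x u Y = F.hproj ξ x (tors nab x u Y) := rfl

/-- Connections that preserve the structures of a local frame, up to rotations of the frame. -/
structure Compat (F : LocalFrame H PQ g U) (ξ : Fin 3 → VField n M) (W : Set M) (nab : Conn n M) :
    Prop where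
  pres_H : ∀ V : Set M, IsOpen V → V ⊆ W → ∀ Y : HField H, SmoothHF V Y → ∀ x ∈ V, ∀ v, ∀ s,
    F.η s x (nab Y.toVField x v) = 0
  pres_g : ∀ V : Set M, IsOpen V → V ⊆ W → ∀ Y Z : HField H, SmoothHF V Y → SmoothHF V Z →
    ∀ x ∈ V, ∀ v, dirD (fun y => g.form y (Y y) (Z y)) x v
      = g.form x (F.hproj ξ x (nab Y.toVField x v)) (Z x)
        + g.form x (Y x) (F.hproj ξ x (nab Z.toVField x v))
  cov_I : ∀ i, ∀ V : Set M, IsOpen V → V ⊆ W → ∀ Y : HField H, SmoothHF V Y → ∀ x ∈ V, ∀ v,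
    F.hproj ξ x (nab (HField.toVField fun y => F.I i y (Y y)) x v)
      = F.I i x (F.hproj ξ x (nab Y.toVField x v)) + ∑ s, F.η s x (nab (ξ i) x v) • F.I s x (Y x)
  cov_ξ : ∀ i, ∀ x ∈ W, ∀ v, F.hproj ξ x (nab (ξ i) x v) = 0

theorem Adapted.compat {F : LocalFrame H PQ g U} {ξ : Fin 3 → VField n M} {D : Conn n M}
    (hD : Adapted F ξ W D) (hW : W ⊆ U) : Compat F ξ W D where
  pres_H V hV hVW Y hY x hx v s := by
    rw [hD.par_η s V hV hVW _ hY x hx, dirD_congr (f := fun _ => 0), dirD_const]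
    filter_upwards [hV.mem_nhds hx] with y hy
    exact F.η_coe (hW (hVW hy)) s _
  pres_g := hD.par_g
  cov_I i V hV hVW Y hY x hx v := by
    rw [hD.par_I i V hV hVW Y hY x hx, hD.par_ξ i x (hVW hx)]; simp
  cov_ξ i x hx v := by rw [hD.par_ξ i x hx, map_zero]

section

variable {F : LocalFrame H PQ g U} {ξ : Fin 3 → VField n M} (hξ : IsDual F ξ W) {nab : Conn n M}
include hξ

theorem IsDual.eq_coe_hproj (hx : x ∈ W) {v : Tan n M x} (hv : ∀ s, F.η s x v = 0) :
    v = (F.hproj ξ x v : Tan n M x) := by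
  rw [hξ.coe_hproj hx]; simp [hv]

theorem Compat.cov_coe (hc : Compat F ξ W nab) (hV : IsOpen V) (hVW : V ⊆ W) {Y : HField H}
    (hY : SmoothHF V Y) (hx : x ∈ V) (v : Tan n M x) :
    nab Y.toVField x v = (F.hproj ξ x (nab Y.toVField x v) : Tan n M x) :=
  hξ.eq_coe_hproj (hVW hx) fun s => hc.pres_H V hV hVW Y hY x hx v s

theorem Compat.η_tors (hc : Compat F ξ W nab) (hH : IsSmoothDistribution (4 * n) H) (hx : x ∈ W)
    (s : Fin 3) (X Y : H x) : F.η s x (tors nab x X Y) = extT (F.η s) x X Y := by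
  obtain ⟨V, X', hV, hxV, hX, rfl⟩ := exists_horizontal_extend hH g x X
  obtain ⟨V', Y', hV', hxV', hY, rfl⟩ := exists_horizontal_extend hH g x Y
  set O := V ∩ V' ∩ W
  have hO : IsOpen O := (hV.inter hV').inter hξ.isOpen
  have hOW : O ⊆ W := Set.inter_subset_right
  have hxO : x ∈ O := ⟨⟨hxV, hxV'⟩, hx⟩
  replace hX : SmoothHF O X' := hX.mono fun y hy => hy.1.1
  replace hY : SmoothHF O Y' := hY.mono fun y hy => hy.1.2
  have hX' : DiffVF X'.toVField x := SmoothVF.diffVF hX hO hxO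
  have hY' : DiffVF Y'.toVField x := SmoothVF.diffVF hY hO hxO
  have e1 := tors_apply nab hX' hY'
  have e2 := extT_apply (F.diffForm (hξ.subset hx) s) hX' hY'
  simp only [HField.toVField] at e1 e2
  rw [e1, e2, map_sub, map_sub]
  have z : ∀ A : HField H, ∀ v : Tan n M x, dirD (fun y => F.η s y (A.toVField y)) x v = 0 := fun A v => by
    rw [dirD_congr (f := fun _ => 0), dirD_const]
    filter_upwards [hξ.isOpen.mem_nhds hx] with y hy
    exact F.η_coe (hξ.subset hy) s _
  rw [extD, z Y', z X']
  have p1 := hc.pres_H O hO hOW Y' hY x hxO (X' x) s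
  have p2 := hc.pres_H O hO hOW X' hX x hxO (Y' x) s
  rw [p1, p2]

theorem Compat.tors_horizontal (hc : Compat F ξ W nab) (hH : IsSmoothDistribution (4 * n) H)
    (hx : x ∈ W) (X Y : H x) : tors nab x X Y = (F.torsE ξ nab x X Y : Tan n M x)
      + ∑ s, (-2 * eps s * g.form x (F.I s x X) Y) • ξ s x := by
  conv_lhs => rw [hξ.decomp hx (tors nab x X Y)]
  simp only [hc.η_tors hξ hH hx, F.extT_horizontal hH (hξ.subset hx)]
  rfl

/-- On H the form dη_i is -2 ε_i g(I_i ·, ·), and g is parallel, so only the derivative of I_i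
survives; compatibility ties it to that of ξ_i. -/
theorem Compat.deriv_extT (hc : Compat F ξ W nab) (hH : IsSmoothDistribution (4 * n) H)
    {O : Set M} (hO : IsOpen O) (hOW : O ⊆ W) (hxO : x ∈ O) (i : Fin 3) {B C : HField H}
    (hB : SmoothHF O B) (hC : SmoothHF O C) (v : Tan n M x) :
    dirD (fun y => extT (F.η i) y (B.toVField y) (C.toVField y)) x v
        - extT (F.η i) x (nab B.toVField x v) (C.toVField x)
        - extT (F.η i) x (B.toVField x) (nab C.toVField x v)
      = -2 * (eps i * ∑ s, F.η s x (nab (ξ i) x v) * g.form x (F.I s x (B x)) (C x)) := by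
  have hOU : O ⊆ U := hOW.trans hξ.subset
  have hIB : SmoothHF O (fun y => F.I i y (B y)) := F.smooth_I i O hO hOU B hB
  have e1 : dirD (fun y => extT (F.η i) y (B.toVField y) (C.toVField y)) x v
      = -2 * eps i * (g.form x (F.I i x (F.hproj ξ x (nab B.toVField x v))) (C x)
        + ∑ s, F.η s x (nab (ξ i) x v) * g.form x (F.I s x (B x)) (C x)
        + g.form x (F.I i x (B x)) (F.hproj ξ x (nab C.toVField x v))) := by
    rw [dirD_congr (f := fun y => -2 * eps i * g.form y (F.I i y (B y)) (C y)),
      dirD_const_mul _ ((g.smoothFun hO hIB hC).diffFun hO hxO),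
      hc.pres_g O hO hOW _ _ hIB hC x hxO, hc.cov_I i O hO hOW B hB x hxO]
    · simp only [map_add, LinearMap.add_apply, map_sum, LinearMap.sum_apply,
        map_smul, LinearMap.smul_apply, smul_eq_mul]
    · filter_upwards [hO.mem_nhds hxO] with y hy
      exact F.extT_horizontal hH (hOU hy) i _ _
  have e2 : extT (F.η i) x (nab B.toVField x v) (C.toVField x)
      = -2 * eps i * g.form x (F.I i x (F.hproj ξ x (nab B.toVField x v))) (C x) := by
    conv_lhs => rw [hc.cov_coe hξ hO hOW hB hxO]
    exact F.extT_horizontal hH (hOU hxO) i _ _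
  have e3 : extT (F.η i) x (B.toVField x) (nab C.toVField x v)
      = -2 * eps i * g.form x (F.I i x (B x)) (F.hproj ξ x (nab C.toVField x v)) := by
    conv_lhs => rw [hc.cov_coe hξ hO hOW hC hxO]
    exact F.extT_horizontal hH (hOU hxO) i _ _
  rw [e1, e2, e3]
  ring

theorem Compat.bianchi_summand (hc : Compat F ξ W nab) (hH : IsSmoothDistribution (4 * n) H)
    {O : Set M} (hO : IsOpen O) (hOW : O ⊆ W) (hxO : x ∈ O) (i : Fin 3) {A B C : HField H}
    (hB : SmoothHF O B) (hC : SmoothHF O C) :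
    dirD (fun y => extT (F.η i) y (B.toVField y) (C.toVField y)) x (A.toVField x)
        - extT (F.η i) x (nab B.toVField x (A.toVField x)) (C.toVField x)
        - extT (F.η i) x (B.toVField x) (nab C.toVField x (A.toVField x))
        + extT (F.η i) x (tors nab x (A.toVField x) (B.toVField x)) (C.toVField x)
      = -2 * (eps i * ∑ s, F.η s x (nab (ξ i) x (A x)) * g.form x (F.I s x (B x)) (C x)
      + eps i * g.form x (F.I i x (F.torsE ξ nab x (A x) (B x))) (C x)
      + ∑ s, eps s * g.form x (F.I s x (A x)) (B x) * extT (F.η i) x (ξ s x) (C x)) := by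
  have hx : x ∈ W := hOW hxO
  have e4 : extT (F.η i) x (tors nab x (A.toVField x) (B.toVField x)) (C.toVField x)
      = -2 * eps i * g.form x (F.I i x (F.torsE ξ nab x (A x) (B x))) (C x)
        + -2 * ∑ s, eps s * g.form x (F.I s x (A x)) (B x) * extT (F.η i) x (ξ s x) (C x) := by
    have := hc.tors_horizontal hξ hH hx (A x) (B x)
    simp only [HField.toVField]
    rw [this, map_add, LinearMap.add_apply, F.extT_horizontal hH (hξ.subset hx), map_sum,
      LinearMap.sum_apply, Finset.mul_sum]
    congr 1
    exact Finset.sum_congr rfl fun s _ => by simp; ring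
  rw [hc.deriv_extT hξ hH hO hOW hxO i hB hC, e4]
  simp only [HField.toVField]
  ring

/-- The Bianchi identity on `H`. -/
theorem Compat.bianchi_horizontal (hc : Compat F ξ W nab) (hH : IsSmoothDistribution (4 * n) H)
    (hx : x ∈ W) (i : Fin 3) (X Y Z : H x) :
    (eps i * ∑ s, F.η s x (nab (ξ i) x X) * g.form x (F.I s x Y) Z
      + eps i * g.form x (F.I i x (F.torsE ξ nab x X Y)) Z
      + ∑ s, eps s * g.form x (F.I s x X) Y * extT (F.η i) x (ξ s x) Z)
    + (eps i * ∑ s, F.η s x (nab (ξ i) x Y) * g.form x (F.I s x Z) X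
      + eps i * g.form x (F.I i x (F.torsE ξ nab x Y Z)) X
      + ∑ s, eps s * g.form x (F.I s x Y) Z * extT (F.η i) x (ξ s x) X)
    + (eps i * ∑ s, F.η s x (nab (ξ i) x Z) * g.form x (F.I s x X) Y
      + eps i * g.form x (F.I i x (F.torsE ξ nab x Z X)) Y
      + ∑ s, eps s * g.form x (F.I s x Z) X * extT (F.η i) x (ξ s x) Y) = 0 := by
  obtain ⟨V₁, X', hV₁, hxV₁, hX, rfl⟩ := exists_horizontal_extend hH g x X
  obtain ⟨V₂, Y', hV₂, hxV₂, hY, rfl⟩ := exists_horizontal_extend hH g x Y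
  obtain ⟨V₃, Z', hV₃, hxV₃, hZ, rfl⟩ := exists_horizontal_extend hH g x Z
  set O := V₁ ∩ V₂ ∩ V₃ ∩ W
  have hO : IsOpen O := ((hV₁.inter hV₂).inter hV₃).inter hξ.isOpen
  have hOW : O ⊆ W := Set.inter_subset_right
  have hOU : O ⊆ U := hOW.trans hξ.subset
  have hxO : x ∈ O := ⟨⟨⟨hxV₁, hxV₂⟩, hxV₃⟩, hx⟩
  replace hX : SmoothHF O X' := hX.mono fun y hy => hy.1.1.1
  replace hY : SmoothHF O Y' := hY.mono fun y hy => hy.1.1.2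
  replace hZ : SmoothHF O Z' := hZ.mono fun y hy => hy.1.2
  have hη : SmoothOneForm O (F.η i) := fun A hA hAO => F.smooth_η i A hA (hAO.trans hOU)
  have hb := bianchi_extT hη nab hO hxO hX hY hZ
  have b1 := hc.bianchi_summand hξ hH hO hOW hxO i (A := X') hY hZ
  have b2 := hc.bianchi_summand hξ hH hO hOW hxO i (A := Y') hZ hX
  have b3 := hc.bianchi_summand hξ hH hO hOW hxO i (A := Z') hX hY
  rw [b1, b2, b3] at hb
  have key : ∀ a b c : ℝ, -2 * a + -2 * b + -2 * c = 0 → a + b + c = 0 := fun a b c h => by linarith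
  exact key _ _ _ hb

end

/-- The Bianchi identity on `H` for an adapted connection. -/
theorem Adapted.cyclic {F : LocalFrame H PQ g U} {ξ : Fin 3 → VField n M} (hξ : IsDual F ξ W)
    {D : Conn n M} (hD : Adapted F ξ W D) (hH : IsSmoothDistribution (4 * n) H)
    (hx : x ∈ W) (i : Fin 3) (X Y Z : H x) :
    (eps i * g.form x (F.I i x (F.torsE ξ D x X Y)) Z
      + ∑ s, eps s * g.form x (F.I s x X) Y * extT (F.η i) x (ξ s x) Z)
    + (eps i * g.form x (F.I i x (F.torsE ξ D x Y Z)) X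
      + ∑ s, eps s * g.form x (F.I s x Y) Z * extT (F.η i) x (ξ s x) X)
    + (eps i * g.form x (F.I i x (F.torsE ξ D x Z X)) Y
      + ∑ s, eps s * g.form x (F.I s x Z) X * extT (F.η i) x (ξ s x) Y) = 0 := by
  have := (hD.compat hξ.subset).bianchi_horizontal hξ hH hx i X Y Z
  simpa [hD.par_ξ i x hx] using this

theorem LocalFrame.torsE_swap (F : LocalFrame H PQ g U) (ξ : Fin 3 → VField n M) (nab : Conn n M)
    (x : M) (X Y : H x) : F.torsE ξ nab x X Y = -F.torsE ξ nab x Y X := by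
  rw [F.torsE_apply, tors_swap, map_neg]; rfl

theorem Adapted.η_tors {F : LocalFrame H PQ g U} {ξ : Fin 3 → VField n M} (hξ : IsDual F ξ W)
    {D : Conn n M} (hD : Adapted F ξ W D) (hx : x ∈ W) (s : Fin 3) (u v : Tan n M x) :
    F.η s x (tors D x u v) = extT (F.η s) x u v := by
  obtain ⟨V, X, hV, hxV, hX, rfl⟩ := exists_smooth_extend x u
  obtain ⟨V', Y, hV', hxV', hY, rfl⟩ := exists_smooth_extend x v
  have hO : IsOpen (V ∩ V' ∩ W) := (hV.inter hV').inter hξ.isOpen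
  have hxO : x ∈ V ∩ V' ∩ W := ⟨⟨hxV, hxV'⟩, hx⟩
  have hX' := hX.mono (W := V ∩ V' ∩ W) fun y hy => hy.1.1
  have hY' := hY.mono (W := V ∩ V' ∩ W) fun y hy => hy.1.2
  rw [tors_apply D (hX.diffVF hV hxV) (hY.diffVF hV' hxV'),
    extT_apply (F.diffForm (hξ.subset hx) s) (hX.diffVF hV hxV) (hY.diffVF hV' hxV'),
    map_sub, map_sub, hD.par_η s _ hO Set.inter_subset_right _ hX' x hxO,
    hD.par_η s _ hO Set.inter_subset_right _ hY' x hxO, extD]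

set_option maxHeartbeats 1000000 in
/-- The Bianchi identity with one vertical argument. -/
theorem Adapted.torsRel {F : LocalFrame H PQ g U} {ξ : Fin 3 → VField n M} (hξ : ReebOn F ξ W)
    {D : Conn n M} (hD : Adapted F ξ W D) (hH : IsSmoothDistribution (4 * n) H) (hx : x ∈ W) :
    TorsRel (g.form x) (g.nondegenerate x) (fun s => F.I s x) (fun t => F.torsE ξ D x (ξ t x))
      (fun s u v => extT (F.η s) x (ξ u x) (ξ v x)) where
  swap s u v := extT_swap _ _ _
  rel s t := by
    have h := F.paraQuat (hξ.subset hx)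
    refine h.ext_end fun X Y => ?_
    have hx' := hξ.toIsDual
    obtain ⟨V₁, X', hV₁, hxV₁, hX, rfl⟩ := exists_horizontal_extend hH g x X
    obtain ⟨V₂, Y', hV₂, hxV₂, hY, rfl⟩ := exists_horizontal_extend hH g x Y
    set O := V₁ ∩ V₂ ∩ W
    have hO : IsOpen O := (hV₁.inter hV₂).inter hξ.isOpen
    have hOW : O ⊆ W := Set.inter_subset_right
    have hOU : O ⊆ U := hOW.trans hξ.subset
    have hxO : x ∈ O := ⟨⟨hxV₁, hxV₂⟩, hx⟩
    replace hX : SmoothHF O X' := hX.mono fun y hy => hy.1.1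
    replace hY : SmoothHF O Y' := hY.mono fun y hy => hy.1.2
    have hc := hD.compat hξ.subset
    have hη : ∀ s, SmoothOneForm O (F.η s) := fun s A hA hAO => F.smooth_η s A hA (hAO.trans hOU)
    have hζ : ∀ s, SmoothVF O (ξ s) := fun s => (hξ.smooth s).mono hOW
    have hpar : ∀ s (v : Tan n M x), D (ξ s) x v = 0 := fun s v => hD.par_ξ s x hx v
    -- the Bianchi identity for one pair of indices
    have key : ∀ s t,
        (-2 * eps s * g.form x (F.I s x (F.torsE ξ D x (ξ t x) (X' x))) (Y' x)
          + ∑ u, extT (F.η u) x (ξ t x) (X' x) * extT (F.η s) x (ξ u x) (Y' x))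
        + (dirD (n := n) (fun y => extT (F.η s) y (Y' y) (ξ t y)) x (X' x)
          - extT (F.η s) x (F.hproj ξ x (D Y'.toVField x (X' x))) (ξ t x)
          + extT (F.η s) x (F.torsE ξ D x (X' x) (Y' x)) (ξ t x)
          + ∑ u, -2 * eps u * g.form x (F.I u x (X' x)) (Y' x) * extT (F.η s) x (ξ u x) (ξ t x))
        + (dirD (n := n) (fun y => extT (F.η s) y (ξ t y) (X' y)) x (Y' x)
          - extT (F.η s) x (ξ t x) (F.hproj ξ x (D X'.toVField x (Y' x)))
          + 2 * eps s * g.form x (F.I s x (F.torsE ξ D x (ξ t x) (Y' x))) (X' x)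
          - ∑ u, extT (F.η u) x (ξ t x) (Y' x) * extT (F.η s) x (ξ u x) (X' x)) = 0 := by
      intro s t
      have hb := bianchi_extT (hη s) D hO hxO (hζ t) hX hY
      have f1 : dirD (fun y => extT (F.η s) y (X'.toVField y) (Y'.toVField y)) x (ξ t x)
          - extT (F.η s) x (D X'.toVField x (ξ t x)) (Y'.toVField x)
          - extT (F.η s) x (X'.toVField x) (D Y'.toVField x (ξ t x)) = 0 := by
        rw [hc.deriv_extT hx' hH hO hOW hxO s hX hY]
        simp [hpar]
      have f2 : ∀ A B : H x, extT (F.η s) x (tors D x (ξ t x) A) B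
          = -2 * eps s * g.form x (F.I s x (F.torsE ξ D x (ξ t x) A)) B
          + ∑ u, extT (F.η u) x (ξ t x) A * extT (F.η s) x (ξ u x) B := by
        intro A B
        rw [hx'.decomp hx (tors D x (ξ t x) A), ← F.torsE_apply, map_add, LinearMap.add_apply,
          F.extT_horizontal hH (hOU hxO), map_sum, LinearMap.sum_apply]
        simp only [hD.η_tors hx' hx, map_smul, LinearMap.smul_apply, smul_eq_mul]
      have f3 : extT (F.η s) x (tors D x (X' x) (Y' x)) (ξ t x)
          = extT (F.η s) x (F.torsE ξ D x (X' x) (Y' x)) (ξ t x)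
          + ∑ u, -2 * eps u * g.form x (F.I u x (X' x)) (Y' x) * extT (F.η s) x (ξ u x) (ξ t x) := by
        rw [hc.tors_horizontal hx' hH hx, map_add, LinearMap.add_apply, map_sum,
          LinearMap.sum_apply]
        simp only [map_smul, LinearMap.smul_apply, smul_eq_mul]
      have f4 := f2 (Y' x) (X' x)
      have f5 := f2 (X' x) (Y' x)
      have f6 : extT (F.η s) x (tors D x (Y' x) (ξ t x)) (X' x)
          = -extT (F.η s) x (tors D x (ξ t x) (Y' x)) (X' x) := by
        rw [tors_swap, map_neg, LinearMap.neg_apply]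
      have f7 := hc.cov_coe hx' hO hOW hX hxO (Y' x)
      have f8 := hc.cov_coe hx' hO hOW hY hxO (X' x)
      rw [hpar, hpar] at hb
      simp only [HField.toVField, map_zero, LinearMap.zero_apply, sub_zero] at hb f1 f7 f8 ⊢
      rw [f6, f3, f4, f5, f7, f8] at hb
      linarith
    have k1 := key s t
    have k2 := key t s
    -- the terms that cancel after symmetrisation
    have hr := hξ.reeb s t
    have a1 : eps t * dirD (n := n) (fun y => extT (F.η s) y (ξ t y) (X' y)) x (Y' x)
        + eps s * dirD (n := n) (fun y => extT (F.η t) y (ξ s y) (X' y)) x (Y' x) = 0 := by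
      have d : ∀ s t, DiffFun (n := n) (fun y => extT (F.η s) y (ξ t y) (X' y)) x := fun s t =>
        ((F.smooth_η s).extT F.isOpen hO hOU (hζ t) hX).diffFun hO hxO
      rw [← dirD_const_mul _ (d s t), ← dirD_const_mul _ (d t s),
        ← dirD_add ((DiffFun.const _).mul (d s t)) ((DiffFun.const _).mul (d t s)),
        dirD_congr (f := fun _ => 0), dirD_const]
      filter_upwards [hO.mem_nhds hxO] with y hy
      exact hr y (hOW hy) (X' y)
    have a2 : eps t * dirD (n := n) (fun y => extT (F.η s) y (Y' y) (ξ t y)) x (X' x)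
        + eps s * dirD (n := n) (fun y => extT (F.η t) y (Y' y) (ξ s y)) x (X' x) = 0 := by
      have d : ∀ s t, DiffFun (n := n) (fun y => extT (F.η s) y (Y' y) (ξ t y)) x := fun s t =>
        ((F.smooth_η s).extT F.isOpen hO hOU hY (hζ t)).diffFun hO hxO
      rw [← dirD_const_mul _ (d s t), ← dirD_const_mul _ (d t s),
        ← dirD_add ((DiffFun.const _).mul (d s t)) ((DiffFun.const _).mul (d t s)),
        dirD_congr (f := fun _ => 0), dirD_const]
      filter_upwards [hO.mem_nhds hxO] with y hy
      have := hr y (hOW hy) (Y' y)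
      rw [extT_swap (F.η s), extT_swap (F.η t)]
      linarith
    have a3 := hr x hx (F.hproj ξ x (D X'.toVField x (Y' x)))
    have a4 := hr x hx (F.hproj ξ x (D Y'.toVField x (X' x)))
    have a5 := hr x hx (F.torsE ξ D x (X' x) (Y' x))
    -- The terms quadratic in dη(ξ, ·): two applications of the Reeb condition, to (u, s) and to (u,
    -- t), exchange s with t together with the two horizontal arguments.
    have a6 : eps t * (∑ u, extT (F.η u) x (ξ t x) (X' x) * extT (F.η s) x (ξ u x) (Y' x)
          - ∑ u, extT (F.η u) x (ξ t x) (Y' x) * extT (F.η s) x (ξ u x) (X' x))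
        + eps s * (∑ u, extT (F.η u) x (ξ s x) (X' x) * extT (F.η t) x (ξ u x) (Y' x)
          - ∑ u, extT (F.η u) x (ξ s x) (Y' x) * extT (F.η t) x (ξ u x) (X' x)) = 0 := by
      have q : ∀ u (A B : H x), eps s * (extT (F.η u) x (ξ s x) A * extT (F.η t) x (ξ u x) B)
          = eps t * (extT (F.η u) x (ξ t x) B * extT (F.η s) x (ξ u x) A) := by
        intro u A B
        have r1 := hξ.reeb u s x hx A
        have r2 := hξ.reeb u t x hx B
        have e := eps_mul_self u
        linear_combination extT (F.η t) x (ξ u x) B * r1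
          - extT (F.η s) x (ξ u x) A * r2
      simp only [mul_sub, Finset.mul_sum, q]
      ring
    rw [extT_swap (F.η s) _ (ξ t x), extT_swap (F.η s) (F.torsE ξ D x (X' x) (Y' x) : Tan n M x)]
      at k1
    rw [extT_swap (F.η t) _ (ξ s x), extT_swap (F.η t) (F.torsE ξ D x (X' x) (Y' x) : Tan n M x)]
      at k2
    have es := eps_mul_self s
    have et := eps_mul_self t
    -- Weighted by ε_t and ε_s, the two Bianchi identities add up so that the forms dη_s(ξ_t, ·)|_H
    -- and their derivatives cancel. Only torsion endomorphisms and the numbers dη_s(ξ_u, ξ_t)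
    -- remain.
    have k3 : eps s * eps t * (g.form x (F.I s x (F.torsE ξ D x (ξ t x) (X' x))) (Y' x)
        - g.form x (F.I s x (F.torsE ξ D x (ξ t x) (Y' x))) (X' x)
        + g.form x (F.I t x (F.torsE ξ D x (ξ s x) (X' x))) (Y' x)
        - g.form x (F.I t x (F.torsE ξ D x (ξ s x) (Y' x))) (X' x))
        + (eps t * ∑ u, eps u * g.form x (F.I u x (X' x)) (Y' x) * extT (F.η s) x (ξ u x) (ξ t x)
          + eps s * ∑ u, eps u * g.form x (F.I u x (X' x)) (Y' x) * extT (F.η t) x (ξ u x) (ξ s x))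
        = 0 := by
      have m : ∀ s t, ∑ u, -2 * eps u * g.form x (F.I u x (X' x)) (Y' x)
            * extT (F.η s) x (ξ u x) (ξ t x)
          = -2 * ∑ u, eps u * g.form x (F.I u x (X' x)) (Y' x) * extT (F.η s) x (ξ u x) (ξ t x) :=
        fun s t => by rw [Finset.mul_sum]; exact Finset.sum_congr rfl fun u _ => by ring
      rw [m] at k1 k2
      linear_combination (-1 / 2 * eps t) * k1 + (-1 / 2 * eps s) * k2 + 1 / 2 * a1 + 1 / 2 * a2
        - 1 / 2 * a3 + 1 / 2 * a4 - 1 / 2 * a5 + 1 / 2 * a6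
    have m2 : ∀ s t (A B : H x), g.form x (adj (g.form x) (g.nondegenerate x)
        (F.torsE ξ D x (ξ t x)) (F.I s x A)) B
        = -g.form x (F.I s x (F.torsE ξ D x (ξ t x) B)) A := by
      intro s t A B
      rw [form_adj, h.skew, g.symm x A]
    simp only [LinearMap.add_apply, Module.End.mul_apply, map_add, m2, LinearMap.neg_apply,
      LinearMap.sum_apply, map_neg, map_sum, LinearMap.smul_apply, map_smul, smul_eq_mul]
    have m3 : ∑ u, eps u * (eps s * extT (F.η s) x (ξ u x) (ξ t x)
          + eps t * extT (F.η t) x (ξ u x) (ξ s x)) * g.form x (F.I u x (X' x)) (Y' x)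
        = eps s * eps t * (eps t * ∑ u, eps u * g.form x (F.I u x (X' x)) (Y' x)
            * extT (F.η s) x (ξ u x) (ξ t x)
          + eps s * ∑ u, eps u * g.form x (F.I u x (X' x)) (Y' x)
            * extT (F.η t) x (ξ u x) (ξ s x)) := by
      rw [Finset.mul_sum, Finset.mul_sum, ← Finset.sum_add_distrib, Finset.mul_sum]
      refine Finset.sum_congr rfl fun u _ => ?_
      linear_combination (-eps u * g.form x (F.I u x (X' x)) (Y' x)
        * extT (F.η s) x (ξ u x) (ξ t x) * eps s) * et
        + (-eps u * g.form x (F.I u x (X' x)) (Y' x)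
        * extT (F.η t) x (ξ u x) (ξ s x) * eps t) * es
    rw [m3]
    set Q := g.form x (F.I s x (F.torsE ξ D x (ξ t x) (X' x))) (Y' x)
        - g.form x (F.I s x (F.torsE ξ D x (ξ t x) (Y' x))) (X' x)
        + g.form x (F.I t x (F.torsE ξ D x (ξ s x) (X' x))) (Y' x)
        - g.form x (F.I t x (F.torsE ξ D x (ξ s x) (Y' x))) (X' x) with hQ
    linear_combination (eps s * eps t) * k3 + (-Q) * (eps t * eps t * es + et)

end Compat

/-! ### The complement spanned by the Reeb fields -/

section ReebComplement

variable {n : ℕ} {M : Type*} [TopologicalSpace M]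
  [ChartedSpace (EuclideanSpace ℝ (Fin (4 * n + 3))) M] [IsManifold (𝓡 (4 * n + 3)) ∞ M]
  {H : SubspaceField n M} {PQ : Π x : M, Submodule ℝ (Module.End ℝ (H x))} {g : HMetric H}
  {U U' W V : Set M} {x : M}

/-- In dimension greater than seven every local frame has Reeb fields. -/
theorem LocalFrame.reebOn_of_one_lt (hn : 1 < n) (hH : IsSmoothDistribution (4 * n) H)
    (F : LocalFrame H PQ g U) : ReebOn F F.reeb U := by
  have hd := F.reeb_isDual hH
  refine ⟨hd, fun s t x hx X => ?_⟩
  obtain ⟨W', D, hxW, hWU, hξ, -, hD⟩ := hd.exists_adapted hH hx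
  let a : Fin 3 → Fin 3 → H x →ₗ[ℝ] ℝ := fun s t => extT (F.η s) x (F.reeb t x) ∘ₗ (H x).subtype
  refine reeb_of_self_cross (a := fun s t => extT (F.η s) x (F.reeb t x) X)
    (fun s => F.reeb_self hH s hx X) (fun i => ?_) s t
  -- The horizontal Bianchi identity of a connection adapted to the fields `F.reeb` is precisely the
  -- cyclic hypothesis, with t the horizontal torsion and a the forms dη_s(ξ_t, ·).
  have h := (F.paraQuat hx).cross_of_cyclic (by rw [finrank_horizontal hH]; omega)
    (F.torsE F.reeb D x ∘ₗ (H x).subtype) (F.torsE_swap _ _ _) a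
    (fun s => LinearMap.ext fun X => F.reeb_self hH s hx X) (hD.cyclic hξ hH hxW) i
  exact congr($h X)

/-- The Bianchi argument needs two non-null vectors with orthogonal quaternionic spans, which H does
not contain when n = 1; there the assumed Reeb fields take its place. -/
theorem exists_reebOn (P : PqcStructure n M) (g : HMetric P.H) (hg : g ∈ P.metrics)
    (hn : 1 ≤ n) (hR : n = 1 → P.HasReebFields g) (x : M) :
    ∃ (V : Set M) (F : LocalFrame P.H P.PQ g V) (ξ : Fin 3 → VField n M) (W : Set M),
      x ∈ W ∧ ReebOn F ξ W := by
  rcases hn.eq_or_lt with h | h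
  · obtain ⟨V, F, ξ, hx, hξ⟩ := hR h.symm x
    exact ⟨V, F, ξ, V, hx, (isReeb_iff P.smooth_H F ξ).1 hξ⟩
  · obtain ⟨V, hx, ⟨F⟩⟩ := P.exists_frame g hg x
    exact ⟨V, F, F.reeb, V, hx, F.reebOn_of_one_lt h P.smooth_H⟩

theorem IsDual.linearIndependent {F : LocalFrame H PQ g U} {ξ : Fin 3 → VField n M}
    (hξ : IsDual F ξ W) (hx : x ∈ W) : LinearIndependent ℝ fun s => ξ s x := by
  rw [Fintype.linearIndependent_iff]
  intro c hc s
  have := congr(F.η s x $hc)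
  simpa [hξ.dual _ _ x hx] using this

theorem IsDual.isCompl {F : LocalFrame H PQ g U} {ξ : Fin 3 → VField n M}
    (hξ : IsDual F ξ W) (hx : x ∈ W) :
    IsCompl (H x) (Submodule.span ℝ (Set.range fun s => ξ s x)) := by
  refine ⟨Submodule.disjoint_def.2 fun v hv hv' => ?_, codisjoint_iff.2 (eq_top_iff.2 fun v _ => ?_)⟩
  · obtain ⟨c, rfl⟩ := (Submodule.mem_span_range_iff_exists_fun ℝ).1 hv'
    have h := (F.mem_iff (hξ.subset hx) _).1 hv
    simp only [map_sum, map_smul, hξ.dual _ _ x hx, smul_eq_mul, mul_ite, mul_one, mul_zero,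
      Finset.sum_ite_eq, Finset.mem_univ, if_true] at h
    simp [h]
  · rw [hξ.decomp hx v]
    exact Submodule.add_mem_sup (F.hproj ξ x v).2
      ((Submodule.mem_span_range_iff_exists_fun ℝ).2 ⟨_, rfl⟩)

theorem Complement.projH_coe (C : Complement H) (x : M) (X : H x) : C.projH x X = X :=
  Submodule.projectionOnto_apply_left _ X

theorem Complement.projH_of_mem (C : Complement H) {v : Tan n M x} (hv : v ∈ C.V x) :
    C.projH x v = 0 := Submodule.projectionOnto_apply_right _ ⟨v, hv⟩

theorem Complement.mem_V_iff (C : Complement H) {v : Tan n M x} : v ∈ C.V x ↔ C.projH x v = 0 :=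
  (Submodule.projectionOnto_apply_eq_zero_iff _).symm

theorem IsDual.projH_eq {F : LocalFrame H PQ g U} {ξ : Fin 3 → VField n M}
    (hξ : IsDual F ξ W) (hx : x ∈ W) {C : Complement H}
    (hC : C.V x = Submodule.span ℝ (Set.range fun s => ξ s x)) : C.projH x = F.hproj ξ x := by
  refine LinearMap.ext fun v => ?_
  conv_lhs => rw [hξ.decomp hx v, map_add, C.projH_coe]
  rw [C.projH_of_mem, add_zero]
  rw [hC]
  exact (Submodule.mem_span_range_iff_exists_fun ℝ).2 ⟨_, rfl⟩

theorem Complement.projV_eq (C : Complement H) (x : M) (v : Tan n M x) :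
    C.projV x v = v - C.projH x v := by
  have h := Submodule.projection_add_projection_eq_self (C.isCompl x) v
  rw [Complement.projV, Complement.projH, Submodule.coe_projectionOnto_apply, eq_sub_iff_add_eq,
    add_comm, h]

theorem Complement.ext {C C' : Complement H} (h : ∀ x, C.V x = C'.V x) : C = C' := by
  cases C; cases C'; congr; exact funext h

theorem span_changeFields_le (F' : LocalFrame H PQ g U') (ξ : Fin 3 → VField n M) (x : M) :
    Submodule.span ℝ (Set.range fun s => changeFields F' ξ s x)
      ≤ Submodule.span ℝ (Set.range fun s => ξ s x) := by
  refine Submodule.span_le.2 ?_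
  rintro _ ⟨s, rfl⟩
  exact (Submodule.mem_span_range_iff_exists_fun ℝ).2 ⟨_, rfl⟩

theorem span_reeb_le (hn : 1 ≤ n) (hH : IsSmoothDistribution (4 * n) H)
    {F : LocalFrame H PQ g U} {F' : LocalFrame H PQ g U'} (hF : ReebOn F F.reeb U)
    (hx : x ∈ U) (hx' : x ∈ U') : Submodule.span ℝ (Set.range fun s => F'.reeb s x)
      ≤ Submodule.span ℝ (Set.range fun s => F.reeb s x) := by
  have h : (fun s => F'.reeb s x) = fun s => changeFields F' F.reeb s x :=
    funext fun s => ((hF.change hn hH F').eq_reeb hH s ⟨hx, hx'⟩).symm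
  rw [h]
  exact span_changeFields_le F' F.reeb x

/-- The complement of `H` spanned by the Reeb fields of all local frames. -/
theorem exists_reeb_complement (P : PqcStructure n M) (g : HMetric P.H) (hg : g ∈ P.metrics)
    (hn : 1 ≤ n) (hF : ∀ (U : Set M) (F : LocalFrame P.H P.PQ g U), ReebOn F F.reeb U) :
    ∃ C : Complement P.H, ∀ (U : Set M) (F : LocalFrame P.H P.PQ g U), C.SpannedBy U F.reeb := by
  choose O hO hF₀ using P.exists_frame g hg
  let Vx : SubspaceField n M := fun x =>
    Submodule.span ℝ (Set.range fun s => (hF₀ x).some.reeb s x)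
  have hV : ∀ (U : Set M) (F : LocalFrame P.H P.PQ g U), ∀ x ∈ U,
      Vx x = Submodule.span ℝ (Set.range fun s => F.reeb s x) := fun U F x hx =>
    le_antisymm (span_reeb_le hn P.smooth_H (hF _ _) hx (hO x))
      (span_reeb_le hn P.smooth_H (hF _ _) (hO x) hx)
  refine ⟨⟨Vx, fun x => ?_, fun x => ?_⟩, hV⟩
  · have hd := (hF _ (hF₀ x).some).toIsDual
    exact ⟨O x, hd.isOpen, hO x, (hF₀ x).some.reeb, hd.smooth, fun y hy =>
      ⟨hd.linearIndependent hy, (hV _ _ y hy).symm⟩⟩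
  · exact (hF _ (hF₀ x).some).toIsDual.isCompl (hO x)

theorem eq_reeb_complement (P : PqcStructure n M) (g : HMetric P.H) {C C' : Complement P.H}
    (hC : ∀ (U : Set M) (F : LocalFrame P.H P.PQ g U), C.SpannedBy U F.reeb)
    (hC' : P.IsReebComplement g C') : C' = C := by
  refine Complement.ext fun x => ?_
  obtain ⟨U, F, ξ, hx, hξ, hs⟩ := hC' x
  rw [hs x hx, hC U F x hx]
  simp only [((isReeb_iff P.smooth_H F ξ).1 hξ).eq_reeb P.smooth_H _ hx]

/-- Any complement is locally spanned by fields dual to the 1-forms of a frame. -/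
theorem Complement.exists_isDual (C : Complement H) (F : LocalFrame H PQ g U) (hx : x ∈ U) :
    ∃ (W : Set M) (ξ : Fin 3 → VField n M), x ∈ W ∧ IsDual F ξ W ∧ C.SpannedBy W ξ := by
  obtain ⟨O, hO, hxO, e, he, hsp⟩ := C.smooth_V x
  have hW : IsOpen (O ∩ U) := hO.inter F.isOpen
  have he' : ∀ a, SmoothVF (O ∩ U) (e a) := fun a => (he a).mono Set.inter_subset_left
  let A : M → Matrix (Fin 3) (Fin 3) ℝ := fun y => .of fun s a => F.η s y (e a y)
  have hA : ∀ s a, SmoothFun (n := n) (O ∩ U) fun y => A y s a := fun s a =>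
    F.smooth_η s _ hW Set.inter_subset_right _ (he' a)
  -- A kernel vector would give a nonzero combination of the e_a annihilated by all η_s, that is, a
  -- vector in the intersection of H and V.
  have hdet : ∀ y ∈ O ∩ U, IsUnit (A y).det := by
    intro y hy
    rw [← Matrix.isUnit_iff_isUnit_det, ← Matrix.mulVec_injective_iff_isUnit,
      ← Matrix.coe_mulVecLin, ← LinearMap.ker_eq_bot, LinearMap.ker_eq_bot']
    intro c hc
    have h1 : ∑ a, c a • e a y ∈ H y := by
      rw [F.mem_iff hy.2]
      intro s
      have := congrFun hc s
      simpa [A, Matrix.mulVec, dotProduct, mul_comm] using this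
    have h2 : ∑ a, c a • e a y ∈ C.V y := by
      rw [← (hsp y hy.1).2]; exact (Submodule.mem_span_range_iff_exists_fun ℝ).2 ⟨c, rfl⟩
    have h3 := Submodule.disjoint_def.1 (C.isCompl y).disjoint _ h1 h2
    exact funext (Fintype.linearIndependent_iff.1 (hsp y hy.1).1 c h3)
  let ξ : Fin 3 → VField n M := fun t y => ∑ a, (A y)⁻¹ a t • e a y
  have hξ : IsDual F ξ (O ∩ U) := by
    refine ⟨hW, Set.inter_subset_right, fun t => SmoothVF.sum fun a _ => SmoothVF.smul ?_ (he' a),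
      fun s t y hy => ?_⟩
    · exact SmoothFun.matrix_inv hA (fun y hy => (hdet y hy).ne_zero) a t
    · have := congr($(Matrix.mul_nonsing_inv (A y) (hdet y hy)) s t)
      rw [Matrix.mul_apply, Matrix.one_apply] at this
      simp only [ξ, map_sum, map_smul, smul_eq_mul, ← this]
      exact Finset.sum_congr rfl fun a _ => mul_comm _ _
  refine ⟨O ∩ U, ξ, ⟨hxO, hx⟩, hξ, fun y hy => (Submodule.eq_of_le_of_finrank_eq ?_ ?_).symm⟩
  · refine Submodule.span_le.2 ?_
    rintro _ ⟨s, rfl⟩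
    rw [← (hsp y hy.1).2]
    exact (Submodule.mem_span_range_iff_exists_fun ℝ).2 ⟨_, rfl⟩
  · rw [← (hsp y hy.1).2, finrank_span_eq_card (hsp y hy.1).1,
      finrank_span_eq_card (hξ.linearIndependent hy)]

end ReebComplement

/-! ### Commutators with the structure, and smooth fields of endomorphisms -/

section Algebra

variable {E : Type*} [AddCommGroup E] [Module ℝ E] [FiniteDimensional ℝ E]
  {g : LinearMap.BilinForm ℝ E} {I : Fin 3 → Module.End ℝ E}

theorem ParaQuat.coefPart_of_sub_commute [Nontrivial E] (h : ParaQuat g I) {A : Module.End ℝ E}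
    {p : Fin 3 → ℝ} (hA : ∀ i, (A - ∑ s, p s • I s) * I i = I i * (A - ∑ s, p s • I s))
    (s : Fin 3) : coefPart I s A = p s := by
  have h1 := h.coefPart_of_commute hA s
  rw [map_sub, sub_eq_zero] at h1
  simpa [h.coefPart_I] using h1

theorem ParaQuat.comm_of_sub_commute [Nontrivial E] (h : ParaQuat g I) {A : Module.End ℝ E}
    (hA : ∀ i, (A - ∑ s, coefPart I s A • I s) * I i = I i * (A - ∑ s, coefPart I s A • I s))
    (i : Fin 3) : A * I i - I i * A = (2 * eps (i + 2) * coefPart I (i + 1) A) • I (i + 2)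
      + (eps (i + 2) * (2 * eps i * coefPart I (i + 2) A)) • I (i + 1) := by
  have h1 := hA i
  rw [sub_mul, mul_sub] at h1
  have h2 := h.comm_I (fun s => coefPart I s A) i
  have h3 : A * I i - I i * A
      = (∑ s, coefPart I s A • I s) * I i - I i * ∑ s, coefPart I s A • I s := by
    rw [sub_eq_sub_iff_add_eq_add] at h1 ⊢
    rw [h1, add_comm]
  have h4 : eps (i + 2) * (2 * eps i * coefPart I (i + 2) A) = -(2 * eps (i + 1) * coefPart I (i + 2) A) := by
    fin_cases i <;> simp
  rw [h3, h2, h4, neg_smul, sub_eq_add_neg]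

theorem ParaQuat.spProj_sub_commute [Nontrivial E] (h : ParaQuat g I) (A : Module.End ℝ E) (i : Fin 3) :
    (spProj g h.nondeg I A - ∑ s, coefPart I s A • I s) * I i
      = I i * (spProj g h.nondeg I A - ∑ s, coefPart I s A • I s) := by
  rw [spProj_apply, add_sub_cancel_right, h.commute_commPart]

end Algebra

section SmoothEnd

variable {n : ℕ} {M : Type*} [TopologicalSpace M]
  [ChartedSpace (EuclideanSpace ℝ (Fin (4 * n + 3))) M] [IsManifold (𝓡 (4 * n + 3)) ∞ M]
  {H : SubspaceField n M} {PQ : Π x : M, Submodule ℝ (Module.End ℝ (H x))} {g : HMetric H}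
  {U U' W V : Set M} {x : M} {A B : Π x : M, Module.End ℝ (H x)}

theorem SmoothEnd.mono (hA : SmoothEnd W A) (h : V ⊆ W) : SmoothEnd V A :=
  fun O hO hOV => hA O hO (hOV.trans h)

theorem SmoothEnd.congr (hA : SmoothEnd W A) (h : ∀ y ∈ W, B y = A y) : SmoothEnd W B :=
  fun O hO hOW X hX => (hA O hO hOW X hX).congr fun y hy => by rw [h y (hOW hy)]

theorem SmoothEnd.add (hA : SmoothEnd W A) (hB : SmoothEnd W B) :
    SmoothEnd W (fun y => A y + B y) :=
  fun O hO hOW X hX => (hA O hO hOW X hX).add (hB O hO hOW X hX)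

theorem SmoothEnd.sub (hA : SmoothEnd W A) (hB : SmoothEnd W B) :
    SmoothEnd W (fun y => A y - B y) :=
  fun O hO hOW X hX => (hA O hO hOW X hX).sub (hB O hO hOW X hX)

theorem SmoothEnd.smul {f : M → ℝ} (hf : SmoothFun (n := n) W f) (hA : SmoothEnd W A) :
    SmoothEnd W (fun y => f y • A y) :=
  fun O hO hOW X hX => SmoothHF.smul (hf.mono hOW) (hA O hO hOW X hX)

theorem SmoothEnd.const_smul (c : ℝ) (hA : SmoothEnd W A) : SmoothEnd W (fun y => c • A y) :=
  SmoothEnd.smul (SmoothFun.const c) hA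

theorem SmoothEnd.sum {ι : Type*} {s : Finset ι} {A : ι → Π x : M, Module.End ℝ (H x)}
    (hA : ∀ i ∈ s, SmoothEnd W (A i)) : SmoothEnd W (fun y => ∑ i ∈ s, A i y) := by
  intro O hO hOW X hX
  refine (SmoothHF.sum (s := s) fun i hi => hA i hi O hO hOW X hX).congr fun y _ => ?_
  simp

theorem SmoothEnd.mul (hA : SmoothEnd W A) (hB : SmoothEnd W B) :
    SmoothEnd W (fun y => A y * B y) :=
  fun O hO hOW X hX => hA O hO hOW _ (hB O hO hOW X hX)

theorem SmoothEnd.adj (E : HFrame g W) (hA : SmoothEnd W A) :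
    SmoothEnd W (fun y => Pqc.adj (g.form y) (g.nondegenerate y) (A y)) := by
  intro O hO hOW X hX
  have h1 : SmoothHF O (fun y => ∑ a, g.form y (X y) (A y (E.f a y)) • E.e a y) :=
    SmoothHF.sum fun a _ => SmoothHF.smul
      (g.smoothFun hO hX (hA O hO hOW _ ((E.smooth_f a).mono hOW))) ((E.smooth_e a).mono hOW)
  refine h1.congr fun y hy => ?_
  rw [E.expand_e y (hOW hy) (Pqc.adj (g.form y) (g.nondegenerate y) (A y) (X y))]
  simp only [form_adj]

theorem HFrame.trace_eq (E : HFrame g W) (hx : x ∈ W) (A : Module.End ℝ (H x)) :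
    LinearMap.trace ℝ (H x) A = ∑ a, g.form x (A (E.e a x)) (E.f a x) := by
  have : A = ∑ a, ((g.form x).flip (E.f a x)).smulRight (A (E.e a x)) := by
    refine LinearMap.ext fun Y => ?_
    conv_lhs => rw [E.expand_e x hx Y]
    simp
  conv_lhs => rw [this]
  simp [LinearMap.trace_smulRight]

theorem SmoothEnd.trace (E : HFrame g W) (hW : IsOpen W) (hA : SmoothEnd W A) :
    SmoothFun (n := n) W (fun y => LinearMap.trace ℝ (H y) (A y)) :=
  SmoothFun.congr (SmoothFun.sum (s := Finset.univ) fun a _ =>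
    g.smoothFun hW (hA W hW subset_rfl _ (E.smooth_e a)) (E.smooth_f a))
    fun y hy => E.trace_eq hy (A y)

theorem SmoothEnd.skewPart (E : HFrame g W) (hA : SmoothEnd W A) :
    SmoothEnd W (fun y => Pqc.skewPart (g.form y) (g.nondegenerate y) (A y)) :=
  ((hA.sub (hA.adj E)).const_smul (1 / 2)).congr fun _ _ => skewPart_apply _ _ _

theorem SmoothEnd.symPart (E : HFrame g W) (hA : SmoothEnd W A) :
    SmoothEnd W (fun y => Pqc.symPart (g.form y) (g.nondegenerate y) (A y)) :=
  ((hA.add (hA.adj E)).const_smul (1 / 2)).congr fun _ _ => symPart_apply _ _ _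

theorem LocalFrame.smoothEnd_I (F : LocalFrame H PQ g U) (hW : W ⊆ U) (s : Fin 3) :
    SmoothEnd W (F.I s) := SmoothEnd.mono (F.smooth_I s) hW

theorem SmoothEnd.commPart (F : LocalFrame H PQ g U) (hW : W ⊆ U) (hA : SmoothEnd W A) :
    SmoothEnd W (fun y => Pqc.commPart (fun s => F.I s y) (A y)) := by
  have h1 := (hA.add (SmoothEnd.sum (s := Finset.univ) fun s _ => SmoothEnd.const_smul (eps s)
    (((F.smoothEnd_I hW s).mul hA).mul (F.smoothEnd_I hW s)))).const_smul (1 / 4)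
  refine h1.congr fun y _ => ?_
  simp [Pqc.commPart, mul_assoc]

theorem SmoothEnd.coefPart (hH : IsSmoothDistribution (4 * n) H) (E : HFrame g W) (hWo : IsOpen W)
    (F : LocalFrame H PQ g U) (hW : W ⊆ U)
    (hA : SmoothEnd W A) (s : Fin 3) :
    SmoothFun (n := n) W (fun y => Pqc.coefPart (fun s => F.I s y) s (A y)) := by
  refine SmoothFun.congr (SmoothFun.const_mul (eps s / (4 * n : ℕ))
    (SmoothEnd.trace E hWo ((F.smoothEnd_I hW s).mul hA))) fun y hy => ?_
  rw [coefPart_apply, finrank_horizontal hH]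

theorem SmoothEnd.spProj (hH : IsSmoothDistribution (4 * n) H) (E : HFrame g W) (hWo : IsOpen W)
    (F : LocalFrame H PQ g U) (hW : W ⊆ U) (hA : SmoothEnd W A) :
    SmoothEnd W (fun y => Pqc.spProj (g.form y) (g.nondegenerate y) (fun s => F.I s y) (A y)) := by
  refine (((hA.skewPart E).commPart F hW).add (SmoothEnd.sum (s := Finset.univ) fun s _ =>
    SmoothEnd.smul (SmoothEnd.coefPart hH E hWo F hW hA s) (F.smoothEnd_I hW s))).congr
    fun y _ => ?_
  rw [spProj_apply]

theorem SmoothEnd.smoothForm (g : HMetric H) (hA : SmoothEnd W A) :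
    SmoothForm W (fun y => (g.form y).comp (A y) LinearMap.id) :=
  fun O hO hOW X _ hX hY => g.smoothFun hO (hA O hO hOW X hX) hY

theorem SmoothEnd.of_locally (h : ∀ x ∈ W, ∃ O, IsOpen O ∧ x ∈ O ∧ SmoothEnd (W ∩ O) A) :
    SmoothEnd W A := by
  intro V hV hVW X hX
  refine SmoothHF.of_locally fun x hx => ?_
  obtain ⟨O, hO, hxO, hA⟩ := h x (hVW hx)
  exact ⟨O, hO, hxO, hA (V ∩ O) (hV.inter hO) (Set.inter_subset_inter_left _ hVW) X
    (hX.mono Set.inter_subset_left)⟩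

end SmoothEnd

/-! ### The canonical connection as a modification of an adapted one -/

section Canonical

variable {n : ℕ} {M : Type*} [TopologicalSpace M]
  [ChartedSpace (EuclideanSpace ℝ (Fin (4 * n + 3))) M] [IsManifold (𝓡 (4 * n + 3)) ∞ M]
  {H : SubspaceField n M} {PQ : Π x : M, Submodule ℝ (Module.End ℝ (H x))} {g : HMetric H}
  {U U' W V : Set M} {x : M}

/-- The horizontal part of the tensor by which the canonical connection differs from an adapted
connection. -/
def LocalFrame.conH (F : LocalFrame H PQ g U) (ξ : Fin 3 → VField n M) (D : Conn n M) (x : M) :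
    Tan n M x →ₗ[ℝ] Module.End ℝ (H x) :=
  -- In horizontal directions the contorsion removes the horizontal torsion. In the direction ξ_t,
  -- subtracting the sp(n, ℝ) ⊕ sp(1, ℝ) component of T(ξ_t, ·)_H leaves its orthogonal part.
  koszul (g.form x) (g.nondegenerate x) (F.torsE ξ D x ∘ₗ (H x).subtype) ∘ₗ F.hproj ξ x
    - ∑ t, (F.η t x).smulRight
      (spProj (g.form x) (g.nondegenerate x) (fun s => F.I s x) (F.torsE ξ D x (ξ t x)))

theorem LocalFrame.conH_apply (F : LocalFrame H PQ g U) (ξ : Fin 3 → VField n M) (D : Conn n M)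
    (x : M) (v : Tan n M x) : F.conH ξ D x v
      = koszul (g.form x) (g.nondegenerate x) (F.torsE ξ D x ∘ₗ (H x).subtype) (F.hproj ξ x v)
        - ∑ t, F.η t x v • spProj (g.form x) (g.nondegenerate x) (fun s => F.I s x)
          (F.torsE ξ D x (ξ t x)) := by
  simp [LocalFrame.conH]

/-- The connection 1-forms of the canonical connection. -/
def LocalFrame.con1 (F : LocalFrame H PQ g U) (ξ : Fin 3 → VField n M) (D : Conn n M) (s : Fin 3)
    (x : M) : Module.Dual ℝ (Tan n M x) :=
  -- The normalisation is the one for which [conH, I_i] = α_j I_k + ε_k α_k I_j, the factor 2 coming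
  -- from the commutators of the I_s.
  (2 * eps (s + 1)) • (coefPart (fun s => F.I s x) s ∘ₗ F.conH ξ D x)

theorem LocalFrame.con1_apply (F : LocalFrame H PQ g U) (ξ : Fin 3 → VField n M) (D : Conn n M)
    (s : Fin 3) (x : M) (v : Tan n M x) :
    F.con1 ξ D s x v = 2 * eps (s + 1) * coefPart (fun s => F.I s x) s (F.conH ξ D x v) := rfl

/-- The tensor by which the canonical connection differs from an adapted connection. -/
def LocalFrame.conT (F : LocalFrame H PQ g U) (ξ : Fin 3 → VField n M) (D : Conn n M) (x : M) :
    Tan n M x →ₗ[ℝ] Tan n M x →ₗ[ℝ] Tan n M x :=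
  -- On V the fields ξ_i are rotated with the same coefficients as the I_i are by commutation with
  -- `conH`; this keeps φ parallel.
  LinearMap.mk₂ ℝ (fun w v => (F.conH ξ D x v (F.hproj ξ x w) : Tan n M x)
    + ∑ i, F.η i x w • (F.con1 ξ D (i + 1) x v • ξ (i + 2) x
      + (eps (i + 2) * F.con1 ξ D (i + 2) x v) • ξ (i + 1) x))
    (fun w w' v => by
      simp only [map_add, Submodule.coe_add, add_smul, Finset.sum_add_distrib]; abel)
    (fun c w v => by
      simp only [map_smul, Submodule.coe_smul, smul_eq_mul, mul_smul, smul_add, Finset.smul_sum])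
    (fun w v v' => by
      simp only [map_add, LinearMap.add_apply, Submodule.coe_add, add_smul, smul_add, mul_add,
        Finset.sum_add_distrib]; abel)
    (fun c w v => by
      simp only [map_smul, LinearMap.smul_apply, Submodule.coe_smul, smul_eq_mul, mul_smul,
        smul_add, Finset.smul_sum]
      congr 1
      refine Finset.sum_congr rfl fun i _ => ?_
      module)

/-- The canonical connection, in terms of an adapted connection. -/
def LocalFrame.canon (F : LocalFrame H PQ g U) (ξ : Fin 3 → VField n M) (D : Conn n M) :
    Conn n M :=
  D.addOneForm fun x => LinearMap.toContinuousLinearMap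
    (LinearMap.toContinuousLinearMap.toLinearMap ∘ₗ F.conT ξ D x)

theorem LocalFrame.conT_apply (F : LocalFrame H PQ g U) (ξ : Fin 3 → VField n M) (D : Conn n M)
    (x : M) (w v : Tan n M x) : F.conT ξ D x w v = (F.conH ξ D x v (F.hproj ξ x w) : Tan n M x)
      + ∑ i, F.η i x w • (F.con1 ξ D (i + 1) x v • ξ (i + 2) x
        + (eps (i + 2) * F.con1 ξ D (i + 2) x v) • ξ (i + 1) x) :=
  LinearMap.mk₂_apply _ _ _ _

theorem LocalFrame.canon_apply (F : LocalFrame H PQ g U) (ξ : Fin 3 → VField n M) (D : Conn n M)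
    (Y : VField n M) (x : M) (v : Tan n M x) : F.canon ξ D Y x v
      = D Y x v + ((F.conH ξ D x v (F.hproj ξ x (Y x)) : Tan n M x)
        + ∑ i, F.η i x (Y x) • (F.con1 ξ D (i + 1) x v • ξ (i + 2) x
          + (eps (i + 2) * F.con1 ξ D (i + 2) x v) • ξ (i + 1) x)) := by
  rw [← F.conT_apply]
  rfl

/-- The canonical connection over an open subset of the domain of a local frame. -/
structure CanonOn (F : LocalFrame H PQ g U) (ξ : Fin 3 → VField n M) (W : Set M) (nab : Conn n M) :
    Prop extends Compat F ξ W nab where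
  tors_H : ∀ x ∈ W, ∀ X : H x, F.torsE ξ nab x X = 0
  perp : ∀ t, ∀ x ∈ W, spProj (g.form x) (g.nondegenerate x) (fun s => F.I s x)
    (F.torsE ξ nab x (ξ t x)) = 0

variable {F : LocalFrame H PQ g U} {ξ : Fin 3 → VField n M} {D : Conn n M}

theorem Adapted.smooth_torsE (hξ : IsDual F ξ W) (hD : Adapted F ξ W D) {X : VField n M}
    (hX : SmoothVF W X) : SmoothEnd W (fun y => F.torsE ξ D y (X y)) := by
  intro O hO hOW Y hY
  have hX' : SmoothVF O X := hX.mono hOW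
  have hY' : SmoothVF O Y.toVField := hY
  have h0 : SmoothVF O (fun y => D Y.toVField y (X y)) := hD.smooth O hO hOW X Y.toVField hX' hY'
  have h0' : SmoothVF O (fun y => D X y (Y.toVField y)) := hD.smooth O hO hOW Y.toVField X hY' hX'
  have h1 := SmoothVF.sub (SmoothVF.sub h0 h0') (hX'.bracket hO hY')
  refine (hξ.smooth_hproj hO hOW h1).congr fun y hy => ?_
  have e := tors_apply D (hX'.diffVF hO hy) (SmoothVF.diffVF hY' hO hy)
  change F.hproj ξ y (tors D y (X y) (Y.toVField y)) = _
  rw [e]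

theorem Adapted.smooth_conH (hH : IsSmoothDistribution (4 * n) H) (E : HFrame g W)
    (hξ : IsDual F ξ W) (hD : Adapted F ξ W D) {X : VField n M} (hX : SmoothVF W X) :
    SmoothEnd W (fun y => F.conH ξ D y (X y)) := by
  intro O hO hOW Y hY
  have hX' := hξ.smooth_hproj hξ.isOpen subset_rfl hX
  have h1 := hD.smooth_torsE hξ hX'
  have hDO : Adapted F ξ O D := ⟨fun s V hV h => hD.par_η s V hV (h.trans hOW),
    fun s x hx => hD.par_ξ s x (hOW hx), fun s V hV h => hD.par_I s V hV (h.trans hOW),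
    fun V hV h => hD.par_g V hV (h.trans hOW), fun V hV h => hD.smooth V hV (h.trans hOW)⟩
  have EO : HFrame g O := ⟨E.e, E.f, fun a => (E.smooth_e a).mono hOW,
    fun a => (E.smooth_f a).mono hOW, fun y hy => E.expand_e y (hOW hy),
    fun y hy => E.expand_f y (hOW hy), fun y hy => E.linInd y (hOW hy),
    fun y hy => E.dual y (hOW hy)⟩
  -- The third term of `koszul` exchanges the two arguments, so here the torsion is taken in the
  -- direction of the test field Y.
  have h2 := (hDO.smooth_torsE (hξ.mono hO hOW) hY).adj EO
  have h3 : ∀ t, SmoothEnd W (fun y => spProj (g.form y) (g.nondegenerate y) (fun s => F.I s y)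
      (F.torsE ξ D y (ξ t y))) := fun t =>
    SmoothEnd.spProj hH E hξ.isOpen F hξ.subset (hD.smooth_torsE hξ (hξ.smooth t))
  have h4 := SmoothHF.sub (SmoothHF.const_smul (1 / 2) (SmoothHF.add (SmoothHF.add
    (SmoothHF.neg (h1 O hO hOW Y hY)) (h1.adj E O hO hOW Y hY))
      (h2 O hO subset_rfl _ (hX'.mono hOW))))
    (SmoothHF.sum (s := Finset.univ) fun t _ => SmoothHF.smul
      (F.smooth_η t O hO (hOW.trans hξ.subset) X (hX.mono hOW)) (h3 t O hO hOW Y hY))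
  refine h4.congr fun y hy => ?_
  simp only [F.conH_apply, LinearMap.sub_apply, koszul_apply, LinearMap.comp_apply,
    Submodule.subtype_apply, LinearMap.sum_apply, LinearMap.smul_apply, HField.toVField]

theorem Adapted.smooth_con1 (hH : IsSmoothDistribution (4 * n) H) (E : HFrame g W)
    (hξ : IsDual F ξ W) (hD : Adapted F ξ W D) (s : Fin 3) {X : VField n M} (hX : SmoothVF W X) :
    SmoothFun (n := n) W (fun y => F.con1 ξ D s y (X y)) :=
  (SmoothEnd.coefPart hH E hξ.isOpen F hξ.subset (hD.smooth_conH hH E hξ hX) s).const_mul _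

theorem Adapted.smooth_canon (hH : IsSmoothDistribution (4 * n) H) (E : HFrame g W)
    (hξ : IsDual F ξ W) (hD : Adapted F ξ W D) {X Y : VField n M} (hX : SmoothVF W X)
    (hY : SmoothVF W Y) : SmoothVF W (fun y => F.canon ξ D Y y (X y)) := by
  have h1 := hD.smooth _ hξ.isOpen subset_rfl X Y hX hY
  have h2 := hD.smooth_conH hH E hξ hX _ hξ.isOpen subset_rfl _
    (hξ.smooth_hproj hξ.isOpen subset_rfl hY)
  have h3 : ∀ s, SmoothFun (n := n) W (fun y => F.con1 ξ D s y (X y)) := fun s =>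
    hD.smooth_con1 hH E hξ s hX
  have h4 := SmoothVF.sum (s := Finset.univ) fun i (_ : i ∈ Finset.univ) =>
    SmoothVF.smul (F.smooth_η i W hξ.isOpen hξ.subset Y hY)
      (SmoothVF.add (SmoothVF.smul (h3 (i + 1)) (hξ.smooth (i + 2)))
        (SmoothVF.smul (SmoothFun.const_mul (eps (i + 2)) (h3 (i + 2))) (hξ.smooth (i + 1))))
  exact (h1.add (SmoothVF.add h2 h4)).congr fun y _ => F.canon_apply ξ D Y y (X y)

end Canonical

/-! ### Endomorphisms normalising the paraquaternionic structure -/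

section Normalizing

variable {E : Type*} [AddCommGroup E] [Module ℝ E] [FiniteDimensional ℝ E]
  {g : LinearMap.BilinForm ℝ E} {I : Fin 3 → Module.End ℝ E}

/-- Endomorphisms whose difference with their projection to the span of the `I s` commutes with
the `I s`. -/
def normalizing (I : Fin 3 → Module.End ℝ E) : Submodule ℝ (Module.End ℝ E) :=
  ⨅ i, LinearMap.ker ((LinearMap.mulRight ℝ (I i) - LinearMap.mulLeft ℝ (I i))
    ∘ₗ (LinearMap.id - ∑ s, (coefPart I s).smulRight (I s)))

theorem mem_normalizing {A : Module.End ℝ E} : A ∈ normalizing I ↔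
    ∀ i, (A - ∑ s, coefPart I s A • I s) * I i = I i * (A - ∑ s, coefPart I s A • I s) := by
  simp only [normalizing, Submodule.mem_iInf, LinearMap.mem_ker, LinearMap.comp_apply,
    LinearMap.sub_apply, LinearMap.mulRight_apply, LinearMap.mulLeft_apply, LinearMap.id_apply,
    LinearMap.sum_apply, LinearMap.smulRight_apply, sub_eq_zero]

theorem ParaQuat.mem_normalizing_of_sub_commute [Nontrivial E] (h : ParaQuat g I)
    {A : Module.End ℝ E} {p : Fin 3 → ℝ}
    (hA : ∀ i, (A - ∑ s, p s • I s) * I i = I i * (A - ∑ s, p s • I s)) : A ∈ normalizing I := by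
  rw [mem_normalizing]
  simpa only [h.coefPart_of_sub_commute hA] using hA

theorem ParaQuat.spProj_mem_normalizing [Nontrivial E] (h : ParaQuat g I) (A : Module.End ℝ E) :
    spProj g h.nondeg I A ∈ normalizing I :=
  h.mem_normalizing_of_sub_commute (h.spProj_sub_commute A)

/-- A skew endomorphism that normalises the structure and is orthogonal to
`sp(n, ℝ) ⊕ sp(1, ℝ)` vanishes. -/
theorem ParaQuat.eq_zero_of_normalizing [Nontrivial E] (h : ParaQuat g I) {A : Module.End ℝ E}
    (hA : A ∈ normalizing I) (hs : adj g h.nondeg A = -A) (hp : spProj g h.nondeg I A = 0) :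
    A = 0 := by
  -- Such an A is a combination of the I_s plus a skew endomorphism commuting with them, so it
  -- belongs to sp(n, ℝ) ⊕ sp(1, ℝ), on which the projection is the identity.
  have h1 : spProj g h.nondeg I (A - ∑ s, coefPart I s A • I s) = A - ∑ s, coefPart I s A • I s := by
    refine h.spProj_of_skew_commute ?_ (mem_normalizing.1 hA)
    simp only [map_sub, map_sum, map_smul, hs, h.adj_I, smul_neg, Finset.sum_neg_distrib]
    abel
  have h2 : ∀ s, coefPart I s A = 0 := fun s => by
    rw [← h.coefPart_spProj, hp, map_zero]
  simpa [h2, hp] using h1.symm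

/-- The trace form is nondegenerate on sp(n, ℝ) and on the span of the I_s. Orthogonality thus
becomes the vanishing of a linear projection, which can be imposed by subtracting that projection.
-/
theorem ParaQuat.spProj_eq_zero_iff [Nontrivial E] (h : ParaQuat g I) (A : Module.End ℝ E) :
    spProj g h.nondeg I A = 0 ↔
      (∀ B : Module.End ℝ E, adj g h.nondeg B = -B → (∀ s, B * I s = I s * B) →
        LinearMap.trace ℝ E (B * A) = 0) ∧ ∀ s, LinearMap.trace ℝ E (I s * A) = 0 := by
  constructor
  · intro hA
    refine ⟨fun B hB hc => h.trace_mul_eq_zero_of_spProj hA hB hc, fun s => ?_⟩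
    have h1 := h.coefPart_spProj A s
    have hN : (Module.finrank ℝ E : ℝ) ≠ 0 := by
      exact_mod_cast (Module.finrank_pos (R := ℝ) (M := E)).ne'
    rw [hA, map_zero, coefPart_apply] at h1
    simpa [eps_ne_zero, hN] using h1.symm
  · rintro ⟨h1, h2⟩
    have h3 : ∀ s, coefPart I s A = 0 := fun s => by rw [coefPart_apply, h2, mul_zero]
    rw [spProj_apply]
    simp only [h3, zero_smul, Finset.sum_const_zero, add_zero]
    have hsk : adj g h.nondeg (commPart I (skewPart g h.nondeg A))
        = -commPart I (skewPart g h.nondeg A) := by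
      rw [h.adj_commPart, h.adj_skewPart, map_neg]
    refine h.eq_zero_of_trace_mul hsk (h.commute_commPart _) fun B hB hc => ?_
    rw [h.trace_mul_commPart, h.commPart_of_commute hc]
    have h4 := h1 B hB hc
    rw [← symPart_add_skewPart g h.nondeg A, mul_add, map_add,
      LinearMap.trace_mul_comm, h.trace_sym_mul_skew (h.adj_symPart A) hB, zero_add] at h4
    exact h4

theorem trace_neg_mul (A B : Module.End ℝ E) :
    LinearMap.trace ℝ E (-A * B) = -LinearMap.trace ℝ E (A * B) := by
  rw [neg_mul, map_neg]

theorem ParaQuat.apply_I_of_normalizing [Nontrivial E] (h : ParaQuat g I) {A : Module.End ℝ E}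
    (hA : A ∈ normalizing I) (i : Fin 3) (X : E) : A (I i X) = I i (A X)
      + ((2 * eps (i + 2) * coefPart I (i + 1) A) • I (i + 2) X
        + (eps (i + 2) * (2 * eps i * coefPart I (i + 2) A)) • I (i + 1) X) := by
  have h1 := congr($(h.comm_of_sub_commute (mem_normalizing.1 hA) i) X)
  simp only [LinearMap.sub_apply, Module.End.mul_apply, LinearMap.add_apply,
    LinearMap.smul_apply] at h1
  rw [sub_eq_iff_eq_add] at h1
  rw [h1, add_comm]

end Normalizing

/-! ### The modified connection is canonical over its frame -/

section Canonical

variable {n : ℕ} {M : Type*} [TopologicalSpace M]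
  [ChartedSpace (EuclideanSpace ℝ (Fin (4 * n + 3))) M] [IsManifold (𝓡 (4 * n + 3)) ∞ M]
  {H : SubspaceField n M} {PQ : Π x : M, Submodule ℝ (Module.End ℝ (H x))} {g : HMetric H}
  {U U' W V : Set M} {x : M}

/-- The inner product ⟨A, B⟩ is tr(B* A), and B* = -B on both summands; what is left is the trace
criterion `ParaQuat.spProj_eq_zero_iff`. -/
theorem LocalFrame.inPerp_iff (hn : 1 ≤ n) (hH : IsSmoothDistribution (4 * n) H)
    (F : LocalFrame H PQ g U) (hx : x ∈ U) (A : Module.End ℝ (H x)) :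
    InPerp g PQ x A ↔ spProj (g.form x) (g.nondegenerate x) (fun s => F.I s x) A = 0 := by
  have := nontrivial_horizontal hn hH x
  have h := F.paraQuat hx
  have hend : ∀ B : Module.End ℝ (H x), g.endInner x A B
      = LinearMap.trace ℝ (H x) (adj (g.form x) (g.nondegenerate x) B * A) :=
    fun B => contraction_comp (g.nondegenerate x) A B
  have hspn : ∀ B : Module.End ℝ (H x), B ∈ spn g PQ x ↔
      adj (g.form x) (g.nondegenerate x) B = -B ∧ ∀ s, B * F.I s x = F.I s x * B := by
    intro B
    rw [spn, Set.mem_ofPred_eq, ← h.form_skew_iff]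
    refine and_congr Iff.rfl ⟨fun hB s => hB _ ?_, fun hB D hD => ?_⟩
    · rw [F.span_I x hx]; exact Submodule.subset_span ⟨s, rfl⟩
    · rw [F.span_I x hx] at hD
      obtain ⟨c, rfl⟩ := (Submodule.mem_span_range_iff_exists_fun ℝ).1 hD
      simp only [Finset.mul_sum, Finset.sum_mul, mul_smul_comm, smul_mul_assoc, hB]
  rw [h.spProj_eq_zero_iff]
  constructor
  · intro hA
    refine ⟨fun B hB hc => ?_, fun s => ?_⟩
    · have h1 := hA B ((hspn B).2 ⟨hB, hc⟩) 0 (Submodule.zero_mem _)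
      rw [add_zero, hend, hB, trace_neg_mul, neg_eq_zero] at h1
      exact h1
    · have h1 := hA 0 ((hspn 0).2 (by simp)) (F.I s x)
        (by rw [F.span_I x hx]; exact Submodule.subset_span ⟨s, rfl⟩)
      rw [zero_add, hend, h.adj_I, trace_neg_mul, neg_eq_zero] at h1
      exact h1
  · rintro ⟨h1, h2⟩ B hB D hD
    rw [F.span_I x hx] at hD
    obtain ⟨c, rfl⟩ := (Submodule.mem_span_range_iff_exists_fun ℝ).1 hD
    obtain ⟨hB1, hB2⟩ := (hspn B).1 hB
    rw [hend, map_add, hB1, map_sum]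
    simp only [map_smul, h.adj_I, add_mul, Finset.sum_mul, smul_mul_assoc, map_add, trace_neg_mul,
      map_sum, h1 B hB1 hB2, h2, neg_zero, smul_zero, Finset.sum_const_zero, add_zero]

variable {F : LocalFrame H PQ g U} {ξ : Fin 3 → VField n M} {D : Conn n M}

/-- The Reeb condition is exactly the symmetry that `ParaQuat.koszul_commute` requires of the forms
dη_s(ξ_t, ·), and the horizontal Bianchi identity is its cyclic hypothesis. -/
theorem Adapted.koszul_commute (hn : 1 ≤ n) (hH : IsSmoothDistribution (4 * n) H)
    (hξ : ReebOn F ξ W) (hD : Adapted F ξ W D) (hx : x ∈ W) (i : Fin 3) (X : H x) :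
    (koszul (g.form x) (g.nondegenerate x) (F.torsE ξ D x ∘ₗ (H x).subtype) X
      - ∑ s, (eps (s + 1) / 2 * extT (F.η (s + 1)) x (ξ (s + 2) x) X) • F.I s x) * F.I i x
      = F.I i x * (koszul (g.form x) (g.nondegenerate x) (F.torsE ξ D x ∘ₗ (H x).subtype) X
      - ∑ s, (eps (s + 1) / 2 * extT (F.η (s + 1)) x (ξ (s + 2) x) X) • F.I s x) := by
  have := nontrivial_horizontal hn hH x
  exact (F.paraQuat (hξ.subset hx)).koszul_commute (t := F.torsE ξ D x ∘ₗ (H x).subtype)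
    (a := fun s t => extT (F.η s) x (ξ t x) ∘ₗ (H x).subtype) (F.torsE_swap _ _ _)
    (fun s u => LinearMap.ext fun Y => hξ.reeb s u x hx Y)
    (hD.cyclic hξ.toIsDual hH hx) i X

theorem Adapted.conH_mem (hn : 1 ≤ n) (hH : IsSmoothDistribution (4 * n) H)
    (hξ : ReebOn F ξ W) (hD : Adapted F ξ W D) (hx : x ∈ W) (v : Tan n M x) :
    F.conH ξ D x v ∈ normalizing fun s => F.I s x := by
  have := nontrivial_horizontal hn hH x
  have h := F.paraQuat (hξ.subset hx)
  rw [F.conH_apply]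
  refine Submodule.sub_mem _ (h.mem_normalizing_of_sub_commute fun i =>
    hD.koszul_commute hn hH hξ hx i _) (Submodule.sum_mem _ fun t _ => Submodule.smul_mem _ _ ?_)
  exact h.spProj_mem_normalizing _

theorem Adapted.conH_I (hn : 1 ≤ n) (hH : IsSmoothDistribution (4 * n) H)
    (hξ : ReebOn F ξ W) (hD : Adapted F ξ W D) (hx : x ∈ W) (v : Tan n M x) (i : Fin 3) (X : H x) :
    F.conH ξ D x v (F.I i x X) = F.I i x (F.conH ξ D x v X)
      + (F.con1 ξ D (i + 1) x v • F.I (i + 2) x X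
        + (eps (i + 2) * F.con1 ξ D (i + 2) x v) • F.I (i + 1) x X) := by
  have := nontrivial_horizontal hn hH x
  have h1 := (F.paraQuat (hξ.subset hx)).apply_I_of_normalizing (hD.conH_mem hn hH hξ hx v) i X
  have e1 : i + 1 + 1 = i + 2 := by fin_cases i <;> rfl
  have e2 : i + 2 + 1 = i := by fin_cases i <;> rfl
  rw [F.con1_apply, F.con1_apply, e1, e2]
  exact h1

theorem Adapted.coefPart_conH (hn : 1 ≤ n) (hH : IsSmoothDistribution (4 * n) H)
    (hξ : ReebOn F ξ W) (hD : Adapted F ξ W D) (hx : x ∈ W) (s : Fin 3) (v : Tan n M x) :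
    coefPart (fun s => F.I s x) s (F.conH ξ D x v)
      = eps (s + 1) / 2 * extT (F.η (s + 1)) x (ξ (s + 2) x) (F.hproj ξ x v)
        - ∑ t, F.η t x v * coefPart (fun s => F.I s x) s (F.torsE ξ D x (ξ t x)) := by
  have := nontrivial_horizontal hn hH x
  have h := F.paraQuat (hξ.subset hx)
  rw [F.conH_apply, map_sub, map_sum, h.coefPart_of_sub_commute
    (fun i => hD.koszul_commute hn hH hξ hx i _)]
  congr 1
  exact Finset.sum_congr rfl fun t _ => by rw [map_smul, h.coefPart_spProj, smul_eq_mul]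

theorem Adapted.con1_eq (hn : 1 ≤ n) (hH : IsSmoothDistribution (4 * n) H)
    (hξ : ReebOn F ξ W) (hD : Adapted F ξ W D) (hx : x ∈ W) (s : Fin 3) (v : Tan n M x) :
    F.con1 ξ D s x v = extT (F.η (s + 1)) x (ξ (s + 2) x) (F.hproj ξ x v)
        - 2 * eps (s + 1) * ∑ t, F.η t x v * coefPart (fun s => F.I s x) s
          (F.torsE ξ D x (ξ t x)) := by
  rw [F.con1_apply, hD.coefPart_conH hn hH hξ hx]
  linear_combination extT (F.η (s + 1)) x (ξ (s + 2) x) (F.hproj ξ x v) * eps_mul_self (s + 1)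

theorem Adapted.conH_skew (hξ : IsDual F ξ W) (hx : x ∈ W) (v : Tan n M x) (X Y : H x) :
    g.form x (F.conH ξ D x v X) Y = -g.form x X (F.conH ξ D x v Y) := by
  have h := F.paraQuat (hξ.subset hx)
  have h1 := h.koszul_skew (t := F.torsE ξ D x ∘ₗ (H x).subtype) (F.torsE_swap _ _ _)
    (F.hproj ξ x v) X Y
  have h2 := fun t => h.form_skew_iff.2 (h.adj_spProj (F.torsE ξ D x (ξ t x))) X Y
  simp only [F.conH_apply, LinearMap.sub_apply, map_sub, LinearMap.sum_apply, map_sum,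
    LinearMap.smul_apply, map_smul, smul_eq_mul, h1, h2, mul_neg, Finset.sum_neg_distrib]
  ring

theorem LocalFrame.conH_horizontal (hξ : IsDual F ξ W) (hx : x ∈ W) (X : H x) :
    F.conH ξ D x X
      = koszul (g.form x) (g.nondegenerate x) (F.torsE ξ D x ∘ₗ (H x).subtype) X := by
  rw [F.conH_apply, hξ.hproj_coe hx]
  simp [F.η_coe (hξ.subset hx)]

theorem LocalFrame.conH_ξ (hξ : IsDual F ξ W) (hx : x ∈ W) (t : Fin 3) :
    F.conH ξ D x (ξ t x)
      = -spProj (g.form x) (g.nondegenerate x) (fun s => F.I s x) (F.torsE ξ D x (ξ t x)) := by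
  rw [F.conH_apply, hξ.hproj_ξ hx]
  simp [hξ.dual _ _ x hx]

theorem LocalFrame.conT_ξ (hξ : IsDual F ξ W) (hx : x ∈ W) (i : Fin 3) (v : Tan n M x) :
    F.conT ξ D x (ξ i x) v = F.con1 ξ D (i + 1) x v • ξ (i + 2) x
      + (eps (i + 2) * F.con1 ξ D (i + 2) x v) • ξ (i + 1) x := by
  rw [F.conT_apply, hξ.hproj_ξ hx]
  simp [hξ.dual _ _ x hx, Finset.sum_add_distrib]

theorem LocalFrame.conT_horizontal (hξ : IsDual F ξ W) (hx : x ∈ W) (Y : H x) (v : Tan n M x) :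
    F.conT ξ D x Y v = (F.conH ξ D x v Y : Tan n M x) := by
  rw [F.conT_apply, hξ.hproj_coe hx]
  simp [F.η_coe (hξ.subset hx)]

theorem Adapted.canon_horizontal (hξ : IsDual F ξ W) (hV : V ⊆ W) (Y : HField H)
    (hx : x ∈ V) (v : Tan n M x) : F.canon ξ D Y.toVField x v
      = D Y.toVField x v + (F.conH ξ D x v (Y x) : Tan n M x) := by
  rw [F.canon_apply, ← F.conT_apply, HField.toVField, F.conT_horizontal hξ (hV hx)]

theorem Adapted.canon_ξ (hξ : IsDual F ξ W) (hD : Adapted F ξ W D) (hx : x ∈ W) (i : Fin 3)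
    (v : Tan n M x) : F.canon ξ D (ξ i) x v = F.con1 ξ D (i + 1) x v • ξ (i + 2) x
          + (eps (i + 2) * F.con1 ξ D (i + 2) x v) • ξ (i + 1) x := by
  rw [F.canon_apply, ← F.conT_apply, hD.par_ξ i x hx, F.conT_ξ hξ hx, zero_add]

theorem IsDual.sum_η_pair (hξ : IsDual F ξ W) (hx : x ∈ W) (i : Fin 3) (p q : ℝ) (Z : Fin 3 → H x) :
    ∑ s, F.η s x (p • ξ (i + 2) x + q • ξ (i + 1) x) • Z s = p • Z (i + 2) + q • Z (i + 1) := by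
  simp [hξ.dual _ _ x hx, add_smul, Finset.sum_add_distrib, ite_smul]

theorem LocalFrame.tors_canon (F : LocalFrame H PQ g U) (ξ : Fin 3 → VField n M) (D : Conn n M)
    (x : M) (u v : Tan n M x) : tors (F.canon ξ D) x u v
      = tors D x u v + F.conT ξ D x v u - F.conT ξ D x u v := by
  obtain ⟨V, X, hV, hxV, hX, rfl⟩ := exists_smooth_extend x u
  obtain ⟨V', Y, hV', hxV', hY, rfl⟩ := exists_smooth_extend x v
  have hX' := hX.diffVF hV hxV
  have hY' := hY.diffVF hV' hxV'
  rw [tors_apply _ hX' hY', tors_apply _ hX' hY', F.canon_apply, F.canon_apply, ← F.conT_apply,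
    ← F.conT_apply]
  abel

theorem LocalFrame.torsE_canon_ξ (hξ : IsDual F ξ W) (hx : x ∈ W) (t : Fin 3) :
    F.torsE ξ (F.canon ξ D) x (ξ t x) = F.torsE ξ D x (ξ t x)
      - spProj (g.form x) (g.nondegenerate x) (fun s => F.I s x) (F.torsE ξ D x (ξ t x)) := by
  refine LinearMap.ext fun Y => ?_
  rw [F.torsE_apply, F.tors_canon, F.conT_ξ hξ hx, F.conT_horizontal hξ hx, F.conH_ξ hξ hx]
  simp only [map_add, map_sub, map_smul, hξ.hproj_coe hx, hξ.hproj_ξ hx, smul_zero, add_zero,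
    sub_zero, LinearMap.neg_apply, LinearMap.sub_apply, F.torsE_apply, ← sub_eq_add_neg]

/-- Each clause rests on one ingredient of the added tensor: skewness of `conH` keeps g parallel,
`conH_I` lets the I_i move as the ξ_i do, the contorsion cancels the horizontal torsion, and
idempotence of `spProj` makes the mixed torsion orthogonal. -/
theorem Adapted.canonOn (hn : 1 ≤ n) (hH : IsSmoothDistribution (4 * n) H) (hξ : ReebOn F ξ W)
    (hD : Adapted F ξ W D) : CanonOn F ξ W (F.canon ξ D) where
  pres_H V hV hVW Y hY x hx v s := by
    rw [Adapted.canon_horizontal hξ.toIsDual hVW Y hx, map_add,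
      (hD.compat hξ.subset).pres_H V hV hVW Y hY x hx, F.η_coe (hξ.subset (hVW hx)), add_zero]
  pres_g V hV hVW Y Z hY hZ x hx v := by
    rw [Adapted.canon_horizontal hξ.toIsDual hVW Y hx, Adapted.canon_horizontal hξ.toIsDual hVW Z hx,
      hD.par_g V hV hVW Y Z hY hZ x hx]
    simp only [map_add, LinearMap.add_apply, hξ.toIsDual.hproj_coe (hVW hx)]
    rw [Adapted.conH_skew hξ.toIsDual (hVW hx)]
    ring
  cov_I i V hV hVW Y hY x hx v := by
    rw [Adapted.canon_horizontal hξ.toIsDual hVW _ hx, Adapted.canon_horizontal hξ.toIsDual hVW Y hx,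
      map_add, map_add, hD.par_I i V hV hVW Y hY x hx, hξ.toIsDual.hproj_coe (hVW hx),
      hξ.toIsDual.hproj_coe (hVW hx), Adapted.canon_ξ hξ.toIsDual hD (hVW hx),
      hξ.toIsDual.sum_η_pair (hVW hx) i _ _ (fun s => F.I s x (Y x)), map_add, add_assoc,
      hD.conH_I hn hH hξ (hVW hx)]
  cov_ξ i x hx v := by
    rw [Adapted.canon_ξ hξ.toIsDual hD hx]
    simp [hξ.toIsDual.hproj_ξ hx]
  tors_H x hx X := by
    refine LinearMap.ext fun Y => ?_
    have h := F.paraQuat (hξ.subset hx)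
    rw [F.torsE_apply, F.tors_canon, F.conT_horizontal hξ.toIsDual hx,
      F.conT_horizontal hξ.toIsDual hx, map_sub, map_add, hξ.toIsDual.hproj_coe hx,
      hξ.toIsDual.hproj_coe hx, F.conH_horizontal hξ.toIsDual hx, F.conH_horizontal hξ.toIsDual hx,
      add_sub_assoc, h.koszul_sub (t := F.torsE ξ D x ∘ₗ (H x).subtype) (F.torsE_swap _ _ _)]
    exact add_neg_cancel _
  perp t x hx := by
    have := nontrivial_horizontal hn hH x
    rw [F.torsE_canon_ξ hξ.toIsDual hx, map_sub, (F.paraQuat (hξ.subset hx)).spProj_spProj, sub_self]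

end Canonical

/-! ### Uniqueness of the canonical connection -/

section Uniqueness

variable {n : ℕ} {M : Type*} [TopologicalSpace M]
  [ChartedSpace (EuclideanSpace ℝ (Fin (4 * n + 3))) M] [IsManifold (𝓡 (4 * n + 3)) ∞ M]
  {H : SubspaceField n M} {PQ : Π x : M, Submodule ℝ (Module.End ℝ (H x))} {g : HMetric H}
  {U U' W W' V : Set M} {x : M} {nab nab' : Conn n M} {X Y Z : VField n M}

theorem cov_smul {f : M → ℝ} (nab : Conn n M) (hf : DiffFun (n := n) f x) (hY : DiffVF Y x)
    (v : Tan n M x) : nab (fun y => f y • Y y) x v = f x • nab Y x v + dirD f x v • Y x :=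
  congr($(nab.isCovariantDerivativeOnUniv.leibniz hY hf trivial) v)

theorem cov_add (nab : Conn n M) (hY : DiffVF Y x) (hZ : DiffVF Z x) (v : Tan n M x) :
    nab (fun y => Y y + Z y) x v = nab Y x v + nab Z x v :=
  congr($(nab.isCovariantDerivativeOnUniv.add hY hZ trivial) v)

theorem cov_zero (nab : Conn n M) (v : Tan n M x) : nab (fun _ => 0) x v = 0 := by
  have := congr($(nab.zero) x v)
  exact this

theorem cov_sum {ι : Type*} {s : Finset ι} {Y : ι → VField n M} (nab : Conn n M)
    (hY : ∀ i ∈ s, DiffVF (Y i) x) (v : Tan n M x) :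
    nab (fun y => ∑ i ∈ s, Y i y) x v = ∑ i ∈ s, nab (Y i) x v := by
  classical
  induction s using Finset.induction_on with
  | empty => simpa using cov_zero nab v
  | insert a s ha ih =>
    simp only [Finset.sum_insert ha]
    rw [cov_add nab (hY a (by simp)) (DiffVF.sum fun i hi => hY i (by simp [hi])),
      ih fun i hi => hY i (by simp [hi])]

theorem cov_congr (nab : Conn n M) (hY : DiffVF Y x) (h : ∀ᶠ y in nhds x, Z y = Y y)
    (v : Tan n M x) : nab Z x v = nab Y x v :=
  congr($(nab.isCovariantDerivativeOnUniv.congr_of_eventuallyEq (hY.congr h) hY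
    Filter.univ_mem h) v)

theorem tors_sub (nab nab' : Conn n M) (u v : Tan n M x) : tors nab x u v - tors nab' x u v
    = nab.difference nab' x v u - nab.difference nab' x u v := by
  obtain ⟨V, X, hV, hxV, hX, rfl⟩ := exists_smooth_extend x u
  obtain ⟨V', Y, hV', hxV', hY, rfl⟩ := exists_smooth_extend x v
  have hX' := hX.diffVF hV hxV
  have hY' := hY.diffVF hV' hxV'
  have e : ∀ {Z : VField n M}, DiffVF Z x → nab.difference nab' x (Z x) = nab Z x - nab' Z x :=
    fun hZ => IsCovariantDerivativeOn.difference_apply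
      nab.isCovariantDerivativeOnUniv nab'.isCovariantDerivativeOnUniv (Set.mem_univ x) hZ
  rw [tors_apply _ hX' hY', tors_apply _ hX' hY', e hX', e hY', sub_apply,
    sub_apply]
  abel

theorem difference_apply (nab nab' : Conn n M) (hZ : DiffVF Z x) (v : Tan n M x) :
    nab.difference nab' x (Z x) v = nab Z x v - nab' Z x v := by
  have : nab.difference nab' x (Z x) = nab Z x - nab' Z x :=
    IsCovariantDerivativeOn.difference_apply
      nab.isCovariantDerivativeOnUniv nab'.isCovariantDerivativeOnUniv (Set.mem_univ x) hZ
  rw [this, sub_apply]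

variable {F : LocalFrame H PQ g U} {ξ : Fin 3 → VField n M}

/-- The canonical connection is unique. -/
theorem CanonOn.unique (hn : 1 ≤ n) (hH : IsSmoothDistribution (4 * n) H) (hξ : IsDual F ξ W)
    (h1 : CanonOn F ξ W nab) (h2 : CanonOn F ξ W nab') (hx : x ∈ W) (hY : DiffVF Y x)
    (v : Tan n M x) : nab Y x v = nab' Y x v := by
  have := nontrivial_horizontal hn hH x
  have h := F.paraQuat (hξ.subset hx)
  -- The horizontal action of the difference tensor. It is skew because both connections are metric,
  -- and it normalises the structure because each of them rotates the I_i within their span.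
  let B : Tan n M x →ₗ[ℝ] Module.End ℝ (H x) :=
    LinearMap.mk₂ ℝ (fun v Y => F.hproj ξ x (nab.difference nab' x Y v)) (by simp) (by simp)
      (by simp) (by simp)
  have hB : ∀ v (Y : H x), B v Y = F.hproj ξ x (nab.difference nab' x Y v) := fun v Y => rfl
  have key : ∀ {O : Set M} (hO : IsOpen O) (hx : x ∈ O) {Y : HField H} (hY : SmoothHF O Y) v,
      B v (Y x) = F.hproj ξ x (nab Y.toVField x v) - F.hproj ξ x (nab' Y.toVField x v) := by
    intro O hO hx Y hY v
    rw [hB, ← map_sub, ← difference_apply nab nab' (SmoothVF.diffVF hY hO hx)]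
    rfl
  have hdξ : ∀ i v, nab.difference nab' x (ξ i x) v = nab (ξ i) x v - nab' (ξ i) x v := fun i v =>
    difference_apply nab nab' ((hξ.smooth i).diffVF hξ.isOpen hx) v
  have hskew : ∀ v (Y Z : H x), g.form x (B v Y) Z = -g.form x Y (B v Z) := by
    intro v Y Z
    obtain ⟨O₁, Y', hO₁, hx₁, hY', rfl⟩ := exists_horizontal_extend hH g x Y
    obtain ⟨O₂, Z', hO₂, hx₂, hZ', rfl⟩ := exists_horizontal_extend hH g x Z
    have hO : IsOpen (O₁ ∩ O₂ ∩ W) := (hO₁.inter hO₂).inter hξ.isOpen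
    have hY'' : SmoothHF (O₁ ∩ O₂ ∩ W) Y' := hY'.mono fun y hy => hy.1.1
    have hZ'' : SmoothHF (O₁ ∩ O₂ ∩ W) Z' := hZ'.mono fun y hy => hy.1.2
    have p1 := h1.pres_g _ hO Set.inter_subset_right Y' Z' hY'' hZ'' x ⟨⟨hx₁, hx₂⟩, hx⟩ v
    have p2 := h2.pres_g _ hO Set.inter_subset_right Y' Z' hY'' hZ'' x ⟨⟨hx₁, hx₂⟩, hx⟩ v
    rw [key hO₁ hx₁ hY', key hO₂ hx₂ hZ', map_sub, map_sub, LinearMap.sub_apply]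
    linarith
  have hcomm : ∀ v i, B v * F.I i x - F.I i x * B v
      = ∑ s, F.η s x (nab.difference nab' x (ξ i x) v) • F.I s x := by
    intro v i
    refine LinearMap.ext fun Y => ?_
    obtain ⟨O₁, Y', hO₁, hx₁, hY', rfl⟩ := exists_horizontal_extend hH g x Y
    have hO : IsOpen (O₁ ∩ W) := hO₁.inter hξ.isOpen
    have hY'' : SmoothHF (O₁ ∩ W) Y' := hY'.mono Set.inter_subset_left
    have hxO : x ∈ O₁ ∩ W := ⟨hx₁, hx⟩
    have hIY : SmoothHF (O₁ ∩ W) (fun y => F.I i y (Y' y)) :=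
      F.smooth_I i _ hO (Set.inter_subset_right.trans hξ.subset) _ hY''
    have p1 := h1.cov_I i _ hO Set.inter_subset_right Y' hY'' x hxO v
    have p2 := h2.cov_I i _ hO Set.inter_subset_right Y' hY'' x hxO v
    have k1 := key hO hxO hIY v
    have k2 := key hO hxO hY'' v
    rw [p1, p2] at k1
    simp only [LinearMap.sub_apply, Module.End.mul_apply, LinearMap.sum_apply,
      LinearMap.smul_apply, hdξ, map_sub, sub_smul, Finset.sum_sub_distrib]
    rw [k1, k2, map_sub]
    abel
  have hnorm : ∀ v, B v ∈ normalizing fun s => F.I s x := fun v =>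
    mem_normalizing.2 (h.commute_of_normalizes (hcomm v))
  have hdvξ : ∀ i v, F.hproj ξ x (nab.difference nab' x (ξ i x) v) = 0 := fun i v => by
    rw [hdξ, map_sub, h1.cov_ξ i x hx, h2.cov_ξ i x hx, sub_zero]
  -- Both horizontal torsions vanish, so B X Y is symmetric in X and Y, while g(B X Y, Z) is skew in
  -- Y and Z.
  have hB0 : ∀ X : H x, B X = 0 := fun X => by
    refine LinearMap.ext fun Y => ?_
    refine h.eq_zero_of_skew_of_symm (D := fun X Y => B X Y) (fun X Y Z => hskew X Y Z)
      (fun X Y => ?_) X Y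
    have t1 := congr($(h1.tors_H x hx X) Y)
    have t2 := congr($(h2.tors_H x hx X) Y)
    rw [F.torsE_apply, LinearMap.zero_apply] at t1 t2
    have t3 := congr(F.hproj ξ x $(tors_sub nab nab' (X : Tan n M x) (Y : Tan n M x)))
    rw [map_sub, map_sub, t1, t2, sub_zero] at t3
    exact (sub_eq_zero.1 t3.symm)
  -- Since ∇ξ_t has no horizontal part for either connection, B(ξ_t) is the difference of two
  -- torsion endomorphisms orthogonal to sp(n, ℝ) ⊕ sp(1, ℝ). As a skew normalising endomorphism it
  -- also belongs to that algebra.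
  have hB1 : ∀ t, B (ξ t x) = 0 := fun t => by
    refine h.eq_zero_of_normalizing (hnorm _) (h.form_skew_iff.1 (hskew _)) ?_
    have : B (ξ t x) = F.torsE ξ nab x (ξ t x) - F.torsE ξ nab' x (ξ t x) := by
      refine LinearMap.ext fun Y => ?_
      rw [LinearMap.sub_apply, F.torsE_apply, F.torsE_apply, ← map_sub, tors_sub, map_sub, hdvξ,
        sub_zero, hB]
    rw [this, map_sub, h1.perp t x hx, h2.perp t x hx, sub_zero]
  have hB2 : B v = 0 := by
    rw [hξ.decomp hx v, map_add, hB0, map_sum, zero_add]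
    simp [hB1]
  -- The action of the difference tensor on ξ_i has the same coefficients as the commutator [B v,
  -- I_i], which is now zero.
  have hη : ∀ i s, F.η s x (nab.difference nab' x (ξ i x) v) = 0 := by
    intro i s
    have c1 := hcomm v i
    rw [hB2, zero_mul, mul_zero, sub_zero] at c1
    have c2 := congr(coefPart (fun s => F.I s x) s $c1)
    rw [map_zero, map_sum] at c2
    simpa [h.coefPart_I] using c2.symm
  have z1 : ∀ X : H x, nab.difference nab' x X v = 0 := by
    intro X
    obtain ⟨O₁, X', hO₁, hx₁, hX', rfl⟩ := exists_horizontal_extend hH g x X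
    have hO : IsOpen (O₁ ∩ W) := hO₁.inter hξ.isOpen
    have hX'' : SmoothHF (O₁ ∩ W) X' := hX'.mono Set.inter_subset_left
    have e1 : nab.difference nab' x (X' x) v = nab X'.toVField x v - nab' X'.toVField x v :=
      difference_apply nab nab' (SmoothVF.diffVF hX' hO₁ hx₁) v
    have e2 : ∀ s, F.η s x (nab.difference nab' x (X' x) v) = 0 := fun s => by
      rw [e1, map_sub, h1.pres_H _ hO Set.inter_subset_right X' hX'' x ⟨hx₁, hx⟩,
        h2.pres_H _ hO Set.inter_subset_right X' hX'' x ⟨hx₁, hx⟩, sub_zero]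
    have e3 := hξ.eq_coe_hproj hx e2
    have e4 : F.hproj ξ x (nab.difference nab' x (X' x) v) = 0 := by
      rw [← hB, hB2, LinearMap.zero_apply]
    rw [e4] at e3
    exact e3
  have z2 : ∀ i, nab.difference nab' x (ξ i x) v = 0 := fun i => by
    rw [hξ.eq_coe_hproj hx (hη i), hdvξ]; rfl
  let E : Tan n M x →ₗ[ℝ] Tan n M x :=
    { toFun := fun Y => nab.difference nab' x Y v
      map_add' := fun _ _ => by simp
      map_smul' := fun _ _ => by simp }
  have hE : E (Y x) = 0 := by
    rw [hξ.decomp hx (Y x), map_add, map_sum]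
    have z3 : E (F.hproj ξ x (Y x) : Tan n M x) = 0 := z1 _
    rw [z3, zero_add]
    refine Finset.sum_eq_zero fun i _ => ?_
    rw [map_smul]
    have z4 : E (ξ i x) = 0 := z2 i
    rw [z4, smul_zero]
  rw [← sub_eq_zero, ← difference_apply nab nab' hY]
  exact hE

theorem CanonOn.congr (hξ : IsDual F ξ W)
    (h1 : CanonOn F ξ W nab)
    (h : ∀ x ∈ W, ∀ Y : VField n M, DiffVF Y x → nab' Y x = nab Y x) : CanonOn F ξ W nab' := by
  have ht : ∀ x ∈ W, ∀ u v : Tan n M x, tors nab' x u v = tors nab x u v := by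
    intro x hx u v
    obtain ⟨V, X, hV, hxV, hX, rfl⟩ := exists_smooth_extend x u
    obtain ⟨V', Y, hV', hxV', hY, rfl⟩ := exists_smooth_extend x v
    have hX' := hX.diffVF hV hxV
    have hY' := hY.diffVF hV' hxV'
    rw [tors_apply _ hX' hY', tors_apply _ hX' hY', h x hx _ hX', h x hx _ hY']
  have hE : ∀ x ∈ W, ∀ u : Tan n M x, F.torsE ξ nab' x u = F.torsE ξ nab x u := fun x hx u =>
    LinearMap.ext fun Y => by rw [F.torsE_apply, F.torsE_apply, ht x hx]
  refine ⟨⟨fun V hV hVW Y hY x hx v s => ?_, fun V hV hVW Y Z hY hZ x hx v => ?_,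
    fun i V hV hVW Y hY x hx v => ?_, fun i x hx v => ?_⟩, fun x hx X => ?_, fun t x hx => ?_⟩
  · rw [h x (hVW hx) _ (SmoothVF.diffVF hY hV hx)]
    exact h1.pres_H V hV hVW Y hY x hx v s
  · rw [h x (hVW hx) _ (SmoothVF.diffVF hY hV hx), h x (hVW hx) _ (SmoothVF.diffVF hZ hV hx)]
    exact h1.pres_g V hV hVW Y Z hY hZ x hx v
  · have hIY : SmoothHF V (fun y => F.I i y (Y y)) :=
      F.smooth_I i _ hV (hVW.trans hξ.subset) _ hY
    rw [h x (hVW hx) _ (SmoothVF.diffVF hY hV hx), h x (hVW hx) _ (SmoothVF.diffVF hIY hV hx),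
      h x (hVW hx) _ ((hξ.smooth i).diffVF hξ.isOpen (hVW hx))]
    exact h1.cov_I i V hV hVW Y hY x hx v
  · rw [h x hx _ ((hξ.smooth i).diffVF hξ.isOpen hx)]
    exact h1.cov_ξ i x hx v
  · rw [hE x hx]; exact h1.tors_H x hx X
  · rw [hE x hx]; exact h1.perp t x hx

/-- Vertical fields are combinations of the dual fields. -/
theorem IsDual.eq_sum (hξ : IsDual F ξ W) (hx : x ∈ W) {v : Tan n M x}
    (hv : F.hproj ξ x v = 0) : v = ∑ s, F.η s x v • ξ s x := by
  conv_lhs => rw [hξ.decomp hx v, hv]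
  simp

theorem IsDual.cov_vertical (hξ : IsDual F ξ W) (nab : Conn n M) (hV : IsOpen V)
    (hVW : V ⊆ W) (hZ : SmoothVF V Z) (hZ0 : ∀ y ∈ V, F.hproj ξ y (Z y) = 0) (hx : x ∈ V)
    (v : Tan n M x) : nab Z x v = ∑ s, (F.η s x (Z x) • nab (ξ s) x v
      + dirD (fun y => F.η s y (Z y)) x v • ξ s x) := by
  have hs : ∀ s, DiffVF (ξ s) x := fun s => (hξ.smooth s).diffVF hξ.isOpen (hVW hx)
  have hf : ∀ s, DiffFun (n := n) (fun y => F.η s y (Z y)) x := fun s =>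
    (F.smooth_η s V hV (hVW.trans hξ.subset) Z hZ).diffFun hV hx
  rw [cov_congr nab (Y := fun y => ∑ s, F.η s y (Z y) • ξ s y)
    (DiffVF.sum fun s _ => DiffVF.smul (hf s) (hs s)), cov_sum nab fun s _ => DiffVF.smul (hf s) (hs s)]
  · exact Finset.sum_congr rfl fun s _ => cov_smul nab (hf s) (hs s) v
  · filter_upwards [hV.mem_nhds hx] with y hy
    exact hξ.eq_sum (hVW hy) (hZ0 y hy)

theorem Compat.hproj_cov_vertical (hξ : IsDual F ξ W) (h1 : Compat F ξ W nab) (hV : IsOpen V)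
    (hVW : V ⊆ W) (hZ : SmoothVF V Z) (hZ0 : ∀ y ∈ V, F.hproj ξ y (Z y) = 0) (hx : x ∈ V)
    (v : Tan n M x) : F.hproj ξ x (nab Z x v) = 0 := by
  rw [hξ.cov_vertical nab hV hVW hZ hZ0 hx]
  simp [h1.cov_ξ _ x (hVW hx), hξ.hproj_ξ (hVW hx)]

/-- The identification of vertical vectors with endomorphisms of `H` is parallel. -/
theorem Compat.cov_phi (hξ : IsDual F ξ W) (h1 : Compat F ξ W nab) (hV : IsOpen V)
    (hVW : V ⊆ W) (hZ : SmoothVF V Z) (hZ0 : ∀ y ∈ V, F.hproj ξ y (Z y) = 0) {Y : HField H}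
    (hY : SmoothHF V Y) (hx : x ∈ V) (v : Tan n M x) :
    F.hproj ξ x (nab (HField.toVField fun y => F.phi y (Z y) (Y y)) x v)
      = F.phi x (nab Z x v) (Y x) + F.phi x (Z x) (F.hproj ξ x (nab Y.toVField x v)) := by
  have hf : ∀ s, DiffFun (n := n) (fun y => F.η s y (Z y)) x := fun s =>
    (F.smooth_η s V hV (hVW.trans hξ.subset) Z hZ).diffFun hV hx
  have hI : ∀ s, DiffVF (HField.toVField fun y => F.I s y (Y y)) x := fun s =>
    SmoothVF.diffVF (F.smooth_I s V hV (hVW.trans hξ.subset) Y hY) hV hx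
  have e0 : (HField.toVField fun y => F.phi y (Z y) (Y y))
      = fun y => ∑ s, F.η s y (Z y) • HField.toVField (fun y => F.I s y (Y y)) y := by
    funext y
    simp [HField.toVField, LocalFrame.phi]
  have e1 : ∀ s, F.hproj ξ x (F.η s x (Z x) • nab (HField.toVField fun y => F.I s y (Y y)) x v
        + dirD (fun y => F.η s y (Z y)) x v • HField.toVField (fun y => F.I s y (Y y)) x)
      = F.η s x (Z x) • (F.I s x (F.hproj ξ x (nab Y.toVField x v))
        + F.phi x (nab (ξ s) x v) (Y x)) + dirD (fun y => F.η s y (Z y)) x v • F.I s x (Y x) := by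
    intro s
    rw [map_add, map_smul, map_smul, h1.cov_I s V hV hVW Y hY x hx, HField.toVField,
      hξ.hproj_coe (hVW hx)]
    simp [LocalFrame.phi]
  have e2 : F.phi x (nab Z x v) = ∑ s, (F.η s x (Z x) • F.phi x (nab (ξ s) x v)
      + dirD (fun y => F.η s y (Z y)) x v • F.I s x) := by
    rw [hξ.cov_vertical nab hV hVW hZ hZ0 hx]
    have p1 : ∀ s, F.phi x (ξ s x) = F.I s x := fun s => by
      simp [LocalFrame.phi, hξ.dual _ _ x (hVW hx)]
    simp only [← p1]
    simp only [LocalFrame.phi, map_sum, map_add, map_smul, smul_eq_mul, Finset.smul_sum,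
      Finset.sum_smul, add_smul, mul_smul, Finset.sum_add_distrib]
    congr 1 <;> exact Finset.sum_comm
  rw [e0, cov_sum nab fun s _ => DiffVF.smul (hf s) (hI s), map_sum,
    Finset.sum_congr rfl fun s _ => (congrArg (F.hproj ξ x) (cov_smul nab (hf s) (hI s) v)).trans
      (e1 s), e2]
  simp only [LocalFrame.phi, LinearMap.sum_apply, LinearMap.add_apply, LinearMap.smul_apply,
    smul_add, Finset.sum_add_distrib]
  abel

end Uniqueness

/-! ### Independence of the local frame and gluing -/

section FrameChange

variable {n : ℕ} {M : Type*} [TopologicalSpace M]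
  [ChartedSpace (EuclideanSpace ℝ (Fin (4 * n + 3))) M] [IsManifold (𝓡 (4 * n + 3)) ∞ M]
  {H : SubspaceField n M} {PQ : Π x : M, Submodule ℝ (Module.End ℝ (H x))} {g : HMetric H}
  {U U' W W' V : Set M} {x : M} {nab nab' : Conn n M} {X Y Z : VField n M}
  {F : LocalFrame H PQ g U} {F' : LocalFrame H PQ g U'} {ξ ξ' : Fin 3 → VField n M}

/-- The forms η_s change with the transition matrix b and the I_s with diag(ε) b diag(ε);
orthogonality of b makes the contraction Σ η_s ⊗ I_s invariant. -/
theorem IsDual.phi_change (hn : 1 ≤ n) (hH : IsSmoothDistribution (4 * n) H) (hξ : IsDual F ξ W)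
    (F' : LocalFrame H PQ g U') (hx : x ∈ W) (hx' : x ∈ U') (v : Tan n M x) :
    F'.phi x v = F.phi x v := by
  have h1 : ∀ s, F'.η s x v = ∑ t, transition F' ξ s t x * F.η t x v := fun s =>
    hξ.η_change hx hx' s v
  have h2 : ∀ s, F'.I s x = ∑ t, (eps s * eps t * transition F' ξ s t x) • F.I t x := fun s =>
    hξ.I_change hH hx hx' s
  have h3 := hξ.transition_orthogonal' (F' := F') hn hH hx hx'
  simp only [LocalFrame.phi, h1, h2, Finset.smul_sum, smul_smul]
  rw [Finset.sum_comm]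
  refine Finset.sum_congr rfl fun u _ => ?_
  rw [← Finset.sum_smul]
  refine congrArg (· • F.I u x) ?_
  have h4 : F.η u x v = ∑ t, F.η t x v * (eps u * if t = u then eps t else 0) := by
    simp [mul_ite, eps_mul_self]
  rw [h4]
  simp only [← h3, Finset.mul_sum, Finset.sum_mul]
  rw [Finset.sum_comm]
  exact Finset.sum_congr rfl fun t _ => Finset.sum_congr rfl fun s _ => by ring

theorem IsDual.phi_ξ (hξ : IsDual F ξ W) (hx : x ∈ W) (s : Fin 3) : F.phi x (ξ s x) = F.I s x := by
  simp [LocalFrame.phi, hξ.dual _ _ x hx]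

theorem torsE_congr (h : ∀ v : Tan n M x, F'.hproj ξ' x v = F.hproj ξ x v) (nab : Conn n M)
    (u : Tan n M x) : F'.torsE ξ' nab x u = F.torsE ξ nab x u :=
  LinearMap.ext fun Y => by rw [F.torsE_apply, F'.torsE_apply, h]

/-- The characterization of the canonical connection does not depend on the local frame. -/
theorem CanonOn.change (hn : 1 ≤ n) (hH : IsSmoothDistribution (4 * n) H) (hξ : IsDual F ξ W)
    (hξ' : IsDual F' ξ' V) (hVW : V ⊆ W)
    (hp : ∀ y ∈ V, ∀ v : Tan n M y, F'.hproj ξ' y v = F.hproj ξ y v)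
    (h : CanonOn F ξ W nab) : CanonOn F' ξ' V nab := by
  have hφ : ∀ y ∈ V, ∀ v : Tan n M y, F.phi y v = F'.phi y v := fun y hy v =>
    (hξ.phi_change hn hH F' (hVW hy) (hξ'.subset hy) v).symm
  have hvert : ∀ i, ∀ y ∈ V, F.hproj ξ y (ξ' i y) = 0 := fun i y hy => by
    rw [← hp y hy, hξ'.hproj_ξ hy]
  refine ⟨⟨fun O hO hOV Y hY x hx v s => ?_, fun O hO hOV Y Z hY hZ x hx v => ?_,
    fun i O hO hOV Y hY x hx v => ?_, fun i x hx v => ?_⟩, fun x hx X => ?_, fun t x hx => ?_⟩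
  · have h1 := h.pres_H O hO (hOV.trans hVW) Y hY x hx v
    rw [← F.mem_iff (hξ.subset (hVW (hOV hx))), F'.mem_iff (hξ'.subset (hOV hx))] at h1
    exact h1 s
  · rw [hp x (hOV hx), hp x (hOV hx)]
    exact h.pres_g O hO (hOV.trans hVW) Y Z hY hZ x hx v
  · have hZ : SmoothVF O (ξ' i) := (hξ'.smooth i).mono hOV
    -- The parallelism of φ is applied to ξ'_i, whose image is I'_i. As φ is the same for both
    -- frames, the rule for ∇I'_i follows.
    have h1 := h.toCompat.cov_phi hξ hO (hOV.trans hVW) hZ (fun y hy => hvert i y (hOV hy)) hY hx v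
    have hIY : SmoothHF O (fun y => F'.I i y (Y y)) :=
      F'.smooth_I i _ hO (hOV.trans hξ'.subset) _ hY
    rw [cov_congr nab (Y := HField.toVField fun y => F'.I i y (Y y))
      (SmoothVF.diffVF hIY hO hx) ?_, ← hp x (hOV hx), ← hp x (hOV hx), hφ x (hOV hx),
      hφ x (hOV hx), hξ'.phi_ξ (hOV hx)] at h1
    · rw [h1]
      simp only [LocalFrame.phi, LinearMap.sum_apply, LinearMap.smul_apply]
      exact add_comm _ _
    · filter_upwards [hO.mem_nhds hx] with y hy
      simp only [HField.toVField]
      rw [hφ y (hOV hy), hξ'.phi_ξ (hOV hy)]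
  · rw [hp x hx]
    exact h.toCompat.hproj_cov_vertical hξ hξ'.isOpen hVW (hξ'.smooth i) (hvert i) hx v
  · rw [torsE_congr (hp x hx)]
    exact h.tors_H x (hVW hx) X
  · rw [torsE_congr (hp x hx), ← F'.inPerp_iff hn hH (hξ'.subset hx),
      F.inPerp_iff hn hH (hξ.subset (hVW hx)), hξ.eq_sum (hVW hx) (hvert t x hx), map_sum, map_sum]
    refine Finset.sum_eq_zero fun s _ => ?_
    rw [map_smul, map_smul, h.perp s x (hVW hx), smul_zero]

theorem Compat.mono (h : Compat F ξ W nab) (hV : V ⊆ W) : Compat F ξ V nab where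
  pres_H O hO hOV := h.pres_H O hO (hOV.trans hV)
  pres_g O hO hOV := h.pres_g O hO (hOV.trans hV)
  cov_I i O hO hOV := h.cov_I i O hO (hOV.trans hV)
  cov_ξ i x hx := h.cov_ξ i x (hV hx)

theorem CanonOn.mono (h : CanonOn F ξ W nab) (hV : V ⊆ W) : CanonOn F ξ V nab :=
  ⟨h.toCompat.mono hV, fun x hx => h.tors_H x (hV hx), fun t x hx => h.perp t x (hV hx)⟩

end FrameChange

section Glue

variable {n : ℕ} {M : Type*} [TopologicalSpace M]
  [ChartedSpace (EuclideanSpace ℝ (Fin (4 * n + 3))) M] [IsManifold (𝓡 (4 * n + 3)) ∞ M]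
  {H : SubspaceField n M} {PQ : Π x : M, Submodule ℝ (Module.End ℝ (H x))} {g : HMetric H}
  {U U' W W' V : Set M} {x : M} {nab nab' : Conn n M} {X Y Z : VField n M}

/-- A connection whose value at `x` is the value of a connection depending on `x`. -/
def gluedConn (N : M → Conn n M) : Conn n M where
  toFun Y x := N x Y x
  isCovariantDerivativeOnUniv :=
    { add := fun {_ _ x} hσ hσ' _ => (N x).isCovariantDerivativeOnUniv.add hσ hσ' trivial
      leibniz := fun {_ _ x} hσ hf _ => (N x).isCovariantDerivativeOnUniv.leibniz hσ hf trivial }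

theorem gluedConn_apply (N : M → Conn n M) (Y : VField n M) (x : M) :
    gluedConn N Y x = N x Y x := rfl

theorem contMDiffAt_clm_of_basis {E : Type*} [NormedAddCommGroup E] [NormedSpace ℝ E]
    {ι : Type*} [Fintype ι] (b : Module.Basis ι ℝ E) {f : M → E →L[ℝ] E}
    (h : ∀ i, ContMDiffAt (𝓡 (4 * n + 3)) 𝓘(ℝ, E) ∞ (fun y => f y (b i)) x) :
    ContMDiffAt (𝓡 (4 * n + 3)) 𝓘(ℝ, E →L[ℝ] E) ∞ f x := by
  have := b.finiteDimensional_of_finite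
  have e : f = fun y => ∑ i, ContinuousLinearMap.smulRightL ℝ E E
      (LinearMap.toContinuousLinearMap (b.coord i)) (f y (b i)) := by
    funext y
    refine ContinuousLinearMap.ext fun v => ?_
    conv_lhs => rw [← b.sum_repr v, map_sum]
    simp
  rw [e]
  exact contMDiffAt_finsetSum fun i _ =>
    ContMDiffAt.clm_apply contMDiffAt_const (h i)

/-- A connection is smooth if it takes, locally, smooth fields to smooth fields. -/
theorem contMDiffCovariantDerivative_of_locally (nab : Conn n M)
    (h : ∀ x, ∃ W, IsOpen W ∧ x ∈ W ∧ ∀ V ⊆ W, IsOpen V → ∀ X Y : VField n M, SmoothVF V X →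
      SmoothVF V Y → SmoothVF V fun y => nab Y y (X y)) :
    CovariantDerivative.ContMDiffCovariantDerivative nab ∞ := by
  refine ⟨⟨fun {σ} hσ => ?_⟩⟩
  intro x _
  refine ContMDiffAt.contMDiffWithinAt ?_
  obtain ⟨W, hW, hxW, hs⟩ := h x
  -- A section of the bundle of homomorphisms is smooth if, in a trivialisation, its values on a
  -- local frame of the tangent bundle are smooth.
  rw [contMDiffAt_hom_bundle]
  refine ⟨contMDiffAt_id, ?_⟩
  let e := trivializationAt (EuclideanSpace ℝ (Fin (4 * n + 3)))
    (fun x : M => TangentSpace (𝓡 (4 * n + 3)) x) x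
  let b := (EuclideanSpace.basisFun (Fin (4 * n + 3)) ℝ).toBasis
  have hxe : x ∈ e.baseSet := FiberBundle.mem_baseSet_trivializationAt _ _ x
  have hWe : IsOpen (W ∩ e.baseSet) := hW.inter e.open_baseSet
  have hσ' : SmoothVF (W ∩ e.baseSet) σ := hσ.mono (Set.subset_univ _)
  refine contMDiffAt_clm_of_basis b fun i => ?_
  have h1 : SmoothVF (W ∩ e.baseSet) (e.localFrame b i) :=
    (e.contMDiffOn_localFrame_baseSet ∞ b i).mono Set.inter_subset_right
  have h2 := (hs _ Set.inter_subset_left hWe _ _ h1 hσ').contMDiffAt (hWe.mem_nhds ⟨hxW, hxe⟩)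
  have h3 := (Bundle.contMDiffAt_totalSpace.1 h2).2
  refine h3.congr_of_eventuallyEq ?_
  filter_upwards [hWe.mem_nhds ⟨hxW, hxe⟩] with y hy
  rw [ContinuousLinearMap.inCoordinates_eq hy.2 hy.2]
  simp only [ContinuousLinearMap.comp_apply, ContinuousLinearEquiv.coe_coe]
  rw [e.localFrame_apply_of_mem_baseSet b hy.2]
  rfl

theorem Adapted.mono {F : LocalFrame H PQ g U} {ξ : Fin 3 → VField n M} {D : Conn n M}
    (h : Adapted F ξ W D) (hV : V ⊆ W) : Adapted F ξ V D where
  par_η s O hO hOV := h.par_η s O hO (hOV.trans hV)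
  par_ξ s x hx := h.par_ξ s x (hV hx)
  par_I s O hO hOV := h.par_I s O hO (hOV.trans hV)
  par_g O hO hOV := h.par_g O hO (hOV.trans hV)
  smooth O hO hOV := h.smooth O hO (hOV.trans hV)

/-- The restriction of a horizontal frame. -/
def HFrame.restrict (E : HFrame g W) (hV : V ⊆ W) : HFrame g V where
  e := E.e
  f := E.f
  smooth_e a := (E.smooth_e a).mono hV
  smooth_f a := (E.smooth_f a).mono hV
  expand_e y hy := E.expand_e y (hV hy)
  expand_f y hy := E.expand_f y (hV hy)
  linInd y hy := E.linInd y (hV hy)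
  dual y hy := E.dual y (hV hy)

theorem ReebOn.restrict {F : LocalFrame H PQ g U} {ξ : Fin 3 → VField n M} (hξ : ReebOn F ξ U)
    (hW : IsDual F ξ W) : ReebOn F ξ W :=
  hξ.mono hW.isOpen hW.subset

/-- The connections of the local frames are the restrictions of one smooth connection. -/
theorem exists_canonOn (hn : 1 ≤ n) (hH : IsSmoothDistribution (4 * n) H)
    (hex : ∀ x₀ : M, ∃ U : Set M, x₀ ∈ U ∧ Nonempty (LocalFrame H PQ g U))
    (hF : ∀ (U : Set M) (F : LocalFrame H PQ g U), ReebOn F F.reeb U) (C : Complement H)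
    (hC : ∀ (U : Set M) (F : LocalFrame H PQ g U), C.SpannedBy U F.reeb) :
    ∃ nab : Conn n M, CovariantDerivative.ContMDiffCovariantDerivative nab ∞ ∧
      ∀ x, ∃ (U : Set M) (F : LocalFrame H PQ g U) (W : Set M), x ∈ W ∧ IsDual F F.reeb W ∧
        CanonOn F F.reeb W nab := by
  have hloc : ∀ x : M, ∃ (U : Set M) (F : LocalFrame H PQ g U) (W : Set M) (D : Conn n M),
      x ∈ W ∧ IsDual F F.reeb W ∧ Nonempty (HFrame g W) ∧ Adapted F F.reeb W D := by
    intro x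
    obtain ⟨U, hx, ⟨F⟩⟩ := hex x
    obtain ⟨W, D, hxW, -, h1, h2, h3⟩ := (hF U F).toIsDual.exists_adapted hH hx
    exact ⟨U, F, W, D, hxW, h1, h2, h3⟩
  choose U F W D hxW hd hE hD using hloc
  have hcan : ∀ x, CanonOn (F x) (F x).reeb (W x) ((F x).canon (F x).reeb (D x)) := fun x =>
    (hD x).canonOn hn hH ((hF _ _).restrict (hd x))
  -- All frames give the same V, hence the same horizontal projection, so the connection chosen at x
  -- also satisfies the characterisation for the frame chosen at x₀. Uniqueness makes the two agree
  -- on the overlap.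
  have key : ∀ x₀, ∀ x ∈ W x₀, ∀ Y : VField n M, DiffVF Y x →
      gluedConn (fun x => (F x).canon (F x).reeb (D x)) Y x
        = (F x₀).canon (F x₀).reeb (D x₀) Y x := by
    intro x₀ x hx Y hY
    rw [gluedConn_apply]
    refine ContinuousLinearMap.ext fun v => ?_
    have hd' : IsDual (F x₀) (F x₀).reeb (W x₀ ∩ W x) :=
      (hd x₀).mono ((hd x₀).isOpen.inter (hd x).isOpen) Set.inter_subset_left
    refine CanonOn.unique hn hH hd' ((hcan x).change hn hH (hd x) hd' Set.inter_subset_right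
      fun y hy v => ?_) ((hcan x₀).mono Set.inter_subset_left) ⟨hx, hxW x⟩ hY v
    rw [← (hd x₀).projH_eq hy.1 (hC _ (F x₀) y ((hd x₀).subset hy.1)),
      ← (hd x).projH_eq hy.2 (hC _ (F x) y ((hd x).subset hy.2))]
  refine ⟨gluedConn fun x => (F x).canon (F x).reeb (D x), ?_, fun x =>
    ⟨U x, F x, W x, hxW x, hd x, (hcan x).congr (hd x) (key x)⟩⟩
  refine contMDiffCovariantDerivative_of_locally _ fun x => ⟨W x, (hd x).isOpen, hxW x,
    fun V hVW hV X Y hX hY => ?_⟩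
  obtain ⟨E⟩ := hE x
  refine SmoothVF.congr (((hD x).mono hVW).smooth_canon hH (E.restrict hVW) ((hd x).mono hV hVW)
    hX hY) fun y hy => ?_
  rw [key x y (hVW hy) Y (hY.diffVF hV hy)]

end Glue

/-! ### From the local characterisation to the intrinsic one and back -/

section Canonical

variable {n : ℕ} {M : Type*} [TopologicalSpace M]
  [ChartedSpace (EuclideanSpace ℝ (Fin (4 * n + 3))) M] [IsManifold (𝓡 (4 * n + 3)) ∞ M]
  {H : SubspaceField n M} {PQ : Π x : M, Submodule ℝ (Module.End ℝ (H x))} {g : HMetric H}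
  {U U' W W' V : Set M} {x : M} {nab nab' : Conn n M} {X Y Z : VField n M} {C : Complement H}
  {F : LocalFrame H PQ g U} {ξ : Fin 3 → VField n M}

theorem torsEnd_eq (h : C.projH x = F.hproj ξ x) (nab : Conn n M) (u : Tan n M x) :
    torsEnd C nab x u = F.torsE ξ nab x u :=
  LinearMap.ext fun Y => by rw [F.torsE_apply, ← h]; rfl

/-- Locally a smooth section σ of PQ is φ(Z) for a smooth vertical field Z, with components the
trace coefficients of σ. Since φ is parallel, ∇σ = φ(∇Z) is again in PQ. -/
theorem IsDual.exists_phi (hn : 1 ≤ n) (hξ : IsDual F ξ W) (hx : x ∈ W)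
    (hH : IsSmoothDistribution (4 * n) H) {σ : Π x : M, Module.End ℝ (H x)} (hV : IsOpen V)
    (hxV : x ∈ V) (hσ : SmoothEnd V σ) (hσ' : ∀ y ∈ V, σ y ∈ PQ y) :
    ∃ (O : Set M) (Z : VField n M), IsOpen O ∧ x ∈ O ∧ O ⊆ V ∩ W ∧ SmoothVF O Z ∧
      (∀ y ∈ O, F.hproj ξ y (Z y) = 0) ∧ ∀ y ∈ O, F.phi y (Z y) = σ y := by
  obtain ⟨B, hB, hxB, ⟨E⟩⟩ := exists_hframe hH g x
  have hO : IsOpen (V ∩ W ∩ B) := (hV.inter hξ.isOpen).inter hB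
  have hOU : V ∩ W ∩ B ⊆ U := fun y hy => hξ.subset hy.1.2
  have hσO : SmoothEnd (V ∩ W ∩ B) σ := hσ.mono fun y hy => hy.1.1
  refine ⟨V ∩ W ∩ B, fun y => ∑ s, coefPart (fun s => F.I s y) s (σ y) • ξ s y, hO,
    ⟨⟨hxV, hx⟩, hxB⟩, Set.inter_subset_left, SmoothVF.sum fun s _ => SmoothVF.smul
      (hσO.coefPart hH (E.restrict Set.inter_subset_right) hO F hOU s)
      ((hξ.smooth s).mono fun y hy => hy.1.2), fun y hy => ?_, fun y hy => ?_⟩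
  · simp [hξ.hproj_ξ hy.1.2]
  · have := nontrivial_horizontal hn hH y
    have h := F.paraQuat (hOU hy)
    have h1 := hσ' y hy.1.1
    rw [F.span_I y (hOU hy)] at h1
    obtain ⟨c, hc⟩ := (Submodule.mem_span_range_iff_exists_fun ℝ).1 h1
    have h2 : ∀ s, F.η s y (∑ t, coefPart (fun s => F.I s y) t (σ y) • ξ t y) = c s := fun s => by
      rw [← hc]
      simp [h.coefPart_I, hξ.dual _ _ y hy.1.2]
    simp only [LocalFrame.phi, h2]
    exact hc

/-- The intrinsic conditions are local and do not mention a frame except through φ, which is frame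
independent; over a frame with its dual fields they follow from the rules for ∇I_i and ∇ξ_i. -/
theorem isCanonical_of_locally (hn : 1 ≤ n) (hH : IsSmoothDistribution (4 * n) H)
    (hnab : CovariantDerivative.ContMDiffCovariantDerivative nab ∞)
    (h : ∀ x, ∃ (U : Set M) (F : LocalFrame H PQ g U) (ξ : Fin 3 → VField n M) (W : Set M), x ∈ W ∧
      IsDual F ξ W ∧ C.SpannedBy W ξ ∧ CanonOn F ξ W nab) : IsCanonical g PQ C nab where
  smooth := hnab
  pres_H O hO Y hY x hx v := by
    obtain ⟨U, F, ξ, W, hxW, hξ, hC, hc⟩ := h x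
    exact (F.mem_iff (hξ.subset hxW) _).2 (hc.pres_H (O ∩ W) (hO.inter hξ.isOpen)
      Set.inter_subset_right Y (hY.mono Set.inter_subset_left) x ⟨hx, hxW⟩ v)
  pres_V O hO Y hY hYV x hx v := by
    obtain ⟨U, F, ξ, W, hxW, hξ, hC, hc⟩ := h x
    rw [C.mem_V_iff, hξ.projH_eq hxW (hC x hxW)]
    refine hc.toCompat.hproj_cov_vertical hξ (hO.inter hξ.isOpen) Set.inter_subset_right
      (hY.mono Set.inter_subset_left) (fun y hy => ?_) ⟨hx, hxW⟩ v
    rw [← hξ.projH_eq hy.2 (hC y hy.2), ← C.mem_V_iff]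
    exact hYV y hy.1
  pres_g O hO Y Z hY hZ x hx v := by
    obtain ⟨U, F, ξ, W, hxW, hξ, hC, hc⟩ := h x
    rw [covH, covH, hξ.projH_eq hxW (hC x hxW)]
    exact hc.pres_g (O ∩ W) (hO.inter hξ.isOpen) Set.inter_subset_right Y Z
      (hY.mono Set.inter_subset_left) (hZ.mono Set.inter_subset_left) x ⟨hx, hxW⟩ v
  pres_PQ O hO σ hσ hσ' x hx v := by
    obtain ⟨U, F, ξ, W, hxW, hξ, hC, hc⟩ := h x
    obtain ⟨B, Z, hB, hxB, hBW, hZ, hZ0, hZσ⟩ := hξ.exists_phi hn hxW hH hO hx hσ hσ'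
    refine ⟨F.phi x (nab Z x v), ?_, fun O' hO' hOO' hx' Y hY => ?_⟩
    · rw [F.span_I x (hξ.subset hxW)]
      exact (Submodule.mem_span_range_iff_exists_fun ℝ).2 ⟨_, rfl⟩
    · have hV : IsOpen (O' ∩ B) := hO'.inter hB
      have hYV : SmoothHF (O' ∩ B) Y := hY.mono Set.inter_subset_left
      have h1 := hc.toCompat.cov_phi hξ hV (fun y hy => (hBW hy.2).2)
        (hZ.mono Set.inter_subset_right) (fun y hy => hZ0 y hy.2) hYV ⟨hx', hxB⟩ v
      have hσY : SmoothHF O' (fun y => σ y (Y y)) := hσ O' hO' hOO' Y hY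
      rw [cov_congr nab (Y := HField.toVField fun y => σ y (Y y)) (SmoothVF.diffVF hσY hO' hx') ?_,
        hZσ x hxB] at h1
      · rw [covH, covH, hξ.projH_eq hxW (hC x hxW), h1, add_sub_cancel_right]
      · filter_upwards [hB.mem_nhds hxB] with y hy
        simp only [HField.toVField]
        rw [hZσ y hy]
  tors_H O hO X Y hX hY x hx := by
    obtain ⟨U, F, ξ, W, hxW, hξ, hC, hc⟩ := h x
    have hX' := SmoothVF.diffVF hX hO hx
    have hY' := SmoothVF.diffVF hY hO hx
    have hOW := hO.inter hξ.isOpen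
    have hH' : ∀ {A : HField H}, SmoothHF O A → ∀ v, nab A.toVField x v ∈ H x := fun hA v =>
      (F.mem_iff (hξ.subset hxW) _).2 (hc.pres_H (O ∩ W) hOW Set.inter_subset_right _
        (SmoothHF.mono hA Set.inter_subset_left) x ⟨hx, hxW⟩ v)
    have h1 : C.projH x (tors nab x (X.toVField x) (Y.toVField x)) = 0 := by
      rw [hξ.projH_eq hxW (hC x hxW)]
      exact congr($(hc.tors_H x hxW (X x)) (Y x))
    have h2 := tors_apply nab hX' hY'
    have h3 : bracket X.toVField Y.toVField x = nab Y.toVField x (X.toVField x)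
        - nab X.toVField x (Y.toVField x) - tors nab x (X.toVField x) (Y.toVField x) := by
      rw [h2]; abel
    have h4 : (C.projH x (bracket X.toVField Y.toVField x) : Tan n M x)
        = nab Y.toVField x (X.toVField x) - nab X.toVField x (Y.toVField x) := by
      rw [h3, map_sub, map_sub, h1, sub_zero]
      have h5 := C.projH_coe x ⟨_, hH' hY (X.toVField x)⟩
      have h6 := C.projH_coe x ⟨_, hH' hX (Y.toVField x)⟩
      simp only at h5 h6
      rw [h5, h6]
      rfl
    rw [C.projV_eq, h4, h3]
    change tors nab x (X.toVField x) (Y.toVField x) = _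
    abel
  tors_V x u hu := by
    obtain ⟨U, F, ξ, W, hxW, hξ, hC, hc⟩ := h x
    have hp := hξ.projH_eq hxW (hC x hxW)
    rw [torsEnd_eq hp, F.inPerp_iff hn hH (hξ.subset hxW),
      hξ.eq_sum hxW (v := u) (by rw [← hp, ← C.mem_V_iff]; exact hu), map_sum, map_sum]
    refine Finset.sum_eq_zero fun s _ => ?_
    rw [map_smul, map_smul, hc.perp s x hxW, smul_zero]
  pres_phi U' F' O hO hOU Z hZ hZV Y hY x hx v := by
    obtain ⟨U, F, ξ, W, hxW, hξ, hC, hc⟩ := h x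
    have hφ : ∀ y ∈ O ∩ W, ∀ v : Tan n M y, F'.phi y v = F.phi y v := fun y hy v =>
      hξ.phi_change hn hH F' hy.2 (hOU hy.1) v
    have hYO : SmoothHF (O ∩ W) Y := hY.mono Set.inter_subset_left
    have hO' := hO.inter hξ.isOpen
    have h1 := hc.toCompat.cov_phi hξ hO' Set.inter_subset_right
      (hZ.mono Set.inter_subset_left) (fun y hy => by
        rw [← hξ.projH_eq hy.2 (hC y hy.2), ← C.mem_V_iff]; exact hZV y hy.1) hYO ⟨hx, hxW⟩ v
    rw [covH, covH, hξ.projH_eq hxW (hC x hxW), hφ x ⟨hx, hxW⟩, hφ x ⟨hx, hxW⟩, ← h1]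
    have h2 : SmoothHF (O ∩ W) (fun y => F.phi y (Z y) (Y y)) := by
      have : (fun y => F.phi y (Z y) (Y y))
          = fun y => ∑ s, F.η s y (Z y) • F.I s y (Y y) := by
        funext y; simp [LocalFrame.phi]
      rw [this]
      exact SmoothHF.sum fun s _ => SmoothHF.smul
        (F.smooth_η s _ hO' (Set.inter_subset_right.trans hξ.subset) Z
          (hZ.mono Set.inter_subset_left))
        (F.smooth_I s _ hO' (Set.inter_subset_right.trans hξ.subset) Y hYO)
    rw [cov_congr nab (SmoothVF.diffVF h2 hO' ⟨hx, hxW⟩)]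
    filter_upwards [hO'.mem_nhds ⟨hx, hxW⟩] with y hy
    simp only [HField.toVField]
    rw [hφ y hy]

theorem IsCanonical.canonOn (hn : 1 ≤ n) (hH : IsSmoothDistribution (4 * n) H)
    (h : IsCanonical g PQ C nab) (hξ : IsDual F ξ W) (hC : C.SpannedBy W ξ) :
    CanonOn F ξ W nab := by
  have hp : ∀ y ∈ W, C.projH y = F.hproj ξ y := fun y hy => hξ.projH_eq hy (hC y hy)
  have hξV : ∀ i, ∀ y ∈ W, ξ i y ∈ C.V y := fun i y hy => by
    rw [C.mem_V_iff, hp y hy, hξ.hproj_ξ hy]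
  refine ⟨⟨fun O hO hOV Y hY x hx v => ?_, fun O hO hOV Y Z hY hZ x hx v => ?_,
    fun i O hO hOV Y hY x hx v => ?_, fun i x hx v => ?_⟩, fun x hx X => ?_, fun t x hx => ?_⟩
  · exact (F.mem_iff (hξ.subset (hOV hx)) _).1 (h.pres_H O hO Y hY x hx v)
  · rw [← hp x (hOV hx)]
    exact h.pres_g O hO Y Z hY hZ x hx v
  -- The parallelism of φ, applied to the vertical field ξ_i with φ(ξ_i) = I_i, is the rule that
  -- ∇I_i has the coefficients of ∇ξ_i.
  · have h1 := h.pres_phi U F O hO (hOV.trans hξ.subset) (ξ i) ((hξ.smooth i).mono hOV)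
      (fun y hy => hξV i y (hOV hy)) Y hY x hx v
    have hIY : SmoothHF O (fun y => F.I i y (Y y)) :=
      F.smooth_I i _ hO (hOV.trans hξ.subset) _ hY
    rw [covH, covH, cov_congr nab (Y := HField.toVField fun y => F.I i y (Y y))
      (SmoothVF.diffVF hIY hO hx) ?_, hp x (hOV hx), hξ.phi_ξ (hOV hx)] at h1
    · rw [h1]
      simp only [LocalFrame.phi, LinearMap.sum_apply, LinearMap.smul_apply]
      exact add_comm _ _
    · filter_upwards [hO.mem_nhds hx] with y hy
      simp only [HField.toVField]
      rw [hξ.phi_ξ (hOV hy)]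
  · rw [← hp x hx, ← C.mem_V_iff]
    exact h.pres_V W hξ.isOpen (ξ i) (hξ.smooth i) (hξV i) x hx v
  · refine LinearMap.ext fun Y => ?_
    obtain ⟨O₁, X', hO₁, hx₁, hX', rfl⟩ := exists_horizontal_extend hH g x X
    obtain ⟨O₂, Y', hO₂, hx₂, hY', rfl⟩ := exists_horizontal_extend hH g x Y
    have h1 := h.tors_H (O₁ ∩ O₂) (hO₁.inter hO₂) X' Y' (hX'.mono Set.inter_subset_left)
      (hY'.mono Set.inter_subset_right) x ⟨hx₁, hx₂⟩
    rw [F.torsE_apply, h1, ← hp x hx, C.projV_eq, map_neg, map_sub, C.projH_coe, sub_self,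
      neg_zero, LinearMap.zero_apply]
  · rw [← torsEnd_eq (hp x hx), ← F.inPerp_iff hn hH (hξ.subset hx)]
    exact h.tors_V x _ (hξV t x hx)

end Canonical

/-! ### Uniqueness of the complement in dimension greater than seven -/

theorem ParaQuat.anticomm {E : Type*} [AddCommGroup E] [Module ℝ E] {g : LinearMap.BilinForm ℝ E}
    {I : Fin 3 → Module.End ℝ E} (h : ParaQuat g I) (i j : Fin 3) :
    I i * I j + I j * I i = (if i = j then 2 * eps i else 0 : ℝ) • 1 := by
  rcases eq_or_ne i j with rfl | hij
  · rw [if_pos rfl, h.sq, ← two_smul ℝ, smul_smul]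
  · rw [if_neg hij, zero_smul]
    rcases eq_add_one_or hij with rfl | rfl <;> rw [h.mul, h.mul_rev] <;> simp

section

variable {n : ℕ} {M : Type*} [TopologicalSpace M]
  [ChartedSpace (EuclideanSpace ℝ (Fin (4 * n + 3))) M] [IsManifold (𝓡 (4 * n + 3)) ∞ M]
  {H : SubspaceField n M} {PQ : Π x : M, Submodule ℝ (Module.End ℝ (H x))} {g : HMetric H}
  {U U' W W' V : Set M} {x : M} {nab nab' : Conn n M} {X Y Z : VField n M} {C : Complement H}
  {F : LocalFrame H PQ g U} {ξ : Fin 3 → VField n M}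

/-- The connection 1-forms of a compatible connection are skew-symmetric. -/
theorem Compat.skew (hn : 1 ≤ n) (hH : IsSmoothDistribution (4 * n) H) (hξ : IsDual F ξ W)
    (hc : Compat F ξ W nab) (hx : x ∈ W) (v : Tan n M x) (i j : Fin 3) :
    eps j * F.η j x (nab (ξ i) x v) + eps i * F.η i x (nab (ξ j) x v) = 0 := by
  have := nontrivial_horizontal hn hH x
  have h := F.paraQuat (hξ.subset hx)
  refine h.skew_of_derivation (d := fun i => ∑ s, F.η s x (nab (ξ i) x v) • F.I s x)
    (m := fun i s => F.η s x (nab (ξ i) x v)) (fun i => rfl) (fun i j => ?_) i j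
  refine LinearMap.ext fun Y => ?_
  obtain ⟨O₁, Y', hO₁, hx₁, hY', rfl⟩ := exists_horizontal_extend hH g x Y
  have hO : IsOpen (O₁ ∩ W) := hO₁.inter hξ.isOpen
  have hOU : O₁ ∩ W ⊆ U := Set.inter_subset_right.trans hξ.subset
  have hxO : x ∈ O₁ ∩ W := ⟨hx₁, hx⟩
  have hY : SmoothHF (O₁ ∩ W) Y' := hY'.mono Set.inter_subset_left
  have hI : ∀ i, SmoothHF (O₁ ∩ W) (fun y => F.I i y (Y' y)) := fun i => F.smooth_I i _ hO hOU _ hY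
  have hII : ∀ i j, SmoothHF (O₁ ∩ W) (fun y => F.I i y (F.I j y (Y' y))) := fun i j =>
    F.smooth_I i _ hO hOU _ (hI j)
  have c1 : ∀ i, F.hproj ξ x (nab (HField.toVField fun y => F.I i y (Y' y)) x v)
      = F.I i x (F.hproj ξ x (nab Y'.toVField x v))
        + (∑ s, F.η s x (nab (ξ i) x v) • F.I s x) (Y' x) := fun i => by
    rw [hc.cov_I i _ hO Set.inter_subset_right Y' hY x hxO v]
    simp
  have c2 : ∀ i j, F.hproj ξ x (nab (HField.toVField fun y => F.I i y (F.I j y (Y' y))) x v)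
      = F.I i x (F.hproj ξ x (nab (HField.toVField fun y => F.I j y (Y' y)) x v))
        + (∑ s, F.η s x (nab (ξ i) x v) • F.I s x) (F.I j x (Y' x)) := fun i j => by
    rw [hc.cov_I i _ hO Set.inter_subset_right _ (hI j) x hxO v]
    simp
  have hd : ∀ i j, DiffVF (HField.toVField fun y => F.I i y (F.I j y (Y' y))) x := fun i j =>
    SmoothVF.diffVF (hII i j) hO hxO
  -- The field (I_i I_j + I_j I_i) Y is a constant multiple of Y; it is differentiated in both
  -- forms.
  have c3 := cov_add nab (hd i j) (hd j i) v
  have c4 := cov_smul (f := fun _ => (if i = j then 2 * eps i else 0 : ℝ)) nab (DiffFun.const _)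
    (SmoothVF.diffVF hY hO hxO) v
  rw [dirD_const, zero_smul, add_zero] at c4
  rw [cov_congr nab (Y := fun y => (if i = j then 2 * eps i else 0 : ℝ) • Y'.toVField y)
    (DiffVF.smul (DiffFun.const _) (SmoothVF.diffVF hY hO hxO)), c4] at c3
  · have c5 := congr(F.hproj ξ x $c3)
    rw [map_add, map_smul, c2, c2, c1, c1] at c5
    have c6 := congr($(h.anticomm i j) (F.hproj ξ x (nab Y'.toVField x v)))
    simp only [LinearMap.add_apply, Module.End.mul_apply, LinearMap.smul_apply,
      Module.End.one_apply] at c6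
    rw [← c6] at c5
    simp only [LinearMap.add_apply, Module.End.mul_apply, map_add, LinearMap.zero_apply] at c5 ⊢
    rw [eq_comm, ← sub_eq_zero] at c5
    rw [← c5]
    abel
  · filter_upwards [hO.mem_nhds hxO] with y hy
    have c6 := congr(($((F.paraQuat (hOU hy)).anticomm i j) (Y' y) : Tan n M y))
    exact c6

/-- In dimension greater than seven, the vertical distribution of a canonical connection is spanned
by Reeb fields. -/
theorem CanonOn.reebOn (hn : 1 < n) (hH : IsSmoothDistribution (4 * n) H) (hξ : IsDual F ξ W)
    (hc : CanonOn F ξ W nab) : ReebOn F ξ W := by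
  refine ⟨hξ, fun s t x hx X => ?_⟩
  have h := F.paraQuat (hξ.subset hx)
  -- Without horizontal torsion the Bianchi identity reads Σ ω_s ∧ θ_s = 0, with θ_s(Z) = ε_i
  -- η_s(∇_Z ξ_i) + ε_s dη_i(ξ_s, Z), and this forces θ_s = 0 when dim H > 4. Together with the
  -- skewness of the connection forms it is the Reeb condition.
  have key : ∀ i s (Z : H x), eps i * F.η s x (nab (ξ i) x Z)
      + eps s * extT (F.η i) x (ξ s x) Z = 0 := by
    intro i s Z
    let θ : Fin 3 → H x →ₗ[ℝ] ℝ := fun s => eps i • (F.η s x ∘ₗ (nab (ξ i) x).toLinearMap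
      ∘ₗ (H x).subtype) + eps s • (extT (F.η i) x (ξ s x) ∘ₗ (H x).subtype)
    have hθ : ∀ s Z, θ s Z = eps i * F.η s x (nab (ξ i) x Z)
      + eps s * extT (F.η i) x (ξ s x) Z := fun s Z => rfl
    rw [← hθ, h.wedge_injective (by rw [finrank_horizontal hH]; omega) θ (fun X Y Z => ?_) s,
      LinearMap.zero_apply]
    have hb := hc.toCompat.bianchi_horizontal hξ hH hx i X Y Z
    simp only [hc.tors_H x hx, LinearMap.zero_apply, map_zero, mul_zero, add_zero,
      Finset.mul_sum] at hb
    simp only [hθ]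
    rw [← hb]
    simp only [← Finset.sum_add_distrib]
    refine Finset.sum_congr rfl fun s _ => ?_
    ring
  have k1 := key s t X
  have k2 := key t s X
  have k3 := hc.toCompat.skew hn.le hH hξ hx (X : Tan n M x) s t
  have k4 : ∀ a b m m' p q : ℝ, p * p = 1 → q * q = 1 → p * m + q * a = 0 → q * m' + p * b = 0 →
      q * m + p * m' = 0 → q * a + p * b = 0 := by
    intro a b m m' p q hp hq h1 h2 h3
    linear_combination h1 + h2 - (p * q) * h3 + (q * m') * hp + (p * m) * hq
  exact k4 _ _ _ _ _ _ (eps_mul_self s) (eps_mul_self t) k1 k2 k3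

theorem IsCanonical.eq_reeb_complement (hn : 1 < n) (P : PqcStructure n M) {g : HMetric P.H}
    (hg : g ∈ P.metrics) {C C' : Complement P.H}
    (hC : ∀ (U : Set M) (F : LocalFrame P.H P.PQ g U), C.SpannedBy U F.reeb)
    (h : IsCanonical g P.PQ C' nab) : C' = C := by
  refine Complement.ext fun x => ?_
  obtain ⟨U, hx, ⟨F⟩⟩ := P.exists_frame g hg x
  obtain ⟨W, ξ, hxW, hξ, hs⟩ := C'.exists_isDual F hx
  have h1 := (h.canonOn hn.le P.smooth_H hξ hs).reebOn hn P.smooth_H hξ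
  rw [hs x hxW, hC U F x hx, funext fun s => h1.eq_reeb P.smooth_H s hxW]

end

/-! ### Connection forms, Lie derivatives and torsion over a local frame -/

theorem add_one_add_one (i : Fin 3) : i + 1 + 1 = i + 2 := by revert i; decide

theorem add_one_add_two (i : Fin 3) : i + 1 + 2 = i := by revert i; decide

theorem add_two_add_one (i : Fin 3) : i + 2 + 1 = i := by revert i; decide

theorem add_two_add_two (i : Fin 3) : i + 2 + 2 = i + 1 := by revert i; decide

theorem sum_eq_cyclic {A : Type*} [AddCommMonoid A] (i : Fin 3) (f : Fin 3 → A) :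
    ∑ s, f s = f i + f (i + 1) + f (i + 2) := by
  rw [Fin.sum_univ_three]
  fin_cases i
  · rfl
  · change _ = f 1 + f 2 + f 0
    rw [add_comm (f 1 + f 2), add_assoc]
  · change _ = f 2 + f 0 + f 1
    rw [add_comm (f 0 + f 1), add_assoc]

theorem eps_cyclic (i : Fin 3) : eps i * eps (i + 1) = -eps (i + 2) := by
  fin_cases i <;> simp

section

variable {n : ℕ} {M : Type*} [TopologicalSpace M]
  [ChartedSpace (EuclideanSpace ℝ (Fin (4 * n + 3))) M] [IsManifold (𝓡 (4 * n + 3)) ∞ M]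
  {H : SubspaceField n M} {PQ : Π x : M, Submodule ℝ (Module.End ℝ (H x))} {g : HMetric H}
  {U U' W W' V : Set M} {x : M} {nab nab' : Conn n M} {X Y Z : VField n M} {C : Complement H}

/-- The connection 1-forms `α_s` in a local frame. -/
def LocalFrame.conn1 (F : LocalFrame H PQ g U) (ξ : Fin 3 → VField n M) (nab : Conn n M)
    (s : Fin 3) (x : M) : Module.Dual ℝ (Tan n M x) :=
  -- For i = s + 2 one has j = s and k = s + 1, so this is the coefficient α_j of ξ_k in ∇ξ_i.
  F.η (s + 1) x ∘ₗ (nab (ξ (s + 2)) x).toLinearMap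

theorem LocalFrame.conn1_apply (F : LocalFrame H PQ g U) (ξ : Fin 3 → VField n M) (nab : Conn n M)
    (s : Fin 3) (x : M) (v : Tan n M x) :
    F.conn1 ξ nab s x v = F.η (s + 1) x (nab (ξ (s + 2)) x v) := rfl

/-- The Lie derivative `L_{ξ_t} I_s`, in terms of a compatible connection. -/
def LocalFrame.lieI (F : LocalFrame H PQ g U) (ξ : Fin 3 → VField n M) (nab : Conn n M)
    (t s : Fin 3) (x : M) : Module.End ℝ (H x) :=
  -- Since [ξ_t, X]_H = (∇_{ξ_t} X)_H - T(ξ_t, X)_H, the Lie derivative is the covariant derivative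
  -- of I_s plus the commutator of I_s with the torsion endomorphism.
  ∑ u, F.η u x (nab (ξ s) x (ξ t x)) • F.I u x
    + (F.I s x * F.torsE ξ nab x (ξ t x) - F.torsE ξ nab x (ξ t x) * F.I s x)

variable {F : LocalFrame H PQ g U} {ξ : Fin 3 → VField n M}

theorem Compat.cov_ξ_conn1 (hn : 1 ≤ n) (hH : IsSmoothDistribution (4 * n) H) (hξ : IsDual F ξ W)
    (hc : Compat F ξ W nab) (hx : x ∈ W) (i : Fin 3) (v : Tan n M x) :
    nab (ξ i) x v = F.conn1 ξ nab (i + 1) x v • ξ (i + 2) x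
      + (eps (i + 2) * F.conn1 ξ nab (i + 2) x v) • ξ (i + 1) x := by
  have h0 := hc.skew hn hH hξ hx v i i
  have h1 := hc.skew hn hH hξ hx v i (i + 1)
  have key : ∀ a b p q r : ℝ, p * p = 1 → q * q = 1 → p * q = -r → q * a + p * b = 0 →
      a = r * b := fun a b p q r hp hq hr h => by
    linear_combination q * h - a * hq - b * hr
  have h2 : F.η i x (nab (ξ i) x v) = 0 := by
    have h3 : 2 * eps i * F.η i x (nab (ξ i) x v) = 0 := by linear_combination h0
    simpa [eps_ne_zero] using h3
  have h4 := key _ _ _ _ _ (eps_mul_self i) (eps_mul_self (i + 1)) (eps_cyclic i) h1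
  rw [hξ.eq_sum hx (hc.cov_ξ i x hx v), sum_eq_cyclic i, h2, h4, zero_smul, zero_add,
    F.conn1_apply, F.conn1_apply, add_one_add_one, add_one_add_two, add_two_add_one,
    add_two_add_two]
  exact add_comm _ _

theorem Compat.cov_I_conn1 (hn : 1 ≤ n) (hH : IsSmoothDistribution (4 * n) H) (hξ : IsDual F ξ W)
    (hc : Compat F ξ W nab) (i : Fin 3) (hV : IsOpen V) (hVW : V ⊆ W) {Y : HField H}
    (hY : SmoothHF V Y) (hx : x ∈ V) (v : Tan n M x) :
    F.hproj ξ x (nab (HField.toVField fun y => F.I i y (Y y)) x v)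
      = F.I i x (F.hproj ξ x (nab Y.toVField x v))
        + (F.conn1 ξ nab (i + 1) x v • F.I (i + 2) x (Y x)
        + (eps (i + 2) * F.conn1 ξ nab (i + 2) x v) • F.I (i + 1) x (Y x)) := by
  rw [hc.cov_I i V hV hVW Y hY x hx v, hc.cov_ξ_conn1 hn hH hξ (hVW hx) i v,
    hξ.sum_η_pair (hVW hx)]

/-- The canonical connection agrees locally with the one built from an adapted connection. -/
theorem CanonOn.exists_adapted (hn : 1 ≤ n) (hH : IsSmoothDistribution (4 * n) H)
    (hξ : ReebOn F ξ W) (hc : CanonOn F ξ W nab) (hx : x ∈ W) :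
    ∃ (W' : Set M) (D : Conn n M), x ∈ W' ∧ W' ⊆ W ∧ ReebOn F ξ W' ∧ Nonempty (HFrame g W') ∧
      Adapted F ξ W' D ∧
      ∀ y ∈ W', ∀ Y : VField n M, DiffVF Y y → ∀ v, nab Y y v = F.canon ξ D Y y v := by
  obtain ⟨W', D, hxW, hWW, hξ', hE, hD⟩ := hξ.toIsDual.exists_adapted hH hx
  have hR : ReebOn F ξ W' := hξ.mono hξ'.isOpen hWW
  exact ⟨W', D, hxW, hWW, hR, hE, hD, fun y hy Y hY v => CanonOn.unique hn hH hξ' (hc.mono hWW)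
    (hD.canonOn hn hH hR) hy hY v⟩

theorem tors_eq_of_eq (h : ∀ Y : VField n M, DiffVF Y x → ∀ v, nab Y x v = nab' Y x v)
    (u v : Tan n M x) : tors nab x u v = tors nab' x u v := by
  obtain ⟨V, X, hV, hxV, hX, rfl⟩ := exists_smooth_extend x u
  obtain ⟨V', Y, hV', hxV', hY, rfl⟩ := exists_smooth_extend x v
  have hX' := hX.diffVF hV hxV
  have hY' := hY.diffVF hV' hxV'
  rw [tors_apply _ hX' hY', tors_apply _ hX' hY', h _ hX', h _ hY']

theorem torsE_eq_of_eq (h : ∀ Y : VField n M, DiffVF Y x → ∀ v, nab Y x v = nab' Y x v)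
    (u : Tan n M x) : F.torsE ξ nab x u = F.torsE ξ nab' x u :=
  LinearMap.ext fun Y => by rw [F.torsE_apply, F.torsE_apply, tors_eq_of_eq h]

theorem LocalFrame.conn1_canon (hξ : IsDual F ξ W) {D : Conn n M} (hD : Adapted F ξ W D)
    (h : ∀ Y : VField n M, DiffVF Y x → ∀ v, nab Y x v = F.canon ξ D Y x v) (hx : x ∈ W)
    (s : Fin 3) (v : Tan n M x) : F.conn1 ξ nab s x v = F.con1 ξ D s x v := by
  have h1 := h _ ((hξ.smooth (s + 2)).diffVF hξ.isOpen hx) v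
  rw [F.conn1_apply, h1, Adapted.canon_ξ hξ hD hx (s + 2) v, add_two_add_one, add_two_add_two,
    map_add, map_smul, map_smul, hξ.dual _ _ x hx, hξ.dual _ _ x hx, if_pos rfl,
    if_neg (by simp)]
  simp

theorem CanonOn.smooth_conn1 (hn : 1 ≤ n) (hH : IsSmoothDistribution (4 * n) H)
    (hξ : ReebOn F ξ W) (hc : CanonOn F ξ W nab) (s : Fin 3) :
    SmoothOneForm W (F.conn1 ξ nab s) := by
  intro O hO hOW X hX
  refine SmoothFun.of_locally fun x hx => ?_
  obtain ⟨W', D, hxW, hWW, hR, ⟨E⟩, hD, h⟩ := hc.exists_adapted hn hH hξ (hOW hx)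
  have hOO : IsOpen (O ∩ W') := hO.inter hR.isOpen
  refine ⟨W', hR.isOpen, hxW, ?_⟩
  refine SmoothFun.congr ((hD.mono Set.inter_subset_right).smooth_con1 hH
    (E.restrict Set.inter_subset_right) (hR.toIsDual.mono hOO Set.inter_subset_right) s
    (hX.mono Set.inter_subset_left)) fun y hy => ?_
  exact F.conn1_canon hR.toIsDual hD (h y hy.2) hy.2 s _

/-- The torsion of the canonical connection at a point, in terms of a family of endomorphisms
satisfying the torsion relations. -/
structure TorsData (F : LocalFrame H PQ g U) (ξ : Fin 3 → VField n M) (nab : Conn n M) (x : M)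
    (τ : Fin 3 → Module.End ℝ (H x)) : Prop where
  rel : TorsRel (g.form x) (g.nondegenerate x) (fun s => F.I s x) τ
    (fun s u v => extT (F.η s) x (ξ u x) (ξ v x))
  torsE_eq : ∀ t, F.torsE ξ nab x (ξ t x)
    = τ t - spProj (g.form x) (g.nondegenerate x) (fun s => F.I s x) (τ t)
  lieI_eq : ∀ t s, F.lieI ξ nab t s x = F.I s x * τ t - τ t * F.I s x
  conn1_eq : ∀ s (v : Tan n M x), F.conn1 ξ nab s x v
    = extT (F.η (s + 1)) x (ξ (s + 2) x) (F.hproj ξ x v)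
      - 2 * eps (s + 1) * ∑ t, F.η t x v * coefPart (fun s => F.I s x) s (τ t)

/-- The family is the torsion of an adapted connection. For that connection the I_s are parallel, so
L_{ξ_t} I_s is a bare commutator, and the relations `TorsRel` hold. Passing to the canonical
connection removes the projections of the endomorphisms to sp(n, ℝ) ⊕ sp(1, ℝ). -/
theorem CanonOn.exists_torsData (hn : 1 ≤ n) (hH : IsSmoothDistribution (4 * n) H)
    (hξ : ReebOn F ξ W) (hc : CanonOn F ξ W nab) (hx : x ∈ W) : ∃ τ, TorsData F ξ nab x τ := by
  obtain ⟨W', D, hxW, hWW, hR, -, hD, h⟩ := hc.exists_adapted hn hH hξ hx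
  have hT : ∀ t, F.torsE ξ nab x (ξ t x) = F.torsE ξ D x (ξ t x)
      - spProj (g.form x) (g.nondegenerate x) (fun s => F.I s x) (F.torsE ξ D x (ξ t x)) :=
    fun t => by rw [torsE_eq_of_eq (h x hxW), F.torsE_canon_ξ hR.toIsDual hxW]
  refine ⟨fun t => F.torsE ξ D x (ξ t x), hD.torsRel hR hH hxW, hT, fun t s => ?_, fun s v => ?_⟩
  · refine LinearMap.ext fun Y => ?_
    have h1 := hD.conH_I hn hH hR hxW (ξ t x) s Y
    have e1 : nab (ξ s) x (ξ t x) = F.con1 ξ D (s + 1) x (ξ t x) • ξ (s + 2) x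
        + (eps (s + 2) * F.con1 ξ D (s + 2) x (ξ t x)) • ξ (s + 1) x :=
      (h x hxW (ξ s) ((hR.smooth s).diffVF hR.isOpen hxW) (ξ t x)).trans
        (Adapted.canon_ξ hR.toIsDual hD hxW s (ξ t x))
    have e2 := hR.toIsDual.sum_η_pair hxW s (F.con1 ξ D (s + 1) x (ξ t x))
      (eps (s + 2) * F.con1 ξ D (s + 2) x (ξ t x)) (fun u => F.I u x Y)
    rw [← e1] at e2
    rw [← e2, F.conH_ξ hR.toIsDual hxW] at h1
    simp only [LocalFrame.lieI, hT]
    simp only [LinearMap.add_apply, LinearMap.sub_apply, Module.End.mul_apply, LinearMap.sum_apply,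
      LinearMap.smul_apply, LinearMap.neg_apply, map_sub, map_neg] at h1 ⊢
    rw [eq_comm, neg_add_eq_iff_eq_add] at h1
    rw [h1]
    abel
  · rw [F.conn1_canon hR.toIsDual hD (h x hxW) hxW, hD.con1_eq hn hH hR hxW]

end

/-! ### Recovering the torsion and λ from commutators with the structure -/

section Algebra

variable {E : Type*} [AddCommGroup E] [Module ℝ E] [FiniteDimensional ℝ E]
  {g : LinearMap.BilinForm ℝ E} {I : Fin 3 → Module.End ℝ E} {τ : Fin 3 → Module.End ℝ E}
  {c : Fin 3 → Fin 3 → Fin 3 → ℝ}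

theorem ParaQuat.symPart_sub_spProj (h : ParaQuat g I) (A : Module.End ℝ E) :
    symPart g h.nondeg (A - spProj g h.nondeg I A) = symPart g h.nondeg A := by
  rw [h.sub_spProj, map_add, h.symPart_of_sym (h.adj_symPart A),
    h.symPart_of_skew (h.adj_perpSkew A), add_zero]

theorem ParaQuat.skewPart_sub_spProj (h : ParaQuat g I) (A : Module.End ℝ E) :
    skewPart g h.nondeg (A - spProj g h.nondeg I A) = perpSkew g h.nondeg I A := by
  rw [h.sub_spProj, map_add, h.skewPart_of_sym (h.adj_symPart A),
    h.skewPart_of_skew (h.adj_perpSkew A), zero_add]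

/-- Each commutator contributes -g(A X, Y) and a conjugate of A by I_s; the conjugates add up to 4
times `commPart` of A, minus A. In this way the Lie derivatives of the I_s determine the torsion up
to its commuting component. -/
theorem ParaQuat.sum_form_comm (h : ParaQuat g I) (A : Module.End ℝ E) (X Y : E) :
    ∑ s, eps s * g ((I s * A - A * I s) X) (I s Y) = -4 * g ((A - commPart I A) X) Y := by
  have h1 : ∀ s, g ((I s * A - A * I s) X) (I s Y)
      = -(eps s * g (A X) Y) + g (I s (A (I s X))) Y := fun s => by
    have := h.skew s (A (I s X)) Y
    rw [LinearMap.sub_apply, map_sub, LinearMap.sub_apply, Module.End.mul_apply,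
      Module.End.mul_apply, h.compat, this]
    ring
  simp only [h1]
  simp only [LinearMap.sub_apply, commPart_apply, map_sub, map_add, map_smul,
    LinearMap.smul_apply, LinearMap.add_apply, Fin.sum_univ_three, smul_eq_mul, eps_zero, eps_one,
    eps_two]
  ring

/-- The skew-symmetric form of the Lie derivatives, in terms of the torsion. -/
theorem ParaQuat.sum_form_comm_skew (h : ParaQuat g I) (A : Module.End ℝ E) (X Y : E) :
    ∑ s, eps s * (g ((I s * A - A * I s) X) (I s Y) - g ((I s * A - A * I s) Y) (I s X))
      = g ((-8 : ℝ) • (skewPart g h.nondeg A - commPart I (skewPart g h.nondeg A)) X) Y := by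
  simp only [mul_sub, Finset.sum_sub_distrib, h.sum_form_comm]
  have h1 : g ((A - commPart I A) Y) X = g (adj g h.nondeg (A - commPart I A) X) Y := by
    rw [form_adj, h.symm]
  rw [h1, map_sub, h.adj_commPart]
  simp only [skewPart_apply, map_sub, map_smul, LinearMap.sub_apply, LinearMap.smul_apply,
    smul_eq_mul]
  ring

theorem ParaQuat.perpSkew_eq (h : ParaQuat g I) (A B : Module.End ℝ E)
    (hB : B = (-8 : ℝ) • (skewPart g h.nondeg A - commPart I (skewPart g h.nondeg A))) :
    perpSkew g h.nondeg I A = -(1 / 8 : ℝ) • (B - ∑ s, coefPart I s B • I s) := by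
  have h1 : ∀ s, coefPart I s B = -8 * coefPart I s A := fun s => by
    rw [hB, map_smul, map_sub, h.coefPart_of_commute (h.commute_commPart _), sub_zero,
      ← h.coefPart_eq_skewPart, smul_eq_mul]
  simp only [h1, mul_smul, ← Finset.smul_sum]
  rw [perpSkew, spProj_apply, hB, ← smul_sub, smul_smul]
  norm_num
  abel

/-- The function `λ`, computed from the torsion relations. -/
def lamOp (I τ : Fin 3 → Module.End ℝ E) (c : Fin 3 → Fin 3 → Fin 3 → ℝ) (i : Fin 3) : ℝ :=
  4 * coefPart I i (τ i) - eps i * c i (i + 1) (i + 2) + eps (i + 1) * c (i + 1) (i + 2) i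
    + eps (i + 2) * c (i + 2) i (i + 1)

theorem TorsRel.lamOp_succ (h : ParaQuat g I) [Nontrivial E] (r : TorsRel g h.nondeg I τ c)
    (i : Fin 3) : lamOp I τ c (i + 1) = lamOp I τ c i := by
  have h1 := TorsRel.lam_succ h r i
  simp only [lamOp, add_one_add_one, add_one_add_two]
  exact h1.symm

theorem TorsRel.lamOp_eq (h : ParaQuat g I) [Nontrivial E] (r : TorsRel g h.nondeg I τ c)
    (i : Fin 3) : lamOp I τ c i = lamOp I τ c 0 := by
  have h0 := r.lamOp_succ h 0
  have h1 := r.lamOp_succ h 1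
  fin_cases i
  · rfl
  · exact h0
  · exact h1.trans h0

/-- By cyclicity the trace is tr([I_j, I_k] A), and [I_j, I_k] = -2 ε_i I_i. With dim H = 4n this
accounts for the factors 1/4n and 1/2n in the formulas for α_i(ξ_i) and λ. -/
theorem ParaQuat.trace_comm_mul [Nontrivial E] (h : ParaQuat g I) (A : Module.End ℝ E) (i : Fin 3) :
    LinearMap.trace ℝ E ((I (i + 2) * A - A * I (i + 2)) * I (i + 1))
      = -2 * (Module.finrank ℝ E * coefPart I i A) := by
  have h1 : LinearMap.trace ℝ E ((I (i + 2) * A - A * I (i + 2)) * I (i + 1))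
      = LinearMap.trace ℝ E ((I (i + 1) * I (i + 2) - I (i + 2) * I (i + 1)) * A) := by
    rw [sub_mul, sub_mul, map_sub, map_sub, LinearMap.trace_mul_comm, mul_assoc A,
      LinearMap.trace_mul_comm ℝ A, mul_assoc, mul_assoc]
  have h2 := h.mul (i + 1)
  have h3 := h.mul_rev (i + 1)
  rw [add_one_add_one, add_one_add_two] at h2 h3
  have h4 : I (i + 1) * I (i + 2) - I (i + 2) * I (i + 1) = (-2 * eps i) • I i := by
    rw [h2, h3, mul_smul, neg_smul, two_smul]
    abel
  rw [h1, h4, smul_mul_assoc, map_smul, TorsRel.trace_I_mul]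
  have h5 := eps_mul_self i
  rw [smul_eq_mul]
  linear_combination (-2 * (Module.finrank ℝ E * coefPart I i A)) * h5

end Algebra

/-! ### Components of the torsion of the canonical connection -/

section

variable {n : ℕ} {M : Type*} [TopologicalSpace M]
  [ChartedSpace (EuclideanSpace ℝ (Fin (4 * n + 3))) M] [IsManifold (𝓡 (4 * n + 3)) ∞ M]
  {H : SubspaceField n M} {PQ : Π x : M, Submodule ℝ (Module.End ℝ (H x))} {g : HMetric H}
  {U U' W W' V : Set M} {x : M} {nab nab' : Conn n M} {X Y Z : VField n M} {C : Complement H}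
  {F : LocalFrame H PQ g U} {ξ : Fin 3 → VField n M}

/-- A linear family of endomorphisms, contracted with a local frame, is independent of the frame. -/
theorem sum_eps_frame (hn : 1 ≤ n) (hH : IsSmoothDistribution (4 * n) H) (hξ : IsDual F ξ W)
    {F' : LocalFrame H PQ g U'} {ξ' : Fin 3 → VField n M} (hξ' : IsDual F' ξ' W') (hx : x ∈ W)
    (hx' : x ∈ W') (hp : ∀ v : Tan n M x, F'.hproj ξ' x v = F.hproj ξ x v)
    (B : Tan n M x →ₗ[ℝ] Module.End ℝ (H x)) :
    ∑ s, eps s • (B (ξ' s x) * F'.I s x) = ∑ s, eps s • (B (ξ s x) * F.I s x) := by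
  have h1 : ∀ s, ξ' s x = ∑ u, transition F ξ' u s x • ξ u x := fun s =>
    hξ.eq_sum hx (by rw [← hp, hξ'.hproj_ξ hx'])
  have h2 : ∀ s, F'.I s x = ∑ u, transition F ξ' u s x • F.I u x := fun s => by
    rw [← hξ'.phi_ξ hx' s, hξ.phi_change hn hH F' hx (hξ'.subset hx')]
    rfl
  -- Both factors change with the same matrix b, and Σ_s ε_s b_us b_vs = ε_u δ_uv.
  have h3 : ∀ s t, _ := fun s t =>
    hξ'.transition_orthogonal (F' := F) hn hH hx' (hξ.subset hx) s t
  have h4 : ∀ s, eps s • (B (ξ' s x) * F'.I s x) = ∑ u, ∑ v,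
      (eps s * transition F ξ' u s x * transition F ξ' v s x) • (B (ξ u x) * F.I v x) := by
    intro s
    rw [h1 s, h2 s, map_sum, Finset.sum_mul, Finset.smul_sum]
    refine Finset.sum_congr rfl fun u _ => ?_
    rw [Finset.mul_sum, Finset.smul_sum]
    refine Finset.sum_congr rfl fun v _ => ?_
    rw [map_smul, smul_mul_smul_comm, smul_smul, mul_assoc]
  rw [Finset.sum_congr rfl fun s _ => h4 s, Finset.sum_comm]
  refine Finset.sum_congr rfl fun u _ => ?_
  rw [Finset.sum_comm]
  simp only [← Finset.sum_smul, h3]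
  simp

theorem IsDual.η_tors_ξ (hξ : IsDual F ξ W) (hx : x ∈ W) (nab : Conn n M) (u s t : Fin 3) :
    F.η u x (tors nab x (ξ s x) (ξ t x)) = F.η u x (nab (ξ t) x (ξ s x))
      - F.η u x (nab (ξ s) x (ξ t x)) + extT (F.η u) x (ξ s x) (ξ t x) := by
  have hd : ∀ s, DiffVF (ξ s) x := fun s => (hξ.smooth s).diffVF hξ.isOpen hx
  have h0 : ∀ t (v : Tan n M x), dirD (fun y => F.η u y (ξ t y)) x v = 0 := fun t v => by
    rw [dirD_congr (f := fun _ => if u = t then (1 : ℝ) else 0), dirD_const]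
    filter_upwards [hξ.isOpen.mem_nhds hx] with y hy
    exact hξ.dual u t y hy
  rw [tors_apply nab (hd s) (hd t), extT_apply (F.diffForm (hξ.subset hx) u) (hd s) (hd t), extD,
    h0, h0, map_sub, map_sub]
  ring

theorem Compat.η_cov (hn : 1 ≤ n) (hH : IsSmoothDistribution (4 * n) H) (hξ : IsDual F ξ W)
    (hc : Compat F ξ W nab) (hx : x ∈ W) (i : Fin 3) (v : Tan n M x) :
    F.η i x (nab (ξ i) x v) = 0 ∧
    F.η (i + 1) x (nab (ξ i) x v) = eps (i + 2) * F.conn1 ξ nab (i + 2) x v ∧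
    F.η (i + 2) x (nab (ξ i) x v) = F.conn1 ξ nab (i + 1) x v := by
  rw [hc.cov_ξ_conn1 hn hH hξ hx i v]
  simp only [map_add, map_smul, hξ.dual _ _ x hx, smul_eq_mul]
  refine ⟨?_, ?_, ?_⟩ <;> simp

theorem TorsData.conn1_ξ {τ : Fin 3 → Module.End ℝ (H x)} (d : TorsData F ξ nab x τ)
    (hξ : IsDual F ξ W) (hx : x ∈ W) (s t : Fin 3) :
    F.conn1 ξ nab s x (ξ t x) = -2 * eps (s + 1) * coefPart (fun s => F.I s x) s (τ t) := by
  rw [d.conn1_eq, hξ.hproj_ξ hx]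
  simp [hξ.dual _ _ x hx]

/-- The vertical components of the torsion on vertical vectors. -/
theorem TorsData.tors_vertical {τ : Fin 3 → Module.End ℝ (H x)} (d : TorsData F ξ nab x τ)
    (hn : 1 ≤ n) (hH : IsSmoothDistribution (4 * n) H) (hξ : IsDual F ξ W)
    (hc : Compat F ξ W nab) (hx : x ∈ W) (i : Fin 3) :
    F.η i x (tors nab x (ξ i x) (ξ (i + 1) x)) = 0 ∧
    F.η i x (tors nab x (ξ i x) (ξ (i + 2) x)) = 0 ∧
    F.η (i + 2) x (tors nab x (ξ i x) (ξ (i + 1) x)) = eps (i + 2)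
      * lamOp (fun s => F.I s x) τ (fun s u v => extT (F.η s) x (ξ u x) (ξ v x)) 0 := by
  have := nontrivial_horizontal hn hH x
  have h := F.paraQuat (hξ.subset hx)
  obtain ⟨a1, a2, a3⟩ := hc.η_cov hn hH hξ hx i (ξ (i + 1) x)
  obtain ⟨-, -, a4⟩ := hc.η_cov hn hH hξ hx (i + 1) (ξ i x)
  obtain ⟨-, a5, -⟩ := hc.η_cov hn hH hξ hx (i + 1) (ξ i x)
  obtain ⟨a6, -, -⟩ := hc.η_cov hn hH hξ hx i (ξ (i + 2) x)
  obtain ⟨-, a7, -⟩ := hc.η_cov hn hH hξ hx (i + 2) (ξ i x)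
  rw [add_one_add_one, add_one_add_two] at a5
  rw [add_one_add_two, add_one_add_one] at a4
  rw [add_two_add_one, add_two_add_two] at a7
  have c1 := TorsRel.coefPart_succ h d.rel i
  have c2 := TorsRel.coefPart_pred h d.rel i
  -- λ can be computed from any index; half the sum of the expressions for i and i + 1 gives, up to
  -- the sign ε_{i+2}, the component along ξ_{i+2}.
  have l1 := d.rel.lamOp_eq h i
  have l2 := d.rel.lamOp_eq h (i + 1)
  have s1 := d.rel.swap i (i + 2) i
  have s2 := d.rel.swap i (i + 1) i
  simp only [lamOp, add_one_add_one, add_one_add_two] at l1 l2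
  have e1 := eps_mul_self (i + 1)
  have e2 := eps_mul_self (i + 2)
  have e0 := eps_mul_self i
  have e3 := eps_cyclic i
  rw [hξ.η_tors_ξ hx, hξ.η_tors_ξ hx, hξ.η_tors_ξ hx, a1, a3, a4, a5, a6, a7, d.conn1_ξ hξ hx,
    d.conn1_ξ hξ hx, d.conn1_ξ hξ hx, d.conn1_ξ hξ hx, c1, c2, add_two_add_one, add_one_add_one]
  have k1 : ∀ e a b : ℝ, e * e = 1 → a = -b → -2 * e * -(e / 2 * a) - 0 + b = 0 := by
    intro e a b he hb
    linear_combination a * he + hb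
  have k2 : ∀ p q r a b : ℝ, p * q = -r → r * r = 1 → a = -b →
      q * (-2 * r * (p / 2 * a)) - 0 + b = 0 := by
    intro p q r a b h1 h2 hb
    linear_combination -(r * a) * h1 + a * h2 + hb
  have k3 : ∀ p q r a b A B c L : ℝ, p * q = -r → r * r = 1 →
      4 * a - p * A + q * B + r * c = L → 4 * b - q * B + r * c + p * A = L →
      p * (-2 * q * a) - (-2 * r * b) + c = r * L := by
    intro p q r a b A B c L h1 h2 h3 h4
    linear_combination -2 * a * h1 + (r / 2) * h3 + (r / 2) * h4 - c * h2
  exact ⟨k1 _ _ _ e0 s2, k2 _ _ _ _ _ e3 e2 s1, k3 _ _ _ _ _ _ _ _ _ e3 e2 l1 l2⟩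

end

section

variable {n : ℕ} {M : Type*} [TopologicalSpace M]
  [ChartedSpace (EuclideanSpace ℝ (Fin (4 * n + 3))) M] [IsManifold (𝓡 (4 * n + 3)) ∞ M]
  {H : SubspaceField n M} {PQ : Π x : M, Submodule ℝ (Module.End ℝ (H x))} {g : HMetric H}
  {U U' W W' V : Set M} {x : M} {nab nab' : Conn n M} {X Y Z : VField n M} {C : Complement H}
  {F : LocalFrame H PQ g U} {ξ : Fin 3 → VField n M}

theorem eq_or_eq_add_one_or (u s : Fin 3) : u = s ∨ u = s + 1 ∨ u = s + 2 := by
  revert u s; decide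

theorem contr_of_form (P : LinearMap.BilinForm ℝ (H x)) (Q : Module.End ℝ (H x))
    (hP : ∀ X Y, P X Y = g.form x (Q X) Y) : g.contr x P = LinearMap.trace ℝ (H x) Q :=
  contraction_of_form (g.nondegenerate x) hP

theorem tors3_coe (hx : x ∈ U) (hp : C.projH x = F.hproj ξ x) (nab : Conn n M)
    (u v : Tan n M x) (Y : H x) :
    tors3 F C nab x u v Y = g.form x (F.hproj ξ x (tors nab x u v)) Y := by
  have hY : F.hproj ξ x (Y : Tan n M x) = Y := by rw [← hp, C.projH_coe]
  simp [tors3, LocalFrame.extMetric, F.η_coe hx, hp, hY]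

theorem torsSym_eq (hx : x ∈ U) (hp : C.projH x = F.hproj ξ x) (nab : Conn n M)
    (u : Tan n M x) (X Y : H x) : torsSym F C nab x u X Y
      = g.form x (symPart (g.form x) (g.nondegenerate x) (F.torsE ξ nab x u) X) Y := by
  rw [torsSym, tors3_coe hx hp, tors3_coe hx hp, symPart_apply, LinearMap.smul_apply,
    LinearMap.add_apply, map_smul, map_add, LinearMap.smul_apply, LinearMap.add_apply, form_adj,
    g.symm x X, smul_eq_mul, F.torsE_apply, F.torsE_apply]
  ring

theorem torsSkew_eq (hx : x ∈ U) (hp : C.projH x = F.hproj ξ x) (nab : Conn n M)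
    (u : Tan n M x) (X Y : H x) : torsSkew F C nab x u X Y
      = g.form x (skewPart (g.form x) (g.nondegenerate x) (F.torsE ξ nab x u) X) Y := by
  rw [torsSkew, tors3_coe hx hp, tors3_coe hx hp, skewPart_apply, LinearMap.smul_apply,
    LinearMap.sub_apply, map_smul, map_sub, LinearMap.smul_apply, LinearMap.sub_apply, form_adj,
    g.symm x X, smul_eq_mul, F.torsE_apply, F.torsE_apply]
  ring

theorem IsDual.dirD_dual (hξ : IsDual F ξ W) (hx : x ∈ W) (u t : Fin 3) (v : Tan n M x) :
    dirD (fun y => F.η u y (ξ t y)) x v = 0 := by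
  rw [dirD_congr (f := fun _ => if u = t then (1 : ℝ) else 0), dirD_const]
  filter_upwards [hξ.isOpen.mem_nhds hx] with y hy
  exact hξ.dual u t y hy

theorem LocalFrame.dirD_horizontal (F : LocalFrame H PQ g U) (hx : x ∈ U) (X : HField H)
    (u : Fin 3) (v : Tan n M x) : dirD (fun y => F.η u y (X.toVField y)) x v = 0 := by
  rw [dirD_congr (f := fun _ => (0 : ℝ)), dirD_const]
  filter_upwards [F.isOpen.mem_nhds hx] with y hy
  exact F.η_coe hy u (X y)

/-- The horizontal values of the α_s are known from `conn1_eq`, which covers one of each pair of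
components directly; the Reeb conditions supply the other and the diagonal. It follows that T(ξ_s,
X) has no vertical part. -/
theorem TorsData.cov_ξ_coe {τ : Fin 3 → Module.End ℝ (H x)} (d : TorsData F ξ nab x τ)
    (hn : 1 ≤ n) (hH : IsSmoothDistribution (4 * n) H) (hξ : ReebOn F ξ W)
    (hc : Compat F ξ W nab) (hx : x ∈ W) (u s : Fin 3) (X : H x) :
    F.η u x (nab (ξ s) x X) = extT (F.η u) x (ξ s x) X := by
  obtain ⟨a1, a2, a3⟩ := hc.η_cov hn hH hξ.toIsDual hx s (X : Tan n M x)
  have hα : ∀ s, F.conn1 ξ nab s x X = extT (F.η (s + 1)) x (ξ (s + 2) x) X := fun s => by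
    rw [d.conn1_eq, hξ.toIsDual.hproj_coe hx]
    simp [F.η_coe (hξ.subset hx)]
  rcases eq_or_eq_add_one_or u s with rfl | rfl | rfl
  · rw [a1, hξ.self _ hx]
  · rw [a2, hα, add_two_add_one, add_two_add_two, hξ.cross s hx, ← mul_assoc, eps_mul_self,
      one_mul]
  · rw [a3, hα, add_one_add_one, add_one_add_two]

/-- The mixed torsion is horizontal. -/
theorem TorsData.η_tors_mixed {τ : Fin 3 → Module.End ℝ (H x)} (d : TorsData F ξ nab x τ)
    (hn : 1 ≤ n) (hH : IsSmoothDistribution (4 * n) H) (hξ : ReebOn F ξ W)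
    (hc : Compat F ξ W nab) (hx : x ∈ W) (u s : Fin 3) (X : H x) :
    F.η u x (tors nab x (ξ s x) X) = 0 := by
  obtain ⟨O, X', hO, hxO, hX, rfl⟩ := exists_horizontal_extend hH g x X
  have hξs : DiffVF (ξ s) x := (hξ.smooth s).diffVF hξ.isOpen hx
  have hX' : DiffVF X'.toVField x := SmoothVF.diffVF hX hO hxO
  have hOW := hO.inter hξ.isOpen
  have e1 := tors_apply nab hξs hX'
  have e2 := extT_apply (F.diffForm (hξ.subset hx) u) hξs hX'
  have e3 := d.cov_ξ_coe hn hH hξ hc hx u s (X' x)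
  have e4 := hc.pres_H _ hOW Set.inter_subset_right X' (hX.mono Set.inter_subset_left) x
    ⟨hxO, hx⟩ (ξ s x) u
  rw [extD, F.dirD_horizontal (hξ.subset hx), hξ.toIsDual.dirD_dual hx] at e2
  change F.η u x (nab (ξ s) x (X'.toVField x)) = extT (F.η u) x (ξ s x) (X'.toVField x) at e3
  change F.η u x (tors nab x (ξ s x) (X'.toVField x)) = 0
  rw [e1, map_sub, map_sub, e3, e2, e4]
  ring

theorem Compat.hproj_bracket (hξ : IsDual F ξ W) (hc : Compat F ξ W nab) (hx : x ∈ W)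
    (t : Fin 3) {O : Set M} (hO : IsOpen O) (hxO : x ∈ O) {A : HField H} (hA : SmoothHF O A) :
    F.hproj ξ x (bracket (ξ t) A.toVField x) = F.hproj ξ x (nab A.toVField x (ξ t x))
      - F.torsE ξ nab x (ξ t x) (A x) := by
  have e1 := tors_apply nab ((hξ.smooth t).diffVF hξ.isOpen hx) (SmoothVF.diffVF hA hO hxO)
  have e2 : F.torsE ξ nab x (ξ t x) (A x)
    = F.hproj ξ x (tors nab x (ξ t x) (A.toVField x)) := rfl
  rw [e2, e1, map_sub, map_sub, hc.cov_ξ t x hx]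
  abel

theorem Compat.isLieI (hξ : IsDual F ξ U) (hc : Compat F ξ U nab) (hC : C.SpannedBy U ξ) :
    IsLieI F C ξ (F.lieI ξ nab) := by
  intro t s O hO hOU A hA x hx
  have hxU := hOU hx
  have hIA : SmoothHF O (fun y => F.I s y (A y)) := F.smooth_I s O hO hOU A hA
  rw [hξ.projH_eq hxU (hC x hxU), hc.hproj_bracket hξ hxU t hO hx hA,
    hc.hproj_bracket hξ hxU t hO hx hIA, hc.cov_I s O hO hOU A hA x hx]
  simp only [LocalFrame.lieI, LinearMap.add_apply, LinearMap.sub_apply, Module.End.mul_apply,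
    LinearMap.sum_apply, LinearMap.smul_apply, map_sub]
  abel

/-- The covariant derivative of a field in terms of its horizontal and vertical components. -/
theorem Compat.cov_decomp (hξ : IsDual F ξ W) (hc : Compat F ξ W nab) (hV : IsOpen V)
    (hVW : V ⊆ W) {A : VField n M} (hA : SmoothVF V A) (hx : x ∈ V) (v : Tan n M x) :
    F.hproj ξ x (nab A x v)
      = F.hproj ξ x (nab (HField.toVField fun y => F.hproj ξ y (A y)) x v) ∧
    ∀ s, F.η s x (nab A x v) = dirD (fun y => F.η s y (A y)) x v
      + ∑ t, F.η t x (A x) * F.η s x (nab (ξ t) x v) := by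
  have h1 : SmoothHF V (fun y => F.hproj ξ y (A y) : HField H) := hξ.smooth_hproj hV hVW hA
  have h2 : SmoothVF V fun y => A y - (F.hproj ξ y (A y) : Tan n M y) := hA.sub h1
  have h3 : ∀ y ∈ V, F.hproj ξ y (A y - (F.hproj ξ y (A y) : Tan n M y)) = 0 := fun y hy => by
    rw [map_sub, hξ.hproj_coe (hVW hy), sub_self]
  have h4 : nab A x v = nab (HField.toVField fun y => F.hproj ξ y (A y)) x v
      + nab (fun y => A y - (F.hproj ξ y (A y) : Tan n M y)) x v := by
    rw [← cov_add nab (SmoothVF.diffVF h1 hV hx) (h2.diffVF hV hx)]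
    congr 2
    funext y
    simp [HField.toVField]
  have h5 := hξ.cov_vertical nab hV hVW h2 h3 hx v
  refine ⟨?_, fun s => ?_⟩
  · rw [h4, map_add, hc.hproj_cov_vertical hξ hV hVW h2 h3 hx, add_zero]
  · have h6 : ∀ s, ∀ y ∈ V, F.η s y (A y - (F.hproj ξ y (A y) : Tan n M y)) = F.η s y (A y) :=
      fun s y hy => by rw [map_sub, F.η_coe (hξ.subset (hVW hy)), sub_zero]
    have h7 : ∀ s, dirD (fun y => F.η s y (A y - (F.hproj ξ y (A y) : Tan n M y))) x v
        = dirD (fun y => F.η s y (A y)) x v := fun s => dirD_congr (by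
      filter_upwards [hV.mem_nhds hx] with y hy
      exact h6 s y hy) v
    rw [h4, map_add, hc.pres_H V hV hVW _ h1 x hx, zero_add, h5, map_sum]
    simp only [map_add, map_smul, smul_eq_mul, h6 _ x hx, h7, Finset.sum_add_distrib,
      hξ.dual _ _ x (hVW hx), mul_ite, mul_one, mul_zero, Finset.sum_ite_eq, Finset.mem_univ,
      if_true]
    exact add_comm _ _

/-- The extended metric is parallel. -/
theorem Compat.cov_extMetric (hn : 1 ≤ n) (hH : IsSmoothDistribution (4 * n) H)
    (hξ : IsDual F ξ W) (hc : Compat F ξ W nab) (hC : C.SpannedBy W ξ) (hV : IsOpen V)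
    (hVW : V ⊆ W) {A B : VField n M} (hA : SmoothVF V A) (hB : SmoothVF V B) (hx : x ∈ V)
    (v : Tan n M x) : dirD (fun y => F.extMetric C y (A y) (B y)) x v
      = F.extMetric C x (nab A x v) (B x) + F.extMetric C x (A x) (nab B x v) := by
  have hp : ∀ y ∈ V, C.projH y = F.hproj ξ y := fun y hy => hξ.projH_eq (hVW hy) (hC y (hVW hy))
  have hE : ∀ y ∈ V, ∀ a b : Tan n M y, F.extMetric C y a b
      = g.form y (F.hproj ξ y a) (F.hproj ξ y b) - ∑ s, eps s * (F.η s y a * F.η s y b) := by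
    intro y hy a b
    simp [LocalFrame.extMetric, hp y hy]
  have hAH : SmoothHF V (fun y => F.hproj ξ y (A y) : HField H) := hξ.smooth_hproj hV hVW hA
  have hBH : SmoothHF V (fun y => F.hproj ξ y (B y) : HField H) := hξ.smooth_hproj hV hVW hB
  have hηA : ∀ s, DiffFun (n := n) (fun y => F.η s y (A y)) x := fun s =>
    (F.smooth_η s V hV (hVW.trans hξ.subset) A hA).diffFun hV hx
  have hηB : ∀ s, DiffFun (n := n) (fun y => F.η s y (B y)) x := fun s =>
    (F.smooth_η s V hV (hVW.trans hξ.subset) B hB).diffFun hV hx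
  obtain ⟨a1, a2⟩ := hc.cov_decomp hξ hV hVW hA hx v
  obtain ⟨b1, b2⟩ := hc.cov_decomp hξ hV hVW hB hx v
  have hd : dirD (fun y => F.extMetric C y (A y) (B y)) x v
      = dirD (fun y => g.form y (F.hproj ξ y (A y)) (F.hproj ξ y (B y))) x v
        - ∑ s, eps s * (F.η s x (A x) * dirD (fun y => F.η s y (B y)) x v
          + F.η s x (B x) * dirD (fun y => F.η s y (A y)) x v) := by
    rw [dirD_congr (f := fun y => g.form y (F.hproj ξ y (A y)) (F.hproj ξ y (B y))
        - ∑ s, eps s * (F.η s y (A y) * F.η s y (B y))),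
      dirD_sub ((g.smoothFun hV hAH hBH).diffFun hV hx)
        (DiffFun.sum fun s _ => (DiffFun.const _).mul ((hηA s).mul (hηB s))),
      dirD_sum fun s _ => (DiffFun.const _).mul ((hηA s).mul (hηB s))]
    · simp only [dirD_const_mul _ ((hηA _).mul (hηB _)), dirD_mul (hηA _) (hηB _)]
    · filter_upwards [hV.mem_nhds hx] with y hy
      exact hE y hy _ _
  rw [hd, hc.pres_g V hV hVW _ _ hAH hBH x hx v, hE x hx, hE x hx, a1, b1]
  simp only [a2, b2]
  have hs : ∀ s t, _ := fun s t => hc.skew hn hH hξ (hVW hx) v s t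
  -- The vertical part -Σ ε_s η_s² is parallel because the matrix η_s(∇ξ_t) is skew with respect to
  -- diag(ε).
  have key : ∀ (a b da db : Fin 3 → ℝ) (m : Fin 3 → Fin 3 → ℝ) (P Q : ℝ),
      (∀ s t, eps t * m s t + eps s * m t s = 0) →
      P + Q - ∑ s, eps s * (a s * db s + b s * da s)
        = P - ∑ s, eps s * ((da s + ∑ t, a t * m t s) * b s)
          + (Q - ∑ s, eps s * (a s * (db s + ∑ t, b t * m t s))) := by
    intro a b da db m P Q hm
    have h00 := hm 0 0
    have h11 := hm 1 1
    have h22 := hm 2 2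
    have h01 := hm 0 1
    have h02 := hm 0 2
    have h12 := hm 1 2
    simp only [Fin.sum_univ_three, eps_zero, eps_one, eps_two] at *
    linear_combination (a 0 * b 0) * h00 + (a 1 * b 1) * h11 + (a 2 * b 2) * h22
      + (a 0 * b 1 + a 1 * b 0) * h01 + (a 0 * b 2 + a 2 * b 0) * h02
      + (a 1 * b 2 + a 2 * b 1) * h12
  exact key (fun s => F.η s x (A x)) (fun s => F.η s x (B x)) _ _
    (fun t s => F.η s x (nab (ξ t) x v)) _ _ hs

end

/-! ### The operators of τ and μ and the function λ -/

section

variable {n : ℕ} {M : Type*} [TopologicalSpace M]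
  [ChartedSpace (EuclideanSpace ℝ (Fin (4 * n + 3))) M] [IsManifold (𝓡 (4 * n + 3)) ∞ M]
  {H : SubspaceField n M} {PQ : Π x : M, Submodule ℝ (Module.End ℝ (H x))} {g : HMetric H}
  {U U' W W' V : Set M} {x : M} {nab nab' : Conn n M} {X Y Z : VField n M} {C : Complement H}

/-- The operator of the tensor `τ`. -/
def LocalFrame.tauE (F : LocalFrame H PQ g U) (ξ : Fin 3 → VField n M) (nab : Conn n M) (x : M) :
    Module.End ℝ (H x) :=
  tauOp (g.form x) (g.nondegenerate x) (fun s => F.I s x) fun t => F.torsE ξ nab x (ξ t x)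

/-- The operator of the tensor `μ`. -/
def LocalFrame.muE (F : LocalFrame H PQ g U) (ξ : Fin 3 → VField n M) (nab : Conn n M) (x : M) :
    Module.End ℝ (H x) :=
  -- Each of the three summands equals μ. Their mean is a contraction over the frame, which makes
  -- independence of the frame immediate.
  (1 / 3 : ℝ) • ∑ s, eps s •
    (skewPart (g.form x) (g.nondegenerate x) (F.torsE ξ nab x (ξ s x)) * F.I s x)

/-- The function `λ`. -/
def LocalFrame.lamE (F : LocalFrame H PQ g U) (ξ : Fin 3 → VField n M) (nab : Conn n M) (x : M) :
    ℝ :=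
  -- One component suffices, since `TorsData.tors_vertical` expresses all cyclic components by the
  -- same number.
  eps 2 * F.η 2 x (tors nab x (ξ 0 x) (ξ 1 x))

variable {F : LocalFrame H PQ g U} {ξ : Fin 3 → VField n M}

section Data

variable {τ : Fin 3 → Module.End ℝ (H x)} (d : TorsData F ξ nab x τ)
include d

theorem TorsData.symPart_torsE (hx : x ∈ U) (t : Fin 3) :
    symPart (g.form x) (g.nondegenerate x) (F.torsE ξ nab x (ξ t x))
      = symPart (g.form x) (g.nondegenerate x) (τ t) := by
  rw [d.torsE_eq]
  exact (F.paraQuat hx).symPart_sub_spProj (τ t)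

theorem TorsData.skewPart_torsE (hx : x ∈ U) (t : Fin 3) :
    skewPart (g.form x) (g.nondegenerate x) (F.torsE ξ nab x (ξ t x))
      = perpSkew (g.form x) (g.nondegenerate x) (fun s => F.I s x) (τ t) := by
  rw [d.torsE_eq]
  exact (F.paraQuat hx).skewPart_sub_spProj (τ t)

theorem TorsData.tauE_eq (hx : x ∈ U) : F.tauE ξ nab x
    = tauOp (g.form x) (g.nondegenerate x) (fun s => F.I s x) τ := by
  simp only [LocalFrame.tauE, tauOp, d.symPart_torsE hx]

theorem TorsData.muE_eq (hn : 1 ≤ n) (hH : IsSmoothDistribution (4 * n) H) (hx : x ∈ U) :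
    F.muE ξ nab x = muOp (g.form x) (g.nondegenerate x) (fun s => F.I s x) τ := by
  have := nontrivial_horizontal hn hH x
  have h : ∀ s, _ := fun s => TorsRel.muOp_eq (F.paraQuat hx) d.rel s
  simp only [LocalFrame.muE, d.skewPart_torsE hx, ← h, Finset.sum_const, Finset.card_univ,
    Fintype.card_fin]
  rw [← Nat.cast_smul_eq_nsmul ℝ, smul_smul]
  norm_num

theorem TorsData.lamE_eq (hn : 1 ≤ n) (hH : IsSmoothDistribution (4 * n) H) (hξ : IsDual F ξ W)
    (hc : Compat F ξ W nab) (hx : x ∈ W) : F.lamE ξ nab x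
      = lamOp (fun s => F.I s x) τ (fun s u v => extT (F.η s) x (ξ u x) (ξ v x)) 0 := by
  have h := (d.tors_vertical hn hH hξ hc hx 0).2.2
  rw [zero_add, zero_add] at h
  rw [LocalFrame.lamE, h, ← mul_assoc, eps_mul_self, one_mul]

theorem TorsData.trace_torsE (hn : 1 ≤ n) (hH : IsSmoothDistribution (4 * n) H) (hx : x ∈ U)
    (t : Fin 3) : LinearMap.trace ℝ (H x) (F.torsE ξ nab x (ξ t x)) = 0 ∧
      ∀ s, LinearMap.trace ℝ (H x) (F.torsE ξ nab x (ξ t x) * F.I s x) = 0 := by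
  have := nontrivial_horizontal hn hH x
  have h := F.paraQuat hx
  have e : F.torsE ξ nab x (ξ t x) = symPart (g.form x) h.nondeg (τ t)
      + perpSkew (g.form x) h.nondeg (fun s => F.I s x) (τ t) := by
    rw [d.torsE_eq]
    exact h.sub_spProj (τ t)
  have h1 : LinearMap.trace ℝ (H x) (symPart (g.form x) h.nondeg (τ t)) = 0 :=
    TorsRel.trace_symPart h d.rel t
  have h2 := trace_adj (g.form x) h.nondeg (perpSkew (g.form x) h.nondeg (fun s => F.I s x) (τ t))
  rw [h.adj_perpSkew, map_neg] at h2
  refine ⟨?_, fun s => ?_⟩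
  · rw [e, map_add, h1]
    linarith
  · have h3 : LinearMap.trace ℝ (H x) (symPart (g.form x) h.nondeg (τ t) * F.I s x) = 0 :=
      h.trace_sym_mul_skew (h.adj_symPart (τ t)) (h.adj_I s)
    have h4 : LinearMap.trace ℝ (H x)
        (F.I s x * perpSkew (g.form x) h.nondeg (fun s => F.I s x) (τ t)) = 0 :=
      h.trace_I_perpSkew (τ t) s
    rw [e, add_mul, map_add, h3, LinearMap.trace_mul_comm, h4, add_zero]

theorem TorsData.contr_lieI (hn : 1 ≤ n) (hH : IsSmoothDistribution (4 * n) H) (hx : x ∈ U)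
    (i : Fin 3) :
    g.contr x ((g.form x).comp (F.lieI ξ nab i (i + 2) x * F.I (i + 1) x) LinearMap.id)
      = -2 * (4 * n * coefPart (fun s => F.I s x) i (τ i)) ∧
    g.contr x ((g.form x).comp (F.lieI ξ nab i (i + 2) x) (F.I (i + 1) x))
      = 2 * (4 * n * coefPart (fun s => F.I s x) i (τ i)) := by
  have := nontrivial_horizontal hn hH x
  have h := F.paraQuat hx
  have h1 : LinearMap.trace ℝ (H x)
      ((F.I (i + 2) x * τ i - τ i * F.I (i + 2) x) * F.I (i + 1) x)
      = -2 * (Module.finrank ℝ (H x) * coefPart (fun s => F.I s x) i (τ i)) :=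
    h.trace_comm_mul (τ i) i
  rw [finrank_horizontal hH, Nat.cast_mul, Nat.cast_ofNat] at h1
  rw [d.lieI_eq]
  refine ⟨?_, ?_⟩
  · rw [contr_of_form _ _ fun X Y => rfl, ← h1]
  · rw [contr_of_form _ (-(F.I (i + 1) x * (F.I (i + 2) x * τ i - τ i * F.I (i + 2) x)))
      fun X Y => ?_, map_neg, LinearMap.trace_mul_comm, h1]
    · ring
    · have h2 : ∀ Z : H x, g.form x (F.I (i + 1) x Z) Y = -g.form x Z (F.I (i + 1) x Y) := fun Z =>
        h.skew (i + 1) Z Y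
      rw [LinearMap.neg_apply, map_neg, LinearMap.neg_apply, Module.End.mul_apply, h2, neg_neg]
      rfl

theorem TorsData.torsSkew_eq_lieI (hn : 1 ≤ n) (hH : IsSmoothDistribution (4 * n) H) (hx : x ∈ U)
    (t : Fin 3) (X Y : H x) :
    g.form x (skewPart (g.form x) (g.nondegenerate x) (F.torsE ξ nab x (ξ t x)) X) Y
      = -(1 / 8) * (skewLie F x (fun s => F.lieI ξ nab t s x) X Y
          - sp1Part F x (skewLie F x (fun s => F.lieI ξ nab t s x)) X Y) := by
  have := nontrivial_horizontal hn hH x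
  have h := F.paraQuat hx
  -- The operator of the form `skewLie`: -8 times the skew part of τ_t without its commuting
  -- component. Removing the sp(1)-component as well leaves -8 times the part orthogonal to sp(n, ℝ)
  -- ⊕ sp(1, ℝ), which is the skew torsion.
  set B : Module.End ℝ (H x) := (-8 : ℝ) • (skewPart (g.form x) h.nondeg (τ t)
    - commPart (fun s => F.I s x) (skewPart (g.form x) h.nondeg (τ t))) with hB
  have h1 : ∀ X Y, skewLie F x (fun s => F.lieI ξ nab t s x) X Y = g.form x (B X) Y := by
    intro X Y
    rw [hB, LinearMap.smul_apply]
    have h2 : _ = _ := h.sum_form_comm_skew (τ t) X Y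
    rw [← h2]
    simp only [skewLie, d.lieI_eq, LinearMap.sum_apply, LinearMap.smul_apply, smul_eq_mul,
      LinearMap.sub_apply]
    rfl
  have h3 : ∀ s, g.contr x ((skewLie F x fun s => F.lieI ξ nab t s x).comp LinearMap.id (F.I s x))
      = -LinearMap.trace ℝ (H x) (F.I s x * B) := by
    intro s
    rw [contr_of_form _ (-(F.I s x * B)) fun X Y => ?_, map_neg]
    have h4 : g.form x (F.I s x (B X)) Y = -g.form x (B X) (F.I s x Y) := h.skew s (B X) Y
    rw [LinearMap.neg_apply, map_neg, LinearMap.neg_apply, Module.End.mul_apply, h4, neg_neg,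
      ← h1]
    rfl
  have h5 : ∀ s, coefPart (fun s => F.I s x) s B
      = eps s / (4 * n) * LinearMap.trace ℝ (H x) (F.I s x * B) := fun s => by
    rw [coefPart_apply, finrank_horizontal hH, Nat.cast_mul, Nat.cast_ofNat]
  have h6 : sp1Part F x (skewLie F x fun s => F.lieI ξ nab t s x) X Y
      = ∑ s, coefPart (fun s => F.I s x) s B * g.form x (F.I s x X) Y := by
    simp only [sp1Part, h3, h5, LinearMap.neg_apply, LinearMap.smul_apply, LinearMap.sum_apply,
      smul_eq_mul, Finset.mul_sum, ← Finset.sum_neg_distrib]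
    refine Finset.sum_congr rfl fun s _ => ?_
    have h7 : (g.form x).comp (F.I s x) LinearMap.id X Y = g.form x (F.I s x X) Y := rfl
    rw [h7]
    ring
  have h8 := h.perpSkew_eq (τ t) B hB
  rw [h1, h6, d.skewPart_torsE hx, h8]
  simp only [LinearMap.smul_apply, LinearMap.sub_apply, LinearMap.sum_apply, map_smul, map_sub,
    map_sum, smul_eq_mul]

end Data

end

/-! ### The explicit form over a local frame -/

section

variable {n : ℕ} {M : Type*} [TopologicalSpace M]
  [ChartedSpace (EuclideanSpace ℝ (Fin (4 * n + 3))) M] [IsManifold (𝓡 (4 * n + 3)) ∞ M]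
  {H : SubspaceField n M} {PQ : Π x : M, Submodule ℝ (Module.End ℝ (H x))} {g : HMetric H}
  {U U' W W' V : Set M} {x : M} {nab nab' : Conn n M} {X Y Z : VField n M} {C : Complement H}
  {F : LocalFrame H PQ g U} {ξ : Fin 3 → VField n M}

theorem Compat.tors_VV (hξ : IsDual F ξ W) (hc : Compat F ξ W nab) (hx : x ∈ W) (s t : Fin 3) :
    F.hproj ξ x (tors nab x (ξ t x) (ξ s x)) = -F.hproj ξ x (bracket (ξ t) (ξ s) x) := by
  have hd : ∀ s, DiffVF (ξ s) x := fun s => (hξ.smooth s).diffVF hξ.isOpen hx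
  rw [tors_apply nab (hd t) (hd s), map_sub, map_sub, hc.cov_ξ s x hx, hc.cov_ξ t x hx]
  abel

theorem tors3_VVV (hξ : IsDual F ξ W) (hxW : x ∈ W) (hp : C.projH x = F.hproj ξ x)
    (nab : Conn n M) (u v : Tan n M x) (s : Fin 3) :
    tors3 F C nab x u v (ξ s x) = -(eps s * F.η s x (tors nab x u v)) := by
  have hY : F.hproj ξ x (ξ s x) = 0 := hξ.hproj_ξ hxW s
  simp [tors3, LocalFrame.extMetric, hp, hY, hξ.dual _ _ x hxW]

/-- Since ω_i is extended by zero and ξ_s is vertical, only the term with [ξ_t, ξ_s] survives in the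
Lie derivative; compatibility of I_i with g then removes I_i from both slots. -/
theorem lieForm_omega (hξ : IsDual F ξ W) (hC : C.SpannedBy W ξ) (hx : x ∈ W) (i s t : Fin 3)
    (X : HField H) : lieForm (F.omega C i) (ξ t) (ξ s) (HField.toVField fun y => F.I i y (X y)) x
      = eps i * g.form x (F.hproj ξ x (bracket (ξ t) (ξ s) x)) (X x) := by
  have h := F.paraQuat (hξ.subset hx)
  have hp : ∀ y ∈ W, C.projH y = F.hproj ξ y := fun y hy => hξ.projH_eq hy (hC y hy)
  have h0 : ∀ y ∈ W, ∀ b : Tan n M y, F.omega C i y (ξ s y) b = 0 := fun y hy b => by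
    simp [LocalFrame.omega, hp y hy, hξ.hproj_ξ hy]
  have h1 : dirD (fun y => F.omega C i y (ξ s y) (HField.toVField (fun y => F.I i y (X y)) y)) x
      (ξ t x) = 0 := by
    rw [dirD_congr (f := fun _ => (0 : ℝ)), dirD_const]
    filter_upwards [hξ.isOpen.mem_nhds hx] with y hy
    exact h0 y hy _
  have h2 : F.omega C i x (bracket (ξ t) (ξ s) x) (HField.toVField (fun y => F.I i y (X y)) x)
      = g.form x (F.I i x (F.hproj ξ x (bracket (ξ t) (ξ s) x))) (F.I i x (X x)) := by
    rw [LocalFrame.omega, hp x hx]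
    change g.form x (F.I i x (F.hproj ξ x (bracket (ξ t) (ξ s) x)))
      (F.hproj ξ x (F.I i x (X x) : Tan n M x)) = _
    rw [hξ.hproj_coe hx]
  have h3 : g.form x (F.I i x (F.hproj ξ x (bracket (ξ t) (ξ s) x))) (F.I i x (X x))
      = -(eps i * g.form x (F.hproj ξ x (bracket (ξ t) (ξ s) x)) (X x)) := h.compat i _ _
  rw [lieForm, h1, h0 x hx, h2, h3]
  ring

/-- Replacing [ξ_t, X]_H by (∇_{ξ_t} X)_H - T(ξ_t, X)_H, the covariant derivatives cancel because g
is parallel. What remains is twice the symmetric part of the torsion. -/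
theorem Compat.lieForm_extMetric (hξ : IsDual F ξ W) (hc : Compat F ξ W nab)
    (hC : C.SpannedBy W ξ) (t : Fin 3) (hV : IsOpen V) (hVW : V ⊆ W) {X Y : HField H}
    (hX : SmoothHF V X) (hY : SmoothHF V Y) (hx : x ∈ V) :
    lieForm (F.extMetric C) (ξ t) X.toVField Y.toVField x
      = g.form x (F.torsE ξ nab x (ξ t x) (X x)) (Y x)
        + g.form x (X x) (F.torsE ξ nab x (ξ t x) (Y x)) := by
  have hxW := hVW hx
  have hp : ∀ y ∈ V, C.projH y = F.hproj ξ y := fun y hy => hξ.projH_eq (hVW hy) (hC y (hVW hy))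
  have hE : ∀ y ∈ V, ∀ (a : Tan n M y) (Z : H y), F.extMetric C y a Z
      = g.form y (F.hproj ξ y a) Z ∧ F.extMetric C y Z a = g.form y Z (F.hproj ξ y a) := by
    intro y hy a Z
    have hZ : F.hproj ξ y (Z : Tan n M y) = Z := hξ.hproj_coe (hVW hy) Z
    simp [LocalFrame.extMetric, hp y hy, hZ, F.η_coe (hξ.subset (hVW hy))]
  have h1 : dirD (fun y => F.extMetric C y (X.toVField y) (Y.toVField y)) x (ξ t x)
      = dirD (fun y => g.form y (X y) (Y y)) x (ξ t x) := by
    refine dirD_congr ?_ _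
    filter_upwards [hV.mem_nhds hx] with y hy
    change F.extMetric C y (X y : Tan n M y) (Y y : Tan n M y) = _
    rw [(hE y hy _ _).1, hξ.hproj_coe (hVW hy)]
  have h2 : F.extMetric C x (bracket (ξ t) X.toVField x) (Y.toVField x)
      = g.form x (F.hproj ξ x (bracket (ξ t) X.toVField x)) (Y x) := (hE x hx _ (Y x)).1
  have h3 : F.extMetric C x (X.toVField x) (bracket (ξ t) Y.toVField x)
      = g.form x (X x) (F.hproj ξ x (bracket (ξ t) Y.toVField x)) := (hE x hx _ (X x)).2
  rw [lieForm, h1, h2, h3, hc.hproj_bracket hξ hxW t hV hx hX, hc.hproj_bracket hξ hxW t hV hx hY,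
    hc.pres_g V hV hVW X Y hX hY x hx, map_sub, map_sub, LinearMap.sub_apply]
  ring

theorem IsDual.coe_hproj_of_mem (hξ : IsDual F ξ W) (hx : x ∈ W) {v : Tan n M x} (hv : v ∈ H x) :
    (F.hproj ξ x v : Tan n M x) = v :=
  congrArg Subtype.val (hξ.hproj_coe hx ⟨v, hv⟩)

theorem Compat.cov_mem (hc : Compat F ξ W nab) {V : Set M} (hVW : V ⊆ W) {X : HField H}
    (hX : SmoothHF V X) {x : M} (hx : x ∈ V) (hV : IsOpen V) (hWU : W ⊆ U) (v : Tan n M x) :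
    nab X.toVField x v ∈ H x :=
  (F.mem_iff (hWU (hVW hx)) _).2 fun u => hc.pres_H V hV hVW X hX x hx v u

-- At each point the data of `CanonOn.exists_torsData` reduce the formulas to the algebra of
-- `TorsRel`; metricity and compatibility of ∇ account for the clauses on covariant derivatives.
set_option maxHeartbeats 2000000 in
theorem explicitForm (hn : 1 ≤ n) (hH : IsSmoothDistribution (4 * n) H) (hξ : ReebOn F ξ U)
    (hC : C.SpannedBy U ξ) (hc : CanonOn F ξ U nab) {τ μ : Π x : M, LinearMap.BilinForm ℝ (H x)}
    {lam : M → ℝ} (hτ : ∀ x ∈ U, ∀ X Y, τ x X Y = g.form x (F.tauE ξ nab x X) Y)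
    (hμ : ∀ x ∈ U, ∀ X Y, μ x X Y = g.form x (F.muE ξ nab x X) Y)
    (hlam : ∀ x ∈ U, lam x = F.lamE ξ nab x) :
    ExplicitForm F C nab ξ τ μ lam (F.conn1 ξ nab) (F.lieI ξ nab) := by
  have hd := hξ.toIsDual
  have hm := hc.toCompat
  have hp : ∀ x ∈ U, C.projH x = F.hproj ξ x := fun x hx => hd.projH_eq hx (hC x hx)
  have hT : ∀ x ∈ U, ∃ τ, TorsData F ξ nab x τ := fun x hx => hc.exists_torsData hn hH hξ hx
  have hPQ : ∀ x ∈ U, ParaQuat (g.form x) fun s => F.I s x := fun x hx => F.paraQuat hx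
  have hDξ : ∀ s, ∀ x ∈ U, DiffVF (ξ s) x := fun s x hx => (hd.smooth s).diffVF hd.isOpen hx
  have hext : ∀ s t u, ∀ x ∈ U, extD (F.η s) (ξ t) (ξ u) x = extT (F.η s) x (ξ t x) (ξ u x) :=
    fun s t u x hx => (extT_apply (F.diffForm hx s) (hDξ t x hx) (hDξ u x hx)).symm
  have hextX : ∀ s t, ∀ V : Set M, IsOpen V → V ⊆ U → ∀ X : HField H, SmoothHF V X → ∀ x ∈ V,
      extD (F.η s) (ξ t) X.toVField x = extT (F.η s) x (ξ t x) (X x) :=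
    fun s t V hV hVU X hX x hx => (extT_apply (F.diffForm (hVU hx) s) (hDξ t x (hVU hx))
      (SmoothVF.diffVF hX hV hx)).symm
  have hα : ∀ s, ∀ x ∈ U, ∀ X : H x,
      F.conn1 ξ nab s x X = extT (F.η (s + 1)) x (ξ (s + 2) x) X := fun s x hx X => by
    obtain ⟨τ', d⟩ := hT x hx
    rw [d.conn1_eq, hd.hproj_coe hx]
    simp [F.η_coe hx]
  refine
    { pres_ext := fun V hV hVU A B hA hB x hx v =>
        hm.cov_extMetric hn hH hd hC hV hVU hA hB hx v
      cov_I := ?_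
      cov_ξ := fun i x hx v => hm.cov_ξ_conn1 hn hH hd hx i v
      α_hor := ?_
      α_vert₁ := ?_
      α_vert₂ := ?_
      α_vert₃ := ?_
      α_vert₄ := ?_
      lam_eq := ?_
      tors_hor₁ := ?_
      tors_hor₂ := ?_
      tors_mixed := ?_
      tors_trace := ?_
      tors_sym := ?_
      tors_skew := ?_
      tors_VVH := ?_
      tors_VVV₁ := ?_
      tors_VVV₂ := ?_
      tau_def := ?_
      tau_symm := ?_
      tau_trace := ?_
      tau_type := ?_
      tors_tau := ?_
      mu_def := ?_
      mu_symm := ?_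
      mu_trace := ?_
      mu_type := ?_
      tors_mu := ?_
      mu_zero := ?_ }
  · intro i V hV hVU Y hY x hx v
    have hx' := hVU hx
    rw [covH, covH, hp x hx', hm.cov_I_conn1 hn hH hd i hV hVU hY hx v]
    abel
  · intro i V hV hVU X hX x hx
    have hx' := hVU hx
    have h1 := hα (i + 2) x hx' (X x)
    rw [add_two_add_one, add_two_add_two] at h1
    refine ⟨?_, ?_⟩
    · rw [hextX _ _ V hV hVU X hX x hx]
      exact h1
    · rw [hextX _ _ V hV hVU X hX x hx, ← hξ.cross i hx' (X x)]
      exact h1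
  · intro i x hx
    have := nontrivial_horizontal hn hH x
    obtain ⟨τ', d⟩ := hT x hx
    -- α_s(ξ_t) is -2 ε_{s+1} times the coefficient of τ_t along I_s; the off-diagonal coefficients
    -- come from the trace relations.
    have h1 : coefPart (fun s => F.I s x) (i + 1) (τ' i)
        = eps i / 2 * extT (F.η i) x (ξ (i + 2) x) (ξ i x) :=
      TorsRel.coefPart_succ (hPQ x hx) d.rel i
    have h2 := extT_swap (F.η i) (ξ (i + 2) x) (ξ i x)
    have h3 := eps_mul_self i
    have h4 := eps_cyclic i
    have h5 := eps_mul_self (i + 2)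
    have h6 := eps_mul_self (i + 1)
    rw [d.conn1_ξ hd hx, h1, h2, hext _ _ _ x hx, add_one_add_one]
    have key : ∀ p q r a : ℝ, p * q = -r → r * r = 1 → q * q = 1 →
        -2 * r * (p / 2 * -a) = -(q * a) := by
      intro p q r a h1 h2 h3
      linear_combination (r * q * a) * h1 - (q * a) * h2 - (r * p * a) * h3
    exact key _ _ _ _ h4 h5 h6
  · intro i x hx
    have := nontrivial_horizontal hn hH x
    obtain ⟨τ', d⟩ := hT x hx
    have h1 : coefPart (fun s => F.I s x) (i + 2) (τ' i)
        = -(eps i / 2 * extT (F.η i) x (ξ (i + 1) x) (ξ i x)) :=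
      TorsRel.coefPart_pred (hPQ x hx) d.rel i
    have h2 := extT_swap (F.η i) (ξ (i + 1) x) (ξ i x)
    have h3 := eps_mul_self i
    rw [d.conn1_ξ hd hx, h1, h2, hext _ _ _ x hx, add_two_add_one]
    have key : ∀ p a : ℝ, p * p = 1 → -2 * p * -(p / 2 * -a) = -a := by
      intro p a h1
      linear_combination -a * h1
    exact key _ _ h3
  · intro i x hx
    have := nontrivial_horizontal hn hH x
    obtain ⟨τ', d⟩ := hT x hx
    -- The trace relations leave the diagonal coefficients free up to a common summand. The
    -- expression of λ at index i is solved for the coefficient of τ_i along I_i.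
    have h1 := d.rel.lamOp_eq (hPQ x hx) i
    rw [lamOp] at h1
    rw [d.conn1_ξ hd hx, hlam x hx, d.lamE_eq hn hH hd hm hx, ← h1, hext _ _ _ x hx,
      hext _ _ _ x hx, hext _ _ _ x hx]
    have key : ∀ p q r a A B c : ℝ, p * q = -r → q * q = 1 → -2 * q * a
        = (r * A + B - p * c - q * (4 * a - p * A + q * B + r * c)) / 2 := by
      intro p q r a A B c h1 h2
      linear_combination (-A / 2) * h1 + (B / 2) * h2
        + (c / 2 * q) * h1 - (p * c / 2) * h2
    exact key _ _ _ _ _ _ _ (eps_cyclic i) (eps_mul_self (i + 1))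
  · intro i x hx
    obtain ⟨τ', d⟩ := hT x hx
    have hn' : (n : ℝ) ≠ 0 := by exact_mod_cast (by omega : n ≠ 0)
    rw [(d.contr_lieI hn hH hx i).1, d.conn1_ξ hd hx]
    field_simp
  · intro i x hx
    have := nontrivial_horizontal hn hH x
    obtain ⟨τ', d⟩ := hT x hx
    have hn' : (n : ℝ) ≠ 0 := by exact_mod_cast (by omega : n ≠ 0)
    have h1 := d.rel.lamOp_eq (hPQ x hx) i
    rw [lamOp] at h1
    rw [(d.contr_lieI hn hH hx i).2, hlam x hx, d.lamE_eq hn hH hd hm hx, ← h1, hext _ _ _ x hx,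
      hext _ _ _ x hx, hext _ _ _ x hx]
    field_simp
  · intro V hV hVU X Y hX hY x hx
    have hx' := hVU hx
    have h1 := hm.tors_horizontal hd hH hx' (X x) (Y x)
    rw [hc.tors_H x hx', LinearMap.zero_apply, ZeroMemClass.coe_zero, zero_add] at h1
    rw [h1]
    exact Finset.sum_congr rfl fun s _ => by rw [F.contact s V hV hVU X Y hX hY x hx]
  · intro x hx X Y
    have h1 := hm.tors_horizontal hd hH hx X Y
    rw [hc.tors_H x hx, LinearMap.zero_apply, ZeroMemClass.coe_zero, zero_add] at h1
    rw [h1, Finset.smul_sum, ← Finset.sum_neg_distrib]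
    refine Finset.sum_congr rfl fun s _ => ?_
    have h2 : F.omega C s x X Y = g.form x (F.I s x X) Y := by
      change g.form x (F.I s x (C.projH x X)) (C.projH x Y) = _
      rw [C.projH_coe, C.projH_coe]
    rw [h2, smul_smul, ← neg_smul]
    congr 1
    ring
  · intro s V hV hVU X hX x hx
    have hx' := hVU hx
    obtain ⟨τ', d⟩ := hT x hx'
    have h1 : tors nab x (ξ s x) (X x) ∈ H x :=
      (F.mem_iff hx' _).2 fun u => d.η_tors_mixed hn hH hξ hm hx' u s (X x)
    have h2 := hm.hproj_bracket hd hx' s hV hx hX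
    refine ⟨?_, h1⟩
    rw [hp x hx', h2, AddSubgroupClass.coe_sub, F.torsE_apply,
      hd.coe_hproj_of_mem hx' h1, hd.coe_hproj_of_mem hx' (hm.cov_mem hVU hX hx hV subset_rfl _)]
    abel
  · intro t x hx
    obtain ⟨τ', d⟩ := hT x hx
    obtain ⟨h1, h2⟩ := d.trace_torsE hn hH hx t
    rw [torsEnd_eq (hp x hx)]
    refine ⟨?_, fun s => ?_⟩
    · rw [contr_of_form _ _ fun X Y => rfl, h1]
    · rw [contr_of_form _ _ fun X Y => rfl, h2]
  · intro t V hV hVU X Y hX hY x hx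
    have hx' := hVU hx
    rw [torsSym_eq hx' (hp x hx'), hm.lieForm_extMetric hd hC t hV hVU hX hY hx, symPart_apply,
      LinearMap.smul_apply, LinearMap.add_apply, map_smul, map_add, LinearMap.smul_apply,
      LinearMap.add_apply, form_adj, smul_eq_mul]
    ring
  · intro t x hx X Y
    obtain ⟨τ', d⟩ := hT x hx
    rw [torsSkew_eq hx (hp x hx)]
    exact d.torsSkew_eq_lieI hn hH hx t X Y
  · intro i s t V hV hVU X hX x hx
    have hx' := hVU hx
    rw [tors3_coe hx' (hp x hx'), hm.tors_VV hd hx', lieForm_omega hd hC hx', ← mul_assoc,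
      eps_mul_self, one_mul, map_neg, LinearMap.neg_apply]
  · intro i x hx
    obtain ⟨τ', d⟩ := hT x hx
    obtain ⟨h1, h2, -⟩ := d.tors_vertical hn hH hd hm hx i
    rw [tors3_VVV hd hx (hp x hx), tors3_VVV hd hx (hp x hx), h1, h2]
    simp
  · intro i x hx
    obtain ⟨τ', d⟩ := hT x hx
    obtain ⟨-, -, h3⟩ := d.tors_vertical hn hH hd hm hx i
    rw [tors3_VVV hd hx (hp x hx), h3, hlam x hx, d.lamE_eq hn hH hd hm hx, ← mul_assoc,
      eps_mul_self, one_mul]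
  · intro x hx X Y
    rw [hτ x hx, LocalFrame.tauE, tauOp]
    simp only [torsSym_eq hx (hp x hx), LinearMap.neg_apply, map_neg, LinearMap.sum_apply, map_sum,
      LinearMap.smul_apply, map_smul, smul_eq_mul, Module.End.mul_apply]
  · intro x hx X Y
    obtain ⟨τ', d⟩ := hT x hx
    have h1 : adj (g.form x) (g.nondegenerate x) (F.tauE ξ nab x) = F.tauE ξ nab x := by
      rw [d.tauE_eq hx]
      exact TorsRel.adj_tauOp (hPQ x hx) d.rel
    rw [hτ x hx, hτ x hx, ← h1, form_adj, g.symm, h1]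
  · intro x hx
    obtain ⟨τ', d⟩ := hT x hx
    refine ⟨?_, fun s => ?_⟩
    · rw [contr_of_form _ _ (hτ x hx), d.tauE_eq hx]
      exact TorsRel.trace_tauOp (hPQ x hx) d.rel
    · rw [contr_of_form _ (F.tauE ξ nab x * F.I s x) fun X Y => ?_, d.tauE_eq hx]
      · exact TorsRel.trace_tauOp_mul_I (hPQ x hx) d.rel s
      · exact hτ x hx (F.I s x X) Y
  · intro x hx X Y
    obtain ⟨τ', d⟩ := hT x hx
    -- The type condition on τ is the vanishing of the component of its operator that commutes with
    -- the I_s.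
    have h1 : commPart (fun s => F.I s x) (F.tauE ξ nab x) = 0 := by
      rw [d.tauE_eq hx]
      exact TorsRel.commPart_tauOp (hPQ x hx) d.rel
    have h2 := congr(g.form x ($h1 X) Y)
    have h3 : ∀ s, g.form x (F.tauE ξ nab x (F.I s x X)) (F.I s x Y)
        = -g.form x (F.I s x (F.tauE ξ nab x (F.I s x X))) Y := fun s => by
      have h4 : g.form x (F.I s x (F.tauE ξ nab x (F.I s x X))) Y
        = -g.form x (F.tauE ξ nab x (F.I s x X)) (F.I s x Y) := (hPQ x hx).skew s _ Y
      rw [h4, neg_neg]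
    simp only [hτ x hx, h3]
    rw [commPart_apply] at h2
    simp only [map_smul, map_add, map_sub, LinearMap.smul_apply, LinearMap.add_apply,
      LinearMap.sub_apply, LinearMap.zero_apply, map_zero, smul_eq_mul] at h2
    simp only [Fin.sum_univ_three, eps_zero, eps_one, eps_two]
    have key : ∀ a b c d : ℝ, 1 / 4 * (a + b + c - d) = 0 →
        a - (1 * -b + 1 * -c + -1 * -d) = 0 := by
      intro a b c d h
      linarith
    exact key _ _ _ _ h2
  · intro s x hx X Y
    obtain ⟨τ', d⟩ := hT x hx
    have h1 : symPart (g.form x) (g.nondegenerate x) (τ' s) = -(1 / 4 : ℝ)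
        • (F.tauE ξ nab x * F.I s x - F.I s x * F.tauE ξ nab x) := by
      rw [d.tauE_eq hx]
      exact TorsRel.symPart_eq (hPQ x hx) d.rel s
    have h2 : g.form x (F.I s x (F.tauE ξ nab x X)) Y
        = -g.form x (F.tauE ξ nab x X) (F.I s x Y) := (hPQ x hx).skew s _ Y
    rw [torsSym_eq hx (hp x hx), d.symPart_torsE hx, h1, hτ x hx, hτ x hx, LinearMap.smul_apply,
      LinearMap.sub_apply, map_smul, map_sub, LinearMap.smul_apply, LinearMap.sub_apply,
      Module.End.mul_apply, Module.End.mul_apply, h2, smul_eq_mul]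
    ring
  · intro s x hx X Y
    have := nontrivial_horizontal hn hH x
    obtain ⟨τ', d⟩ := hT x hx
    have h1 : F.muE ξ nab x = eps s • (perpSkew (g.form x) (g.nondegenerate x)
        (fun s => F.I s x) (τ' s) * F.I s x) := by
      rw [d.muE_eq hn hH hx]
      exact TorsRel.muOp_eq (hPQ x hx) d.rel s
    rw [hμ x hx, h1, torsSkew_eq hx (hp x hx), d.skewPart_torsE hx, LinearMap.smul_apply, map_smul,
      LinearMap.smul_apply, smul_eq_mul, Module.End.mul_apply]
  · intro x hx X Y
    have := nontrivial_horizontal hn hH x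
    obtain ⟨τ', d⟩ := hT x hx
    have h1 : adj (g.form x) (g.nondegenerate x) (F.muE ξ nab x) = F.muE ξ nab x := by
      rw [d.muE_eq hn hH hx]
      exact TorsRel.adj_muOp (hPQ x hx) d.rel
    rw [hμ x hx, hμ x hx, ← h1, form_adj, g.symm, h1]
  · intro x hx
    have := nontrivial_horizontal hn hH x
    obtain ⟨τ', d⟩ := hT x hx
    rw [contr_of_form _ _ (hμ x hx), d.muE_eq hn hH hx]
    exact TorsRel.trace_muOp (hPQ x hx) d.rel
  · intro s x hx X Y
    have := nontrivial_horizontal hn hH x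
    obtain ⟨τ', d⟩ := hT x hx
    have h1 : F.muE ξ nab x * F.I s x = F.I s x * F.muE ξ nab x := by
      rw [d.muE_eq hn hH hx]
      exact TorsRel.muOp_commute (hPQ x hx) d.rel s
    have h2 : F.muE ξ nab x (F.I s x X) = F.I s x (F.muE ξ nab x X) := congr($h1 X)
    rw [hμ x hx, hμ x hx, h2]
    exact (hPQ x hx).compat s _ _
  · intro s x hx X Y
    have := nontrivial_horizontal hn hH x
    obtain ⟨τ', d⟩ := hT x hx
    have h1 : F.muE ξ nab x * F.I s x
        = perpSkew (g.form x) (g.nondegenerate x) (fun s => F.I s x) (τ' s) := by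
      rw [d.muE_eq hn hH hx]
      exact TorsRel.muOp_mul_I (hPQ x hx) d.rel s
    rw [torsSkew_eq hx (hp x hx), d.skewPart_torsE hx, hμ x hx, ← h1]
    rfl
  · intro hn1 x hx
    have := nontrivial_horizontal hn hH x
    obtain ⟨τ', d⟩ := hT x hx
    have h1 : F.muE ξ nab x = 0 := by
      rw [d.muE_eq hn hH hx]
      exact TorsRel.muOp_eq_zero (hPQ x hx) d.rel (by rw [finrank_horizontal hH, hn1])
    refine LinearMap.ext fun X => LinearMap.ext fun Y => ?_
    rw [hμ x hx, h1]
    simp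

end

/-! ### Smoothness and frame independence of τ, μ and λ -/

section

variable {n : ℕ} {M : Type*} [TopologicalSpace M]
  [ChartedSpace (EuclideanSpace ℝ (Fin (4 * n + 3))) M] [IsManifold (𝓡 (4 * n + 3)) ∞ M]
  {H : SubspaceField n M} {PQ : Π x : M, Submodule ℝ (Module.End ℝ (H x))} {g : HMetric H}
  {U U' W W' V : Set M} {x : M} {nab nab' : Conn n M} {X Y Z : VField n M} {C : Complement H}
  {F : LocalFrame H PQ g U} {ξ : Fin 3 → VField n M}

theorem SmoothForm.congr {B B' : Π x : M, LinearMap.BilinForm ℝ (H x)} (hB : SmoothForm W B)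
    (h : ∀ y ∈ W, B' y = B y) : SmoothForm W B' :=
  fun O hO hOW X Y hX hY => (hB O hO hOW X Y hX hY).congr fun y hy => by rw [h y (hOW hy)]

theorem SmoothForm.mono {B : Π x : M, LinearMap.BilinForm ℝ (H x)} (hB : SmoothForm W B)
    (h : V ⊆ W) : SmoothForm V B :=
  fun O hO hOV => hB O hO (hOV.trans h)

theorem SmoothForm.of_locally {B : Π x : M, LinearMap.BilinForm ℝ (H x)}
    (h : ∀ x ∈ W, ∃ O, IsOpen O ∧ x ∈ O ∧ SmoothForm (W ∩ O) B) : SmoothForm W B := by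
  intro V hV hVW X Y hX hY
  refine SmoothFun.of_locally fun x hx => ?_
  obtain ⟨O, hO, hxO, hB⟩ := h x (hVW hx)
  exact ⟨O, hO, hxO, hB (V ∩ O) (hV.inter hO) (Set.inter_subset_inter_left _ hVW) X Y
    (hX.mono Set.inter_subset_left) (hY.mono Set.inter_subset_left)⟩

theorem CanonOn.exists_smooth_torsE (hn : 1 ≤ n) (hH : IsSmoothDistribution (4 * n) H)
    (hξ : ReebOn F ξ W) (hc : CanonOn F ξ W nab) (hx : x ∈ W) :
    ∃ O, IsOpen O ∧ x ∈ O ∧ O ⊆ W ∧ Nonempty (HFrame g O) ∧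
      ∀ t, SmoothEnd O fun y => F.torsE ξ nab y (ξ t y) := by
  obtain ⟨W', D, hxW, hWW, hR, ⟨E⟩, hD, h⟩ := hc.exists_adapted hn hH hξ hx
  refine ⟨W', hR.isOpen, hxW, hWW, ⟨E⟩, fun t => ?_⟩
  have h1 := hD.smooth_torsE hR.toIsDual (hR.smooth t)
  refine (h1.sub (SmoothEnd.spProj hH E hR.isOpen F hR.subset h1)).congr fun y hy => ?_
  rw [torsE_eq_of_eq (h y hy), F.torsE_canon_ξ hR.toIsDual hy]

theorem CanonOn.smooth_tauE (hn : 1 ≤ n) (hH : IsSmoothDistribution (4 * n) H)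
    (hξ : ReebOn F ξ W) (hc : CanonOn F ξ W nab) : SmoothEnd W (F.tauE ξ nab) := by
  refine SmoothEnd.of_locally fun x hx => ?_
  obtain ⟨O, hO, hxO, hOW, ⟨E⟩, h⟩ := hc.exists_smooth_torsE hn hH hξ hx
  have h1 : SmoothEnd O fun y => (-1 : ℝ) • ∑ s, eps s • (symPart (g.form y) (g.nondegenerate y)
      (F.torsE ξ nab y (ξ s y)) * F.I s y) :=
    SmoothEnd.const_smul _ (SmoothEnd.sum fun s _ => SmoothEnd.const_smul _
      (((h s).symPart E).mul (F.smoothEnd_I (hOW.trans hξ.subset) s)))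
  refine ⟨O, hO, hxO, (h1.congr fun y _ => ?_).mono Set.inter_subset_right⟩
  rw [LocalFrame.tauE, tauOp]
  module

theorem CanonOn.smooth_muE (hn : 1 ≤ n) (hH : IsSmoothDistribution (4 * n) H)
    (hξ : ReebOn F ξ W) (hc : CanonOn F ξ W nab) : SmoothEnd W (F.muE ξ nab) := by
  refine SmoothEnd.of_locally fun x hx => ?_
  obtain ⟨O, hO, hxO, hOW, ⟨E⟩, h⟩ := hc.exists_smooth_torsE hn hH hξ hx
  have h1 : SmoothEnd O fun y => (1 / 3 : ℝ) • ∑ s, eps s • (skewPart (g.form y)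
      (g.nondegenerate y) (F.torsE ξ nab y (ξ s y)) * F.I s y) :=
    SmoothEnd.const_smul _ (SmoothEnd.sum fun s _ => SmoothEnd.const_smul _
      (((h s).skewPart E).mul (F.smoothEnd_I (hOW.trans hξ.subset) s)))
  exact ⟨O, hO, hxO, h1.mono Set.inter_subset_right⟩

theorem CanonOn.smooth_lamE (hn : 1 ≤ n) (hH : IsSmoothDistribution (4 * n) H)
    (hξ : ReebOn F ξ W) (hc : CanonOn F ξ W nab) : SmoothFun (n := n) W (F.lamE ξ nab) := by
  have hd := hξ.toIsDual
  have h0 := hc.smooth_conn1 hn hH hξ 0 W hd.isOpen subset_rfl _ (hd.smooth 0)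
  have h1 := hc.smooth_conn1 hn hH hξ 1 W hd.isOpen subset_rfl _ (hd.smooth 1)
  have h2 := (F.smooth_η 2).extT F.isOpen hd.isOpen hd.subset (hd.smooth 0) (hd.smooth 1)
  refine SmoothFun.congr (SmoothFun.const_mul (eps 2)
    ((SmoothFun.sub (SmoothFun.const_mul (eps 0) h0) h1).add h2)) fun y hy => ?_
  have e0 := hc.toCompat.cov_ξ_conn1 hn hH hd hy 1 (ξ 0 y)
  have e1 := hc.toCompat.cov_ξ_conn1 hn hH hd hy 0 (ξ 1 y)
  rw [LocalFrame.lamE, hd.η_tors_ξ hy, e0, e1]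
  have i1 : (1 : Fin 3) + 1 = 2 := rfl
  have i2 : (1 : Fin 3) + 2 = 0 := rfl
  simp [i1, i2, hd.dual _ _ y hy]

section Change

variable {F' : LocalFrame H PQ g U'} {ξ' : Fin 3 → VField n M}

theorem tauE_change (hn : 1 ≤ n) (hH : IsSmoothDistribution (4 * n) H) (hξ : IsDual F ξ W)
    (hξ' : IsDual F' ξ' W') (hx : x ∈ W) (hx' : x ∈ W')
    (hp : ∀ v : Tan n M x, F'.hproj ξ' x v = F.hproj ξ x v) (nab : Conn n M) :
    F'.tauE ξ' nab x = F.tauE ξ nab x := by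
  have h := sum_eps_frame hn hH hξ hξ' hx hx' hp
    (symPart (g.form x) (g.nondegenerate x) ∘ₗ F.torsE ξ nab x)
  simp only [LocalFrame.tauE, tauOp, torsE_congr hp]
  exact congrArg Neg.neg h

theorem muE_change (hn : 1 ≤ n) (hH : IsSmoothDistribution (4 * n) H) (hξ : IsDual F ξ W)
    (hξ' : IsDual F' ξ' W') (hx : x ∈ W) (hx' : x ∈ W')
    (hp : ∀ v : Tan n M x, F'.hproj ξ' x v = F.hproj ξ x v) (nab : Conn n M) :
    F'.muE ξ' nab x = F.muE ξ nab x := by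
  have h := sum_eps_frame hn hH hξ hξ' hx hx' hp
    (skewPart (g.form x) (g.nondegenerate x) ∘ₗ F.torsE ξ nab x)
  simp only [LocalFrame.muE, torsE_congr hp]
  exact congrArg (fun A => (1 / 3 : ℝ) • A) h

/-- The vertical torsion of ξ_i, ξ_j is λ times a signed third Reeb field, and [I_i, I_j] is twice a
signed third structure; φ matches the two. -/
theorem TorsData.phi_tors_ξ {τ : Fin 3 → Module.End ℝ (H x)} (d : TorsData F ξ nab x τ)
    (hn : 1 ≤ n) (hH : IsSmoothDistribution (4 * n) H) (hξ : IsDual F ξ W)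
    (hc : Compat F ξ W nab) (hx : x ∈ W) (i j : Fin 3) :
    F.phi x (tors nab x (ξ i x) (ξ j x))
      = (-(F.lamE ξ nab x / 2)) • (F.I i x * F.I j x - F.I j x * F.I i x) := by
  have hneg : ∀ v : Tan n M x, F.phi x (-v) = -F.phi x v := fun v => by
    simp only [LocalFrame.phi, Fin.sum_univ_three, map_neg]
    module
  have h1 : ∀ i, F.phi x (tors nab x (ξ i x) (ξ (i + 1) x))
      = (-(F.lamE ξ nab x / 2)) • (F.I i x * F.I (i + 1) x - F.I (i + 1) x * F.I i x) := by
    intro i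
    obtain ⟨h1, -, h3⟩ := d.tors_vertical hn hH hξ hc hx i
    have h2 := (d.tors_vertical hn hH hξ hc hx (i + 1)).2.1
    rw [add_one_add_two, tors_swap, map_neg, neg_eq_zero] at h2
    rw [LocalFrame.phi, sum_eq_cyclic i, h1, h2, h3, ← d.lamE_eq hn hH hξ hc hx,
      F.I_mul i x (hξ.subset hx), F.I_mul_rev i x (hξ.subset hx)]
    module
  rcases eq_or_eq_add_one_or j i with rfl | rfl | rfl
  · rw [tors, nab.torsion_self, sub_self, smul_zero]
    simp only [LocalFrame.phi, map_zero, zero_smul, Finset.sum_const_zero]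
  · exact h1 i
  · have h2 := h1 (i + 2)
    rw [add_two_add_one] at h2
    rw [tors_swap, hneg, h2]
    module

/-- Bilinearity turns the formula for the fields ξ_i into a statement about arbitrary vertical
vectors, in which the frame enters only through φ and λ. -/
theorem TorsData.phi_tors {τ : Fin 3 → Module.End ℝ (H x)} (d : TorsData F ξ nab x τ)
    (hn : 1 ≤ n) (hH : IsSmoothDistribution (4 * n) H) (hξ : IsDual F ξ W)
    (hc : Compat F ξ W nab) (hx : x ∈ W) {u v : Tan n M x} (hu : F.hproj ξ x u = 0)
    (hv : F.hproj ξ x v = 0) : F.phi x (tors nab x u v)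
      = (-(F.lamE ξ nab x / 2)) • (F.phi x u * F.phi x v - F.phi x v * F.phi x u) := by
  set Φ : Tan n M x →ₗ[ℝ] Module.End ℝ (H x) := ∑ s, (F.η s x).smulRight (F.I s x) with hΦ
  have h0 : ∀ w, F.phi x w = Φ w := fun w => by simp [LocalFrame.phi, hΦ]
  set T : Tan n M x →ₗ[ℝ] Tan n M x →ₗ[ℝ] Tan n M x :=
    LinearMap.mk₂ ℝ (tors nab x) (by simp [tors]) (by simp [tors]) (by simp [tors])
      (by simp [tors]) with hT
  have h1 : ∀ i j, Φ (T (ξ i x) (ξ j x))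
      = (-(F.lamE ξ nab x / 2)) • (Φ (ξ i x) * Φ (ξ j x) - Φ (ξ j x) * Φ (ξ i x)) := fun i j => by
    rw [← h0, ← h0, ← h0, hξ.phi_ξ hx, hξ.phi_ξ hx]
    exact d.phi_tors_ξ hn hH hξ hc hx i j
  rw [h0, h0, h0]
  change Φ (T u v) = _
  rw [hξ.eq_sum hx hu, hξ.eq_sum hx hv]
  simp only [map_sum, map_smul, LinearMap.sum_apply, LinearMap.smul_apply, h1, Finset.sum_mul,
    Finset.mul_sum, smul_mul_smul_comm, smul_sub, Finset.sum_sub_distrib, Finset.smul_sum,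
    smul_smul]
  congr 1
  · refine Finset.sum_congr rfl fun s _ => Finset.sum_congr rfl fun t _ => ?_
    congr 1
    ring
  · rw [Finset.sum_comm]
    refine Finset.sum_congr rfl fun s _ => Finset.sum_congr rfl fun t _ => ?_
    congr 1
    ring

/-- By `TorsData.phi_tors` both values are the same factor in φ(T(u, v)) = -(λ/2)[φ(u), φ(v)], with
one φ for both frames. They are compared on ξ_1, ξ_2, where the bracket is 2 I_3 and hence nonzero.
-/
theorem CanonOn.lamE_change (hn : 1 ≤ n) (hH : IsSmoothDistribution (4 * n) H)
    (hξ : ReebOn F ξ W) (hξ' : ReebOn F' ξ' W') (hc : CanonOn F ξ W nab)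
    (hc' : CanonOn F' ξ' W' nab) (hx : x ∈ W) (hx' : x ∈ W')
    (hp : ∀ v : Tan n M x, F'.hproj ξ' x v = F.hproj ξ x v) :
    F'.lamE ξ' nab x = F.lamE ξ nab x := by
  have := nontrivial_horizontal hn hH x
  obtain ⟨τ, d⟩ := hc.exists_torsData hn hH hξ hx
  obtain ⟨τ', d'⟩ := hc'.exists_torsData hn hH hξ' hx'
  have h1 := d.phi_tors hn hH hξ.toIsDual hc.toCompat hx (hξ.hproj_ξ hx 0) (hξ.hproj_ξ hx 1)
  have h2 := d'.phi_tors hn hH hξ'.toIsDual hc'.toCompat hx' (u := ξ 0 x) (v := ξ 1 x)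
    (by rw [hp, hξ.hproj_ξ hx]) (by rw [hp, hξ.hproj_ξ hx])
  simp only [hξ.phi_change hn hH F' hx (hξ'.subset hx')] at h2
  rw [h1, hξ.phi_ξ hx, hξ.phi_ξ hx] at h2
  have h3 : F.I 0 x * F.I 1 x - F.I 1 x * F.I 0 x = (2 : ℝ) • F.I 2 x := by
    have e1 := F.I_mul 0 x (hξ.subset hx)
    have e2 := F.I_mul_rev 0 x (hξ.subset hx)
    simp only [zero_add, eps_two] at e1 e2
    rw [e1, e2]
    module
  have h4 : F.I 2 x ≠ 0 := fun h => by
    have e := F.I_sq 2 x (hξ.subset hx)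
    rw [h, zero_mul] at e
    exact smul_ne_zero (eps_ne_zero 2) one_ne_zero e.symm
  rw [h3, smul_smul, smul_smul] at h2
  have h5 := smul_left_injective ℝ h4 h2
  linarith

end Change

end

section

variable {n : ℕ} {M : Type*} [TopologicalSpace M]
  [ChartedSpace (EuclideanSpace ℝ (Fin (4 * n + 3))) M] [IsManifold (𝓡 (4 * n + 3)) ∞ M]
  {H : SubspaceField n M} {PQ : Π x : M, Submodule ℝ (Module.End ℝ (H x))} {g : HMetric H}
  {U U' W W' V : Set M} {x : M} {nab nab' : Conn n M} {X Y Z : VField n M} {C : Complement H}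

/-- The tensors `τ`, `μ` and the function `λ` of the canonical connection. -/
theorem exists_torsion_tensors (hn : 1 ≤ n) (hH : IsSmoothDistribution (4 * n) H)
    (hex : ∀ x₀ : M, ∃ U : Set M, x₀ ∈ U ∧ Nonempty (LocalFrame H PQ g U))
    (hF : ∀ (U : Set M) (F : LocalFrame H PQ g U), ReebOn F F.reeb U)
    (hC : ∀ (U : Set M) (F : LocalFrame H PQ g U), C.SpannedBy U F.reeb)
    (h : IsCanonical g PQ C nab) :
    ∃ (τ μ : Π x : M, LinearMap.BilinForm ℝ (H x)) (lam : M → ℝ),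
      SmoothForm Set.univ τ ∧ SmoothForm Set.univ μ ∧ SmoothFun (n := n) Set.univ lam ∧
      ∀ (U : Set M) (F : LocalFrame H PQ g U) (ξ : Fin 3 → VField n M), ReebOn F ξ U →
        C.SpannedBy U ξ → ∀ x ∈ U,
          τ x = (g.form x).comp (F.tauE ξ nab x) LinearMap.id ∧
          μ x = (g.form x).comp (F.muE ξ nab x) LinearMap.id ∧ lam x = F.lamE ξ nab x := by
  -- The value at each point is computed in a frame chosen at that point; `key` shows that it agrees
  -- with the value in any frame, which yields smoothness.
  choose O hO hF₀ using hex
  let F₀ := fun x => (hF₀ x).some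
  have hc : ∀ (U : Set M) (F : LocalFrame H PQ g U) (ξ : Fin 3 → VField n M), ReebOn F ξ U →
      C.SpannedBy U ξ → CanonOn F ξ U nab := fun U F ξ hξ hs => h.canonOn hn hH hξ.toIsDual hs
  have hp : ∀ (U : Set M) (F : LocalFrame H PQ g U) (ξ : Fin 3 → VField n M), ReebOn F ξ U →
      C.SpannedBy U ξ → ∀ x ∈ U, ∀ v : Tan n M x,
        (F₀ x).hproj (F₀ x).reeb x v = F.hproj ξ x v := fun U F ξ hξ hs x hx v => by
    rw [← hξ.toIsDual.projH_eq hx (hs x hx),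
      ← (hF _ (F₀ x)).toIsDual.projH_eq (hO x) (hC _ (F₀ x) x (hO x))]
  have key : ∀ (U : Set M) (F : LocalFrame H PQ g U) (ξ : Fin 3 → VField n M), ReebOn F ξ U →
      C.SpannedBy U ξ → ∀ x ∈ U,
        (F₀ x).tauE (F₀ x).reeb nab x = F.tauE ξ nab x ∧
        (F₀ x).muE (F₀ x).reeb nab x = F.muE ξ nab x ∧
        (F₀ x).lamE (F₀ x).reeb nab x = F.lamE ξ nab x := fun U F ξ hξ hs x hx =>
    ⟨tauE_change hn hH hξ.toIsDual (hF _ (F₀ x)).toIsDual hx (hO x) (hp U F ξ hξ hs x hx) nab,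
      muE_change hn hH hξ.toIsDual (hF _ (F₀ x)).toIsDual hx (hO x) (hp U F ξ hξ hs x hx) nab,
      (hc U F ξ hξ hs).lamE_change hn hH hξ (hF _ (F₀ x)) (hc _ (F₀ x) _ (hF _ _) (hC _ _)) hx
        (hO x) (hp U F ξ hξ hs x hx)⟩
  have hc₀ : ∀ x, CanonOn (F₀ x) (F₀ x).reeb (O x) nab :=
    fun x => hc _ (F₀ x) _ (hF _ _) (hC _ _)
  have key₀ := fun x => key _ (F₀ x) _ (hF _ _) (hC _ _)
  refine ⟨fun x => (g.form x).comp ((F₀ x).tauE (F₀ x).reeb nab x) LinearMap.id,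
    fun x => (g.form x).comp ((F₀ x).muE (F₀ x).reeb nab x) LinearMap.id,
    fun x => (F₀ x).lamE (F₀ x).reeb nab x, ?_, ?_, ?_, fun U F ξ hξ hs x hx => ?_⟩
  · refine SmoothForm.of_locally fun x _ => ⟨O x, (F₀ x).isOpen, hO x, ?_⟩
    refine ((((hc₀ x).smooth_tauE hn hH (hF _ _)).smoothForm g).congr fun y hy => ?_).mono
      Set.inter_subset_right
    simp only [(key₀ x y hy).1]
  · refine SmoothForm.of_locally fun x _ => ⟨O x, (F₀ x).isOpen, hO x, ?_⟩
    refine ((((hc₀ x).smooth_muE hn hH (hF _ _)).smoothForm g).congr fun y hy => ?_).mono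
      Set.inter_subset_right
    simp only [(key₀ x y hy).2.1]
  · refine SmoothFun.of_locally fun x _ => ⟨O x, (F₀ x).isOpen, hO x, ?_⟩
    refine (SmoothFun.congr ((hc₀ x).smooth_lamE hn hH (hF _ _)) fun y hy => ?_).mono
      Set.inter_subset_right
    exact (key₀ x y hy).2.2
  · obtain ⟨h1, h2, h3⟩ := key U F ξ hξ hs x hx
    simp only [h1, h2, h3, and_self]

end

end Pqc

end

/-! ### The theorem -/

theorem theorem3p1 (n : ℕ) (hn : 1 ≤ n) (M : Type*) [TopologicalSpace M] [T2Space M]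
    [SigmaCompactSpace M] [ChartedSpace (EuclideanSpace ℝ (Fin (4 * n + 3))) M]
    [IsManifold (𝓡 (4 * n + 3)) ∞ M]
    (P : Pqc.PqcStructure n M) (g : Pqc.HMetric P.H) (hg : g ∈ P.metrics)
    (hReeb : n = 1 → P.HasReebFields g) :
    ∃ (C : Pqc.Complement P.H) (nab : Pqc.Conn n M),
      -- over every local frame, `V` is spanned by Reeb fields
      (∀ (U : Set M) (F : Pqc.LocalFrame P.H P.PQ g U),
        ∃ ξ : Fin 3 → Pqc.VField n M, Pqc.IsReeb F ξ ∧ C.SpannedBy U ξ) ∧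
      -- `V` is the only complement that is locally spanned by Reeb fields
      (∀ C' : Pqc.Complement P.H, P.IsReebComplement g C' → C' = C) ∧
      -- `∇` is canonical, and it is the only canonical connection for `V`
      Pqc.IsCanonical g P.PQ C nab ∧
      (∀ nab' : Pqc.Conn n M, Pqc.IsCanonical g P.PQ C nab' →
        ∀ (Y : Pqc.VField n M) (x : M),
          MDifferentiableAt (𝓡 (4 * n + 3)) (𝓡 (4 * n + 3)).tangent
            (fun y => (⟨y, Y y⟩ : TangentBundle (𝓡 (4 * n + 3)) M)) x →
          nab' Y x = nab Y x) ∧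
      -- in dimension greater than seven, no other complement has a canonical connection
      (1 < n → ∀ (C' : Pqc.Complement P.H) (nab' : Pqc.Conn n M),
        Pqc.IsCanonical g P.PQ C' nab' → C' = C) ∧
      -- the explicit form
      ∃ (τ μ : Π x : M, LinearMap.BilinForm ℝ (P.H x)) (lam : M → ℝ),
        Pqc.SmoothForm Set.univ τ ∧ Pqc.SmoothForm Set.univ μ ∧
        Pqc.SmoothFun (n := n) Set.univ lam ∧
        ∀ (U : Set M) (F : Pqc.LocalFrame P.H P.PQ g U) (ξ : Fin 3 → Pqc.VField n M),
          Pqc.IsReeb F ξ → C.SpannedBy U ξ →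
          ∃ (α : Fin 3 → Π x : M, Module.Dual ℝ (Pqc.Tan n M x))
            (L : Fin 3 → Fin 3 → Π x : M, Module.End ℝ (P.H x)),
            (∀ s, Pqc.SmoothOneForm U (α s)) ∧ Pqc.IsLieI F C ξ L ∧
            Pqc.ExplicitForm F C nab ξ τ μ lam α L := by
  have hH := P.smooth_H
  have hex := P.exists_frame g hg
  have hF : ∀ (U : Set M) (F : Pqc.LocalFrame P.H P.PQ g U), Pqc.ReebOn F F.reeb U :=
    fun U F => F.reebOn hn hH (Pqc.exists_reebOn P g hg hn hReeb)
  obtain ⟨C, hC⟩ := Pqc.exists_reeb_complement P g hg hn hF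
  obtain ⟨nab, hnab, hloc⟩ := Pqc.exists_canonOn hn hH hex hF C hC
  have hcan : Pqc.IsCanonical g P.PQ C nab := Pqc.isCanonical_of_locally hn hH hnab fun x => by
    obtain ⟨U, F, W, hx, hd, hc⟩ := hloc x
    exact ⟨U, F, F.reeb, W, hx, hd, fun y hy => hC U F y (hd.subset hy), hc⟩
  obtain ⟨τ, μ, lam, hτ, hμ, hlam, h⟩ :=
    Pqc.exists_torsion_tensors hn hH hex hF hC hcan
  refine ⟨C, nab, fun U F => ⟨F.reeb, (Pqc.isReeb_iff hH F _).2 (hF U F), hC U F⟩,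
    fun C' hC' => Pqc.eq_reeb_complement P g hC hC', hcan, fun nab' hnab' Y x hY => ?_,
    fun hn' C' nab' hnab' => hnab'.eq_reeb_complement hn' P hg hC,
    τ, μ, lam, hτ, hμ, hlam, fun U F ξ hξ hs => ?_⟩
  -- Both connections satisfy the local characterisation over one frame around x with its Reeb
  -- fields, and there the connection is unique.
  · obtain ⟨U, hx, ⟨F⟩⟩ := hex x
    have hd := (hF U F).toIsDual
    exact ContinuousLinearMap.ext fun v => (hnab'.canonOn hn hH hd (hC U F)).unique hn hH hd
      (hcan.canonOn hn hH hd (hC U F)) hx hY v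
  · have hξ' := (Pqc.isReeb_iff hH F ξ).1 hξ
    have hc := hcan.canonOn hn hH hξ'.toIsDual hs
    exact ⟨F.conn1 ξ nab, F.lieI ξ nab, hc.smooth_conn1 hn hH hξ',
      hc.toCompat.isLieI hξ'.toIsDual hs, Pqc.explicitForm hn hH hξ' hs hc
        (fun x hx X Y => by rw [(h U F ξ hξ' hs x hx).1]; rfl)
        (fun x hx X Y => by rw [(h U F ξ hξ' hs x hx).2.1]; rfl)
        fun x hx => (h U F ξ hξ' hs x hx).2.2⟩
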